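/- Setting. Let $\mathbf k=\bigoplus_{l\ge 0}\mathbf k_l$ be a graded commutative ring, $I$ a finite set, $(a_{ij})_{i,j\in I}$ a Borcherds–Cartan matrix over $\mathbb Z$ ($a_{ii}=2$ or $a_{ii}\in 2\mathbb Z_{\le 0}$; $a_{ij}\le 0$ for $i\ne j$; $a_{ij}=0\iff a_{ji}=0$) and $d_i\in\mathbb Z_{>0}$ with $d_ia_{ij}=d_ja_{ji}$. Let $Q^+=\bigoplus_i\mathbb Z_{\ge 0}\alpha_i$, $|\sum_i m_i\alpha_i|=\sum_i m_i$ and $(\alpha_i|\alpha_j)=d_ia_{ij}$ (extended bilinearly). Let $\mathcal Q_{ii}=0$, $\mathcal Q_{ij}(u,v)=\sum_{d_ip+d_jq\le-(\alpha_i|\alpha_j)}t_{ij}^{p,q}u^pv^q$ for $i\neq j$, with $t_{ij}^{p,q}=t_{ji}^{q,p}\in\mathbf k_{-2((\alpha_i|\alpha_j)+d_ip+d_jq)}$ and $t_{ij}^{-a_{ij},0}\in\mathbf k_0^\times$; and let $\mathcal P_i(u,v)=\sum_{p+q\le 1-a_{ii}/2}w_i^{p,q}u^pv^q$ with $w_i^{p,q}\in\mathbf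 k_{2d_i(1-p-q-a_{ii}/2)}$ and $w_i^{1-a_{ii}/2,0},w_i^{0,1-a_{ii}/2}\in\mathbf k_0^\times$. For $n\ge 0$ let $R(n)$ be the $\mathbf k$-algebra with generators $e(\nu)$ ($\nu\in I^n$), $x_p$ ($1\le p\le n$), $\tau_l$ ($1\le l<n$) and relations $e(\nu)e(\nu')=\delta_{\nu\nu'}e(\nu)$, $\sum_\nu e(\nu)=1$, $x_px_q=x_qx_p$, $x_pe(\nu)=e(\nu)x_p$, $\tau_le(\nu)=e(s_l\nu)\tau_l$, $\tau_l\tau_m=\tau_m\tau_l$ if $|l-m|>1$; $\tau_l^2e(\nu)=\frac{\mathcal P_{\nu_l}(x_{l+1},x_l)-\mathcal P_{\nu_l}(x_l,x_{l+1})}{x_l-x_{l+1}}\tau_le(\nu)$ if $\nu_l=\nu_{l+1}$ and $\tau_l^2e(\nu)=\mathcal Q_{\nu_l,\nu_{l+1}}(x_l,x_{l+1})e(\nu)$ otherwise; $(\tau_lx_p-x_{s_l(p)}\tau_l)e(\nu)$ equals $-\mathcal P_{\nu_l}(x_l,x_{l+1})e(\nu)$ if $p=l$ and $\nu_l=\nu_{l+1}$,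 equals $\mathcal P_{\nu_l}(x_l,x_{l+1})e(\nu)$ if $p=l+1$ and $\nu_l=\nu_{l+1}$, and is $0$ otherwise; $(\tau_{l+1}\tau_l\tau_{l+1}-\tau_l\tau_{l+1}\tau_l)e(\nu)$ equals $\mathcal P_{\nu_l}(x_l,x_{l+2})\overline{\mathcal Q}_{\nu_l,\nu_{l+1}}(x_l,x_{l+1},x_{l+2})e(\nu)$ if $\nu_l=\nu_{l+2}\ne\nu_{l+1}$, equals $\overline{\mathcal P}'_{\nu_l}(x_l,x_{l+1},x_{l+2})\tau_le(\nu)+\overline{\mathcal P}''_{\nu_l}(x_l,x_{l+1},x_{l+2})\tau_{l+1}e(\nu)$ if $\nu_l=\nu_{l+1}=\nu_{l+2}$, and is $0$ otherwise. Here $\overline{\mathcal Q}_{ij}(u,v,w)=\frac{\mathcal Q_{ij}(u,v)-\mathcal Q_{ij}(w,v)}{u-w}$, $$\overline{\mathcal P}'_i(u,v,w)=\tfrac{\mathcal P_i(v,u)\mathcal P_i(u,w)}{(u-v)(u-w)}+\tfrac{\mathcal P_i(u,w)\mathcal P_i(v,w)}{(u-w)(v-w)}-\tfrac{\mathcal P_i(u,v)\mathcal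 P_i(v,w)}{(u-v)(v-w)},$$ $$\overline{\mathcal P}''_i(u,v,w)=-\tfrac{\mathcal P_i(u,v)\mathcal P_i(u,w)}{(u-v)(u-w)}-\tfrac{\mathcal P_i(u,w)\mathcal P_i(w,v)}{(u-w)(v-w)}+\tfrac{\mathcal P_i(u,v)\mathcal P_i(v,w)}{(u-v)(v-w)}.$$ $R(n)$ is $\mathbb Z$-graded by $\deg e(\nu)=0$, $\deg x_pe(\nu)=2d_{\nu_p}$, $\deg\tau_le(\nu)=-(\alpha_{\nu_l}|\alpha_{\nu_{l+1}})$ and the grading of $\mathbf k$. For $\beta\in Q^+$ with $|\beta|=n$ let $I^\beta=\{\nu\in I^n:\sum_p\alpha_{\nu_p}=\beta\}$, $e(\beta)=\sum_{\nu\in I^\beta}e(\nu)$ and $R(\beta)=e(\beta)R(n)$; let $\mathrm{Mod}(R(\beta))$ be the category of graded left $R(\beta)$-modules with degree preserving homomorphisms, and $(q^mM)_d=M_{d-m}$. Let $e(n,i)$, resp. $e(i,n)$, be the sum of the $e(\nu)\in R(n+1)$ with $\nu_{n+1}=i$, resp. $\nu_1=i$, and $e(\beta,i)=e(\beta+\alpha_i)e(n,i)$,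 $e(i,\beta)=e(\beta+\alpha_i)e(i,n)$. Let $\iota,\xi:R(n)\to R(n+1)$ be the algebra homomorphisms $$\iota:\ x_p\mapsto x_p,\ \tau_l\mapsto\tau_l,\ e(\nu)\mapsto\sum_ie(\nu,i);\qquad \xi:\ x_p\mapsto x_{p+1},\ \tau_l\mapsto\tau_{l+1},\ e(\nu)\mapsto\sum_ie(i,\nu).$$ Define $E_i:\mathrm{Mod}(R(\beta+\alpha_i))\to\mathrm{Mod}(R(\beta))$, $E_iM=e(\beta,i)M$ ($R(\beta)$ acting through $\iota$), and $\overline F_i:\mathrm{Mod}(R(\beta))\to\mathrm{Mod}(R(\beta+\alpha_i))$, $\overline F_iM=R(\beta+\alpha_i)e(i,\beta)\otimes_{R(\beta)}M$ (right action of $R(\beta)$ through $\xi$); $E_iM=0$ for $M\in\mathrm{Mod}(R(\beta))$ if $\alpha_i$ does not occur in $\beta$. Let $t_i$ be an indeterminate of degree $2d_i$. Theorem. There are maps $\varphi_n:R(n+1)\to\bigoplus_{i\in I}R(n)\otimes\mathbf k[t_i]$ ($n\ge 0$) such that the following hold. (0) Regard $R(n+1)$ as an $(R(n),R(n))$-bimodule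 via $\iota$ on the left and $\xi$ on the right. For every $n\ge 0$ the map $\varphi_n$ is a surjective bimodule homomorphism with $\varphi_n(\tau_n\cdots\tau_1)=1$ (that is, $1$ in each component). Left multiplication by $x_{n+1}$ and right multiplication by $x_1$ correspond under $\varphi_n$ to multiplication by $t_i$ on the $i$-th component, and left multiplication by $e(n,i)$ and right multiplication by $e(i,n)$ correspond to projection to the $i$-th component. For $n\ge 1$ the sequence of $(R(n),R(n))$-bimodules $$0\to R(n)\otimes_{R(n-1)}R(n)\xrightarrow{\ \Phi\ }R(n+1)\xrightarrow{\ \varphi_n\ }\bigoplus_{i\in I}R(n)\otimes\mathbf k[t_i]\to 0,\qquad \Phi(x\otimes y)=\iota(x)\xi(y),$$ is exact, where in the tensor product $R(n-1)$ acts on the first factor on the right through $\xi$ and on the second factor on the left through $\iota$. For $n=0$ the map $\varphi_0$ is bijective. (i) For $i\ne j$ there is a natural isomorphism $\overline F_jE_i\xrightarrow{\sim}E_i\overline F_j$ of functors $\mathrm{Mod}(R(\gamma+\alpha_i))\to\mathrm{Mod}(R(\gamma+\alpha_j))$ for every $\gamma\in Q^+$. With $\beta=\gamma+\alpha_i$ it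 is given by $r\,e(j,\gamma)\otimes m\mapsto\iota(r)e(\gamma+\alpha_j,i)\,(e(j,\beta)\otimes m)$. (ii) For $i\in I$ and $\beta\in Q^+$ there is an exact sequence in $\mathrm{Mod}(R(\beta))$, functorial in $M\in\mathrm{Mod}(R(\beta))$, $$0\to\overline F_iE_iM\to E_i\overline F_iM\to q^{-(\alpha_i|\beta)}M\otimes\mathbf k[t_i]\to 0 .$$ With $n=|\beta|$, its maps are induced by $\Phi$ and $\varphi_n$. The first one is given, with $\gamma=\beta-\alpha_i$, by $r\,e(i,\gamma)\otimes m\mapsto\iota(r)e(\beta,i)\,(e(i,\beta)\otimes m)$ (it is the zero map from $0$ if $\alpha_i$ does not occur in $\beta$). The second one sends $e(\beta,i)r\,e(i,\beta)\otimes m$, for $r\in R(\beta+\alpha_i)$, to $\sum_p(c_p\,m)\otimes t_i^p$, where $c_p=e(\beta)\,c\,e(\beta)\in R(\beta)$ and $c\in R(n)$ is the coefficient of $t_i^p$ in the $i$-th component of $\varphi_n(r)$. -/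

import Mathlib

open scoped TensorProduct

universe u

noncomputable section

set_option linter.unusedSectionVars false
set_option linter.unusedSimpArgs false

namespace GKM

/-! ### Graded abelian groups, graded modules, and their functors -/

section Grading

variable {M N : Type u} [AddCommGroup M] [AddCommGroup N]

theorem isInternal_of_coaction (ℳ : ℤ → AddSubgroup M) (δ : M →+ (ℤ →₀ M))
    (h : ∀ d m, m ∈ ℳ d → δ m = Finsupp.single d m)
    (hs : ∀ m : M, m ∈ ⨆ d, ℳ d) : DirectSum.IsInternal ℳ := by
  classical
  constructor
  · have key : ∀ x : DirectSum ℤ (fun d => ℳ d), ∀ d,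
        δ (DirectSum.coeAddMonoidHom ℳ x) d = (x d : M) := by
      intro x d
      induction x using DirectSum.induction_on with
      | zero => simp
      | of i y =>
        rw [DirectSum.coeAddMonoidHom_of, h i _ y.2, DirectSum.coe_of_apply]
        by_cases hid : i = d <;> simp [hid]
      | add x y hx hy => simp [hx, hy]
    intro x y hxy
    ext d
    rw [← key x d, ← key y d, hxy]
  · intro m
    have := hs m
    induction this using AddSubgroup.iSup_induction' with
    | hp d m hm => exact ⟨DirectSum.of (fun d => ℳ d) d ⟨m, hm⟩, by simp⟩
    | h1 => exact ⟨0, by simp⟩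
    | hadd x y _ _ hx hy =>
      obtain ⟨a, ha⟩ := hx
      obtain ⟨b, hb⟩ := hy
      exact ⟨a + b, by rw [map_add, ha, hb]⟩

theorem mem_iSup_of_isInternal {ℳ : ℤ → AddSubgroup M} (h : DirectSum.IsInternal ℳ) (m : M) :
    m ∈ ⨆ d, ℳ d := by
  classical
  obtain ⟨x, rfl⟩ := h.2 m
  induction x using DirectSum.induction_on with
  | zero => simp
  | of i y =>
    rw [DirectSum.coeAddMonoidHom_of]
    exact AddSubgroup.mem_iSup_of_mem i y.2
  | add x y hx hy => rw [map_add]; exact add_mem hx hy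

theorem exists_coaction {ℳ : ℤ → AddSubgroup M} (h : DirectSum.IsInternal ℳ) :
    ∃ δ : M →+ (ℤ →₀ M), ∀ d m, m ∈ ℳ d → δ m = Finsupp.single d m := by
  classical
  have h' : Function.Bijective (DirectSum.coeAddMonoidHom ℳ) := h
  refine ⟨(DirectSum.toAddMonoid
    (fun d => (Finsupp.singleAddHom d).comp (ℳ d).subtype)).comp
      (AddEquiv.ofBijective _ h').symm.toAddMonoidHom, ?_⟩
  intro d m hm
  have : (AddEquiv.ofBijective _ h').symm m = DirectSum.of (fun d => ℳ d) d ⟨m, hm⟩ := by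
    rw [AddEquiv.symm_apply_eq]
    simp
  simp [this]

/-- A retract (by degree preserving additive maps) of a graded group is graded. -/
theorem isInternal_retract {ℳ : ℤ → AddSubgroup M} (h : DirectSum.IsInternal ℳ)
    (ι : N →+ M) (p : M →+ N) (hp : ∀ n, p (ι n) = n)
    (hℳ : ∀ d m, m ∈ ℳ d → ι (p m) ∈ ℳ d) :
    DirectSum.IsInternal (fun d => (ℳ d).comap ι) := by
  obtain ⟨δ, hδ⟩ := exists_coaction h
  refine isInternal_of_coaction _ ((Finsupp.mapRange.addMonoidHom p).comp (δ.comp ι)) ?_ ?_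
  · intro d n hn
    simp [hδ d _ hn, hp]
  · intro n
    have : ∀ m : M, m ∈ (⨆ d, ℳ d) → p m ∈ ⨆ d, (ℳ d).comap ι := by
      intro m hm
      induction hm using AddSubgroup.iSup_induction' with
      | hp d m hm => exact AddSubgroup.mem_iSup_of_mem d (hℳ d m hm)
      | h1 => simp
      | hadd x y _ _ hx hy => rw [map_add]; exact add_mem hx hy
    simpa [hp] using this (ι n) (mem_iSup_of_isInternal h _)

end Grading

/-- A `ℤ`-graded left module over a ring `A` equipped with a family `𝒜` of homogeneous parts. -/
structure GrMod {A : Type u} [Ring A] (𝒜 : ℤ → AddSubgroup A) where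
  carrier : Type u
  [addCommGroup : AddCommGroup carrier]
  [module : Module A carrier]
  gr : ℤ → AddSubgroup carrier
  internal : DirectSum.IsInternal gr
  smul_mem : ∀ {a b : ℤ} {r : A} {m : carrier}, r ∈ 𝒜 a → m ∈ gr b → r • m ∈ gr (a + b)

attribute [instance] GrMod.addCommGroup GrMod.module

namespace GrMod

section Basic

variable {A : Type u} [Ring A] {𝒜 : ℤ → AddSubgroup A}

/-- Degree preserving module homomorphisms. -/
@[ext] structure Hom (M N : GrMod 𝒜) where
  toLin : M.carrier →ₗ[A] N.carrier
  map_mem : ∀ {d : ℤ} {m : M.carrier}, m ∈ M.gr d → toLin m ∈ N.gr d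

instance : CategoryTheory.Category (GrMod 𝒜) where
  Hom M N := Hom M N
  id M := ⟨LinearMap.id, fun h => h⟩
  comp f g := ⟨g.toLin.comp f.toLin, fun h => g.map_mem (f.map_mem h)⟩

@[ext] theorem hom_ext {M N : GrMod 𝒜} {f g : M ⟶ N}
    (h : ∀ m, Hom.toLin f m = Hom.toLin g m) : f = g :=
  Hom.ext (LinearMap.ext h)

@[simp] theorem id_apply (M : GrMod 𝒜) (m : M.carrier) :
    Hom.toLin (CategoryTheory.CategoryStruct.id M) m = m := rfl

@[simp] theorem comp_apply {M N P : GrMod 𝒜} (f : M ⟶ N) (g : N ⟶ P) (m : M.carrier) :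
    Hom.toLin (CategoryTheory.CategoryStruct.comp f g) m = Hom.toLin g (Hom.toLin f m) := rfl

/-- The degree shift functor `q ^ s`, with `(q ^ s M)_d = M_{d - s}`. -/
def shift (𝒜 : ℤ → AddSubgroup A) (s : ℤ) : CategoryTheory.Functor (GrMod 𝒜) (GrMod 𝒜) where
  obj M :=
    { carrier := M.carrier
      gr := fun d => M.gr (d - s)
      internal := by
        obtain ⟨δ, hδ⟩ := exists_coaction M.internal
        refine isInternal_of_coaction _
          ((Finsupp.mapDomain.addMonoidHom (fun d => d + s)).comp δ) ?_ ?_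
        · intro d m hm
          simp [hδ _ m hm, Finsupp.mapDomain_single]
        · intro m
          have h := mem_iSup_of_isInternal M.internal m
          have h2 : (⨆ d, M.gr d) ≤ ⨆ d, M.gr (d - s) :=
            iSup_le fun d => le_iSup_of_le (d + s) (by simp)
          exact h2 h
      smul_mem := fun {a b r m} hr hm => by
        have := M.smul_mem hr hm
        rwa [← add_sub_assoc] at this }
  map {M N} f := ⟨Hom.toLin (M := M) (N := N) f, fun h => Hom.map_mem (M := M) (N := N) f h⟩

/-- The functor `M ↦ M ⊗ 𝐤[t]` with `t` of degree `c`: the module `M ⊗ 𝐤[t] = ⨁ p, M tᵖ` is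
realised as the module `ℕ →₀ M` of polynomials in `t` with coefficients in `M`. -/
def polyExt (𝒜 : ℤ → AddSubgroup A) (c : ℤ) : CategoryTheory.Functor (GrMod 𝒜) (GrMod 𝒜) where
  obj M :=
    { carrier := ℕ →₀ M.carrier
      gr := fun d =>
        { carrier := {f | ∀ p : ℕ, f p ∈ M.gr (d - c * p)}
          add_mem' := fun hf hg p => add_mem (hf p) (hg p)
          zero_mem' := fun p => zero_mem _
          neg_mem' := fun hf p => neg_mem (hf p) }
      internal := by
        obtain ⟨δ, hδ⟩ := exists_coaction M.internal
        refine isInternal_of_coaction _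
          (Finsupp.liftAddHom fun p : ℕ =>
            (Finsupp.liftAddHom fun a : ℤ =>
              (Finsupp.singleAddHom (a + c * p)).comp (Finsupp.singleAddHom p)).comp δ) ?_ ?_
        · intro d f hf
          have hf' : ∀ p : ℕ, f p ∈ M.gr (d - c * p) := hf
          rw [Finsupp.liftAddHom_apply, Finsupp.sum]
          have : ∀ p ∈ f.support, ((Finsupp.liftAddHom fun a : ℤ =>
              (Finsupp.singleAddHom (a + c * p)).comp (Finsupp.singleAddHom p)).comp δ) (f p)
              = Finsupp.single d (Finsupp.single p (f p)) := by
            intro p _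
            simp [hδ _ _ (hf' p)]
          rw [Finset.sum_congr rfl this, ← Finsupp.single_finsetSum]
          congr 1
          exact Finsupp.sum_single f
        · intro f
          induction f using Finsupp.induction_linear with
          | zero => exact zero_mem _
          | add f g hf hg => exact add_mem hf hg
          | single p m =>
            have hm := mem_iSup_of_isInternal M.internal m
            induction hm using AddSubgroup.iSup_induction' with
            | hp d m hm =>
              refine AddSubgroup.mem_iSup_of_mem (d + c * p) ?_
              intro p'
              by_cases hpp : p = p'
              · subst hpp; simpa using hm
              · simp [hpp]
            | h1 => simp
            | hadd x y _ _ hx hy => rw [Finsupp.single_add]; exact add_mem hx hy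
      smul_mem := fun {a b r m} hr hm p => by
        have := M.smul_mem hr (hm p)
        rwa [← add_sub_assoc] at this }
  map {M N} f := ⟨Finsupp.mapRange.linearMap (Hom.toLin (M := M) (N := N) f),
    fun h p => Hom.map_mem (M := M) (N := N) f (h p)⟩
  map_id M := by
    apply hom_ext; intro m
    exact Finsupp.ext fun p => rfl
  map_comp f g := by
    apply hom_ext; intro m
    exact Finsupp.ext fun p => rfl

end Basic

end GrMod

/-! ### Balanced tensor products over a noncommutative ring -/

section BalTensor

variable (A : Type u) {B X N : Type u} [Ring A] [AddCommGroup X] [Module A X] [AddCommGroup N]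

/-- The `A`-submodule of `X ⊗[ℤ] N` generated by `x·b ⊗ n - x ⊗ b·n`, where `x·b = rX x b` and
`b·n = lN b n`. When `X` is an `(A, B)`-bimodule it coincides with the additive subgroup
generated by these elements. -/
def balSub (rX : X → B → X) (lN : B → N → N) : Submodule A (X ⊗[ℤ] N) :=
  Submodule.span A {t | ∃ x b n, t = rX x b ⊗ₜ[ℤ] n - x ⊗ₜ[ℤ] lN b n}

/-- The tensor product `X ⊗_B N` of an `(A, B)`-bimodule `X` and a left `B`-module `N`, as a left
`A`-module. The right action of `B` on `X` and the left action on `N` are given explicitly. -/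
abbrev BalTensor (rX : X → B → X) (lN : B → N → N) : Type u :=
  (X ⊗[ℤ] N) ⧸ balSub A rX lN

/-- The class of `x ⊗ n` in `X ⊗_B N`. -/
def BalTensor.tmul {rX : X → B → X} {lN : B → N → N} (x : X) (n : N) : BalTensor A rX lN :=
  Submodule.Quotient.mk (x ⊗ₜ[ℤ] n)

end BalTensor

namespace GrMod

section ResInd

variable {A B : Type u} [Ring A] [Ring B] {𝒜 : ℤ → AddSubgroup A} {ℬ : ℤ → AddSubgroup B}

/-- For a (not necessarily unital) ring homomorphism `j : B → A` and an `A`-module `M`, this is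
`j(1) M`, written as the subgroup of the elements fixed by the idempotent `j(1)`. -/
def resSub (j : B →ₙ+* A) (M : Type u) [AddCommGroup M] [Module A M] : AddSubgroup M where
  carrier := {m | j 1 • m = m}
  add_mem' := fun {a b} ha hb => by
    rw [Set.mem_ofPred_eq] at *
    rw [smul_add, ha, hb]
  zero_mem' := smul_zero _
  neg_mem' := fun {a} ha => by
    rw [Set.mem_ofPred_eq] at *
    rw [smul_neg, ha]

/-- `B` acts on `j(1) M` through `j`. -/
instance (j : B →ₙ+* A) (M : Type u) [AddCommGroup M] [Module A M] : Module B (resSub j M) where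
  smul b m := ⟨j b • m.1, by
    change j 1 • j b • m.1 = j b • m.1
    rw [smul_smul, ← map_mul, one_mul]⟩
  one_smul m := Subtype.ext m.2
  mul_smul b c m := Subtype.ext (by
    change j (b * c) • m.1 = j b • j c • m.1
    rw [map_mul, mul_smul])
  smul_zero b := Subtype.ext (smul_zero _)
  smul_add b m n := Subtype.ext (smul_add _ _ _)
  add_smul b c m := Subtype.ext (by
    change j (b + c) • m.1 = j b • m.1 + j c • m.1
    rw [map_add, add_smul])
  zero_smul m := Subtype.ext (by
    change j 0 • m.1 = 0
    rw [map_zero, zero_smul])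

/-- The map `M → j(1) M`, `m ↦ j(1) m`. -/
def resProj (j : B →ₙ+* A) (M : Type u) [AddCommGroup M] [Module A M] : M →+ resSub j M where
  toFun m := ⟨j 1 • m, by
    change j 1 • j 1 • m = j 1 • m
    rw [smul_smul, ← map_mul, one_mul]⟩
  map_zero' := Subtype.ext (smul_zero _)
  map_add' m n := Subtype.ext (smul_add _ _ _)

/-- The functor `M ↦ j(1) M` from graded `A`-modules to graded `B`-modules, for a degree
preserving ring homomorphism `j : B → A` which need not be unital. -/
def res [GradedRing ℬ] (j : B →ₙ+* A) (hj : ∀ d b, b ∈ ℬ d → j b ∈ 𝒜 d) :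
    CategoryTheory.Functor (GrMod 𝒜) (GrMod ℬ) where
  obj M :=
    { carrier := resSub j M.carrier
      gr := fun d => (M.gr d).comap (resSub j M.carrier).subtype
      internal := by
        refine isInternal_retract M.internal _ (resProj j M.carrier) ?_ ?_
        · intro n
          exact Subtype.ext n.2
        · intro d m hm
          have := M.smul_mem (hj 0 1 SetLike.GradedOne.one_mem) hm
          rwa [zero_add] at this
      smul_mem := fun {a b r m} hr hm => M.smul_mem (hj _ _ hr) hm }
  map {M N} f :=
    { toLin :=
        { toFun := fun m => ⟨Hom.toLin f m.1, by
            change j 1 • Hom.toLin f m.1 = Hom.toLin f m.1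
            rw [← map_smul]
            exact congrArg _ m.2⟩
          map_add' := fun m n => Subtype.ext (map_add (Hom.toLin f) _ _)
          map_smul' := fun b m => Subtype.ext (map_smul (Hom.toLin f) (j b) m.1) }
      map_mem := fun {d m} hm => Hom.map_mem f hm }

/-- The left ideal `A j(1)`. -/
def indIdeal (j : B →ₙ+* A) : Submodule A A where
  carrier := {a | a * j 1 = a}
  add_mem' := fun {a b} ha hb => by
    rw [Set.mem_ofPred_eq] at *
    rw [add_mul, ha, hb]
  zero_mem' := zero_mul _
  smul_mem' := fun c a ha => by
    rw [Set.mem_ofPred_eq] at *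
    rw [smul_eq_mul, mul_assoc, ha]

/-- The map `A → A j(1)`, `a ↦ a j(1)`. -/
def indProj (j : B →ₙ+* A) : A →+ indIdeal j where
  toFun a := ⟨a * j 1, by
    change a * j 1 * j 1 = a * j 1
    rw [mul_assoc, ← map_mul, one_mul]⟩
  map_zero' := Subtype.ext (zero_mul _)
  map_add' m n := Subtype.ext (add_mul _ _ _)

/-- The right action of `B` on `A j(1)`, through `j`. -/
def indRight (j : B →ₙ+* A) (x : indIdeal j) (b : B) : indIdeal j :=
  ⟨x.1 * j b, by
    change x.1 * j b * j 1 = x.1 * j b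
    rw [mul_assoc, ← map_mul, mul_one]⟩

/-- The `A`-module `A j(1) ⊗_B N`. -/
abbrev IndCarrier (j : B →ₙ+* A) (N : Type u) [AddCommGroup N] [Module B N] : Type u :=
  BalTensor A (X := indIdeal j) (N := N) (indRight j) (fun b n => b • n)

/-- The element `a ⊗ n` of `A j(1) ⊗_B N`. -/
abbrev indTmul (j : B →ₙ+* A) {N : Type u} [AddCommGroup N] [Module B N]
    (a : indIdeal j) (n : N) : IndCarrier j N :=
  BalTensor.tmul A a n

theorem ind_induction (j : B →ₙ+* A) {N : Type u} [AddCommGroup N] [Module B N]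
    {p : IndCarrier j N → Prop} (h0 : p 0) (hadd : ∀ x y, p x → p y → p (x + y))
    (ht : ∀ a n, p (indTmul j a n)) (t : IndCarrier j N) : p t := by
  obtain ⟨t, rfl⟩ := Submodule.Quotient.mk_surjective _ t
  induction t using TensorProduct.induction_on with
  | zero => exact h0
  | tmul x y => exact ht x y
  | add x y hx hy => exact hadd _ _ hx hy

/-- Degree `d` part of `A j(1) ⊗_B N`: generated by `a ⊗ n` with `deg a + deg n = d`. -/
def indGr (𝒜 : ℤ → AddSubgroup A) (j : B →ₙ+* A) (N : GrMod ℬ) (d : ℤ) :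
    AddSubgroup (IndCarrier j N.carrier) :=
  AddSubgroup.closure {t | ∃ (a b : ℤ) (x : indIdeal j) (n : N.carrier),
    (x : A) ∈ 𝒜 a ∧ n ∈ N.gr b ∧ a + b = d ∧ t = indTmul j x n}

theorem indIdeal_internal [GradedRing 𝒜] [GradedRing ℬ] (j : B →ₙ+* A)
    (hj : ∀ d b, b ∈ ℬ d → j b ∈ 𝒜 d) :
    DirectSum.IsInternal (fun d => (𝒜 d).comap (indIdeal j).toAddSubgroup.subtype) := by
  refine isInternal_retract (DirectSum.Decomposition.isInternal 𝒜)
    (indIdeal j).toAddSubgroup.subtype (indProj j) (fun n => Subtype.ext n.2) ?_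
  intro d m hm
  have := SetLike.GradedMul.mul_mem hm (hj 0 1 SetLike.GradedOne.one_mem)
  rwa [add_zero] at this

theorem indGr_internal [GradedRing 𝒜] [GradedRing ℬ] (j : B →ₙ+* A)
    (hj : ∀ d b, b ∈ ℬ d → j b ∈ 𝒜 d) (N : GrMod ℬ) :
    DirectSum.IsInternal (indGr 𝒜 j N) := by
  have hX := indIdeal_internal j hj
  obtain ⟨δX, hδX⟩ := exists_coaction hX
  obtain ⟨δN, hδN⟩ := exists_coaction N.internal
  let mk2 : indIdeal j →+ N.carrier →+ IndCarrier j N.carrier :=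
    { toFun := fun x =>
        { toFun := fun n => indTmul j x n
          map_zero' := by simp [BalTensor.tmul]
          map_add' := fun n n' => by
            simp only [BalTensor.tmul, TensorProduct.tmul_add]; rfl }
      map_zero' := by ext n; simp [BalTensor.tmul]
      map_add' := fun x y => by
        ext n
        simp only [BalTensor.tmul, TensorProduct.add_tmul, AddMonoidHom.coe_mk, ZeroHom.coe_mk,
          AddMonoidHom.add_apply]
        rfl }
  let c : (ℤ →₀ indIdeal j) →+ (ℤ →₀ N.carrier) →+ (ℤ →₀ IndCarrier j N.carrier) :=
    Finsupp.liftAddHom fun a => (Finsupp.liftAddHom fun b =>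
      ((AddMonoidHom.compHom (Finsupp.singleAddHom (a + b))).comp mk2).flip).flip
  have hc : ∀ a x b n, c (Finsupp.single a x) (Finsupp.single b n)
      = Finsupp.single (a + b) (indTmul j x n) := by
    intro a x b n
    simp [c, mk2]
  let δ0 : (indIdeal j ⊗[ℤ] N.carrier) →+ (ℤ →₀ IndCarrier j N.carrier) :=
    TensorProduct.liftAddHom ((AddMonoidHom.compl₂ c δN).comp δX) (by
      intro r m n
      simp)
  have hδ0 : ∀ x n, δ0 (x ⊗ₜ n) = c (δX x) (δN n) := fun x n => rfl
  have hbal : ∀ x b n, δ0 (indRight j x b ⊗ₜ n) = δ0 (x ⊗ₜ (b • n)) := by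
    intro x b n
    have hx := mem_iSup_of_isInternal hX x
    induction hx using AddSubgroup.iSup_induction' with
    | h1 =>
      have : indRight j 0 b = 0 := Subtype.ext (zero_mul _)
      rw [this]; simp
    | hadd x y _ _ hx hy =>
      have : indRight j (x + y) b = indRight j x b + indRight j y b := Subtype.ext (add_mul _ _ _)
      rw [this, TensorProduct.add_tmul, TensorProduct.add_tmul, map_add, map_add, hx, hy]
    | hp d x hx =>
    have hn := mem_iSup_of_isInternal N.internal n
    induction hn using AddSubgroup.iSup_induction' with
    | h1 => simp
    | hadd n n' _ _ hn hn' =>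
      rw [smul_add, TensorProduct.tmul_add, TensorProduct.tmul_add, map_add, map_add, hn, hn']
    | hp e n hn =>
    have hb := mem_iSup_of_isInternal (DirectSum.Decomposition.isInternal ℬ) b
    induction hb using AddSubgroup.iSup_induction' with
    | h1 =>
      have : indRight j x 0 = 0 := Subtype.ext (by simp [indRight])
      rw [this]; simp
    | hadd b b' _ _ hb hb' =>
      have : indRight j x (b + b') = indRight j x b + indRight j x b' :=
        Subtype.ext (by simp [indRight, mul_add])
      rw [this, add_smul, TensorProduct.tmul_add, TensorProduct.add_tmul, map_add, map_add, hb, hb']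
    | hp f b hb =>
    have hxb : indRight j x b ∈ (𝒜 (d + f)).comap (indIdeal j).toAddSubgroup.subtype :=
      SetLike.GradedMul.mul_mem (A := 𝒜) hx (hj _ _ hb)
    rw [hδ0, hδ0, hδX _ _ hxb, hδN _ _ hn, hδX _ _ hx, hδN _ _ (N.smul_mem hb hn), hc, hc,
      add_assoc]
    congr 1
    rw [indTmul, indTmul, BalTensor.tmul, BalTensor.tmul, Submodule.Quotient.eq]
    exact Submodule.subset_span ⟨x, b, n, rfl⟩
  have hker : ∀ t ∈ balSub A (indRight j) (fun b (n : N.carrier) => b • n),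
      ∀ a : A, δ0 (a • t) = 0 := by
    intro t ht
    induction ht using Submodule.span_induction with
    | mem t ht =>
      obtain ⟨x, b, n, rfl⟩ := ht
      intro a
      have : a • indRight j x b = indRight j (a • x) b := Subtype.ext (mul_assoc a x.1 _).symm
      rw [smul_sub, TensorProduct.smul_tmul', TensorProduct.smul_tmul', map_sub, this, hbal,
        sub_self]
    | zero => simp
    | add x y _ _ hx hy => intro a; rw [smul_add, map_add, hx, hy, add_zero]
    | smul b x _ hx => intro a; rw [smul_smul]; exact hx _
  let δ : IndCarrier j N.carrier →+ (ℤ →₀ IndCarrier j N.carrier) :=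
    QuotientAddGroup.lift (balSub A (indRight j) (fun b (n : N.carrier) => b • n)).toAddSubgroup δ0
      (fun t ht => by have := hker t ht 1; rwa [one_smul] at this)
  have hδ : ∀ x n, δ (indTmul j x n) = c (δX x) (δN n) := fun x n => rfl
  refine isInternal_of_coaction _ δ ?_ ?_
  · intro d t ht
    induction ht using AddSubgroup.closure_induction with
    | mem t ht =>
      obtain ⟨a, b, x, n, hx, hn, rfl, rfl⟩ := ht
      rw [hδ, hδX a x hx, hδN b n hn, hc]
    | zero => simp
    | add x y _ _ hx hy => rw [map_add, hx, hy, Finsupp.single_add]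
    | neg x _ hx => rw [map_neg, hx, Finsupp.single_neg]
  · intro t
    refine ind_induction j (zero_mem _) (fun x y hx hy => add_mem hx hy) ?_ t
    intro x n
    have hx := mem_iSup_of_isInternal hX x
    have hadd1 : ∀ x y, indTmul j (x + y) n = indTmul j x n + indTmul j y n := fun x y => by
      simp only [BalTensor.tmul, TensorProduct.add_tmul]; rfl
    have hz1 : indTmul j 0 n = 0 := by simp [BalTensor.tmul]
    induction hx using AddSubgroup.iSup_induction' with
    | h1 => rw [show indTmul j (0 : indIdeal j) n = 0 from hz1]; exact zero_mem _
    | hadd x y _ _ hx hy => exact (hadd1 x y) ▸ add_mem hx hy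
    | hp d x hx =>
    have hn := mem_iSup_of_isInternal N.internal n
    clear hadd1 hz1
    induction hn using AddSubgroup.iSup_induction' with
    | h1 =>
      have : indTmul j x (0 : N.carrier) = 0 := by simp [BalTensor.tmul]
      rw [this]; exact zero_mem _
    | hadd n n' _ _ hn hn' =>
      have : indTmul j x (n + n') = indTmul j x n + indTmul j x n' := by
        simp only [BalTensor.tmul, TensorProduct.tmul_add]; rfl
      rw [this]; exact add_mem hn hn'
    | hp e n hn =>
      exact AddSubgroup.mem_iSup_of_mem (d + e)
        (AddSubgroup.subset_closure ⟨d, e, x, n, hx, hn, rfl, rfl⟩)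

/-- The `A`-linear map `A j(1) ⊗_B M → A j(1) ⊗_B N` induced by a `B`-linear map `M → N`. -/
def indMap (j : B →ₙ+* A) {M N : Type u} [AddCommGroup M] [AddCommGroup N] [Module B M]
    [Module B N] (f : M →ₗ[B] N) : IndCarrier j M →ₗ[A] IndCarrier j N :=
  Submodule.mapQ _ _
    (TensorProduct.AlgebraTensorModule.map LinearMap.id (f.toAddMonoidHom.toIntLinearMap)) (by
      rw [balSub, Submodule.span_le]
      rintro _ ⟨x, b, n, rfl⟩
      refine Submodule.subset_span ⟨x, b, f n, ?_⟩
      simp)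

@[simp] theorem indMap_tmul (j : B →ₙ+* A) {M N : Type u} [AddCommGroup M] [AddCommGroup N]
    [Module B M] [Module B N] (f : M →ₗ[B] N) (a : indIdeal j) (m : M) :
    indMap j f (indTmul j a m) = indTmul j a (f m) := rfl

theorem indMap_id (j : B →ₙ+* A) {M : Type u} [AddCommGroup M] [Module B M]
    (t : IndCarrier j M) : indMap j (LinearMap.id : M →ₗ[B] M) t = t := by
  refine ind_induction (p := fun t => indMap j (LinearMap.id : M →ₗ[B] M) t = t) j ?_ ?_ ?_ t
  · exact map_zero _
  · intro x y hx hy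
    rw [map_add, hx, hy]
  · intro a n
    rw [indMap_tmul, LinearMap.id_apply]

theorem indMap_comp (j : B →ₙ+* A) {M N P : Type u} [AddCommGroup M] [AddCommGroup N]
    [AddCommGroup P] [Module B M] [Module B N] [Module B P] (f : M →ₗ[B] N) (g : N →ₗ[B] P)
    (t : IndCarrier j M) : indMap j (g.comp f) t = indMap j g (indMap j f t) := by
  refine ind_induction (p := fun t => indMap j (g.comp f) t = indMap j g (indMap j f t)) j
    ?_ ?_ ?_ t
  · simp only [map_zero]
  · intro x y hx hy
    simp only [map_add, hx, hy]
  · intro a n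
    rw [indMap_tmul, indMap_tmul, indMap_tmul, LinearMap.comp_apply]

/-- The functor `N ↦ A j(1) ⊗_B N` from graded `B`-modules to graded `A`-modules, for a degree
preserving ring homomorphism `j : B → A` which need not be unital. -/
def ind [GradedRing 𝒜] [GradedRing ℬ] (j : B →ₙ+* A) (hj : ∀ d b, b ∈ ℬ d → j b ∈ 𝒜 d) :
    CategoryTheory.Functor (GrMod ℬ) (GrMod 𝒜) where
  obj N :=
    { carrier := IndCarrier j N.carrier
      gr := indGr 𝒜 j N
      internal := indGr_internal j hj N
      smul_mem := fun {a b r m} hr hm => by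
        induction hm using AddSubgroup.closure_induction with
        | mem t ht =>
          obtain ⟨d, e, x, n, hx, hn, rfl, rfl⟩ := ht
          exact AddSubgroup.subset_closure ⟨a + d, e, r • x, n,
            SetLike.GradedMul.mul_mem (A := 𝒜) hr hx, hn, add_assoc _ _ _, rfl⟩
        | zero => rw [smul_zero]; exact zero_mem _
        | add x y _ _ hx hy => rw [smul_add]; exact add_mem hx hy
        | neg x _ hx => rw [smul_neg]; exact neg_mem hx }
  map {M N} f :=
    { toLin := indMap j (Hom.toLin f)
      map_mem := fun {d m} hm => by
        induction hm using AddSubgroup.closure_induction with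
        | mem t ht =>
          obtain ⟨d, e, x, n, hx, hn, rfl, rfl⟩ := ht
          exact AddSubgroup.subset_closure ⟨d, e, x, Hom.toLin f n, hx, Hom.map_mem f hn, rfl, rfl⟩
        | zero => rw [map_zero]; exact zero_mem _
        | add x y _ _ hx hy => rw [map_add]; exact add_mem hx hy
        | neg x _ hx => rw [map_neg]; exact neg_mem hx }
  map_id M := hom_ext (indMap_id j)
  map_comp f g := hom_ext (indMap_comp j (Hom.toLin f) (Hom.toLin g))

end ResInd

end GrMod

/-! ### Divided differences and weighted homogeneous polynomials -/

section Polynomials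

open MvPolynomial

/-- The quotient `p / q` when `q` divides `p`. -/
def exactQuot {R : Type u} [CommRing R] (p q : R) : R :=
  open Classical in if h : q ∣ p then h.choose else 0

theorem mul_exactQuot {R : Type u} [CommRing R] {p q : R} (h : q ∣ p) : q * exactQuot p q = p := by
  rw [exactQuot, dif_pos h]
  exact h.choose_spec.symm

variable {k : Type u} [CommRing k]

/-- `∂ P = (P(v,u) - P(u,v)) / (u - v)`, with `u = X 0`, `v = X 1`. -/
def partialP (P : MvPolynomial (Fin 2) k) : MvPolynomial (Fin 2) k :=
  exactQuot (rename ![1, 0] P - P) (X 0 - X 1)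

/-- `(Q(u,v) - Q(w,v)) / (u - w)`, with `u = X 0`, `v = X 1`, `w = X 2`. -/
def barQ (Q : MvPolynomial (Fin 2) k) : MvPolynomial (Fin 3) k :=
  exactQuot (rename ![0, 1] Q - rename ![2, 1] Q) (X 0 - X 2)

/-- `P(v,u)P(u,w)/((u-v)(u-w)) + P(u,w)P(v,w)/((u-w)(v-w)) - P(u,v)P(v,w)/((u-v)(v-w))`,
brought to the common denominator `(u-v)(u-w)(v-w)`. -/
def barP' (P : MvPolynomial (Fin 2) k) : MvPolynomial (Fin 3) k :=
  exactQuot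
    (rename ![1, 0] P * rename ![0, 2] P * (X 1 - X 2)
      + rename ![0, 2] P * rename ![1, 2] P * (X 0 - X 1)
      - rename ![0, 1] P * rename ![1, 2] P * (X 0 - X 2))
    ((X 0 - X 1) * ((X 0 - X 2) * (X 1 - X 2)))

/-- `-P(u,v)P(u,w)/((u-v)(u-w)) - P(u,w)P(w,v)/((u-w)(v-w)) + P(u,v)P(v,w)/((u-v)(v-w))`,
brought to the common denominator `(u-v)(u-w)(v-w)`. -/
def barP'' (P : MvPolynomial (Fin 2) k) : MvPolynomial (Fin 3) k :=
  exactQuot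
    (-(rename ![0, 1] P * rename ![0, 2] P * (X 1 - X 2))
      - rename ![0, 2] P * rename ![2, 1] P * (X 0 - X 1)
      + rename ![0, 1] P * rename ![1, 2] P * (X 0 - X 2))
    ((X 0 - X 1) * ((X 0 - X 2) * (X 1 - X 2)))

variable {σ : Type} [DecidableEq σ]

/-- Substituting `X b` for `X a`. -/
def subst (a b : σ) : MvPolynomial σ k →ₐ[k] MvPolynomial σ k :=
  rename (fun c => if c = a then b else c)

theorem sub_dvd_sub_subst (a b : σ) (p : MvPolynomial σ k) : (X a - X b) ∣ (p - subst a b p) := by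
  induction p using MvPolynomial.induction_on with
  | C c => simp [subst]
  | add p q hp hq =>
    rw [map_add, add_sub_add_comm]
    exact dvd_add hp hq
  | mul_X p c hp =>
    have h1 : (X a - X b : MvPolynomial σ k) ∣ (X c - subst a b (X c)) := by
      by_cases hc : c = a
      · subst hc; simp [subst]
      · simp [subst, hc]
    rw [map_mul, show p * X c - subst a b p * subst a b (X c)
      = (p - subst a b p) * X c + subst a b p * (X c - subst a b (X c)) by ring]
    exact dvd_add (hp.mul_right _) (h1.mul_left _)

theorem sub_dvd_of_subst (a b : σ) {p : MvPolynomial σ k} (h : subst a b p = 0) :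
    (X a - X b) ∣ p := by
  have := sub_dvd_sub_subst a b p
  rwa [h, sub_zero] at this

theorem isRegular_X_sub_X {a b : σ} (hab : a ≠ b) :
    IsRegular (X a - X b : MvPolynomial σ k) := by
  let f : MvPolynomial σ k →ₐ[k] MvPolynomial σ k := aeval fun c => if c = a then X a + X b else X c
  let g : MvPolynomial σ k →ₐ[k] MvPolynomial σ k := aeval fun c => if c = a then X a - X b else X c
  have hgf : ∀ p, g (f p) = p := by
    intro p
    have : g.comp f = AlgHom.id k _ := by
      apply MvPolynomial.algHom_ext
      intro c
      by_cases hc : c = a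
      · subst hc; simp [f, g, hab.symm]
      · simp [f, g, hc]
    exact DFunLike.congr_fun this p
  have hf : f (X a - X b) = X a := by simp [f, hab.symm]
  suffices hl : IsLeftRegular (X a - X b : MvPolynomial σ k) from
    ⟨hl, fun p q hpq => hl (by simpa [mul_comm] using hpq)⟩
  intro p q hpq
  have h2 : f (X a - X b) * f p = f (X a - X b) * f q := by
    rw [← map_mul, ← map_mul]; exact congrArg f hpq
  rw [hf] at h2
  have h3 := (isRegular_X (R := k) (n := a)).left h2
  rw [← hgf p, ← hgf q]
  exact congrArg g h3

theorem partialP_spec (P : MvPolynomial (Fin 2) k) :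
    (X 0 - X 1) * partialP P = rename ![1, 0] P - P := by
  refine mul_exactQuot (sub_dvd_of_subst 0 1 ?_)
  rw [map_sub, subst, rename_rename, sub_eq_zero]
  congr 2
  funext c; fin_cases c <;> rfl

theorem barQ_spec (Q : MvPolynomial (Fin 2) k) :
    (X 0 - X 2) * barQ Q = rename ![0, 1] Q - rename ![2, 1] Q := by
  refine mul_exactQuot (sub_dvd_of_subst 0 2 ?_)
  rw [map_sub, subst, rename_rename, rename_rename, sub_eq_zero]
  congr 2
  funext c; fin_cases c <;> rfl

theorem vandermonde_dvd {N : MvPolynomial (Fin 3) k} (h01 : subst 0 1 N = 0)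
    (h02 : subst 0 2 N = 0) (h12 : subst 1 2 N = 0) :
    (X 0 - X 1) * ((X 0 - X 2) * (X 1 - X 2)) ∣ N := by
  obtain ⟨N1, rfl⟩ := sub_dvd_of_subst 1 2 h12
  have h3 : subst 0 2 N1 = 0 := by
    rw [map_mul] at h02
    have e : subst 0 2 (X 1 - X 2 : MvPolynomial (Fin 3) k) = X 1 - X 2 := by simp [subst]
    rw [e] at h02
    exact (isRegular_X_sub_X (a := (1 : Fin 3)) (b := 2) (by decide)).left (by simpa using h02)
  obtain ⟨N2, rfl⟩ := sub_dvd_of_subst 0 2 h3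
  have h4 : subst 0 1 N2 = 0 := by
    rw [map_mul, map_mul] at h01
    have e1 : subst 0 1 (X 1 - X 2 : MvPolynomial (Fin 3) k) = X 1 - X 2 := by simp [subst]
    have e2 : subst 0 1 (X 0 - X 2 : MvPolynomial (Fin 3) k) = X 1 - X 2 := by simp [subst]
    rw [e1, e2] at h01
    have h12 : IsRegular (X 1 - X 2 : MvPolynomial (Fin 3) k) := isRegular_X_sub_X (by decide)
    exact h12.left (h12.left (by simpa using h01))
  obtain ⟨N3, rfl⟩ := sub_dvd_of_subst 0 1 h4
  exact ⟨N3, by ring⟩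

theorem subst_rename (a b : Fin 3) (f g : Fin 2 → Fin 3) (P : MvPolynomial (Fin 2) k)
    (h : ∀ c, (if f c = a then b else f c) = g c) :
    subst a b (rename f P) = rename g P := by
  rw [subst, rename_rename]
  congr 2
  funext c
  exact h c

theorem barP'_spec (P : MvPolynomial (Fin 2) k) :
    (X 0 - X 1) * ((X 0 - X 2) * (X 1 - X 2)) * barP' P
      = rename ![1, 0] P * rename ![0, 2] P * (X 1 - X 2)
      + rename ![0, 2] P * rename ![1, 2] P * (X 0 - X 1)
      - rename ![0, 1] P * rename ![1, 2] P * (X 0 - X 2) := by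
  refine mul_exactQuot (vandermonde_dvd ?_ ?_ ?_)
  · simp only [map_add, map_sub, map_mul]
    rw [subst_rename 0 1 ![1, 0] ![1, 1] P (by decide),
      subst_rename 0 1 ![0, 2] ![1, 2] P (by decide),
      subst_rename 0 1 ![1, 2] ![1, 2] P (by decide),
      subst_rename 0 1 ![0, 1] ![1, 1] P (by decide)]
    simp [subst]
  · simp only [map_add, map_sub, map_mul]
    rw [subst_rename 0 2 ![1, 0] ![1, 2] P (by decide),
      subst_rename 0 2 ![0, 2] ![2, 2] P (by decide),
      subst_rename 0 2 ![1, 2] ![1, 2] P (by decide),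
      subst_rename 0 2 ![0, 1] ![2, 1] P (by decide)]
    simp [subst]; ring
  · simp only [map_add, map_sub, map_mul]
    rw [subst_rename 1 2 ![1, 0] ![2, 0] P (by decide),
      subst_rename 1 2 ![0, 2] ![0, 2] P (by decide),
      subst_rename 1 2 ![1, 2] ![2, 2] P (by decide),
      subst_rename 1 2 ![0, 1] ![0, 2] P (by decide)]
    simp [subst]

theorem barP''_spec (P : MvPolynomial (Fin 2) k) :
    (X 0 - X 1) * ((X 0 - X 2) * (X 1 - X 2)) * barP'' P
      = -(rename ![0, 1] P * rename ![0, 2] P * (X 1 - X 2))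
      - rename ![0, 2] P * rename ![2, 1] P * (X 0 - X 1)
      + rename ![0, 1] P * rename ![1, 2] P * (X 0 - X 2) := by
  refine mul_exactQuot (vandermonde_dvd ?_ ?_ ?_)
  · simp only [map_add, map_sub, map_mul, map_neg]
    rw [subst_rename 0 1 ![0, 1] ![1, 1] P (by decide),
      subst_rename 0 1 ![0, 2] ![1, 2] P (by decide),
      subst_rename 0 1 ![2, 1] ![2, 1] P (by decide),
      subst_rename 0 1 ![1, 2] ![1, 2] P (by decide)]
    simp [subst]
  · simp only [map_add, map_sub, map_mul, map_neg]
    rw [subst_rename 0 2 ![0, 1] ![2, 1] P (by decide),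
      subst_rename 0 2 ![0, 2] ![2, 2] P (by decide),
      subst_rename 0 2 ![2, 1] ![2, 1] P (by decide),
      subst_rename 0 2 ![1, 2] ![1, 2] P (by decide)]
    simp [subst]; ring
  · simp only [map_add, map_sub, map_mul, map_neg]
    rw [subst_rename 1 2 ![0, 1] ![0, 2] P (by decide),
      subst_rename 1 2 ![0, 2] ![0, 2] P (by decide),
      subst_rename 1 2 ![2, 1] ![2, 2] P (by decide),
      subst_rename 1 2 ![1, 2] ![2, 2] P (by decide)]
    simp [subst]

end Polynomials

/-! ### Laurent polynomials, used to express gradings -/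

/-- Laurent polynomials `∑ a_d T ^ d` over a ring `A`, with `T` central. -/
def Lau (A : Type u) [Ring A] : Type u := AddMonoidAlgebra A ℤ

namespace Lau

variable {A : Type u} [Ring A]

instance : Ring (Lau A) := inferInstanceAs (Ring (AddMonoidAlgebra A ℤ))

instance {A : Type u} [CommRing A] : CommRing (Lau A) :=
  { (inferInstance : Ring (Lau A)) with
    mul_comm := fun x y => mul_comm (G := AddMonoidAlgebra A ℤ) x y }

/-- The Laurent monomial `a T ^ d`. -/
def mono (d : ℤ) : A →+ Lau A := AddMonoidAlgebra.singleAddHom d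

/-- The coefficients of a Laurent polynomial. -/
def coeff : Lau A ≃+ (ℤ →₀ A) := AddMonoidAlgebra.coeffAddEquiv

theorem mono_mul_mono (d e : ℤ) (a b : A) : mono d a * mono e b = mono (d + e) (a * b) :=
  AddMonoidAlgebra.single_mul_single d e a b

theorem one_eq : (1 : Lau A) = mono 0 1 := rfl

@[simp] theorem coeff_mono (d : ℤ) (a : A) : coeff (mono d a) = Finsupp.single d a := rfl

theorem induction {p : Lau A → Prop} (x : Lau A) (h0 : p 0) (hadd : ∀ x y, p x → p y → p (x + y))
    (h : ∀ d a, p (mono d a)) : p x :=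
  AddMonoidAlgebra.induction_linear (motive := p) x h0 hadd h

theorem coeff_mono_zero_mul (a : A) (x : Lau A) (d : ℤ) :
    coeff (mono 0 a * x) d = a * coeff x d := by
  induction x using induction with
  | h0 => simp
  | hadd x y hx hy => rw [mul_add, map_add, Finsupp.add_apply, hx, hy, map_add, Finsupp.add_apply,
      mul_add]
  | h e b =>
    rw [mono_mul_mono, zero_add, coeff_mono, coeff_mono]
    by_cases h : e = d <;> simp [h]

theorem mono_pow (d : ℤ) (a : A) (n : ℕ) : mono d a ^ n = mono (d * n) (a ^ n) := by
  induction n with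
  | zero => simp [one_eq]
  | succ n ih =>
    rw [pow_succ, ih, mono_mul_mono, pow_succ]
    congr 1
    push_cast; ring_nf

/-- The map induced by a ring homomorphism on coefficients. -/
def map {A' : Type u} [Ring A'] (f : A →+* A') : Lau A →+* Lau A' :=
  AddMonoidAlgebra.mapRingHom ℤ f

@[simp] theorem map_mono {A' : Type u} [Ring A'] (f : A →+* A') (d : ℤ) (a : A) :
    map f (mono d a) = mono d (f a) :=
  AddMonoidAlgebra.map_single f.toAddMonoidHom a d

end Lau

section Homogeneous

variable {k : Type u} [CommRing k] (𝓀 : ℕ → AddSubgroup k) [GradedRing 𝓀]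

/-- The ring homomorphism `k → A[T, T⁻¹]`, `c ↦ ∑ l, c_l T ^ l`, for a `k`-algebra `A`. -/
def twist (A : Type u) [Ring A] [Algebra k A] : k →+* Lau A :=
  (DirectSum.toSemiring (fun l : ℕ =>
    ((Lau.mono (l : ℤ)).comp (algebraMap k A).toAddMonoidHom).comp
      (𝓀 l).subtype)
    (by simp [Lau.one_eq])
    (fun {i j} a b => by simp [Lau.mono_mul_mono])).comp
  (DirectSum.decomposeRingEquiv 𝓀).toRingHom

theorem twist_of_mem (A : Type u) [Ring A] [Algebra k A] {l : ℕ} {c : k} (h : c ∈ 𝓀 l) :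
    twist 𝓀 A c = Lau.mono (l : ℤ) (algebraMap k A c) := by
  lift c to 𝓀 l using h
  have h2 : (DirectSum.decomposeRingEquiv 𝓀) (c : k) = DirectSum.of (fun l => 𝓀 l) l c :=
    DirectSum.decompose_coe 𝓀 c
  simp [twist, h2]

theorem grading_induction {p : k → Prop} (h0 : p 0) (hadd : ∀ x y, p x → p y → p (x + y))
    (h : ∀ l c, c ∈ 𝓀 l → p c) (c : k) : p c := by
  classical
  rw [← DirectSum.sum_support_decompose 𝓀 c]
  exact Finset.sum_induction _ p hadd h0 fun l _ => h l _ (SetLike.coe_mem _)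

theorem twist_commutes (A : Type u) [Ring A] [Algebra k A] (c : k) (x : Lau A) :
    twist 𝓀 A c * x = x * twist 𝓀 A c := by
  induction c using grading_induction 𝓀 with
  | h0 => simp
  | hadd c d hc hd => rw [map_add, add_mul, mul_add, hc, hd]
  | h l c hc =>
    rw [twist_of_mem 𝓀 A hc]
    induction x using Lau.induction with
    | h0 => simp
    | hadd x y hx hy => rw [add_mul, mul_add, hx, hy]
    | h m a =>
      rw [Lau.mono_mul_mono, Lau.mono_mul_mono, add_comm,
        Algebra.commutes]

variable {r : ℕ}

/-- A polynomial over the graded ring `k` is homogeneous of degree `s`, for variables of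
degrees `w a`. -/
def IsHomPoly (w : Fin r → ℤ) (s : ℤ) (p : MvPolynomial (Fin r) k) : Prop :=
  ∀ m, p.coeff m = 0 ∨ ∃ l : ℕ, (l : ℤ) + ∑ a, w a * m a = s ∧ p.coeff m ∈ 𝓀 l

/-- The ring homomorphism `k[X] → k[X][T, T⁻¹]` which multiplies the degree `s` part by `T ^ s`. -/
def polyTwist (w : Fin r → ℤ) :
    MvPolynomial (Fin r) k →+* Lau (MvPolynomial (Fin r) k) :=
  MvPolynomial.eval₂Hom (twist 𝓀 (MvPolynomial (Fin r) k))
    (fun a => Lau.mono (w a) (MvPolynomial.X a))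

theorem polyTwist_monomial (w : Fin r → ℤ) {l : ℕ} {c : k} (hc : c ∈ 𝓀 l) (m : Fin r →₀ ℕ) :
    polyTwist 𝓀 w (MvPolynomial.monomial m c)
      = Lau.mono ((l : ℤ) + ∑ a, w a * m a) (MvPolynomial.monomial m c) := by
  rw [polyTwist, MvPolynomial.eval₂Hom_monomial, twist_of_mem 𝓀 _ hc, Finsupp.prod_fintype _ _
    (by simp)]
  have : ∀ S : Finset (Fin r), ∏ a ∈ S, (Lau.mono (w a)
      (MvPolynomial.X a : MvPolynomial (Fin r) k)) ^ (m a)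
      = Lau.mono (∑ a ∈ S, w a * m a) (∏ a ∈ S, (MvPolynomial.X a) ^ (m a)) := by
    intro S
    induction S using Finset.induction_on with
    | empty => simp [Lau.one_eq]
    | insert a S ha ih =>
      rw [Finset.prod_insert ha, Finset.prod_insert ha, Finset.sum_insert ha, ih,
        Lau.mono_pow, Lau.mono_mul_mono]
  rw [this, Lau.mono_mul_mono, MvPolynomial.monomial_eq,
    Finsupp.prod_fintype _ _ (by simp)]
  rfl

theorem IsHomPoly.polyTwist_eq {w : Fin r → ℤ} {s : ℤ} {p : MvPolynomial (Fin r) k}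
    (h : IsHomPoly 𝓀 w s p) : polyTwist 𝓀 w p = Lau.mono s p := by
  conv_lhs => rw [p.as_sum]
  conv_rhs => rw [p.as_sum]
  rw [map_sum]
  rw [map_sum]
  refine Finset.sum_congr rfl fun m hm => ?_
  rcases h m with h0 | ⟨l, hl, hc⟩
  · simp [h0]
  · rw [polyTwist_monomial 𝓀 w hc, hl]

theorem coeff_polyTwist (w : Fin r → ℤ) (p : MvPolynomial (Fin r) k) (m : Fin r →₀ ℕ) (l : ℕ) :
    MvPolynomial.coeff m (Lau.coeff (polyTwist 𝓀 w p) ((l : ℤ) + ∑ a, w a * m a))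
      = (DirectSum.decompose 𝓀 (p.coeff m) l : k) := by
  classical
  induction p using MvPolynomial.induction_on' with
  | add p q hp hq => simp [hp, hq, DirectSum.decompose_add]
  | monomial m' c =>
    induction c using grading_induction 𝓀 with
    | h0 => simp
    | hadd c d hc hd =>
      rw [map_add (MvPolynomial.monomial m'), map_add (polyTwist 𝓀 w), map_add Lau.coeff,
        Finsupp.add_apply, MvPolynomial.coeff_add, MvPolynomial.coeff_add,
        DirectSum.decompose_add, DirectSum.add_apply, AddSubgroup.coe_add, hc, hd]
    | h l' c hc =>
      rw [polyTwist_monomial 𝓀 w hc]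
      by_cases hm : m' = m
      · subst hm
        by_cases hl : l' = l
        · subst hl
          simp [DirectSum.decompose_of_mem_same 𝓀 hc]
        · have : ((l' : ℤ) + ∑ a, w a * m' a) ≠ (l : ℤ) + ∑ a, w a * m' a := by
            intro h; exact hl (by exact_mod_cast add_right_cancel h)
          simp [DirectSum.decompose_of_mem_ne 𝓀 hc hl, this]
      · rw [MvPolynomial.coeff_monomial, if_neg hm, Lau.coeff_mono, Finsupp.single_apply]
        split_ifs <;> simp [MvPolynomial.coeff_monomial, hm]

theorem isHomPoly_of_polyTwist_eq {w : Fin r → ℤ} {s : ℤ} {p : MvPolynomial (Fin r) k}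
    (h : polyTwist 𝓀 w p = Lau.mono s p) : IsHomPoly 𝓀 w s p := by
  classical
  intro m
  have key : ∀ l : ℕ, (l : ℤ) + ∑ a, w a * m a ≠ s →
      (DirectSum.decompose 𝓀 (p.coeff m) l : k) = 0 := by
    intro l hl
    rw [← coeff_polyTwist 𝓀 w, h, Lau.coeff_mono, Finsupp.single_apply, if_neg hl.symm]
    simp
  by_cases hex : ∃ l : ℕ, (l : ℤ) + ∑ a, w a * m a = s
  · obtain ⟨l, hl⟩ := hex
    refine Or.inr ⟨l, hl, ?_⟩
    rw [← DirectSum.sum_support_decompose 𝓀 (p.coeff m)]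
    refine sum_mem fun l' _ => ?_
    by_cases hll : l' = l
    · subst hll; exact SetLike.coe_mem _
    · rw [key l' (fun h' => hll (by
        have := h'.trans hl.symm
        exact_mod_cast add_right_cancel this))]
      exact zero_mem _
  · left
    rw [← DirectSum.sum_support_decompose 𝓀 (p.coeff m)]
    exact Finset.sum_eq_zero fun l _ => key l fun h' => hex ⟨l, h'⟩

theorem isHomPoly_iff {w : Fin r → ℤ} {s : ℤ} {p : MvPolynomial (Fin r) k} :
    IsHomPoly 𝓀 w s p ↔ polyTwist 𝓀 w p = Lau.mono s p :=
  ⟨fun h => h.polyTwist_eq, isHomPoly_of_polyTwist_eq 𝓀⟩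

variable {𝓀}

theorem IsHomPoly.mul {w : Fin r → ℤ} {s t : ℤ} {p q : MvPolynomial (Fin r) k}
    (hp : IsHomPoly 𝓀 w s p) (hq : IsHomPoly 𝓀 w t q) : IsHomPoly 𝓀 w (s + t) (p * q) := by
  rw [isHomPoly_iff] at *
  rw [map_mul, hp, hq, Lau.mono_mul_mono]

theorem IsHomPoly.add {w : Fin r → ℤ} {s : ℤ} {p q : MvPolynomial (Fin r) k}
    (hp : IsHomPoly 𝓀 w s p) (hq : IsHomPoly 𝓀 w s q) : IsHomPoly 𝓀 w s (p + q) := by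
  rw [isHomPoly_iff] at *
  rw [map_add, hp, hq]
  exact (map_add (Lau.mono s) p q).symm

theorem IsHomPoly.neg {w : Fin r → ℤ} {s : ℤ} {p : MvPolynomial (Fin r) k}
    (hp : IsHomPoly 𝓀 w s p) : IsHomPoly 𝓀 w s (-p) := by
  rw [isHomPoly_iff] at *
  rw [map_neg, hp]
  exact (map_neg (Lau.mono s) p).symm

theorem IsHomPoly.sub {w : Fin r → ℤ} {s : ℤ} {p q : MvPolynomial (Fin r) k}
    (hp : IsHomPoly 𝓀 w s p) (hq : IsHomPoly 𝓀 w s q) : IsHomPoly 𝓀 w s (p - q) := by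
  rw [sub_eq_add_neg]; exact hp.add hq.neg

theorem isHomPoly_X (w : Fin r → ℤ) (a : Fin r) :
    IsHomPoly 𝓀 w (w a) (MvPolynomial.X a : MvPolynomial (Fin r) k) := by
  rw [isHomPoly_iff]
  simp [polyTwist]

theorem IsHomPoly.rename {r' : ℕ} {w : Fin r → ℤ} {w' : Fin r' → ℤ} {s : ℤ}
    {p : MvPolynomial (Fin r) k} (hp : IsHomPoly 𝓀 w s p) (f : Fin r → Fin r')
    (hw : ∀ a, w' (f a) = w a) : IsHomPoly 𝓀 w' s (MvPolynomial.rename f p) := by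
  rw [isHomPoly_iff]
  have h : ∀ p : MvPolynomial (Fin r) k, polyTwist 𝓀 w' (MvPolynomial.rename f p)
      = Lau.map (MvPolynomial.rename f).toRingHom (polyTwist 𝓀 w p) := by
    intro p
    have : (polyTwist 𝓀 w').comp (MvPolynomial.rename f).toRingHom
        = (Lau.map (MvPolynomial.rename (R := k) f).toRingHom).comp
          (polyTwist 𝓀 w) := by
      apply MvPolynomial.ringHom_ext
      · intro c
        induction c using grading_induction 𝓀 with
        | h0 => simp
        | hadd c d hc hd => simp only [map_add, hc, hd]
        | h l c hc =>
          simp [polyTwist, twist_of_mem 𝓀 _ hc]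
      · intro a
        simp [polyTwist, hw]
    exact DFunLike.congr_fun this p
  rw [h, hp.polyTwist_eq]
  simp

theorem IsHomPoly.of_mul {w : Fin r → ℤ} {s t : ℤ} {q p : MvPolynomial (Fin r) k}
    (hreg : IsRegular q) (hq : IsHomPoly 𝓀 w t q) (h : IsHomPoly 𝓀 w (t + s) (q * p)) :
    IsHomPoly 𝓀 w s p := by
  rw [isHomPoly_iff] at *
  rw [map_mul, hq, ← Lau.mono_mul_mono] at h
  have h2 := congrArg (fun z => Lau.mono (-t) (1 : MvPolynomial (Fin r) k) * z) h
  rw [← mul_assoc, ← mul_assoc, Lau.mono_mul_mono, neg_add_cancel, one_mul] at h2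
  apply Lau.coeff.injective
  ext1 d
  have h3 := DFunLike.congr_fun (congrArg Lau.coeff h2) d
  rw [Lau.coeff_mono_zero_mul, Lau.coeff_mono_zero_mul] at h3
  exact hreg.left h3

end Homogeneous

/-! ### Borcherds-Cartan data and Khovanov-Lauda-Rouquier algebras -/

/-- A symmetrizable Borcherds-Cartan matrix `(a i j)` with symmetrizer `diag (d i)`. -/
structure BorcherdsCartan (I : Type u) where
  a : I → I → ℤ
  d : I → ℤ
  diag : ∀ i, a i i = 2 ∨ (a i i ≤ 0 ∧ Even (a i i))
  offDiag : ∀ i j, i ≠ j → a i j ≤ 0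
  zero_iff : ∀ i j, a i j = 0 ↔ a j i = 0
  d_pos : ∀ i, 0 < d i
  symm : ∀ i j, d i * a i j = d j * a j i

/-- The polynomials `Q_{i,j}(u,v)` and `P_i(u,v)` over a graded commutative ring `k`
(with `u = X 0`, `v = X 1`) from which the Khovanov-Lauda-Rouquier algebras are built.
A homogeneous element of degree `0` is a unit of `k` if and only if it is a unit of the degree `0`
part of `k`. -/
structure KLRDatum {k : Type u} [CommRing k] (𝓀 : ℕ → AddSubgroup k) (I : Type u) extends
    BorcherdsCartan I where
  Q : I → I → MvPolynomial (Fin 2) k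
  P : I → MvPolynomial (Fin 2) k
  Q_self : ∀ i, Q i i = 0
  Q_symm : ∀ i j, Q i j = MvPolynomial.rename ![1, 0] (Q j i)
  Q_bound : ∀ i j, i ≠ j → ∀ m : Fin 2 →₀ ℕ,
    -(d i * a i j) < d i * m 0 + d j * m 1 → (Q i j).coeff m = 0
  Q_deg : ∀ i j, i ≠ j → ∀ (m : Fin 2 →₀ ℕ) (l : ℕ),
    (l : ℤ) = -2 * (d i * a i j + d i * m 0 + d j * m 1) → (Q i j).coeff m ∈ 𝓀 l
  Q_lead : ∀ i j, i ≠ j → ∀ N : ℕ, (N : ℤ) = -a i j →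
    IsUnit ((Q i j).coeff (Finsupp.single 0 N))
  P_bound : ∀ i (m : Fin 2 →₀ ℕ), 2 - a i i < 2 * ((m 0 : ℤ) + m 1) → (P i).coeff m = 0
  P_deg : ∀ i (m : Fin 2 →₀ ℕ) (l : ℕ),
    (l : ℤ) = d i * (2 - 2 * m 0 - 2 * m 1 - a i i) → (P i).coeff m ∈ 𝓀 l
  P_lead_left : ∀ i (N : ℕ), 2 * (N : ℤ) = 2 - a i i →
    IsUnit ((P i).coeff (Finsupp.single 0 N))
  P_lead_right : ∀ i (N : ℕ), 2 * (N : ℤ) = 2 - a i i →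
    IsUnit ((P i).coeff (Finsupp.single 1 N))

/-- The value of a polynomial at a tuple of elements of an algebra; the products are taken in
the order of the variables (in the uses below the elements commute in the end). -/
def ncEval {k : Type u} [CommRing k] {A : Type u} [Ring A] [Algebra k A] {r : ℕ}
    (p : MvPolynomial (Fin r) k) (y : Fin r → A) : A :=
  ∑ m ∈ p.support, p.coeff m • ((List.finRange r).map fun a => y a ^ m a).prod

theorem map_ncEval {k : Type u} [CommRing k] {A B : Type u} [Ring A] [Algebra k A] [Ring B]
    [Algebra k B] {r : ℕ} (f : A →ₐ[k] B) (p : MvPolynomial (Fin r) k) (y : Fin r → A) :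
    f (ncEval p y) = ncEval p (fun a => f (y a)) := by
  simp only [ncEval, map_sum, map_smul, map_list_prod, List.map_map]
  refine Finset.sum_congr rfl fun m _ => ?_
  congr 3
  funext a
  simp

/-- Generators of the Khovanov-Lauda-Rouquier algebra `R(n)`. Positions are numbered from `0`;
`tau l` exchanges the positions `l` and `l + 1`. -/
inductive KLRGen (I : Type u) (n : ℕ) : Type u
  | e (ν : Fin n → I)
  | x (p : Fin n)
  | tau (l : ℕ) (h : l + 1 < n)

/-- The transposition of the positions `l` and `l + 1`. -/
def adj {n : ℕ} (l : ℕ) (h : l + 1 < n) : Equiv.Perm (Fin n) :=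
  Equiv.swap ⟨l, Nat.lt_of_succ_lt h⟩ ⟨l + 1, h⟩

namespace KLRDatum

variable {k I : Type u} [CommRing k] {𝓀 : ℕ → AddSubgroup k} (D : KLRDatum 𝓀 I)

section Relations

variable (k) {n : ℕ}

/-- The free generator `e(ν)`. -/
abbrev fe (ν : Fin n → I) : FreeAlgebra k (KLRGen I n) := FreeAlgebra.ι k (KLRGen.e ν)

variable (I) in
/-- The free generator `x_p`. -/
abbrev fx (p : Fin n) : FreeAlgebra k (KLRGen I n) := FreeAlgebra.ι k (KLRGen.x p)

variable (I) in
/-- The free generator `τ_l`. -/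
abbrev ft (l : ℕ) (h : l + 1 < n) : FreeAlgebra k (KLRGen I n) := FreeAlgebra.ι k (KLRGen.tau l h)

end Relations

/-- The defining relations of the Khovanov-Lauda-Rouquier algebra `R(n)`. -/
inductive Rel [Fintype I] (n : ℕ) :
    FreeAlgebra k (KLRGen I n) → FreeAlgebra k (KLRGen I n) → Prop
  | e_idem (ν : Fin n → I) : Rel n (fe k ν * fe k ν) (fe k ν)
  | e_orth (ν ν' : Fin n → I) (h : ν ≠ ν') : Rel n (fe k ν * fe k ν') 0
  | e_sum : Rel n (∑ ν, fe k ν) 1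
  | x_comm (p q : Fin n) : Rel n (fx k I p * fx k I q) (fx k I q * fx k I p)
  | x_e (p : Fin n) (ν : Fin n → I) : Rel n (fx k I p * fe k ν) (fe k ν * fx k I p)
  | tau_e (l : ℕ) (h : l + 1 < n) (ν : Fin n → I) :
      Rel n (ft k I l h * fe k ν) (fe k (ν ∘ adj l h) * ft k I l h)
  | tau_comm (l l' : ℕ) (h : l + 1 < n) (h' : l' + 1 < n) (hl : l + 1 < l') :
      Rel n (ft k I l h * ft k I l' h') (ft k I l' h' * ft k I l h)
  | tau_sq_eq (l : ℕ) (h : l + 1 < n) (ν : Fin n → I)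
      (hν : ν ⟨l, by omega⟩ = ν ⟨l + 1, h⟩) :
      Rel n (ft k I l h * ft k I l h * fe k ν)
        (ncEval (partialP (D.P (ν ⟨l, by omega⟩))) ![fx k I ⟨l, by omega⟩, fx k I ⟨l + 1, h⟩]
          * ft k I l h * fe k ν)
  | tau_sq_ne (l : ℕ) (h : l + 1 < n) (ν : Fin n → I)
      (hν : ν ⟨l, by omega⟩ ≠ ν ⟨l + 1, h⟩) :
      Rel n (ft k I l h * ft k I l h * fe k ν)
        (ncEval (D.Q (ν ⟨l, by omega⟩) (ν ⟨l + 1, h⟩)) ![fx k I ⟨l, by omega⟩, fx k I ⟨l + 1, h⟩]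
          * fe k ν)
  | tau_x_left (l : ℕ) (h : l + 1 < n) (ν : Fin n → I)
      (hν : ν ⟨l, by omega⟩ = ν ⟨l + 1, h⟩) :
      Rel n ((ft k I l h * fx k I ⟨l, by omega⟩ - fx k I ⟨l + 1, h⟩ * ft k I l h) * fe k ν)
        (-(ncEval (D.P (ν ⟨l, by omega⟩)) ![fx k I ⟨l, by omega⟩, fx k I ⟨l + 1, h⟩] * fe k ν))
  | tau_x_right (l : ℕ) (h : l + 1 < n) (ν : Fin n → I)
      (hν : ν ⟨l, by omega⟩ = ν ⟨l + 1, h⟩) :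
      Rel n ((ft k I l h * fx k I ⟨l + 1, h⟩ - fx k I ⟨l, by omega⟩ * ft k I l h) * fe k ν)
        (ncEval (D.P (ν ⟨l, by omega⟩)) ![fx k I ⟨l, by omega⟩, fx k I ⟨l + 1, h⟩] * fe k ν)
  | tau_x_other (l : ℕ) (h : l + 1 < n) (p : Fin n) (ν : Fin n → I)
      (hν : ¬ ((p.1 = l ∨ p.1 = l + 1) ∧ ν ⟨l, by omega⟩ = ν ⟨l + 1, h⟩)) :
      Rel n ((ft k I l h * fx k I p - fx k I (adj l h p) * ft k I l h) * fe k ν) 0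
  | braid_Q (l : ℕ) (h : l + 2 < n) (ν : Fin n → I)
      (hν : ν ⟨l, by omega⟩ = ν ⟨l + 2, h⟩) (hν' : ν ⟨l, by omega⟩ ≠ ν ⟨l + 1, by omega⟩) :
      Rel n
        ((ft k I (l + 1) h * ft k I l (by omega) * ft k I (l + 1) h
          - ft k I l (by omega) * ft k I (l + 1) h * ft k I l (by omega)) * fe k ν)
        (ncEval (D.P (ν ⟨l, by omega⟩)) ![fx k I ⟨l, by omega⟩, fx k I ⟨l + 2, h⟩]
          * ncEval (barQ (D.Q (ν ⟨l, by omega⟩) (ν ⟨l + 1, by omega⟩)))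
            ![fx k I ⟨l, by omega⟩, fx k I ⟨l + 1, by omega⟩, fx k I ⟨l + 2, h⟩]
          * fe k ν)
  | braid_P (l : ℕ) (h : l + 2 < n) (ν : Fin n → I)
      (hν : ν ⟨l, by omega⟩ = ν ⟨l + 2, h⟩) (hν' : ν ⟨l, by omega⟩ = ν ⟨l + 1, by omega⟩) :
      Rel n
        ((ft k I (l + 1) h * ft k I l (by omega) * ft k I (l + 1) h
          - ft k I l (by omega) * ft k I (l + 1) h * ft k I l (by omega)) * fe k ν)
        (ncEval (barP' (D.P (ν ⟨l, by omega⟩)))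
            ![fx k I ⟨l, by omega⟩, fx k I ⟨l + 1, by omega⟩, fx k I ⟨l + 2, h⟩]
            * ft k I l (by omega) * fe k ν
          + ncEval (barP'' (D.P (ν ⟨l, by omega⟩)))
            ![fx k I ⟨l, by omega⟩, fx k I ⟨l + 1, by omega⟩, fx k I ⟨l + 2, h⟩]
            * ft k I (l + 1) h * fe k ν)
  | braid_zero (l : ℕ) (h : l + 2 < n) (ν : Fin n → I)
      (hν : ν ⟨l, by omega⟩ ≠ ν ⟨l + 2, h⟩) :
      Rel n
        ((ft k I (l + 1) h * ft k I l (by omega) * ft k I (l + 1) h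
          - ft k I l (by omega) * ft k I (l + 1) h * ft k I l (by omega)) * fe k ν) 0

variable [Fintype I] [DecidableEq I]

/-- The Khovanov-Lauda-Rouquier algebra `R(n)`. -/
def KLR (n : ℕ) : Type u := RingQuot (D.Rel n)

instance (n : ℕ) : Ring (D.KLR n) := inferInstanceAs (Ring (RingQuot (D.Rel n)))

instance (n : ℕ) : Algebra k (D.KLR n) := inferInstanceAs (Algebra k (RingQuot (D.Rel n)))

/-- The projection from the free algebra. -/
def klrMk (n : ℕ) : FreeAlgebra k (KLRGen I n) →ₐ[k] D.KLR n := RingQuot.mkAlgHom k (D.Rel n)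

variable {n : ℕ}

theorem klrMk_surjective : Function.Surjective (D.klrMk n) := RingQuot.mkAlgHom_surjective k _

theorem klrMk_rel {a b : FreeAlgebra k (KLRGen I n)} (h : D.Rel n a b) : D.klrMk n a = D.klrMk n b :=
  RingQuot.mkAlgHom_rel k h

/-- The idempotent `e(ν)`. -/
def e (ν : Fin n → I) : D.KLR n := D.klrMk n (fe k ν)

/-- The generator `x_p`. -/
def x (p : Fin n) : D.KLR n := D.klrMk n (fx k I p)

/-- The generator `τ_l`. -/
def tau (l : ℕ) (h : l + 1 < n) : D.KLR n := D.klrMk n (ft k I l h)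

theorem e_idem (ν : Fin n → I) : D.e ν * D.e ν = D.e ν := by
  simpa [e] using D.klrMk_rel (Rel.e_idem ν)

theorem e_orth {ν ν' : Fin n → I} (h : ν ≠ ν') : D.e ν * D.e ν' = 0 := by
  simpa [e] using D.klrMk_rel (Rel.e_orth ν ν' h)

theorem e_mul (ν ν' : Fin n → I) : D.e ν * D.e ν' = if ν = ν' then D.e ν else 0 := by
  split_ifs with h
  · subst h; exact D.e_idem ν
  · exact D.e_orth h

theorem e_sum : ∑ ν : Fin n → I, D.e ν = 1 := by
  simpa [e] using D.klrMk_rel (Rel.e_sum (n := n))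

theorem x_comm (p q : Fin n) : D.x p * D.x q = D.x q * D.x p := by
  simpa [x] using D.klrMk_rel (Rel.x_comm p q)

theorem x_e (p : Fin n) (ν : Fin n → I) : D.x p * D.e ν = D.e ν * D.x p := by
  simpa [x, e] using D.klrMk_rel (Rel.x_e p ν)

theorem tau_e (l : ℕ) (h : l + 1 < n) (ν : Fin n → I) :
    D.tau l h * D.e ν = D.e (ν ∘ adj l h) * D.tau l h := by
  simpa [tau, e] using D.klrMk_rel (Rel.tau_e l h ν)

theorem tau_comm {l l' : ℕ} (h : l + 1 < n) (h' : l' + 1 < n) (hl : l + 1 < l') :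
    D.tau l h * D.tau l' h' = D.tau l' h' * D.tau l h := by
  simpa [tau] using D.klrMk_rel (Rel.tau_comm l l' h h' hl)

theorem klr_induction {p : D.KLR n → Prop} (hs : ∀ c : k, p (algebraMap k _ c))
    (he : ∀ ν, p (D.e ν)) (hx : ∀ q, p (D.x q)) (ht : ∀ l h, p (D.tau l h))
    (hmul : ∀ a b, p a → p b → p (a * b)) (hadd : ∀ a b, p a → p b → p (a + b))
    (r : D.KLR n) : p r := by
  obtain ⟨r, rfl⟩ := D.klrMk_surjective r
  induction r using FreeAlgebra.induction with
  | grade0 c => rw [AlgHom.commutes]; exact hs c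
  | grade1 g =>
    cases g with
    | e ν => exact he ν
    | x q => exact hx q
    | tau l h => exact ht l h
  | mul a b ha hb => rw [map_mul]; exact hmul _ _ ha hb
  | add a b ha hb => rw [map_add]; exact hadd _ _ ha hb

/-- Algebra homomorphisms out of `R(n)`. -/
def lift {A : Type u} [Ring A] [Algebra k A] (f : KLRGen I n → A)
    (h : ∀ a b, D.Rel n a b → FreeAlgebra.lift k f a = FreeAlgebra.lift k f b) :
    D.KLR n →ₐ[k] A :=
  RingQuot.liftAlgHom k ⟨FreeAlgebra.lift k f, fun a b hab => h a b hab⟩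

theorem lift_mk {A : Type u} [Ring A] [Algebra k A] (f : KLRGen I n → A)
    (h : ∀ a b, D.Rel n a b → FreeAlgebra.lift k f a = FreeAlgebra.lift k f b)
    (a : FreeAlgebra k (KLRGen I n)) : D.lift f h (D.klrMk n a) = FreeAlgebra.lift k f a :=
  RingQuot.liftAlgHom_mkAlgHom_apply k _ _ a

theorem adj_apply (l : ℕ) (h : l + 1 < n) (p : Fin n) :
    adj l h p = if p.1 = l then ⟨l + 1, h⟩ else if p.1 = l + 1 then ⟨l, by omega⟩ else p := by
  rw [adj, Equiv.swap_apply_def]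
  simp only [Fin.ext_iff]

theorem lift_ncEval2 {A : Type u} [Ring A] [Algebra k A] (f : KLRGen I n → A)
    (P : MvPolynomial (Fin 2) k) (p q : Fin n) :
    FreeAlgebra.lift k f (ncEval P ![fx k I p, fx k I q])
      = ncEval P (fun a => f (.x (![p, q] a))) := by
  rw [map_ncEval]
  congr 1
  funext a
  fin_cases a <;> simp

theorem lift_ncEval3 {A : Type u} [Ring A] [Algebra k A] (f : KLRGen I n → A)
    (P : MvPolynomial (Fin 3) k) (p q r : Fin n) :
    FreeAlgebra.lift k f (ncEval P ![fx k I p, fx k I q, fx k I r])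
      = ncEval P (fun a => f (.x (![p, q, r] a))) := by
  rw [map_ncEval]
  congr 1
  funext a
  fin_cases a <;> simp

theorem klrMk_ncEval2 (P : MvPolynomial (Fin 2) k) (p q : Fin n) :
    D.klrMk n (ncEval P ![fx k I p, fx k I q]) = ncEval P (fun a => D.x (![p, q] a)) := by
  rw [map_ncEval]
  congr 1
  funext a
  fin_cases a <;> rfl

theorem klrMk_ncEval3 (P : MvPolynomial (Fin 3) k) (p q r : Fin n) :
    D.klrMk n (ncEval P ![fx k I p, fx k I q, fx k I r])
      = ncEval P (fun a => D.x (![p, q, r] a)) := by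
  rw [map_ncEval]
  congr 1
  funext a
  fin_cases a <;> rfl

theorem klrMk_fe (ν : Fin n → I) : D.klrMk n (fe k ν) = D.e ν := rfl
theorem klrMk_fx (p : Fin n) : D.klrMk n (fx k I p) = D.x p := rfl
theorem klrMk_ft (l : ℕ) (h : l + 1 < n) : D.klrMk n (ft k I l h) = D.tau l h := rfl

/-! ### The grading of `R(n)` -/

section GradingKLR

/-- The degree of `τ_l e(ν)`. -/
def degTau (l : ℕ) (h : l + 1 < n) (ν : Fin n → I) : ℤ :=
  -(D.d (ν ⟨l, by omega⟩) * D.a (ν ⟨l, by omega⟩) (ν ⟨l + 1, h⟩))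

/-- Homogeneous elements of `R(n)`: the grading is given by `deg e(ν) = 0`,
`deg x_p e(ν) = 2 d_{ν_p}` and `deg τ_l e(ν) = -(α_{ν_l} | α_{ν_{l+1}})`, and extends the grading
of the base ring. -/
inductive IsHomog (n : ℕ) : ℤ → D.KLR n → Prop
  | zero (s : ℤ) : IsHomog n s 0
  | add {s : ℤ} {a b : D.KLR n} (ha : IsHomog n s a) (hb : IsHomog n s b) : IsHomog n s (a + b)
  | mul {s t : ℤ} {a b : D.KLR n} (ha : IsHomog n s a) (hb : IsHomog n t b) :
      IsHomog n (s + t) (a * b)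
  | scalar {l : ℕ} {c : k} (hc : c ∈ 𝓀 l) : IsHomog n l (algebraMap k (D.KLR n) c)
  | e (ν : Fin n → I) : IsHomog n 0 (D.e ν)
  | x (p : Fin n) (ν : Fin n → I) : IsHomog n (2 * D.d (ν p)) (D.x p * D.e ν)
  | tau (l : ℕ) (h : l + 1 < n) (ν : Fin n → I) :
      IsHomog n (D.degTau l h ν) (D.tau l h * D.e ν)

variable [GradedRing 𝓀]

/-- The homogeneous part of degree `s` of `R(n)`. -/
def gr (n : ℕ) (s : ℤ) : AddSubgroup (D.KLR n) where
  carrier := {r | D.IsHomog n s r}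
  add_mem' := fun ha hb => IsHomog.add ha hb
  zero_mem' := IsHomog.zero s
  neg_mem' := fun {a} ha => by
    have h : D.IsHomog n ((0 : ℕ) + s) (algebraMap k (D.KLR n) (-1) * a) :=
      IsHomog.mul (IsHomog.scalar (neg_mem (SetLike.GradedOne.one_mem (A := 𝓀)))) ha
    simpa using h

/-- `R(n)[T, T⁻¹]` as a `k`-algebra through `c ↦ ∑ l, c_l T ^ l`. -/
instance : Algebra k (Lau (D.KLR n)) :=
  (twist 𝓀 (D.KLR n)).toAlgebra' (twist_commutes 𝓀 (D.KLR n))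

theorem algebraMap_lau (c : k) : algebraMap k (Lau (D.KLR n)) c = twist 𝓀 (D.KLR n) c := rfl

/-- The images of the generators in `R(n)[T, T⁻¹]`. -/
def lauGen : KLRGen I n → Lau (D.KLR n)
  | .e ν => Lau.mono 0 (D.e ν)
  | .x p => ∑ ν : Fin n → I, Lau.mono (2 * D.d (ν p)) (D.x p * D.e ν)
  | .tau l h => ∑ ν : Fin n → I, Lau.mono (D.degTau l h ν) (D.tau l h * D.e ν)

theorem ext_e {a b : Lau (D.KLR n)} (h : ∀ ν : Fin n → I, a * Lau.mono 0 (D.e ν)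
    = b * Lau.mono 0 (D.e ν)) : a = b := by
  have h1 : ∑ ν : Fin n → I, (Lau.mono 0 (D.e ν) : Lau (D.KLR n)) = 1 := by
    rw [← map_sum, D.e_sum, Lau.one_eq]
  rw [← mul_one a, ← mul_one b, ← h1, Finset.mul_sum, Finset.mul_sum]
  exact Finset.sum_congr rfl fun ν _ => h ν

theorem lauGen_e_mul (ν : Fin n → I) (t : ℤ) {r : D.KLR n} (hr : D.e ν * r = r) :
    D.lauGen (.e ν) * Lau.mono t r = Lau.mono t r := by
  rw [lauGen, Lau.mono_mul_mono, zero_add, hr]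

theorem e_mul_eq_zero {ν ν' : Fin n → I} (h : ν' ≠ ν) {r : D.KLR n} (hr : D.e ν * r = r) :
    D.e ν' * r = 0 := by
  rw [← hr, ← mul_assoc, D.e_orth h, zero_mul]

theorem lauGen_x_mul (p : Fin n) (ν : Fin n → I) (t : ℤ) {r : D.KLR n} (hr : D.e ν * r = r) :
    D.lauGen (.x p) * Lau.mono t r = Lau.mono (2 * D.d (ν p) + t) (D.x p * r) := by
  rw [lauGen, Finset.sum_mul, Finset.sum_eq_single ν]
  · rw [Lau.mono_mul_mono, mul_assoc, hr]
  · intro ν' _ h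
    rw [Lau.mono_mul_mono, mul_assoc, D.e_mul_eq_zero h hr, mul_zero, map_zero]
  · simp

theorem lauGen_tau_mul (l : ℕ) (h : l + 1 < n) (ν : Fin n → I) (t : ℤ) {r : D.KLR n}
    (hr : D.e ν * r = r) :
    D.lauGen (.tau l h) * Lau.mono t r = Lau.mono (D.degTau l h ν + t) (D.tau l h * r) := by
  rw [lauGen, Finset.sum_mul, Finset.sum_eq_single ν]
  · rw [Lau.mono_mul_mono, mul_assoc, hr]
  · intro ν' _ h
    rw [Lau.mono_mul_mono, mul_assoc, D.e_mul_eq_zero h hr, mul_zero, map_zero]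
  · simp

theorem src_x (p : Fin n) {ν : Fin n → I} {r : D.KLR n} (hr : D.e ν * r = r) :
    D.e ν * (D.x p * r) = D.x p * r := by
  rw [← mul_assoc, ← D.x_e, mul_assoc, hr]

theorem src_tau (l : ℕ) (h : l + 1 < n) {ν : Fin n → I} {r : D.KLR n} (hr : D.e ν * r = r) :
    D.e (ν ∘ adj l h) * (D.tau l h * r) = D.tau l h * r := by
  rw [← mul_assoc, ← D.tau_e, mul_assoc, hr]

theorem lauGen_ncEval {r : ℕ} {p : MvPolynomial (Fin r) k} {s : ℤ} {w : Fin r → ℤ}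
    (hp : IsHomPoly 𝓀 w s p) (pos : Fin r → Fin n) (ν : Fin n → I)
    (hw : ∀ a, w a = 2 * D.d (ν (pos a))) (t : ℤ) {z : D.KLR n} (hz : D.e ν * z = z) :
    ncEval p (fun a => D.lauGen (.x (pos a))) * Lau.mono t z
      = Lau.mono (s + t) (ncEval p (fun a => D.x (pos a)) * z) := by
  have hpow : ∀ (a : Fin r) (m : ℕ) (t : ℤ) (z : D.KLR n), D.e ν * z = z →
      D.e ν * (D.x (pos a) ^ m * z) = D.x (pos a) ^ m * z ∧
      D.lauGen (.x (pos a)) ^ m * Lau.mono t z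
        = Lau.mono (w a * m + t) (D.x (pos a) ^ m * z) := by
    intro a m t z hz
    induction m with
    | zero => simp [hz]
    | succ m ih =>
      rw [pow_succ', pow_succ', mul_assoc, mul_assoc, ih.2, D.lauGen_x_mul _ ν _ ih.1, ← hw]
      refine ⟨D.src_x _ ih.1, ?_⟩
      congr 2
      push_cast; ring
  have hlist : ∀ (L : List (Fin r)) (m : Fin r →₀ ℕ),
      D.e ν * ((L.map fun a => D.x (pos a) ^ m a).prod * z)
        = (L.map fun a => D.x (pos a) ^ m a).prod * z ∧
      (L.map fun a => D.lauGen (.x (pos a)) ^ m a).prod * Lau.mono t z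
        = Lau.mono ((L.map fun a => w a * (m a : ℤ)).sum + t)
          ((L.map fun a => D.x (pos a) ^ m a).prod * z) := by
    intro L m
    induction L with
    | nil => simp [hz]
    | cons a L ih =>
      rw [List.map_cons, List.map_cons, List.map_cons, List.prod_cons, List.prod_cons,
        List.sum_cons, mul_assoc, mul_assoc, ih.2, (hpow a (m a) _ _ ih.1).2, add_assoc]
      exact ⟨(hpow a (m a) 0 _ ih.1).1, rfl⟩
  rw [ncEval, ncEval, Finset.sum_mul, Finset.sum_mul, map_sum]
  refine Finset.sum_congr rfl fun m hm => ?_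
  rcases hp m with h0 | ⟨l, hl, hc⟩
  · exact absurd h0 (MvPolynomial.mem_support_iff.mp hm)
  · rw [Algebra.smul_def, Algebra.smul_def, algebraMap_lau, mul_assoc, (hlist _ m).2,
      twist_of_mem 𝓀 _ hc, Lau.mono_mul_mono, ← mul_assoc, ← Fin.sum_univ_def, ← hl, add_assoc]

theorem src_ncEval {r : ℕ} (p : MvPolynomial (Fin r) k) (pos : Fin r → Fin n) {ν : Fin n → I}
    {z : D.KLR n} (hz : D.e ν * z = z) :
    D.e ν * (ncEval p (fun a => D.x (pos a)) * z) = ncEval p (fun a => D.x (pos a)) * z := by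
  have hc : ∀ (L : List (Fin r)) (m : Fin r →₀ ℕ),
      Commute (D.e ν) (L.map fun a => D.x (pos a) ^ m a).prod := by
    intro L m
    refine Commute.list_prod_right _ _ fun y hy => ?_
    obtain ⟨a, _, rfl⟩ := List.mem_map.mp hy
    exact Commute.pow_right (D.x_e (pos a) ν).symm _
  have : Commute (D.e ν) (ncEval p (fun a => D.x (pos a))) :=
    Commute.sum_right _ _ _ fun m _ => (hc _ m).smul_right _
  rw [← mul_assoc, this.eq, mul_assoc, hz]

theorem P_isHom (i : I) (w : Fin 2 → ℤ) (hw : ∀ a, w a = 2 * D.d i) :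
    IsHomPoly 𝓀 w (D.d i * (2 - D.a i i)) (D.P i) := by
  intro m
  by_cases hb : 2 - D.a i i < 2 * ((m 0 : ℤ) + m 1)
  · exact Or.inl (D.P_bound i m hb)
  · right
    have h2 : 0 ≤ D.d i * (2 - 2 * m 0 - 2 * m 1 - D.a i i) :=
      mul_nonneg (D.d_pos i).le (by linarith)
    refine ⟨(D.d i * (2 - 2 * m 0 - 2 * m 1 - D.a i i)).toNat, ?_, D.P_deg i m _ ?_⟩
    · rw [Int.toNat_of_nonneg h2, Fin.sum_univ_two, hw, hw]; ring
    · rw [Int.toNat_of_nonneg h2]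

theorem Q_isHom {i j : I} (hij : i ≠ j) (w : Fin 2 → ℤ) (h0 : w 0 = 2 * D.d i)
    (h1 : w 1 = 2 * D.d j) : IsHomPoly 𝓀 w (-2 * (D.d i * D.a i j)) (D.Q i j) := by
  intro m
  by_cases hb : -(D.d i * D.a i j) < D.d i * m 0 + D.d j * m 1
  · exact Or.inl (D.Q_bound i j hij m hb)
  · right
    have h2 : 0 ≤ -2 * (D.d i * D.a i j + D.d i * m 0 + D.d j * m 1) := by linarith
    refine ⟨(-2 * (D.d i * D.a i j + D.d i * m 0 + D.d j * m 1)).toNat, ?_, D.Q_deg i j hij m _ ?_⟩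
    · rw [Int.toNat_of_nonneg h2, Fin.sum_univ_two, h0, h1]; ring
    · rw [Int.toNat_of_nonneg h2]

theorem isHom_X_sub_X {r : ℕ} {w : Fin r → ℤ} {s : ℤ} {a b : Fin r} (ha : w a = s) (hb : w b = s) :
    IsHomPoly 𝓀 w s (MvPolynomial.X a - MvPolynomial.X b) := by
  have h := isHomPoly_X (𝓀 := 𝓀) w b
  rw [hb, ← ha] at h
  rw [← ha]
  exact (isHomPoly_X w a).sub h

theorem partialP_isHom (i : I) (w : Fin 2 → ℤ) (hw : ∀ a, w a = 2 * D.d i) :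
    IsHomPoly 𝓀 w (-(D.d i * D.a i i)) (partialP (D.P i)) := by
  refine IsHomPoly.of_mul (isRegular_X_sub_X (a := 0) (b := 1) (by decide))
    (isHom_X_sub_X (hw 0) (hw 1)) ?_
  rw [partialP_spec]
  have h := D.P_isHom i w hw
  have h' := h.rename (w' := w) ![1, 0] (fun a => by rw [hw, hw])
  convert h'.sub h using 1
  ring

theorem barQ_isHom {i j : I} (hij : i ≠ j) (w : Fin 3 → ℤ) (h0 : w 0 = 2 * D.d i)
    (h1 : w 1 = 2 * D.d j) (h2 : w 2 = 2 * D.d i) :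
    IsHomPoly 𝓀 w (-2 * (D.d i * D.a i j) - 2 * D.d i) (barQ (D.Q i j)) := by
  refine IsHomPoly.of_mul (isRegular_X_sub_X (a := 0) (b := 2) (by decide))
    (isHom_X_sub_X h0 h2) ?_
  rw [barQ_spec]
  have h := D.Q_isHom hij ![2 * D.d i, 2 * D.d j] rfl rfl
  have ha := h.rename (w' := w) ![0, 1] (fun a => by fin_cases a <;> simp [h0, h1])
  have hb := h.rename (w' := w) ![2, 1] (fun a => by fin_cases a <;> simp [h2, h1])
  convert ha.sub hb using 1
  ring

theorem vandermonde_isHom (i : I) (w : Fin 3 → ℤ) (hw : ∀ a, w a = 2 * D.d i)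
    {s : ℤ} {p : MvPolynomial (Fin 3) k}
    (h : IsHomPoly 𝓀 w (s + 6 * D.d i) ((MvPolynomial.X 0 - MvPolynomial.X 1) *
      ((MvPolynomial.X 0 - MvPolynomial.X 2) * (MvPolynomial.X 1 - MvPolynomial.X 2)) * p)) :
    IsHomPoly 𝓀 w s p := by
  have e : s + 6 * D.d i = 2 * D.d i + (2 * D.d i + (2 * D.d i + s)) := by ring
  rw [e, mul_assoc, mul_assoc] at h
  exact IsHomPoly.of_mul (isRegular_X_sub_X (a := (1 : Fin 3)) (b := 2) (by decide))
    (isHom_X_sub_X (hw 1) (hw 2)) (IsHomPoly.of_mul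
      (isRegular_X_sub_X (a := (0 : Fin 3)) (b := 2) (by decide)) (isHom_X_sub_X (hw 0) (hw 2))
      (IsHomPoly.of_mul (isRegular_X_sub_X (a := (0 : Fin 3)) (b := 1) (by decide))
        (isHom_X_sub_X (hw 0) (hw 1)) h))

theorem P_rename_isHom (i : I) (w : Fin 3 → ℤ) (hw : ∀ a, w a = 2 * D.d i) (f : Fin 2 → Fin 3) :
    IsHomPoly 𝓀 w (D.d i * (2 - D.a i i)) (MvPolynomial.rename f (D.P i)) :=
  (D.P_isHom i (fun _ => 2 * D.d i) (fun _ => rfl)).rename f (fun _ => hw _)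

theorem barP'_isHom (i : I) (w : Fin 3 → ℤ) (hw : ∀ a, w a = 2 * D.d i) :
    IsHomPoly 𝓀 w (-2 * (D.d i * D.a i i)) (barP' (D.P i)) := by
  refine D.vandermonde_isHom i w hw ?_
  rw [barP'_spec]
  have e : -2 * (D.d i * D.a i i) + 6 * D.d i
      = D.d i * (2 - D.a i i) + D.d i * (2 - D.a i i) + 2 * D.d i := by ring
  rw [e]
  have hP := D.P_rename_isHom i w hw
  exact ((((hP _).mul (hP _)).mul (isHom_X_sub_X (hw 1) (hw 2))).add
    (((hP _).mul (hP _)).mul (isHom_X_sub_X (hw 0) (hw 1)))).sub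
    (((hP _).mul (hP _)).mul (isHom_X_sub_X (hw 0) (hw 2)))

theorem barP''_isHom (i : I) (w : Fin 3 → ℤ) (hw : ∀ a, w a = 2 * D.d i) :
    IsHomPoly 𝓀 w (-2 * (D.d i * D.a i i)) (barP'' (D.P i)) := by
  refine D.vandermonde_isHom i w hw ?_
  rw [barP''_spec]
  have e : -2 * (D.d i * D.a i i) + 6 * D.d i
      = D.d i * (2 - D.a i i) + D.d i * (2 - D.a i i) + 2 * D.d i := by ring
  rw [e]
  have hP := D.P_rename_isHom i w hw
  exact ((((hP _).mul (hP _)).mul (isHom_X_sub_X (hw 1) (hw 2))).neg.sub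
    (((hP _).mul (hP _)).mul (isHom_X_sub_X (hw 0) (hw 1)))).add
    (((hP _).mul (hP _)).mul (isHom_X_sub_X (hw 0) (hw 2)))


theorem lauGen_rel (a b : FreeAlgebra k (KLRGen I n)) (hab : D.Rel n a b) :
    FreeAlgebra.lift k D.lauGen a = FreeAlgebra.lift k D.lauGen b := by
  have hrel := D.klrMk_rel hab
  have lE : ∀ ν : Fin n → I, D.lauGen (.e ν) = Lau.mono 0 (D.e ν) := fun ν => rfl
  cases hab with
  | e_idem ν =>
    simp only [map_mul, FreeAlgebra.lift_ι_apply, lE, Lau.mono_mul_mono, D.e_idem, add_zero]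
  | e_orth ν ν' h =>
    simp only [map_mul, FreeAlgebra.lift_ι_apply, lE, Lau.mono_mul_mono, D.e_orth h, map_zero]
  | e_sum =>
    simp only [map_sum, FreeAlgebra.lift_ι_apply, lE, map_one]
    rw [← map_sum, D.e_sum, Lau.one_eq]
  | x_comm p q =>
    simp only [map_mul, FreeAlgebra.lift_ι_apply]
    refine D.ext_e fun ν => ?_
    have h0 := D.e_idem ν
    rw [mul_assoc, mul_assoc, D.lauGen_x_mul p ν _ h0, D.lauGen_x_mul q ν _ h0,
      D.lauGen_x_mul q ν _ (D.src_x p h0), D.lauGen_x_mul p ν _ (D.src_x q h0), ← mul_assoc,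
      ← mul_assoc, D.x_comm, add_left_comm]
  | x_e p ν =>
    simp only [map_mul, FreeAlgebra.lift_ι_apply]
    refine D.ext_e fun ν' => ?_
    have h0 := D.e_idem ν'
    rw [mul_assoc, mul_assoc, D.lauGen_x_mul p ν' _ h0, lE, Lau.mono_mul_mono, Lau.mono_mul_mono,
      ← mul_assoc, ← D.x_e, mul_assoc]
    by_cases hν : ν = ν'
    · subst hν
      rw [h0, add_zero, D.lauGen_x_mul p ν _ h0, zero_add]
    · rw [D.e_orth hν]; simp
  | tau_e l h ν =>
    simp only [map_mul, FreeAlgebra.lift_ι_apply]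
    refine D.ext_e fun ν' => ?_
    have h0 := D.e_idem ν'
    rw [mul_assoc, mul_assoc, D.lauGen_tau_mul l h ν' _ h0, lE, lE, Lau.mono_mul_mono,
      Lau.mono_mul_mono, ← mul_assoc, ← D.tau_e, mul_assoc]
    by_cases hν : ν = ν'
    · subst hν
      rw [h0, add_zero, D.lauGen_tau_mul l h ν _ h0, zero_add]
    · rw [D.e_orth hν]; simp
  | tau_comm l l' h h' hl =>
    simp only [map_mul, FreeAlgebra.lift_ι_apply]
    refine D.ext_e fun ν => ?_
    have h0 := D.e_idem ν
    rw [mul_assoc, mul_assoc, D.lauGen_tau_mul l h ν _ h0, D.lauGen_tau_mul l' h' ν _ h0,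
      D.lauGen_tau_mul l h _ _ (D.src_tau l' h' h0), D.lauGen_tau_mul l' h' _ _ (D.src_tau l h h0),
      ← mul_assoc, ← mul_assoc, D.tau_comm h h' hl]
    congr 2
    have e1 : l ≠ l' := by omega
    have e2 : l ≠ l' + 1 := by omega
    have e3 : l + 1 ≠ l' := by omega
    have e4 : l' ≠ l + 1 := by omega
    have e5 : l' + 1 ≠ l := by omega
    simp only [degTau, Function.comp_apply, adj_apply, e1, e2, e3, e4, e5, e1.symm, if_false,
      add_left_inj]
    ring
  | tau_sq_eq l h ν hν =>
    simp only [map_mul, FreeAlgebra.lift_ι_apply, lift_ncEval2, klrMk_ncEval2, klrMk_fe,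
      klrMk_ft] at hrel ⊢
    have h0 := D.e_idem ν
    have hc : ν ∘ adj l h = ν := by
      funext p
      simp only [Function.comp_apply, adj_apply]
      split_ifs with h1 h2
      · rw [← hν]; congr 1; exact Fin.ext h1.symm
      · rw [hν]; congr 1; exact Fin.ext h2.symm
      · rfl
    have h1 := D.src_tau l h h0
    rw [hc] at h1
    rw [mul_assoc, mul_assoc, lE, D.lauGen_tau_mul l h ν _ h0, D.lauGen_tau_mul l h ν _ h1,
      D.lauGen_ncEval (D.partialP_isHom (ν ⟨l, by omega⟩) (fun _ => 2 * D.d (ν ⟨l, by omega⟩))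
        (fun _ => rfl)) _ ν (fun a => by fin_cases a <;> simp [hν]) _ h1, ← mul_assoc, hrel,
      mul_assoc]
    congr 2
    simp [degTau, hν]
  | tau_sq_ne l h ν hν =>
    simp only [map_mul, FreeAlgebra.lift_ι_apply, lift_ncEval2, klrMk_ncEval2, klrMk_fe,
      klrMk_ft] at hrel ⊢
    have h0 := D.e_idem ν
    have h1 := D.src_tau l h h0
    rw [mul_assoc, lE, D.lauGen_tau_mul l h ν _ h0, D.lauGen_tau_mul l h _ _ h1,
      D.lauGen_ncEval (D.Q_isHom hν ![2 * D.d (ν ⟨l, by omega⟩), 2 * D.d (ν ⟨l + 1, h⟩)] rfl rfl)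
        _ ν (fun a => by fin_cases a <;> simp) _ h0, ← mul_assoc, hrel]
    congr 2
    simp only [degTau, Function.comp_apply, adj_apply, if_true, Nat.succ_ne_self, if_false]
    rw [D.symm (ν ⟨l + 1, h⟩)]
    ring
  | tau_x_left l h ν hν =>
    simp only [map_mul, map_sub, map_neg, FreeAlgebra.lift_ι_apply, lift_ncEval2, klrMk_ncEval2,
      klrMk_fe, klrMk_fx, klrMk_ft] at hrel ⊢
    have h0 := D.e_idem ν
    rw [sub_mul, mul_assoc, mul_assoc] at hrel
    rw [sub_mul, mul_assoc, mul_assoc, lE, D.lauGen_x_mul _ ν _ h0,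
      D.lauGen_tau_mul l h ν _ (D.src_x _ h0), D.lauGen_tau_mul l h ν _ h0,
      D.lauGen_x_mul _ _ _ (D.src_tau l h h0),
      D.lauGen_ncEval (D.P_isHom (ν ⟨l, by omega⟩) (fun _ => 2 * D.d (ν ⟨l, by omega⟩))
        (fun _ => rfl)) _ ν (fun a => by fin_cases a <;> simp [hν]) _ h0, ← map_neg, ← hrel,
      map_sub]
    congr 2 <;> congr 1 <;>
    · simp only [degTau, Function.comp_apply, adj_apply, if_true, Nat.succ_ne_self, if_false, ← hν]
      ring
  | tau_x_right l h ν hν =>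
    simp only [map_mul, map_sub, map_neg, FreeAlgebra.lift_ι_apply, lift_ncEval2, klrMk_ncEval2,
      klrMk_fe, klrMk_fx, klrMk_ft] at hrel ⊢
    have h0 := D.e_idem ν
    rw [sub_mul, mul_assoc, mul_assoc] at hrel
    rw [sub_mul, mul_assoc, mul_assoc, lE, D.lauGen_x_mul _ ν _ h0,
      D.lauGen_tau_mul l h ν _ (D.src_x _ h0), D.lauGen_tau_mul l h ν _ h0,
      D.lauGen_x_mul _ _ _ (D.src_tau l h h0),
      D.lauGen_ncEval (D.P_isHom (ν ⟨l, by omega⟩) (fun _ => 2 * D.d (ν ⟨l, by omega⟩))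
        (fun _ => rfl)) _ ν (fun a => by fin_cases a <;> simp [hν]) _ h0, ← hrel,
      map_sub]
    congr 2 <;> congr 1 <;>
    · simp only [degTau, Function.comp_apply, adj_apply, if_true, Nat.succ_ne_self, if_false, ← hν]
      ring
  | tau_x_other l h p ν hν =>
    simp only [map_mul, map_sub, map_zero, FreeAlgebra.lift_ι_apply, klrMk_fe, klrMk_fx,
      klrMk_ft] at hrel ⊢
    have h0 := D.e_idem ν
    rw [sub_mul, mul_assoc, mul_assoc] at hrel
    rw [sub_mul, mul_assoc, mul_assoc, lE, D.lauGen_x_mul _ ν _ h0,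
      D.lauGen_tau_mul l h ν _ (D.src_x _ h0), D.lauGen_tau_mul l h ν _ h0,
      D.lauGen_x_mul _ _ _ (D.src_tau l h h0), sub_eq_zero, sub_eq_zero.mp hrel]
    congr 2
    have : adj l h (adj l h p) = p := Equiv.swap_apply_self _ _ _
    rw [Function.comp_apply, this]
    ring
  | braid_Q l h ν hν hν' =>
    simp only [map_mul, map_sub, map_neg, FreeAlgebra.lift_ι_apply, lift_ncEval2, klrMk_ncEval2,
      lift_ncEval3, klrMk_ncEval3, klrMk_fe, klrMk_fx, klrMk_ft] at hrel ⊢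
    have h0 := D.e_idem ν
    have hl1 : l + 1 < n := by omega
    have q1 : l ≠ l + 1 + 1 := by omega
    have q2 : l + 1 + 1 ≠ l := by omega
    have q3 : l ≠ l + 2 := by omega
    have q4 : l + 2 ≠ l := by omega
    have hs1 := D.src_tau l hl1 h0
    have hs2 := D.src_tau (l + 1) h hs1
    have ht1 := D.src_tau (l + 1) h h0
    have ht2 := D.src_tau l hl1 ht1
    have hQ : D.e ν * (ncEval (barQ (D.Q (ν ⟨l, by omega⟩) (ν ⟨l + 1, by omega⟩)))
        (fun a => D.x (![⟨l, by omega⟩, ⟨l + 1, by omega⟩, ⟨l + 2, h⟩] a)) * D.e ν)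
        = ncEval (barQ (D.Q (ν ⟨l, by omega⟩) (ν ⟨l + 1, by omega⟩)))
        (fun a => D.x (![⟨l, by omega⟩, ⟨l + 1, by omega⟩, ⟨l + 2, h⟩] a)) * D.e ν :=
      D.src_ncEval _ _ h0
    simp only [sub_mul, mul_assoc] at hrel ⊢
    rw [lE, D.lauGen_tau_mul l hl1 ν _ h0, D.lauGen_tau_mul (l + 1) h ν _ h0,
      D.lauGen_tau_mul (l + 1) h _ _ hs1, D.lauGen_tau_mul l hl1 _ _ ht1,
      D.lauGen_tau_mul l hl1 _ _ hs2, D.lauGen_tau_mul (l + 1) h _ _ ht2,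
      D.lauGen_ncEval (D.barQ_isHom hν' ![2 * D.d (ν ⟨l, by omega⟩),
        2 * D.d (ν ⟨l + 1, by omega⟩), 2 * D.d (ν ⟨l, by omega⟩)] rfl rfl rfl) _ ν
        (fun a => by fin_cases a <;> simp [hν]) _ h0,
      D.lauGen_ncEval (D.P_isHom (ν ⟨l, by omega⟩) (fun _ => 2 * D.d (ν ⟨l, by omega⟩))
        (fun _ => rfl)) _ ν (fun a => by fin_cases a <;> simp [hν]) _ hQ, ← hrel, map_sub]
    have hsym := D.symm (ν ⟨l, by omega⟩) (ν ⟨l + 1, by omega⟩)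
    congr 2 <;> congr 1 <;>
    · simp [degTau, adj_apply, q1, q2, q3, q4, ← hν]
      linarith
  | braid_P l h ν hν hν' =>
    simp only [map_mul, map_add, map_sub, map_neg, FreeAlgebra.lift_ι_apply,
      lift_ncEval3, klrMk_ncEval3, klrMk_fe, klrMk_fx, klrMk_ft] at hrel ⊢
    have h0 := D.e_idem ν
    have hl1 : l + 1 < n := by omega
    have q1 : l ≠ l + 1 + 1 := by omega
    have q2 : l + 1 + 1 ≠ l := by omega
    have q3 : l ≠ l + 2 := by omega
    have q4 : l + 2 ≠ l := by omega
    have hs1 := D.src_tau l hl1 h0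
    have hs2 := D.src_tau (l + 1) h hs1
    have ht1 := D.src_tau (l + 1) h h0
    have ht2 := D.src_tau l hl1 ht1
    simp only [sub_mul, mul_assoc] at hrel ⊢
    rw [lE, D.lauGen_tau_mul l hl1 ν _ h0, D.lauGen_tau_mul (l + 1) h ν _ h0,
      D.lauGen_tau_mul (l + 1) h _ _ hs1, D.lauGen_tau_mul l hl1 _ _ ht1,
      D.lauGen_tau_mul l hl1 _ _ hs2, D.lauGen_tau_mul (l + 1) h _ _ ht2,
      D.lauGen_ncEval (D.barP'_isHom (ν ⟨l, by omega⟩) (fun _ => 2 * D.d (ν ⟨l, by omega⟩))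
        (fun _ => rfl)) _ _ (fun a => by
          fin_cases a <;> simp [adj_apply, q1, q2, q3, q4, ← hν, ← hν']) _ hs1,
      D.lauGen_ncEval (D.barP''_isHom (ν ⟨l, by omega⟩) (fun _ => 2 * D.d (ν ⟨l, by omega⟩))
        (fun _ => rfl)) _ _ (fun a => by
          fin_cases a <;> simp [adj_apply, q1, q2, q3, q4, ← hν, ← hν']) _ ht1]
    have e1 : ∀ (s1 s2 s3 s4 s : ℤ) (a b c d : D.KLR n), s1 = s → s2 = s → s3 = s → s4 = s →
        a - b = c + d → Lau.mono s1 a - Lau.mono s2 b = Lau.mono s3 c + Lau.mono s4 d := by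
      rintro _ _ _ _ s a b c d rfl rfl rfl rfl habcd
      rw [← map_sub, ← map_add, habcd]
    refine e1 _ _ _ _ (-3 * (D.d (ν ⟨l, by omega⟩) * D.a (ν ⟨l, by omega⟩) (ν ⟨l, by omega⟩)))
      _ _ _ _ ?_ ?_ ?_ ?_ hrel <;>
    · simp [degTau, adj_apply, q1, q2, q3, q4, ← hν, ← hν']
      ring
  | braid_zero l h ν hν =>
    simp only [map_mul, map_sub, map_zero, FreeAlgebra.lift_ι_apply, klrMk_fe, klrMk_fx,
      klrMk_ft] at hrel ⊢
    have h0 := D.e_idem ν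
    have hl1 : l + 1 < n := by omega
    have q1 : l ≠ l + 1 + 1 := by omega
    have q2 : l + 1 + 1 ≠ l := by omega
    have q3 : l ≠ l + 2 := by omega
    have q4 : l + 2 ≠ l := by omega
    have hs1 := D.src_tau l hl1 h0
    have hs2 := D.src_tau (l + 1) h hs1
    have ht1 := D.src_tau (l + 1) h h0
    have ht2 := D.src_tau l hl1 ht1
    simp only [sub_mul, mul_assoc] at hrel ⊢
    rw [lE, D.lauGen_tau_mul l hl1 ν _ h0, D.lauGen_tau_mul (l + 1) h ν _ h0,
      D.lauGen_tau_mul (l + 1) h _ _ hs1, D.lauGen_tau_mul l hl1 _ _ ht1,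
      D.lauGen_tau_mul l hl1 _ _ hs2, D.lauGen_tau_mul (l + 1) h _ _ ht2, sub_eq_zero,
      sub_eq_zero.mp hrel]
    congr 2
    simp [degTau, adj_apply, q1, q2, q3, q4]
    ring

/-- The ring homomorphism `R(n) → R(n)[T, T⁻¹]` which multiplies the degree `s` part by `T ^ s`. -/
def lauHom (n : ℕ) : D.KLR n →ₐ[k] Lau (D.KLR n) := D.lift D.lauGen D.lauGen_rel

theorem lauHom_of_isHomog {s : ℤ} {r : D.KLR n} (h : D.IsHomog n s r) :
    D.lauHom n r = Lau.mono s r := by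
  have hg : ∀ g, D.lauHom n (D.klrMk n (FreeAlgebra.ι k g)) = D.lauGen g := fun g => by
    rw [lauHom, lift_mk, FreeAlgebra.lift_ι_apply]
  induction h with
  | zero s => simp
  | add _ _ ha hb => rw [map_add, ha, hb, map_add]
  | mul _ _ ha hb => rw [map_mul, ha, hb, Lau.mono_mul_mono]
  | scalar hc => rw [AlgHom.commutes, algebraMap_lau, twist_of_mem 𝓀 _ hc]
  | e ν => exact hg _
  | x p ν =>
    rw [map_mul, x, e, hg, hg]
    exact (D.lauGen_x_mul p ν 0 (D.e_idem ν)).trans (by rw [add_zero]; rfl)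
  | tau l h ν =>
    rw [map_mul, tau, e, hg, hg]
    exact (D.lauGen_tau_mul l h ν 0 (D.e_idem ν)).trans (by rw [add_zero]; rfl)

theorem mem_iSup_gr (r : D.KLR n) : r ∈ ⨆ s, D.gr n s := by
  have hm : ∀ s, D.gr n s ≤ ⨆ s, D.gr n s := fun s => le_iSup (D.gr n) s
  induction r using D.klr_induction with
  | hs c =>
    induction c using grading_induction 𝓀 with
    | h0 => rw [map_zero]; exact zero_mem _
    | hadd c d hc hd => rw [map_add]; exact add_mem hc hd
    | h l c hc => exact hm l (IsHomog.scalar hc)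
  | he ν => exact hm 0 (IsHomog.e ν)
  | hx p =>
    rw [← mul_one (D.x p), ← D.e_sum, Finset.mul_sum]
    exact sum_mem fun ν _ => hm _ (IsHomog.x p ν)
  | ht l h =>
    rw [← mul_one (D.tau l h), ← D.e_sum, Finset.mul_sum]
    exact sum_mem fun ν _ => hm _ (IsHomog.tau l h ν)
  | hadd a b ha hb => exact add_mem ha hb
  | hmul a b ha hb =>
    induction ha using AddSubgroup.iSup_induction' with
    | h1 => rw [zero_mul]; exact zero_mem _
    | hadd x y _ _ hx hy => rw [add_mul]; exact add_mem hx hy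
    | hp s a ha =>
      induction hb using AddSubgroup.iSup_induction' with
      | h1 => rw [mul_zero]; exact zero_mem _
      | hadd x y _ _ hx hy => rw [mul_add]; exact add_mem hx hy
      | hp t b hb => exact hm (s + t) (IsHomog.mul ha hb)

theorem gr_internal (n : ℕ) : DirectSum.IsInternal (D.gr n) :=
  isInternal_of_coaction _ (Lau.coeff.toAddMonoidHom.comp (D.lauHom n).toRingHom.toAddMonoidHom)
    (fun s r hr => by
      have h := D.lauHom_of_isHomog (r := r) (s := s) hr
      change Lau.coeff (D.lauHom n r) = _
      rw [h, Lau.coeff_mono])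
    D.mem_iSup_gr

/-- `R(n)` is a `ℤ`-graded ring. -/
instance (n : ℕ) : GradedRing (D.gr n) :=
  { (D.gr_internal n).chooseDecomposition with
    one_mem := by
      have h : D.IsHomog n ((0 : ℕ) : ℤ) (algebraMap k (D.KLR n) 1) :=
        IsHomog.scalar (SetLike.GradedOne.one_mem (A := 𝓀))
      rw [map_one] at h
      exact h
    mul_mem := fun _ _ _ _ ha hb => IsHomog.mul ha hb }

end GradingKLR

/-! ### Inclusions between the algebras `R(n)` -/

section Embeddings

variable {N : ℕ}

theorem ext_e' {a b : D.KLR n} (h : ∀ ν : Fin n → I, a * D.e ν = b * D.e ν) : a = b := by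
  rw [← mul_one a, ← mul_one b, ← D.e_sum, Finset.mul_sum, Finset.mul_sum]
  exact Finset.sum_congr rfl fun ν _ => h ν

/-- `∑ e(ν)` over all `ν` which satisfy `S`. -/
def eSum (S : (Fin n → I) → Prop) [DecidablePred S] : D.KLR n :=
  ∑ ν with S ν, D.e ν

theorem eSum_congr {S T : (Fin n → I) → Prop} [DecidablePred S] [DecidablePred T]
    (h : ∀ ν, S ν ↔ T ν) : D.eSum S = D.eSum T :=
  Finset.sum_congr (Finset.filter_congr fun ν _ => h ν) fun _ _ => rfl

theorem eSum_mul_e (S : (Fin n → I) → Prop) [DecidablePred S] (ν : Fin n → I) :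
    D.eSum S * D.e ν = if S ν then D.e ν else 0 := by
  rw [eSum, Finset.sum_filter, Finset.sum_mul, Finset.sum_eq_single ν]
  · split_ifs
    · exact D.e_idem ν
    · exact zero_mul _
  · intro ν' _ h
    split_ifs
    · exact D.e_orth h
    · exact zero_mul _
  · simp

theorem eSum_mul_eSum (S T : (Fin n → I) → Prop) [DecidablePred S] [DecidablePred T] :
    D.eSum S * D.eSum T = D.eSum (fun ν => S ν ∧ T ν) := by
  refine D.ext_e' fun ν => ?_
  rw [mul_assoc, eSum_mul_e, eSum_mul_e]
  by_cases h : T ν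
  · simp [h, eSum_mul_e]
  · simp [h]

theorem x_eSum (p : Fin n) (S : (Fin n → I) → Prop) [DecidablePred S] :
    D.x p * D.eSum S = D.eSum S * D.x p := by
  rw [eSum, Finset.mul_sum, Finset.sum_mul]
  exact Finset.sum_congr rfl fun ν _ => D.x_e p ν

theorem tau_eSum (l : ℕ) (h : l + 1 < n) (S T : (Fin n → I) → Prop) [DecidablePred S]
    [DecidablePred T] (hST : ∀ ν, T (ν ∘ adj l h) ↔ S ν) :
    D.tau l h * D.eSum S = D.eSum T * D.tau l h := by
  refine D.ext_e' fun ν => ?_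
  rw [mul_assoc, mul_assoc, eSum_mul_e, D.tau_e, ← mul_assoc, eSum_mul_e]
  by_cases hS : S ν
  · rw [if_pos hS, if_pos ((hST ν).mpr hS), D.tau_e]
  · rw [if_neg hS, if_neg (fun hT => hS ((hST ν).mp hT)), zero_mul, mul_zero]

/-- The position `p` of `n` strands inside `N` strands, if `s` strands are added before. -/
def pos {s : ℕ} (h : s + n ≤ N) (p : Fin n) : Fin N := ⟨s + p.1, by omega⟩

theorem pos_injective {s : ℕ} (h : s + n ≤ N) : Function.Injective (pos h) := fun p q hpq => by
  simp only [pos, Fin.mk.injEq] at hpq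
  exact Fin.ext (by omega)

theorem adj_pos {s : ℕ} (h : s + n ≤ N) (l : ℕ) (hl : l + 1 < n) (p : Fin n) :
    adj (s + l) (by omega) (pos h p) = pos h (adj l hl p) := by
  rw [adj_apply, adj_apply]
  simp only [pos]
  have e1 : s + p.1 = s + l ↔ p.1 = l := by omega
  have e2 : s + p.1 = s + l + 1 ↔ p.1 = l + 1 := by omega
  simp only [e1, e2]
  split_ifs <;> rfl

/-- The images of the generators of `R(n)` in `R(N)`. -/
def embGen {s : ℕ} (h : s + n ≤ N) : KLRGen I n → D.KLR N
  | .e ν => D.eSum (fun ν' => ν' ∘ pos h = ν)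
  | .x p => D.x (pos h p)
  | .tau l hl => D.tau (s + l) (by omega)

theorem embGen_rel {s : ℕ} (h : s + n ≤ N) (a b : FreeAlgebra k (KLRGen I n))
    (hab : D.Rel n a b) :
    FreeAlgebra.lift k (D.embGen h) a = FreeAlgebra.lift k (D.embGen h) b := by
  have lx : ∀ p : Fin n, D.embGen h (.x p) = D.klrMk N (fx k I (pos h p)) := fun p => rfl
  have lt : ∀ l (hl : l + 1 < n), D.embGen h (.tau l hl) = D.klrMk N (ft k I (s + l) (by omega)) :=
    fun l hl => rfl
  have n2 : ∀ (P : MvPolynomial (Fin 2) k) (p q : Fin n),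
      FreeAlgebra.lift k (D.embGen h) (ncEval P ![fx k I p, fx k I q])
        = D.klrMk N (ncEval P ![fx k I (pos h p), fx k I (pos h q)]) := fun P p q => by
    rw [lift_ncEval2, klrMk_ncEval2]
    congr 1
    funext a
    fin_cases a <;> rfl
  have n3 : ∀ (P : MvPolynomial (Fin 3) k) (p q r : Fin n),
      FreeAlgebra.lift k (D.embGen h) (ncEval P ![fx k I p, fx k I q, fx k I r])
        = D.klrMk N (ncEval P ![fx k I (pos h p), fx k I (pos h q), fx k I (pos h r)]) :=
    fun P p q r => by
      rw [lift_ncEval3, klrMk_ncEval3]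
      congr 1
      funext a
      fin_cases a <;> rfl
  have main : ∀ (u v : FreeAlgebra k (KLRGen I N)) (ν : Fin n → I),
      (∀ ν' : Fin N → I, ν' ∘ pos h = ν → D.Rel N (u * fe k ν') (v * fe k ν')) →
      D.klrMk N u * D.embGen h (.e ν) = D.klrMk N v * D.embGen h (.e ν) := by
    intro u v ν hu
    refine D.ext_e' fun ν' => ?_
    rw [mul_assoc, mul_assoc, embGen, eSum_mul_e]
    split_ifs with hν
    · have := D.klrMk_rel (hu ν' hν)
      rwa [map_mul, map_mul] at this
    · simp
  have main0 : ∀ (u : FreeAlgebra k (KLRGen I N)) (ν : Fin n → I),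
      (∀ ν' : Fin N → I, ν' ∘ pos h = ν → D.Rel N (u * fe k ν') 0) →
      D.klrMk N u * D.embGen h (.e ν) = 0 := by
    intro u ν hu
    refine D.ext_e' fun ν' => ?_
    rw [mul_assoc, embGen, eSum_mul_e]
    split_ifs with hν
    · have := D.klrMk_rel (hu ν' hν)
      rw [map_mul, map_zero] at this
      rw [zero_mul]
      exact this
    · simp
  cases hab with
  | e_idem ν =>
    simp only [map_mul, FreeAlgebra.lift_ι_apply, embGen, eSum_mul_eSum, and_self]
  | e_orth ν ν' hν =>
    simp only [map_mul, FreeAlgebra.lift_ι_apply, embGen, eSum_mul_eSum, map_zero]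
    rw [eSum, Finset.filter_false_of_mem, Finset.sum_empty]
    rintro μ _ ⟨h1, h2⟩
    exact hν (h1.symm.trans h2)
  | e_sum =>
    simp only [map_sum, FreeAlgebra.lift_ι_apply, map_one]
    refine D.ext_e' fun μ => ?_
    rw [Finset.sum_mul, one_mul, Finset.sum_eq_single (μ ∘ pos h)]
    · rw [embGen, eSum_mul_e, if_pos rfl]
    · intro ν _ hν
      rw [embGen, eSum_mul_e, if_neg (fun h' => hν h'.symm)]
    · simp
  | x_comm p q =>
    simp only [map_mul, FreeAlgebra.lift_ι_apply, embGen]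
    exact D.x_comm _ _
  | x_e p ν =>
    simp only [map_mul, FreeAlgebra.lift_ι_apply, embGen]
    exact D.x_eSum _ _
  | tau_e l hl ν =>
    simp only [map_mul, FreeAlgebra.lift_ι_apply, embGen]
    refine D.tau_eSum _ _ _ _ fun μ => ?_
    have hc : (μ ∘ adj (s + l) (by omega)) ∘ pos h = (μ ∘ pos h) ∘ adj l hl := by
      funext p
      simp only [Function.comp_apply, adj_pos h l hl]
    rw [hc]
    constructor
    · intro h'
      have := congrArg (· ∘ adj l hl) h'
      funext p
      have hp := congrFun this p
      simpa [adj] using hp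
    · rintro rfl; rfl
  | tau_comm l l' hl hl' hll =>
    simp only [map_mul, FreeAlgebra.lift_ι_apply, embGen]
    exact D.tau_comm _ _ (by omega)
  | tau_sq_eq l hl ν hν =>
    simp only [map_mul, FreeAlgebra.lift_ι_apply, n2, lt]
    simp only [← map_mul]
    refine main _ _ _ ?_
    rintro ν' rfl
    exact Rel.tau_sq_eq (s + l) _ ν' hν
  | tau_sq_ne l hl ν hν =>
    simp only [map_mul, FreeAlgebra.lift_ι_apply, n2, lt]
    simp only [← map_mul]
    refine main _ _ _ ?_
    rintro ν' rfl
    exact Rel.tau_sq_ne (s + l) _ ν' hν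
  | tau_x_left l hl ν hν =>
    simp only [map_mul, map_sub, map_neg, FreeAlgebra.lift_ι_apply, n2, lt, lx]
    simp only [← map_mul, ← map_sub, ← neg_mul, ← map_neg]
    refine main _ _ _ ?_
    rintro ν' rfl
    have := D.klrMk_rel (Rel.tau_x_left (D := D) (s + l) (by omega) ν' hν)
    rw [neg_mul]
    exact Rel.tau_x_left (s + l) _ ν' hν
  | tau_x_right l hl ν hν =>
    simp only [map_mul, map_sub, FreeAlgebra.lift_ι_apply, n2, lt, lx]
    simp only [← map_mul, ← map_sub]
    refine main _ _ _ ?_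
    rintro ν' rfl
    exact Rel.tau_x_right (s + l) _ ν' hν
  | tau_x_other l hl p ν hν =>
    simp only [map_mul, map_sub, map_zero, FreeAlgebra.lift_ι_apply, lt, lx]
    simp only [← map_mul, ← map_sub, ← adj_pos h l hl]
    refine main0 _ _ ?_
    rintro ν' rfl
    refine Rel.tau_x_other (s + l) _ (pos h p) ν' ?_
    rintro ⟨h1, h2⟩
    refine hν ⟨?_, h2⟩
    simp only [pos] at h1
    omega
  | braid_Q l hl ν hν hν' =>
    simp only [map_mul, map_sub, FreeAlgebra.lift_ι_apply, n2, n3, lt]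
    simp only [← map_mul, ← map_sub]
    refine main _ _ _ ?_
    rintro ν' rfl
    exact Rel.braid_Q (s + l) _ ν' hν hν'
  | braid_P l hl ν hν hν' =>
    simp only [map_mul, map_sub, map_add, FreeAlgebra.lift_ι_apply, n3, lt]
    simp only [← map_mul, ← map_sub, ← add_mul, ← map_add]
    refine main _ _ _ ?_
    rintro ν' rfl
    rw [add_mul]
    exact Rel.braid_P (s + l) _ ν' hν hν'
  | braid_zero l hl ν hν =>
    simp only [map_mul, map_sub, map_zero, FreeAlgebra.lift_ι_apply, lt]
    simp only [← map_mul, ← map_sub]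
    refine main0 _ _ ?_
    rintro ν' rfl
    exact Rel.braid_zero (s + l) _ ν' hν

/-- The algebra homomorphism `R(n) → R(N)` which puts `s` vertical strands in front of a diagram
(and `N - n - s` behind it): `x_p ↦ x_{s + p}`, `τ_l ↦ τ_{s + l}` and
`e(ν) ↦ ∑ e(ν')`, where `ν'` runs over all the sequences which are equal to `ν` at the positions
`s, …, s + n - 1`. -/
def emb {s : ℕ} (h : s + n ≤ N) : D.KLR n →ₐ[k] D.KLR N := D.lift (D.embGen h) (D.embGen_rel h)

theorem emb_gen {s : ℕ} (h : s + n ≤ N) (g : KLRGen I n) :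
    D.emb h (D.klrMk n (FreeAlgebra.ι k g)) = D.embGen h g := by
  rw [emb, lift_mk, FreeAlgebra.lift_ι_apply]

theorem emb_e {s : ℕ} (h : s + n ≤ N) (ν : Fin n → I) :
    D.emb h (D.e ν) = D.eSum (fun ν' => ν' ∘ pos h = ν) := D.emb_gen h (.e ν)

theorem emb_x {s : ℕ} (h : s + n ≤ N) (p : Fin n) : D.emb h (D.x p) = D.x (pos h p) :=
  D.emb_gen h (.x p)

theorem emb_tau {s : ℕ} (h : s + n ≤ N) (l : ℕ) (hl : l + 1 < n) :
    D.emb h (D.tau l hl) = D.tau (s + l) (by omega) :=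
  D.emb_gen h (.tau l hl)

theorem emb_eSum {s : ℕ} (h : s + n ≤ N) (S : (Fin n → I) → Prop) [DecidablePred S] :
    D.emb h (D.eSum S) = D.eSum (fun ν' => S (ν' ∘ pos h)) := by
  refine D.ext_e' fun μ => ?_
  rw [eSum_mul_e, eSum, map_sum, Finset.sum_filter, Finset.sum_mul,
    Finset.sum_eq_single (μ ∘ pos h)]
  · split_ifs
    · rw [emb_e, eSum_mul_e, if_pos rfl]
    · exact zero_mul _
  · intro ν _ hν
    split_ifs
    · rw [emb_e, eSum_mul_e, if_neg (fun h' => hν h'.symm)]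
    · exact zero_mul _
  · simp

theorem eSum_isHomog [GradedRing 𝓀] (S : (Fin n → I) → Prop) [DecidablePred S] :
    D.eSum S ∈ D.gr n 0 :=
  sum_mem fun ν _ => IsHomog.e ν

theorem mul_eSum (r : D.KLR n) (S : (Fin n → I) → Prop) [DecidablePred S] :
    r * D.eSum S = ∑ ν with S ν, r * D.e ν := Finset.mul_sum _ _ _

theorem emb_mem_gr [GradedRing 𝓀] {s : ℕ} (h : s + n ≤ N) {t : ℤ} {r : D.KLR n}
    (hr : r ∈ D.gr n t) : D.emb h r ∈ D.gr N t := by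
  have hr' : D.IsHomog n t r := hr
  induction hr' with
  | zero t => rw [map_zero]; exact zero_mem _
  | add ha hb iha ihb => rw [map_add]; exact add_mem (iha ha) (ihb hb)
  | mul ha hb iha ihb => rw [map_mul]; exact SetLike.GradedMul.mul_mem (iha ha) (ihb hb)
  | scalar hc => rw [AlgHom.commutes]; exact IsHomog.scalar hc
  | e ν => rw [emb_e]; exact D.eSum_isHomog _
  | x p ν =>
    rw [map_mul, emb_e, emb_x, mul_eSum]
    refine sum_mem fun ν' hν' => ?_
    obtain rfl := (Finset.mem_filter.mp hν').2
    exact IsHomog.x (pos h p) ν'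
  | tau l hl ν =>
    rw [map_mul, emb_e, emb_tau, mul_eSum]
    refine sum_mem fun ν' hν' => ?_
    obtain rfl := (Finset.mem_filter.mp hν').2
    exact IsHomog.tau (s + l) _ ν'

/-- The inclusion `R(n) → R(n + 1)` which adds a strand at the end. -/
def iota (n : ℕ) : D.KLR n →ₐ[k] D.KLR (n + 1) := D.emb (s := 0) (by omega)

/-- The inclusion `ξ_n : R(n) → R(n + 1)` which adds a strand at the beginning. -/
def xi (n : ℕ) : D.KLR n →ₐ[k] D.KLR (n + 1) := D.emb (s := 1) (by omega)

end Embeddings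

/-! ### The algebras `R(β)` and the functors `E_i`, `F̄_i` -/

section Blocks

/-- The element `α_{ν_0} + ⋯ + α_{ν_{n - 1}}` of the positive cone `Q⁺` of the root lattice, which
is the free commutative monoid `I →₀ ℕ` on the simple roots `α_i = Finsupp.single i 1`. -/
def wt (ν : Fin n → I) : I →₀ ℕ := ∑ p, Finsupp.single (ν p) 1

theorem wt_adj (l : ℕ) (h : l + 1 < n) (ν : Fin n → I) : wt (ν ∘ adj l h) = wt ν :=
  Equiv.sum_comp (adj l h) fun p => Finsupp.single (ν p) 1

/-- The central idempotent `e(β) = ∑ e(ν)` of `R(n)`, where `ν` runs over the sequences in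
`I ^ β`. -/
def eBlock (n : ℕ) (β : I →₀ ℕ) : D.KLR n := D.eSum (fun ν => wt ν = β)

theorem eBlock_idem (n : ℕ) (β : I →₀ ℕ) : IsIdempotentElem (D.eBlock n β) := by
  rw [IsIdempotentElem, eBlock, eSum_mul_eSum]
  simp only [and_self]

theorem eBlock_comm (β : I →₀ ℕ) (r : D.KLR n) : r * D.eBlock n β = D.eBlock n β * r := by
  induction r using D.klr_induction with
  | hs c => exact Algebra.commutes c _
  | he ν =>
    rw [eBlock, eSum_mul_e, eSum, Finset.mul_sum, Finset.sum_filter, Finset.sum_eq_single ν]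
    · split_ifs
      · exact D.e_idem ν
      · rfl
    · intro ν' _ h
      split_ifs
      · exact D.e_orth h.symm
      · rfl
    · simp
  | hx p => exact D.x_eSum p _
  | ht l h => exact D.tau_eSum l h _ _ fun ν => by rw [wt_adj]
  | hmul a b ha hb => rw [mul_assoc, hb, ← mul_assoc, ha, mul_assoc]
  | hadd a b ha hb => rw [add_mul, mul_add, ha, hb]

/-- The algebra `R(β) = e(β) R(n) e(β) = R(n) e(β)`, where `n` is the height of `β`. -/
abbrev Block (n : ℕ) (β : I →₀ ℕ) : Type u := (D.eBlock_idem n β).Corner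

/-- The inclusion `R(β) → R(n)`. -/
def blockVal (n : ℕ) (β : I →₀ ℕ) : D.Block n β →+ D.KLR n where
  toFun r := r.1
  map_zero' := rfl
  map_add' _ _ := rfl

/-- The projection `R(n) → R(β)`, `r ↦ e(β) r e(β)`. -/
def toBlock (n : ℕ) (β : I →₀ ℕ) : D.KLR n →+ D.Block n β where
  toFun r := ⟨D.eBlock n β * r * D.eBlock n β, r, rfl⟩
  map_zero' := Subtype.ext (by
    change D.eBlock n β * 0 * D.eBlock n β = 0
    rw [mul_zero, zero_mul])
  map_add' a b := Subtype.ext (by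
    change D.eBlock n β * (a + b) * D.eBlock n β
      = D.eBlock n β * a * D.eBlock n β + D.eBlock n β * b * D.eBlock n β
    rw [mul_add, add_mul])

theorem eBlock_mul_val {β : I →₀ ℕ} (r : D.Block n β) : D.eBlock n β * r.1 = r.1 :=
  ((Subsemigroup.mem_corner_iff (D.eBlock_idem n β)).mp r.2).1

theorem val_mul_eBlock {β : I →₀ ℕ} (r : D.Block n β) : r.1 * D.eBlock n β = r.1 :=
  ((Subsemigroup.mem_corner_iff (D.eBlock_idem n β)).mp r.2).2

theorem toBlock_val {β : I →₀ ℕ} (r : D.Block n β) : D.toBlock n β r.1 = r :=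
  Subtype.ext (by
    change D.eBlock n β * r.1 * D.eBlock n β = r.1
    rw [eBlock_mul_val, val_mul_eBlock])

variable [GradedRing 𝓀]

/-- The homogeneous part of degree `s` of `R(β)`. -/
def blockGr (n : ℕ) (β : I →₀ ℕ) (s : ℤ) : AddSubgroup (D.Block n β) :=
  (D.gr n s).comap (D.blockVal n β)

theorem blockGr_internal (n : ℕ) (β : I →₀ ℕ) : DirectSum.IsInternal (D.blockGr n β) := by
  refine isInternal_retract (D.gr_internal n) (D.blockVal n β) (D.toBlock n β)
    (fun r => D.toBlock_val r) ?_
  intro s r hr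
  have h := SetLike.GradedMul.mul_mem (SetLike.GradedMul.mul_mem
    (D.eSum_isHomog (fun ν : Fin n → I => wt ν = β)) hr)
    (D.eSum_isHomog (fun ν : Fin n → I => wt ν = β))
  rwa [zero_add, add_zero] at h

/-- `R(β)` is a `ℤ`-graded ring. -/
instance (n : ℕ) (β : I →₀ ℕ) : GradedRing (D.blockGr n β) :=
  { (D.blockGr_internal n β).chooseDecomposition with
    one_mem := D.eSum_isHomog (fun ν : Fin n → I => wt ν = β)
    mul_mem := fun _ _ _ _ ha hb => SetLike.GradedMul.mul_mem (A := D.gr n) ha hb }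


theorem emb_comm {N s : ℕ} (h : s + n ≤ N) (S : (Fin N → I) → Prop) [DecidablePred S]
    (hS : ∀ l (hl : l + 1 < n) ν, S (ν ∘ adj (s + l) (by omega)) ↔ S ν) (r : D.KLR n) :
    D.emb h r * D.eSum S = D.eSum S * D.emb h r := by
  induction r using D.klr_induction with
  | hs c => rw [AlgHom.commutes]; exact Algebra.commutes c _
  | he ν =>
    rw [emb_e, eSum_mul_eSum, eSum_mul_eSum]
    simp only [and_comm]
  | hx p => rw [emb_x]; exact D.x_eSum _ _
  | ht l hl => rw [emb_tau]; exact D.tau_eSum _ _ _ _ (hS l hl)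
  | hmul a b ha hb => rw [map_mul, mul_assoc, hb, ← mul_assoc, ha, mul_assoc]
  | hadd a b ha hb => rw [map_add, add_mul, mul_add, ha, hb]

/-- The ring homomorphism `R(β) → R(γ)`, `r ↦ emb(r) ∑ e(ν)` (not unital in general), where `ν`
runs over the sequences in `I ^ γ` which satisfy `S`. -/
def blockHom {N s : ℕ} (h : s + n ≤ N) (β γ : I →₀ ℕ) (S : (Fin N → I) → Prop) [DecidablePred S]
    (hS : ∀ l (hl : l + 1 < n) ν, S (ν ∘ adj (s + l) (by omega)) ↔ S ν) :
    D.Block n β →ₙ+* D.Block N γ where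
  toFun r := ⟨D.emb h r.1 * D.eSum (fun ν => wt ν = γ ∧ S ν), by
    have hc := D.emb_comm h (fun ν => wt ν = γ ∧ S ν)
      (fun l hl ν => by rw [wt_adj, hS l hl]) r.1
    rw [Subsemigroup.mem_corner_iff (D.eBlock_idem N γ)]
    constructor
    · rw [hc, ← mul_assoc, eBlock, eSum_mul_eSum]
      simp only [← and_assoc, and_self]
    · change D.emb h r.1 * D.eSum (fun ν => wt ν = γ ∧ S ν) * D.eSum (fun ν => wt ν = γ) = _
      rw [mul_assoc, eSum_mul_eSum]
      congr 1
      exact D.eSum_congr fun ν => by tauto⟩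
  map_zero' := Subtype.ext (by
    change D.emb h 0 * _ = 0
    rw [map_zero, zero_mul])
  map_add' a b := Subtype.ext (by
    change D.emb h (a.1 + b.1) * _ = D.emb h a.1 * _ + D.emb h b.1 * _
    rw [map_add, add_mul])
  map_mul' a b := Subtype.ext (by
    have hc := D.emb_comm h (fun ν => wt ν = γ ∧ S ν)
      (fun l hl ν => by rw [wt_adj, hS l hl]) b.1
    change D.emb h (a.1 * b.1) * _ = (D.emb h a.1 * _) * (D.emb h b.1 * _)
    rw [map_mul, mul_assoc, mul_assoc, ← mul_assoc (D.eSum _), ← hc, mul_assoc, eSum_mul_eSum]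
    simp only [and_self])

theorem blockHom_mem {N s : ℕ} (h : s + n ≤ N) (β γ : I →₀ ℕ) (S : (Fin N → I) → Prop)
    [DecidablePred S] (hS : ∀ l (hl : l + 1 < n) ν, S (ν ∘ adj (s + l) (by omega)) ↔ S ν)
    (d : ℤ) (b : D.Block n β) (hb : b ∈ D.blockGr n β d) :
    D.blockHom h β γ S hS b ∈ D.blockGr N γ d := by
  have h1 := SetLike.GradedMul.mul_mem (D.emb_mem_gr h (r := b.1) hb)
    (D.eSum_isHomog (fun ν : Fin N → I => wt ν = γ ∧ S ν))
  rwa [add_zero] at h1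

/-- The homomorphism `R(β) → R(γ)`, `r ↦ ι(r) e(β, i)`, where `γ = β + α_i`. -/
def homE (n : ℕ) (i : I) (β γ : I →₀ ℕ) : D.Block n β →ₙ+* D.Block (n + 1) γ :=
  D.blockHom (s := 0) (by omega) β γ (fun ν => ν (Fin.last n) = i) (by
    intro l hl ν
    have h : adj (0 + l) (by omega) (Fin.last n) = Fin.last n := by
      rw [adj_apply, if_neg (fun h => by simp at h; omega), if_neg (fun h => by simp at h; try omega)]
    rw [Function.comp_apply, h])

/-- The homomorphism `R(β) → R(γ)`, `r ↦ ξ(r) e(i, β)`, where `γ = β + α_i`. -/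
def homF (n : ℕ) (i : I) (β γ : I →₀ ℕ) : D.Block n β →ₙ+* D.Block (n + 1) γ :=
  D.blockHom (s := 1) (by omega) β γ (fun ν => ν 0 = i) (by
    intro l hl ν
    have h : adj (1 + l) (by omega) (0 : Fin (n + 1)) = 0 := by
      rw [adj_apply, if_neg (fun h => by simp at h; omega), if_neg (fun h => by simp at h; try omega)]
    rw [Function.comp_apply, h])

/-- The image of `1` under `R(β) → R(β + α_i)`, `r ↦ ι(r) e(β, i)`, is `e(β, i)`. -/
theorem homE_one (n : ℕ) (i : I) (β : I →₀ ℕ) :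
    (D.homE n i β (β + Finsupp.single i 1) 1).1
      = D.eSum (fun ν => wt (fun p : Fin n => ν p.castSucc) = β ∧ ν (Fin.last n) = i) := by
  change D.emb _ (D.eBlock n β) * _ = _
  rw [eBlock, emb_eSum, eSum_mul_eSum]
  congr 1
  funext ν
  have h : ν ∘ pos (s := 0) (by omega) = fun p : Fin n => ν p.castSucc := by
    funext p
    exact congrArg ν (Fin.ext (zero_add p.1))
  have hw : wt ν = wt (fun p : Fin n => ν p.castSucc) + Finsupp.single (ν (Fin.last n)) 1 :=
    Fin.sum_univ_castSucc _
  rw [h, hw]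
  refine propext ⟨fun ⟨h1, _, h2⟩ => ⟨h1, h2⟩, fun ⟨h1, h2⟩ => ⟨h1, ?_, h2⟩⟩
  rw [h1, h2]

/-- The image of `1` under `R(β) → R(β + α_i)`, `r ↦ ξ(r) e(i, β)`, is `e(i, β)`. -/
theorem homF_one (n : ℕ) (i : I) (β : I →₀ ℕ) :
    (D.homF n i β (β + Finsupp.single i 1) 1).1
      = D.eSum (fun ν => wt (fun p : Fin n => ν p.succ) = β ∧ ν 0 = i) := by
  change D.emb _ (D.eBlock n β) * _ = _
  rw [eBlock, emb_eSum, eSum_mul_eSum]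
  congr 1
  funext ν
  have h : ν ∘ pos (s := 1) (by omega) = fun p : Fin n => ν p.succ := by
    funext p
    exact congrArg ν (Fin.ext (add_comm 1 p.1))
  have hw : wt ν = Finsupp.single (ν 0) 1 + wt (fun p : Fin n => ν p.succ) :=
    Fin.sum_univ_succ _
  rw [h, hw]
  refine propext ⟨fun ⟨h1, _, h2⟩ => ⟨h1, h2⟩, fun ⟨h1, h2⟩ => ⟨h1, ?_, h2⟩⟩
  rw [h1, h2, add_comm]

/-- The category `Mod(R(β))` of graded left `R(β)`-modules, where `n` is the height of `β`. -/
abbrev ModR (n : ℕ) (β : I →₀ ℕ) : Type (u + 1) := GrMod (D.blockGr n β)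

/-- The functor `E_i : Mod(R(β + α_i)) → Mod(R(β))`, `M ↦ e(β, i) M`, where `γ = β + α_i`. -/
def E (n : ℕ) (i : I) (γ β : I →₀ ℕ) :
    CategoryTheory.Functor (D.ModR (n + 1) γ) (D.ModR n β) :=
  GrMod.res (D.homE n i β γ) (D.blockHom_mem _ _ _ _ _)

/-- The functor `F̄_i : Mod(R(β)) → Mod(R(β + α_i))`, `M ↦ R(β + α_i) e(i, β) ⊗_{R(β)} M`, where
`γ = β + α_i`. -/
def Fbar (n : ℕ) (i : I) (β γ : I →₀ ℕ) :
    CategoryTheory.Functor (D.ModR n β) (D.ModR (n + 1) γ) :=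
  GrMod.ind (D.homF n i β γ) (D.blockHom_mem _ _ _ _ _)

/-- The functor `M ↦ q ^ {-(α_i | β)} M ⊗ 𝐤[t_i]` on `Mod(R(β))`, where `deg t_i = 2 d_i`. -/
def qPoly (n : ℕ) (i : I) (β : I →₀ ℕ) : CategoryTheory.Functor (D.ModR n β) (D.ModR n β) :=
  CategoryTheory.Functor.comp (GrMod.polyExt (D.blockGr n β) (2 * D.d i))
    (GrMod.shift (D.blockGr n β) (-(β.sum fun j m => m * (D.d i * D.a i j))))

section Elements

variable {i : I} {β γ : I →₀ ℕ}

/-- The element `r e(i, β) ⊗ m` of `F̄_i M = R(β + α_i) e(i, β) ⊗_{R(β)} M`, for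
`r ∈ R(β + α_i)`. -/
def fMk {M : D.ModR n β} (r : D.Block (n + 1) γ) (m : M.carrier) :
    ((D.Fbar n i β γ).obj M).carrier :=
  GrMod.indTmul (D.homF n i β γ) (GrMod.indProj (D.homF n i β γ) r) m

/-- The inclusion `E_i M = e(β, i) M → M`. -/
def eIncl {M : D.ModR (n + 1) γ} : ((D.E n i γ β).obj M).carrier →+ M.carrier :=
  (GrMod.resSub (D.homE n i β γ) M.carrier).subtype

/-- The projection `M → E_i M`, `m ↦ e(β, i) m`. -/
def eProj {M : D.ModR (n + 1) γ} : M.carrier →+ ((D.E n i γ β).obj M).carrier :=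
  GrMod.resProj (D.homE n i β γ) M.carrier

/-- The coefficient of `t_i ^ p` of an element of `q ^ {-(α_i | β)} M ⊗ 𝐤[t_i]`. -/
def qCoeff {M : D.ModR n β} (z : ((D.qPoly n i β).obj M).carrier) (p : ℕ) : M.carrier :=
  DFunLike.coe (F := ℕ →₀ M.carrier) z p

end Elements

end Blocks

/-! ### Objects in the exact sequence of bimodules -/

section Bimodules

/-- The idempotent `e(n, i)` of `R(n + 1)`. -/
def eLast (n : ℕ) (i : I) : D.KLR (n + 1) := D.eSum (fun ν => ν (Fin.last n) = i)

/-- The idempotent `e(i, n)` of `R(n + 1)`. -/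
def eFirst (n : ℕ) (i : I) : D.KLR (n + 1) := D.eSum (fun ν => ν 0 = i)

/-- The element `τ_n ⋯ τ_2 τ_1` of `R(n + 1)` (in our numbering `τ_{n - 1} ⋯ τ_1 τ_0`). -/
def tauDesc (n : ℕ) : D.KLR (n + 1) :=
  ((List.finRange n).reverse.map fun l => D.tau l.1 (by omega)).prod

/-- The tensor product `R(n + 1) ⊗_{R(n)} R(n + 1)`, where the right action of `R(n)` on the
first factor is through `ξ_n` and the left action on the second factor is through the inclusion
`R(n) → R(n + 1)`. -/
abbrev TensorSq (n : ℕ) : Type u :=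
  BalTensor (D.KLR (n + 1)) (X := D.KLR (n + 1)) (N := D.KLR (n + 1))
    (fun x (b : D.KLR n) => x * D.xi n b) (fun b y => D.iota n b * y)

/-- The element `x ⊗ y` of `R(n + 1) ⊗_{R(n)} R(n + 1)`. -/
def tsMk {n : ℕ} (x y : D.KLR (n + 1)) : D.TensorSq n := BalTensor.tmul (D.KLR (n + 1)) x y

/-- `φ : R(n + 1) → ⨁ i, R(n) ⊗ 𝐤[t_i]` is a homomorphism of `R(n)`-bimodules (`R(n)` acts on
`R(n + 1)` from the left through the inclusion `R(n) → R(n + 1)` and from the right through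
`ξ_n`) such that the left multiplication by `x_{n+1}` and the right multiplication by `x_1` on
`R(n + 1)` correspond to the multiplication by `t_i`, the left multiplication by `e(n, i)` and the
right multiplication by `e(i, n)` correspond to the projection to the component of `i`, and
`τ_n ⋯ τ_1` is mapped to `1`. -/
structure IsTauCoeff {n : ℕ} (φ : D.KLR (n + 1) →+ (I → Polynomial (D.KLR n))) : Prop where
  iota_mul : ∀ a r i, φ (D.iota n a * r) i = Polynomial.C a * φ r i
  mul_xi : ∀ r a i, φ (r * D.xi n a) i = φ r i * Polynomial.C a
  x_last_mul : ∀ r i, φ (D.x (Fin.last n) * r) i = Polynomial.X * φ r i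
  mul_x_first : ∀ r i, φ (r * D.x 0) i = φ r i * Polynomial.X
  eLast_mul : ∀ i r, φ (D.eLast n i * r) = Pi.single i (φ r i)
  mul_eFirst : ∀ i r, φ (r * D.eFirst n i) = Pi.single i (φ r i)
  tauDesc : φ (D.tauDesc n) = 1

end Bimodules

end KLRDatum

end GKM

end

noncomputable section

set_option linter.unusedSectionVars false

namespace GKM

open MvPolynomial (aeval)

/-! ### Configurations of coloured points and operators on their functions -/

section Conf

variable (L I : Type u) [CommRing L]

/-- Configurations of `n` coloured points with values in `L`, whose differences are units. -/
structure Conf (n : ℕ) : Type u where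
  pt : Fin n → L × I
  isUnit_sub : ∀ p q : Fin n, p ≠ q → IsUnit ((pt p).1 - (pt q).1)

variable {L I} {n : ℕ}

/-- Permutation of the points of a configuration. -/
def Conf.perm (s : Conf L I n) (w : Equiv.Perm (Fin n)) : Conf L I n :=
  ⟨fun p => s.1 (w p), fun _ _ h => s.2 _ _ (fun h' => h (w.injective h'))⟩

/-- The sequence of colours of a configuration. -/
def Conf.col (s : Conf L I n) : Fin n → I := fun p => (s.1 p).2

@[simp] theorem Conf.perm_val (s : Conf L I n) (w : Equiv.Perm (Fin n)) (p : Fin n) :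
    (s.perm w).1 p = s.1 (w p) := rfl

theorem Conf.col_perm (s : Conf L I n) (w : Equiv.Perm (Fin n)) :
    (s.perm w).col = s.col ∘ w := rfl

theorem Conf.perm_perm (s : Conf L I n) (v w : Equiv.Perm (Fin n)) :
    (s.perm v).perm w = s.perm (v * w) := rfl

@[simp] theorem Conf.perm_one (s : Conf L I n) : s.perm 1 = s := rfl

end Conf

/-! ### Adjacent transpositions and the braid identity. -/

theorem adj_mul_self {n : ℕ} (l : ℕ) (h : l + 1 < n) : adj l h * adj l h = 1 :=
  Equiv.swap_mul_self _ _

theorem comp_adj_adj {n : ℕ} {X : Type*} (l : ℕ) (h : l + 1 < n) (ν : Fin n → X) :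
    (ν ∘ adj l h) ∘ adj l h = ν := by
  funext p; simp [adj]

theorem adj_self {n : ℕ} (l : ℕ) (h : l + 1 < n) :
    adj l h ⟨l, Nat.lt_of_succ_lt h⟩ = ⟨l + 1, h⟩ := Equiv.swap_apply_left _ _

theorem adj_succ {n : ℕ} (l : ℕ) (h : l + 1 < n) :
    adj l h ⟨l + 1, h⟩ = ⟨l, Nat.lt_of_succ_lt h⟩ := Equiv.swap_apply_right _ _

theorem adj_of_ne {n : ℕ} (l : ℕ) (h : l + 1 < n) {p : Fin n} (h1 : p.1 ≠ l) (h2 : p.1 ≠ l + 1) :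
    adj l h p = p :=
  Equiv.swap_apply_of_ne_of_ne (fun h => h1 (congrArg Fin.val h)) (fun h => h2 (congrArg Fin.val h))

/-- Naming the common value of the two braid words as the transposition of the outer positions shows
at once that a colour sequence with equal outer colours is fixed by them. -/
theorem adj_braid_left {n : ℕ} (l : ℕ) (hl : l + 1 < n) (h : l + 2 < n) :
    adj (l + 1) h * adj l hl * adj (l + 1) h = Equiv.swap ⟨l, by omega⟩ ⟨l + 2, h⟩ := by
  have h1 : (⟨l, by omega⟩ : Fin n) ≠ ⟨l + 1, by omega⟩ := by simp
  have h2 : (⟨l, by omega⟩ : Fin n) ≠ ⟨l + 2, h⟩ := by simp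
  simp only [adj]
  rw [Equiv.swap_mul_swap_mul_swap h1 h2, Equiv.swap_comm]

theorem adj_braid_right {n : ℕ} (l : ℕ) (hl : l + 1 < n) (h : l + 2 < n) :
    adj l hl * adj (l + 1) h * adj l hl = Equiv.swap ⟨l, by omega⟩ ⟨l + 2, h⟩ := by
  have h2 : (⟨l, by omega⟩ : Fin n) ≠ ⟨l + 2, h⟩ := by simp
  have h3 : (⟨l + 1, by omega⟩ : Fin n) ≠ ⟨l + 2, h⟩ := by simp
  simp only [adj]
  rw [Equiv.swap_comm _ (⟨l + 1, _⟩ : Fin n), Equiv.swap_comm _ (⟨l + 1 + 1, _⟩ : Fin n),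
    Equiv.swap_mul_swap_mul_swap h3.symm h2.symm]

theorem comp_braid_left {n : ℕ} {X : Type*} (ν : Fin n → X) (l : ℕ) (hl : l + 1 < n)
    (h : l + 2 < n) : ((ν ∘ adj (l + 1) h) ∘ adj l hl) ∘ adj (l + 1) h
      = ν ∘ Equiv.swap ⟨l, by omega⟩ ⟨l + 2, h⟩ := by
  rw [← adj_braid_left l hl h]; rfl

theorem comp_braid_right {n : ℕ} {X : Type*} (ν : Fin n → X) (l : ℕ) (hl : l + 1 < n)
    (h : l + 2 < n) : ((ν ∘ adj l hl) ∘ adj (l + 1) h) ∘ adj l hl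
      = ν ∘ Equiv.swap ⟨l, by omega⟩ ⟨l + 2, h⟩ := by
  rw [← adj_braid_right l hl h]; rfl

theorem comp_swap_of_eq {n : ℕ} {X : Type*} {ν : Fin n → X} {p q : Fin n} (h : ν p = ν q) :
    ν ∘ Equiv.swap p q = ν := by
  funext r
  rw [Function.comp_apply, Equiv.swap_apply_def]
  split_ifs with h1 h2
  · rw [h1, h]
  · rw [h2, h]
  · rfl

theorem adj_comm {n : ℕ} {l l' : ℕ} (h : l + 1 < n) (h' : l' + 1 < n) (hl : l + 1 < l') :
    adj l h * adj l' h' = adj l' h' * adj l h := by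
  refine (Equiv.Perm.disjoint_swap_swap ?_).commute
  simp
  omega

/-- In a commutative algebra the order of the factors is immaterial, so the ordered products in the
relations become ordinary polynomial values. -/
theorem ncEval_eq_aeval {k : Type u} [CommRing k] {A : Type u} [CommRing A] [Algebra k A] {r : ℕ}
    (p : MvPolynomial (Fin r) k) (y : Fin r → A) : ncEval p y = aeval y p := by
  rw [MvPolynomial.aeval_def, MvPolynomial.eval₂_eq', ncEval]
  refine Finset.sum_congr rfl fun m _ => ?_
  rw [Algebra.smul_def, ← List.prod_ofFn, List.ofFn_eq_map]

/-! ### Exchange operators on functions of configurations. -/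

namespace KLRDatum

section Representation

variable {k I : Type u} [CommRing k] {𝓀 : ℕ → AddSubgroup k} (D : KLRDatum 𝓀 I)
variable (L : Type u) [CommRing L] [Algebra k L] {n : ℕ}

open Classical in
/-- The coefficient of the exchange of two neighbouring points in the action of `τ`. -/
def exchA (y y' : L × I) : L :=
  if y.2 = y'.2 then aeval ![y.1, y'.1] (D.P y.2) * Ring.inverse (y.1 - y'.1)
  else if WellOrderingRel y.2 y'.2 then 1 else aeval ![y.1, y'.1] (D.Q y.2 y'.2)

open Classical in
/-- The diagonal coefficient in the action of `τ`. -/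
def exchB (y y' : L × I) : L := if y.2 = y'.2 then -D.exchA L y y' else 0

variable {L}

theorem exchB_of_ne {y y' : L × I} (h : y.2 ≠ y'.2) : D.exchB L y y' = 0 := if_neg h

theorem exchB_of_eq {y y' : L × I} (h : y.2 = y'.2) : D.exchB L y y' = -D.exchA L y y' := if_pos h

theorem aeval_swap (p : MvPolynomial (Fin 2) k) (u v : L) :
    aeval ![u, v] (MvPolynomial.rename ![1, 0] p) = aeval ![v, u] p := by
  rw [MvPolynomial.aeval_rename]
  congr 2
  funext a; fin_cases a <;> rfl

/-- The well-order on colours serves only to distribute `Q` between the two directions: one of the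
factors is 1 and the other is the whole of `Q`. The relations see only this product, and the
symmetry of `Q` makes it independent of the order chosen. -/
theorem exchA_mul_exchA {y y' : L × I} (h : y.2 ≠ y'.2) :
    D.exchA L y y' * D.exchA L y' y = aeval ![y.1, y'.1] (D.Q y.2 y'.2) := by
  rw [exchA, exchA, if_neg h, if_neg h.symm]
  by_cases hw : WellOrderingRel y.2 y'.2
  · rw [if_pos hw, if_neg (fun h' => (asymm hw h').elim), one_mul, D.Q_symm y.2, aeval_swap]
  · have : WellOrderingRel y'.2 y.2 := by
      rcases trichotomous_of WellOrderingRel y.2 y'.2 with h1 | h1 | h1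
      · exact absurd h1 hw
      · exact absurd h1 h
      · exact h1
    rw [if_neg hw, if_pos this, mul_one]

theorem exchA_of_eq {y y' : L × I} (h : y.2 = y'.2) :
    D.exchA L y y' = aeval ![y.1, y'.1] (D.P y.2) * Ring.inverse (y.1 - y'.1) := if_pos h

theorem inverse_sub_swap (u v : L) : Ring.inverse (v - u) = -Ring.inverse (u - v) := by
  by_cases h : IsUnit (u - v)
  · have h' : IsUnit (v - u) := by rw [← neg_sub]; exact h.neg
    apply h'.mul_left_cancel
    rw [Ring.mul_inverse_cancel _ h', mul_neg, ← neg_mul, neg_sub, Ring.mul_inverse_cancel _ h]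
  -- Off the units both inverses take the default value 0, so no unit hypothesis is needed.
  · have h' : ¬ IsUnit (v - u) := fun h' => h (by rw [← neg_sub]; exact h'.neg)
    rw [Ring.inverse_non_unit _ h, Ring.inverse_non_unit _ h', neg_zero]

variable (L)

/-- The action of the generators of `R(n)` on functions on configurations. -/
def repGen [DecidableEq I] : KLRGen I n → Module.End k (Conf L I n → L)
  | .e ν => Algebra.lmul k (Conf L I n → L) fun s => if s.col = ν then 1 else 0
  | .x p => Algebra.lmul k (Conf L I n → L) fun s => (s.1 p).1
  | .tau l h =>
    { toFun := fun F s => D.exchA L (s.1 ⟨l, by omega⟩) (s.1 ⟨l + 1, h⟩) * F (s.perm (adj l h))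
        + D.exchB L (s.1 ⟨l, by omega⟩) (s.1 ⟨l + 1, h⟩) * F s
      map_add' := fun F G => by funext s; simp only [Pi.add_apply]; ring
      map_smul' := fun c F => by
        funext s
        simp only [Pi.smul_apply, Algebra.smul_def, RingHom.id_apply]; ring }

variable {L} [DecidableEq I]

theorem repGen_e (ν : Fin n → I) (F : Conf L I n → L) (s : Conf L I n) :
    D.repGen L (.e ν) F s = if s.col = ν then F s else 0 := by
  change (if s.col = ν then (1 : L) else 0) * F s = _
  split_ifs <;> simp

theorem repGen_x (p : Fin n) (F : Conf L I n → L) (s : Conf L I n) :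
    D.repGen L (.x p) F s = (s.1 p).1 * F s := rfl

theorem repGen_tau (l : ℕ) (h : l + 1 < n) (F : Conf L I n → L) (s : Conf L I n) :
    D.repGen L (.tau l h) F s
      = D.exchA L (s.1 ⟨l, by omega⟩) (s.1 ⟨l + 1, h⟩) * F (s.perm (adj l h))
        + D.exchB L (s.1 ⟨l, by omega⟩) (s.1 ⟨l + 1, h⟩) * F s := rfl

/-- The operators of the `x_p` are the images, under the algebra map `Algebra.lmul`, of functions in
a commutative ring; evaluation of a polynomial therefore happens pointwise. -/
theorem ncEval_repGen {r : ℕ} (p : MvPolynomial (Fin r) k) (pos : Fin r → Fin n)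
    (F : Conf L I n → L) (s : Conf L I n) :
    ncEval p (fun a => D.repGen L (.x (pos a))) F s = aeval (fun a => (s.1 (pos a)).1) p * F s := by
  have h : ncEval p (fun a => D.repGen L (.x (pos a)))
      = Algebra.lmul k (Conf L I n → L) (ncEval p fun a (s : Conf L I n) => (s.1 (pos a)).1) :=
    (map_ncEval (Algebra.lmul k (Conf L I n → L)) p _).symm
  rw [h, ncEval_eq_aeval]
  change (aeval _ p : Conf L I n → L) s * F s = _
  congr 1
  exact (MvPolynomial.map_aeval _ (Pi.evalAlgHom k (fun _ : Conf L I n => L) s).toRingHom p).trans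
    (by rw [MvPolynomial.aeval_def, MvPolynomial.coe_eval₂Hom]; congr 1)

/-- The operator `X` maps functions supported on colours `ν` to functions supported on `ν'`. -/
def Moves (X : Module.End k (Conf L I n → L)) (ν ν' : Fin n → I) : Prop :=
  X * D.repGen L (.e ν) = D.repGen L (.e ν') * X

variable {D}

theorem Moves.mul {X Y : Module.End k (Conf L I n → L)} {ν ν' ν'' : Fin n → I}
    (hX : D.Moves X ν' ν'') (hY : D.Moves Y ν ν') : D.Moves (X * Y) ν ν'' := by
  rw [Moves] at *
  rw [mul_assoc, hY, ← mul_assoc, hX, mul_assoc]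

theorem Moves.add {X Y : Module.End k (Conf L I n → L)} {ν ν' : Fin n → I}
    (hX : D.Moves X ν ν') (hY : D.Moves Y ν ν') : D.Moves (X + Y) ν ν' := by
  rw [Moves] at *
  rw [add_mul, mul_add, hX, hY]

theorem Moves.neg {X : Module.End k (Conf L I n → L)} {ν ν' : Fin n → I}
    (hX : D.Moves X ν ν') : D.Moves (-X) ν ν' := by
  exact (neg_mul X _).trans ((congrArg Neg.neg hX).trans (mul_neg _ _).symm)

theorem Moves.sub {X Y : Module.End k (Conf L I n → L)} {ν ν' : Fin n → I}
    (hX : D.Moves X ν ν') (hY : D.Moves Y ν ν') : D.Moves (X - Y) ν ν' := by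
  rw [sub_eq_add_neg]; exact hX.add hY.neg

theorem Moves.zero {ν ν' : Fin n → I} : D.Moves (0 : Module.End k (Conf L I n → L)) ν ν' := by
  rw [Moves, zero_mul, mul_zero]

variable (D)

theorem moves_x (p : Fin n) (ν : Fin n → I) : D.Moves (D.repGen L (.x p)) ν ν := by
  refine LinearMap.ext fun F => funext fun s => ?_
  simp only [Module.End.mul_apply, repGen_e, repGen_x]
  split_ifs <;> simp

theorem moves_ncEval {r : ℕ} (p : MvPolynomial (Fin r) k) (pos : Fin r → Fin n) (ν : Fin n → I) :
    D.Moves (ncEval p (fun a => D.repGen L (.x (pos a)))) ν ν := by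
  refine LinearMap.ext fun F => funext fun s => ?_
  simp only [Module.End.mul_apply, repGen_e, ncEval_repGen]
  split_ifs <;> simp

theorem comp_adj_of_eq {l : ℕ} {h : l + 1 < n} {ν : Fin n → I}
    (hν : ν ⟨l, by omega⟩ = ν ⟨l + 1, h⟩) : ν ∘ adj l h = ν := by
  funext p
  simp only [Function.comp_apply, adj_apply]
  split_ifs with h1 h2
  · rw [← hν]; exact congrArg ν (Fin.ext h1.symm)
  · rw [hν]; exact congrArg ν (Fin.ext h2.symm)
  · rfl

/-- The exchange term permutes colours by the transposition. The diagonal term survives only if the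
two colours agree, and then the transposition does not change the sequence. -/
theorem moves_tau (l : ℕ) (h : l + 1 < n) (ν : Fin n → I) :
    D.Moves (D.repGen L (.tau l h)) ν (ν ∘ adj l h) := by
  refine LinearMap.ext fun F => funext fun s => ?_
  simp only [Module.End.mul_apply, repGen_e, repGen_tau, Conf.col_perm]
  have hiff : s.col ∘ adj l h = ν ↔ s.col = ν ∘ adj l h := by
    constructor
    · rintro rfl; rw [comp_adj_adj]
    · intro h'; rw [h', comp_adj_adj]
  by_cases hc : (s.1 ⟨l, by omega⟩).2 = (s.1 ⟨l + 1, h⟩).2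
  · have h1 : s.col ∘ adj l h = s.col := comp_adj_of_eq hc
    simp only [← hiff, h1]
    split_ifs <;> simp
  · simp only [D.exchB_of_ne hc, hiff]
    split_ifs <;> simp

/-- Since both operators carry `e(ν)` to the left as `e(ν')`, a relation multiplied by `e(ν)` need
only be checked at configurations of colour `ν'`, where the case distinctions in the coefficients
are resolved. -/
theorem moves_ext {X Y : Module.End k (Conf L I n → L)} {ν ν' : Fin n → I}
    (hX : D.Moves X ν ν') (hY : D.Moves Y ν ν')
    (h : ∀ F (s : Conf L I n), s.col = ν' → X F s = Y F s) :
    X * D.repGen L (.e ν) = Y * D.repGen L (.e ν) := by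
  rw [hX, hY]
  refine LinearMap.ext fun F => funext fun s => ?_
  rw [Module.End.mul_apply, Module.End.mul_apply, repGen_e, repGen_e]
  split_ifs with hs
  · exact h F s hs
  · rfl

theorem perm_adj_left (s : Conf L I n) (l : ℕ) (h : l + 1 < n) :
    (s.perm (adj l h)).1 ⟨l, by omega⟩ = s.1 ⟨l + 1, h⟩ := congrArg s.1 (adj_self l h)

theorem perm_adj_right (s : Conf L I n) (l : ℕ) (h : l + 1 < n) :
    (s.perm (adj l h)).1 ⟨l + 1, h⟩ = s.1 ⟨l, by omega⟩ := congrArg s.1 (adj_succ l h)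

theorem perm_adj_of_ne (s : Conf L I n) (l : ℕ) (h : l + 1 < n) {p : Fin n} (h1 : p.1 ≠ l)
    (h2 : p.1 ≠ l + 1) : (s.perm (adj l h)).1 p = s.1 p := congrArg s.1 (adj_of_ne l h h1 h2)

theorem perm_adj_perm_adj (s : Conf L I n) (l : ℕ) (h : l + 1 < n) :
    (s.perm (adj l h)).perm (adj l h) = s := by
  rw [Conf.perm_perm, adj_mul_self, Conf.perm_one]

/-- When both words are expanded, the terms with two or three exchanges cancel before anything is
assumed about colours. What is left, a diagonal term and one term for each adjacent exchange, is
compared below with the right-hand sides of the three braid relations. -/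
theorem rep_braid (l : ℕ) (hl1 : l + 1 < n) (h : l + 2 < n) (F : Conf L I n → L) (s : Conf L I n)
    {y0 y1 y2 : L × I} (h0 : s.1 ⟨l, by omega⟩ = y0) (h1 : s.1 ⟨l + 1, by omega⟩ = y1)
    (h2 : s.1 ⟨l + 2, h⟩ = y2) :
    (D.repGen L (.tau (l + 1) h) * D.repGen L (.tau l hl1) * D.repGen L (.tau (l + 1) h)
      - D.repGen L (.tau l hl1) * D.repGen L (.tau (l + 1) h)
        * D.repGen L (.tau l hl1) : Module.End k (Conf L I n → L)) F s
      = (D.exchA L y1 y2 * D.exchB L y0 y2 * D.exchA L y2 y1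
          + D.exchB L y1 y2 * D.exchB L y0 y1 * D.exchB L y1 y2
          - D.exchA L y0 y1 * D.exchB L y0 y2 * D.exchA L y1 y0
          - D.exchB L y0 y1 * D.exchB L y1 y2 * D.exchB L y0 y1) * F s
        + D.exchA L y1 y2 * (D.exchB L y0 y2 * D.exchB L y2 y1 + D.exchB L y1 y2 * D.exchB L y0 y1
          - D.exchB L y0 y1 * D.exchB L y0 y2) * F (s.perm (adj (l + 1) h))
        + D.exchA L y0 y1 * (D.exchB L y1 y2 * D.exchB L y0 y2 - D.exchB L y0 y2 * D.exchB L y1 y0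
          - D.exchB L y0 y1 * D.exchB L y1 y2) * F (s.perm (adj l hl1)) := by
  have a0 : ∀ t : Conf L I n, (t.perm (adj l hl1)).1 ⟨l, by omega⟩ = t.1 ⟨l + 1, hl1⟩ :=
    fun t => perm_adj_left t l hl1
  have a1 : ∀ t : Conf L I n, (t.perm (adj l hl1)).1 ⟨l + 1, by omega⟩ = t.1 ⟨l, by omega⟩ :=
    fun t => perm_adj_right t l hl1
  have a2 : ∀ t : Conf L I n, (t.perm (adj l hl1)).1 ⟨l + 2, h⟩ = t.1 ⟨l + 2, h⟩ :=
    fun t => perm_adj_of_ne t l hl1 (by simp) (by simp)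
  have b0 : ∀ t : Conf L I n, (t.perm (adj (l + 1) h)).1 ⟨l, by omega⟩ = t.1 ⟨l, by omega⟩ :=
    fun t => perm_adj_of_ne t (l + 1) h (by simp) (by simp; omega)
  have b1 : ∀ t : Conf L I n, (t.perm (adj (l + 1) h)).1 ⟨l + 1, by omega⟩ = t.1 ⟨l + 2, h⟩ :=
    fun t => perm_adj_left t (l + 1) h
  have b2 : ∀ t : Conf L I n, (t.perm (adj (l + 1) h)).1 ⟨l + 2, h⟩ = t.1 ⟨l + 1, by omega⟩ :=
    fun t => perm_adj_right t (l + 1) h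
  have hb : ((s.perm (adj (l + 1) h)).perm (adj l hl1)).perm (adj (l + 1) h)
      = ((s.perm (adj l hl1)).perm (adj (l + 1) h)).perm (adj l hl1) := by
    simp only [Conf.perm_perm]
    rw [adj_braid_left l hl1 h, adj_braid_right l hl1 h]
  simp only [LinearMap.sub_apply, Pi.sub_apply, Module.End.mul_apply, repGen_tau, Nat.add_assoc,
    Nat.reduceAdd, a0, a1, a2, b0, b1, b2, perm_adj_perm_adj, hb, h0, h1, h2]
  ring

end Representation

end KLRDatum

end GKM

end

/-! ### Verification of the defining relations in the representation. -/

noncomputable section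

set_option linter.unusedSectionVars false

namespace GKM

open MvPolynomial (aeval)

namespace KLRDatum

section Representation

variable {k I : Type u} [CommRing k] {𝓀 : ℕ → AddSubgroup k} (D : KLRDatum 𝓀 I)
variable {L : Type u} [CommRing L] [Algebra k L] {n : ℕ}

theorem aeval_partialP (P : MvPolynomial (Fin 2) k) {u v : L} (h : IsUnit (u - v)) :
    aeval ![u, v] (partialP P) = (aeval ![v, u] P - aeval ![u, v] P) * Ring.inverse (u - v) := by
  have := congrArg (aeval ![u, v]) (partialP_spec P)
  rw [map_mul, map_sub, map_sub, aeval_swap, MvPolynomial.aeval_X, MvPolynomial.aeval_X] at this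
  rw [← this]
  change _ = (u - v) * _ * _
  rw [mul_right_comm, Ring.mul_inverse_cancel _ h, one_mul]

theorem aeval_rename2 (P : MvPolynomial (Fin 2) k) (y : Fin 3 → L) (a b : Fin 3) :
    aeval y (MvPolynomial.rename ![a, b] P) = aeval ![y a, y b] P := by
  rw [MvPolynomial.aeval_rename]
  congr 2
  funext a; fin_cases a <;> rfl

theorem aeval_barQ (Q : MvPolynomial (Fin 2) k) {u v w : L} (h : IsUnit (u - w)) :
    aeval ![u, v, w] (barQ Q) = (aeval ![u, v] Q - aeval ![w, v] Q) * Ring.inverse (u - w) := by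
  have := congrArg (aeval ![u, v, w]) (barQ_spec Q)
  rw [map_mul, map_sub, map_sub, aeval_rename2, aeval_rename2, MvPolynomial.aeval_X,
    MvPolynomial.aeval_X] at this
  change (u - w) * _ = aeval ![u, v] Q - aeval ![w, v] Q at this
  rw [← this, mul_right_comm, Ring.mul_inverse_cancel _ h, one_mul]

theorem aeval_barP' (P : MvPolynomial (Fin 2) k) {u v w : L} (h01 : IsUnit (u - v))
    (h02 : IsUnit (u - w)) (h12 : IsUnit (v - w)) :
    aeval ![u, v, w] (barP' P)
      = aeval ![v, u] P * aeval ![u, w] P * Ring.inverse (u - v) * Ring.inverse (u - w)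
        + aeval ![u, w] P * aeval ![v, w] P * Ring.inverse (u - w) * Ring.inverse (v - w)
        - aeval ![u, v] P * aeval ![v, w] P * Ring.inverse (u - v) * Ring.inverse (v - w) := by
  have := congrArg (aeval ![u, v, w]) (barP'_spec P)
  simp only [map_mul, map_sub, map_add, aeval_rename2, MvPolynomial.aeval_X] at this
  change (u - v) * ((u - w) * (v - w)) * _
    = aeval ![v, u] P * aeval ![u, w] P * (v - w) + aeval ![u, w] P * aeval ![v, w] P * (u - v)
      - aeval ![u, v] P * aeval ![v, w] P * (u - w) at this
  -- Multiplying by the three unit differences brings the claim to the common denominator of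
  -- `barP'_spec`; the final combination cancels each difference against its inverse.
  apply h01.mul_left_cancel
  apply h02.mul_left_cancel
  apply h12.mul_left_cancel
  have e1 := Ring.mul_inverse_cancel _ h01
  have e2 := Ring.mul_inverse_cancel _ h02
  have e3 := Ring.mul_inverse_cancel _ h12
  generalize Ring.inverse (u - v) = α at *
  generalize Ring.inverse (u - w) = β at *
  generalize Ring.inverse (v - w) = γ at *
  generalize aeval ![u, v] P = p at *
  generalize aeval ![v, u] P = p1 at *
  generalize aeval ![u, w] P = p2 at *
  generalize aeval ![v, w] P = p3 at *
  linear_combination this - p1 * p2 * (v - w) * ((u - w) * β) * e1 - p1 * p2 * (v - w) * e2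
    - p2 * p3 * (u - v) * ((v - w) * γ) * e2 - p2 * p3 * (u - v) * e3
    + p * p3 * (u - w) * ((v - w) * γ) * e1 + p * p3 * (u - w) * e3

theorem aeval_barP'' (P : MvPolynomial (Fin 2) k) {u v w : L} (h01 : IsUnit (u - v))
    (h02 : IsUnit (u - w)) (h12 : IsUnit (v - w)) :
    aeval ![u, v, w] (barP'' P)
      = -(aeval ![u, v] P * aeval ![u, w] P * Ring.inverse (u - v) * Ring.inverse (u - w))
        - aeval ![u, w] P * aeval ![w, v] P * Ring.inverse (u - w) * Ring.inverse (v - w)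
        + aeval ![u, v] P * aeval ![v, w] P * Ring.inverse (u - v) * Ring.inverse (v - w) := by
  have := congrArg (aeval ![u, v, w]) (barP''_spec P)
  simp only [map_mul, map_sub, map_add, map_neg, aeval_rename2, MvPolynomial.aeval_X] at this
  change (u - v) * ((u - w) * (v - w)) * _
    = -(aeval ![u, v] P * aeval ![u, w] P * (v - w)) - aeval ![u, w] P * aeval ![w, v] P * (u - v)
      + aeval ![u, v] P * aeval ![v, w] P * (u - w) at this
  apply h01.mul_left_cancel
  apply h02.mul_left_cancel
  apply h12.mul_left_cancel
  have e1 := Ring.mul_inverse_cancel _ h01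
  have e2 := Ring.mul_inverse_cancel _ h02
  have e3 := Ring.mul_inverse_cancel _ h12
  generalize Ring.inverse (u - v) = α at *
  generalize Ring.inverse (u - w) = β at *
  generalize Ring.inverse (v - w) = γ at *
  generalize aeval ![u, v] P = p at *
  generalize aeval ![w, v] P = p1 at *
  generalize aeval ![u, w] P = p2 at *
  generalize aeval ![v, w] P = p3 at *
  linear_combination this + p * p2 * (v - w) * ((u - w) * β) * e1 + p * p2 * (v - w) * e2
    + p2 * p1 * (u - v) * ((v - w) * γ) * e2 + p2 * p1 * (u - v) * e3
    - p * p3 * (u - w) * ((v - w) * γ) * e1 - p * p3 * (u - w) * e3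

variable [Fintype I] [DecidableEq I]

theorem rep_tau_sq (l : ℕ) (h : l + 1 < n) (F : Conf L I n → L) (s : Conf L I n)
    {y y' : L × I} (h0 : s.1 ⟨l, by omega⟩ = y) (h1 : s.1 ⟨l + 1, h⟩ = y') :
    (D.repGen L (.tau l h) * D.repGen L (.tau l h)) F s
      = (D.exchA L y y' * D.exchA L y' y + D.exchB L y y' * D.exchB L y y') * F s
        + D.exchA L y y' * (D.exchB L y' y + D.exchB L y y') * F (s.perm (adj l h)) := by
  have a0 := perm_adj_left s l h
  have a1 := perm_adj_right s l h
  simp only [Module.End.mul_apply, repGen_tau, a0, a1, perm_adj_perm_adj, h0, h1]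
  ring

theorem lift_repGen_ncEval2 (P : MvPolynomial (Fin 2) k) (p q : Fin n) :
    FreeAlgebra.lift k (D.repGen L) (ncEval P ![fx k I p, fx k I q])
      = ncEval P (fun a => D.repGen L (.x (![p, q] a))) := lift_ncEval2 _ _ _ _

theorem aeval_pos2 (P : MvPolynomial (Fin 2) k) (p q : Fin n) (s : Conf L I n) :
    aeval (fun a => (s.1 (![p, q] a)).1) P = aeval ![(s.1 p).1, (s.1 q).1] P := by
  congr 2
  funext a; fin_cases a <;> rfl

theorem aeval_pos3 (P : MvPolynomial (Fin 3) k) (p q r : Fin n) (s : Conf L I n) :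
    aeval (fun a => (s.1 (![p, q, r] a)).1) P
      = aeval ![(s.1 p).1, (s.1 q).1, (s.1 r).1] P := by
  congr 2
  funext a; fin_cases a <;> rfl

-- After multiplication by `e(ν)`, `moves_ext` fixes the colours. The coefficients then have a
-- definite form and each relation becomes an identity of rational functions in the points, whose
-- denominators are units by the definition of a configuration.
variable (L) in
theorem repGen_rel (a b : FreeAlgebra k (KLRGen I n)) (hab : D.Rel n a b) :
    FreeAlgebra.lift k (D.repGen L) a = FreeAlgebra.lift k (D.repGen L) b := by
  cases hab with
  | e_idem ν =>
    simp only [map_mul, FreeAlgebra.lift_ι_apply]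
    refine LinearMap.ext fun F => funext fun s => ?_
    simp only [Module.End.mul_apply, repGen_e]
    split_ifs <;> rfl
  | e_orth ν ν' hν =>
    simp only [map_mul, FreeAlgebra.lift_ι_apply, map_zero]
    refine LinearMap.ext fun F => funext fun s => ?_
    simp only [Module.End.mul_apply, repGen_e]
    split_ifs with h1 h2
    · exact absurd (h1.symm.trans h2) hν
    · rfl
    · rfl
  | e_sum =>
    simp only [map_sum, FreeAlgebra.lift_ι_apply, map_one]
    refine LinearMap.ext fun F => funext fun s => ?_
    simp [LinearMap.sum_apply, Finset.sum_apply, repGen_e]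
  | x_comm p q =>
    simp only [map_mul, FreeAlgebra.lift_ι_apply]
    refine LinearMap.ext fun F => funext fun s => ?_
    simp only [Module.End.mul_apply, repGen_x]
    ring
  | x_e p ν =>
    simp only [map_mul, FreeAlgebra.lift_ι_apply]
    exact D.moves_x p ν
  | tau_e l h ν =>
    simp only [map_mul, FreeAlgebra.lift_ι_apply]
    exact D.moves_tau l h ν
  | tau_comm l l' h h' hl =>
    simp only [map_mul, FreeAlgebra.lift_ι_apply]
    refine LinearMap.ext fun F => funext fun s => ?_
    have a0 := perm_adj_of_ne s l h (p := ⟨l', by omega⟩) (by simp; omega) (by simp; omega)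
    have a1 := perm_adj_of_ne s l h (p := ⟨l' + 1, h'⟩) (by simp; omega) (by simp; omega)
    have b0 := perm_adj_of_ne s l' h' (p := ⟨l, by omega⟩) (by simp; omega) (by simp; omega)
    have b1 := perm_adj_of_ne s l' h' (p := ⟨l + 1, h⟩) (by simp; omega) (by simp; omega)
    simp only [Module.End.mul_apply, repGen_tau, a0, a1, b0, b1, Conf.perm_perm, adj_comm h h' hl]
    ring
  | tau_sq_eq l h ν hν =>
    simp only [map_mul, FreeAlgebra.lift_ι_apply, lift_repGen_ncEval2]
    have hm := D.moves_tau (L := L) l h ν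
    rw [comp_adj_of_eq hν] at hm
    refine D.moves_ext (hm.mul hm) ((D.moves_ncEval _ _ ν).mul hm) ?_
    rintro F s rfl
    change (s.1 _).2 = (s.1 _).2 at hν
    rw [rep_tau_sq D l h F s rfl rfl, Module.End.mul_apply, ncEval_repGen, repGen_tau, aeval_pos2,
      aeval_partialP _ (s.2 _ _ (by simp)), exchB_of_eq _ hν, exchB_of_eq _ hν.symm,
      exchA_of_eq _ hν, exchA_of_eq _ hν.symm, inverse_sub_swap (s.1 ⟨l, _⟩).1, ← hν]
    simp only [Conf.col]
    ring
  | tau_sq_ne l h ν hν =>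
    simp only [map_mul, FreeAlgebra.lift_ι_apply, lift_repGen_ncEval2]
    have hm := (D.moves_tau (L := L) l h (ν ∘ adj l h)).mul (D.moves_tau l h ν)
    rw [comp_adj_adj] at hm
    refine D.moves_ext hm (D.moves_ncEval _ _ ν) ?_
    rintro F s rfl
    change (s.1 _).2 ≠ (s.1 _).2 at hν
    rw [rep_tau_sq D l h F s rfl rfl, ncEval_repGen, aeval_pos2,
      exchB_of_ne _ hν, exchB_of_ne _ hν.symm, exchA_mul_exchA _ hν]
    simp only [Conf.col]
    ring
  | tau_x_left l h ν hν =>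
    simp only [map_mul, map_sub, map_neg, FreeAlgebra.lift_ι_apply, lift_repGen_ncEval2]
    have hm := D.moves_tau (L := L) l h ν
    rw [comp_adj_of_eq hν] at hm
    refine Eq.trans ?_ (LinearMap.neg_comp _ _)
    refine D.moves_ext ((hm.mul (D.moves_x _ ν)).sub ((D.moves_x _ ν).mul hm))
      (D.moves_ncEval _ _ ν).neg ?_
    rintro F s rfl
    change (s.1 _).2 = (s.1 _).2 at hν
    have hc := Ring.mul_inverse_cancel _ (s.2 ⟨l, by omega⟩ ⟨l + 1, h⟩ (by simp))
    simp only [LinearMap.sub_apply, LinearMap.neg_apply, Pi.sub_apply, Pi.neg_apply,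
      Module.End.mul_apply, repGen_tau, repGen_x, ncEval_repGen, aeval_pos2, perm_adj_left,
      exchB_of_eq _ hν, exchA_of_eq _ hν]
    simp only [Conf.col]
    linear_combination (-aeval ![(s.1 ⟨l, by omega⟩).1, (s.1 ⟨l + 1, h⟩).1]
      (D.P (s.1 ⟨l, by omega⟩).2) * F s) * hc
  | tau_x_right l h ν hν =>
    simp only [map_mul, map_sub, FreeAlgebra.lift_ι_apply, lift_repGen_ncEval2]
    have hm := D.moves_tau (L := L) l h ν
    rw [comp_adj_of_eq hν] at hm
    refine D.moves_ext ((hm.mul (D.moves_x _ ν)).sub ((D.moves_x _ ν).mul hm))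
      (D.moves_ncEval _ _ ν) ?_
    rintro F s rfl
    change (s.1 _).2 = (s.1 _).2 at hν
    have hc := Ring.mul_inverse_cancel _ (s.2 ⟨l, by omega⟩ ⟨l + 1, h⟩ (by simp))
    simp only [LinearMap.sub_apply, Pi.sub_apply,
      Module.End.mul_apply, repGen_tau, repGen_x, ncEval_repGen, aeval_pos2, perm_adj_right,
      exchB_of_eq _ hν, exchA_of_eq _ hν]
    simp only [Conf.col]
    linear_combination (aeval ![(s.1 ⟨l, by omega⟩).1, (s.1 ⟨l + 1, h⟩).1]
      (D.P (s.1 ⟨l, by omega⟩).2) * F s) * hc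
  | tau_x_other l h p ν hν =>
    simp only [map_mul, map_sub, map_zero, FreeAlgebra.lift_ι_apply]
    have hm := D.moves_tau (L := L) l h ν
    rw [← zero_mul (D.repGen L (.e ν))]
    refine D.moves_ext ((hm.mul (D.moves_x _ ν)).sub ((D.moves_x _ _).mul hm)) Moves.zero ?_
    intro F s hs
    simp only [LinearMap.sub_apply, Pi.sub_apply, LinearMap.zero_apply, Pi.zero_apply,
      Module.End.mul_apply, repGen_tau, repGen_x, Conf.perm_val]
    -- If the two neighbours of `s` have the same colour, `s` has colour sequence `ν` itself, and
    -- the hypothesis excludes the positions `l` and `l + 1`. Otherwise there is no diagonal term.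
    by_cases hc : (s.1 ⟨l, by omega⟩).2 = (s.1 ⟨l + 1, h⟩).2
    · have hs' : s.col = ν := by
        rw [← comp_adj_adj l h ν, ← hs]
        exact (comp_adj_of_eq hc).symm
      subst hs'
      have hp : ¬ (p.1 = l ∨ p.1 = l + 1) := fun hp => hν ⟨hp, hc⟩
      push Not at hp
      rw [adj_of_ne l h hp.1 hp.2]
      ring
    · rw [exchB_of_ne _ hc]
      ring
  | braid_Q l h ν hν hν' =>
    simp only [map_mul, map_sub, FreeAlgebra.lift_ι_apply, lift_ncEval3, lift_repGen_ncEval2]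
    have hl1 : l + 1 < n := by omega
    -- Equal outer colours: the braid permutation fixes `ν`, so both sides carry `e(ν)` to itself.
    have hc := (comp_braid_left ν l hl1 h).trans (comp_swap_of_eq hν)
    have hc' := (comp_braid_right ν l hl1 h).trans (comp_swap_of_eq hν)
    have hm := ((D.moves_tau (L := L) (l + 1) h _).mul (D.moves_tau l hl1 _)).mul
      (D.moves_tau (l + 1) h ν)
    have hm' := ((D.moves_tau (L := L) l hl1 _).mul (D.moves_tau (l + 1) h _)).mul
      (D.moves_tau l hl1 ν)
    rw [hc] at hm
    rw [hc'] at hm'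
    refine D.moves_ext (hm.sub hm') ((D.moves_ncEval _ _ ν).mul (D.moves_ncEval _ _ ν)) ?_
    rintro F s rfl
    change (s.1 _).2 = (s.1 _).2 at hν
    change (s.1 _).2 ≠ (s.1 _).2 at hν'
    have hν2 : (s.1 ⟨l + 1, hl1⟩).2 ≠ (s.1 ⟨l + 2, h⟩).2 := fun h' => hν' (hν.trans h'.symm)
    rw [rep_braid D l hl1 h F s rfl rfl rfl, Module.End.mul_apply, ncEval_repGen, ncEval_repGen,
      aeval_pos2, aeval_pos3, aeval_barQ _ (s.2 _ _ (by simp)), exchB_of_ne _ hν',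
      exchB_of_ne _ hν2, exchB_of_ne _ hν2.symm, exchB_of_ne _ hν'.symm, exchB_of_eq _ hν, exchA_of_eq _ hν]
    -- Only the terms containing the diagonal coefficient of the outer pair survive. They carry `Q`
    -- at the first and middle points and `Q` at the last and middle points, whose difference
    -- quotient is `barQ`.
    have e1 := D.exchA_mul_exchA hν'
    have e2 := D.exchA_mul_exchA (y := s.1 ⟨l + 2, h⟩) (y' := s.1 ⟨l + 1, hl1⟩) hν2.symm
    simp only [Conf.col]
    rw [← e1, hν, ← e2]
    ring
  | braid_P l h ν hν hν' =>
    simp only [map_mul, map_sub, map_add, FreeAlgebra.lift_ι_apply, lift_ncEval3, ← add_mul]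
    have hl1 : l + 1 < n := by omega
    have hm0 := D.moves_tau (L := L) l hl1 ν
    have hm1 := D.moves_tau (L := L) (l + 1) h ν
    rw [comp_adj_of_eq hν'] at hm0
    rw [comp_adj_of_eq (hν'.symm.trans hν)] at hm1
    refine D.moves_ext (((hm1.mul hm0).mul hm1).sub ((hm0.mul hm1).mul hm0))
      (((D.moves_ncEval _ _ ν).mul hm0).add ((D.moves_ncEval _ _ ν).mul hm1)) ?_
    rintro F s rfl
    change (s.1 _).2 = (s.1 _).2 at hν
    change (s.1 _).2 = (s.1 _).2 at hν'
    rw [rep_braid D l hl1 h F s rfl rfl rfl]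
    simp only [LinearMap.add_apply, Pi.add_apply, Module.End.mul_apply, ncEval_repGen, aeval_pos3,
      repGen_tau]
    rw [aeval_barP' _ (s.2 _ _ (by simp)) (s.2 _ _ (by simp)) (s.2 _ _ (by simp)),
      aeval_barP'' _ (s.2 _ _ (by simp)) (s.2 _ _ (by simp)) (s.2 _ _ (by simp))]
    have hν2 := hν'.symm.trans hν
    rw [exchB_of_eq _ hν, exchB_of_eq _ hν', exchB_of_eq _ hν2, exchB_of_eq _ hν'.symm,
      exchB_of_eq _ hν2.symm, exchA_of_eq _ hν, exchA_of_eq _ hν', exchA_of_eq _ hν2,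
      exchA_of_eq _ hν'.symm, exchA_of_eq _ hν2.symm, inverse_sub_swap (s.1 ⟨l, _⟩).1,
      inverse_sub_swap (s.1 ⟨l + 1, _⟩).1, ← hν, ← hν']
    simp only [Conf.col]
    ring
  | braid_zero l h ν hν =>
    simp only [map_mul, map_sub, map_zero, FreeAlgebra.lift_ι_apply]
    have hl1 : l + 1 < n := by omega
    have hm := ((D.moves_tau (L := L) (l + 1) h _).mul (D.moves_tau l hl1 _)).mul
      (D.moves_tau (l + 1) h ν)
    have hm' := ((D.moves_tau (L := L) l hl1 _).mul (D.moves_tau (l + 1) h _)).mul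
      (D.moves_tau l hl1 ν)
    rw [comp_braid_left] at hm
    rw [comp_braid_right] at hm'
    rw [← zero_mul (D.repGen L (.e ν))]
    refine D.moves_ext (hm.sub hm') Moves.zero ?_
    intro F s hs
    have h02 : (s.1 ⟨l, by omega⟩).2 ≠ (s.1 ⟨l + 2, h⟩).2 := by
      have e0 := congrFun hs ⟨l, by omega⟩
      have e2 := congrFun hs ⟨l + 2, h⟩
      rw [Function.comp_apply, Equiv.swap_apply_left] at e0
      rw [Function.comp_apply, Equiv.swap_apply_right] at e2
      exact fun h' => hν (e2.symm.trans (h'.symm.trans e0))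
    rw [rep_braid D l hl1 h F s rfl rfl rfl, exchB_of_ne _ h02]
    -- The outer colours differ, so the middle colour differs from at least one of them. Every
    -- remaining term contains both neighbouring diagonal coefficients, and one of these is 0.
    by_cases h01 : (s.1 ⟨l, by omega⟩).2 = (s.1 ⟨l + 1, hl1⟩).2
    · have h12 : (s.1 ⟨l + 1, hl1⟩).2 ≠ (s.1 ⟨l + 2, h⟩).2 := h01 ▸ h02
      rw [exchB_of_ne _ h12]
      simp
    · rw [exchB_of_ne _ h01]
      simp

variable (L) in
/-- The action of `R(n)` on functions on configurations. -/
def rep (n : ℕ) : D.KLR n →ₐ[k] Module.End k (Conf L I n → L) :=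
  D.lift (D.repGen L) (D.repGen_rel L)

theorem rep_gen (g : KLRGen I n) : D.rep L n (D.klrMk n (FreeAlgebra.ι k g)) = D.repGen L g := by
  rw [rep, lift_mk, FreeAlgebra.lift_ι_apply]

theorem rep_e (ν : Fin n → I) (F : Conf L I n → L) (s : Conf L I n) :
    D.rep L n (D.e ν) F s = if s.col = ν then F s else 0 := by
  rw [← D.repGen_e ν F s, e, fe, rep_gen]

theorem rep_x (p : Fin n) (F : Conf L I n → L) (s : Conf L I n) :
    D.rep L n (D.x p) F s = (s.1 p).1 * F s := by
  rw [← D.repGen_x p F s, x, fx, rep_gen]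

theorem rep_tau (l : ℕ) (h : l + 1 < n) (F : Conf L I n → L) (s : Conf L I n) :
    D.rep L n (D.tau l h) F s
      = D.exchA L (s.1 ⟨l, by omega⟩) (s.1 ⟨l + 1, h⟩) * F (s.perm (adj l h))
        + D.exchB L (s.1 ⟨l, by omega⟩) (s.1 ⟨l + 1, h⟩) * F s := by
  rw [← D.repGen_tau l h F s, tau, ft, rep_gen]

theorem rep_eSum (S : (Fin n → I) → Prop) [DecidablePred S] (F : Conf L I n → L)
    (s : Conf L I n) : D.rep L n (D.eSum S) F s = if S s.col then F s else 0 := by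
  rw [eSum, map_sum, LinearMap.sum_apply, Finset.sum_apply]
  simp only [rep_e]
  rw [Finset.sum_ite_eq]
  simp

end Representation

end KLRDatum

end GKM

end

noncomputable section

set_option linter.unusedSectionVars false

namespace GKM

open MvPolynomial (aeval)

namespace KLRDatum

section Elements

variable {k I : Type u} [CommRing k] {𝓀 : ℕ → AddSubgroup k} (D : KLRDatum 𝓀 I)
variable [Fintype I] [DecidableEq I] {n N : ℕ}

/-! ### The elements `τ_{n-1} ⋯ τ_a` and the map `Ψ` -/

theorem tau_x_of_ne (l : ℕ) (h : l + 1 < n) (p : Fin n) (h1 : p.1 ≠ l) (h2 : p.1 ≠ l + 1) :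
    D.tau l h * D.x p = D.x p * D.tau l h := by
  refine D.ext_e' fun ν => ?_
  have := D.klrMk_rel (Rel.tau_x_other l h p ν (fun h' => by omega))
  simp only [map_mul, map_sub, map_zero, klrMk_fe, klrMk_fx, klrMk_ft, adj_of_ne l h h1 h2,
    sub_mul, sub_eq_zero] at this
  exact this

theorem emb_commute {s : ℕ} (h : s + n ≤ N) {z : D.KLR N}
    (he : ∀ ν : Fin n → I, Commute (D.eSum (fun ν' => ν' ∘ pos h = ν)) z)
    (hx : ∀ p, Commute (D.x (pos h p)) z)
    (ht : ∀ l (hl : l + 1 < n), Commute (D.tau (s + l) (by omega)) z) (r : D.KLR n) :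
    Commute (D.emb h r) z := by
  induction r using D.klr_induction with
  | hs c => rw [AlgHom.commutes]; exact Algebra.commutes c z
  | he ν => rw [emb_e]; exact he ν
  | hx p => rw [emb_x]; exact hx p
  | ht l hl => rw [emb_tau]; exact ht l hl
  | hmul a b ha hb => rw [map_mul]; exact ha.mul_left hb
  | hadd a b ha hb => rw [map_add]; exact ha.add_left hb

theorem emb_emb {m s t w : ℕ} (h : s + n ≤ m) (h' : t + m ≤ N) (h'' : w + n ≤ N) (hw : w = t + s)
    (r : D.KLR n) : D.emb h' (D.emb h r) = D.emb h'' r := by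
  subst hw
  have hp : ∀ p, pos h' (pos h p) = pos h'' p := fun p => Fin.ext (by simp only [pos]; omega)
  induction r using D.klr_induction with
  | hs c => simp only [AlgHom.commutes]
  | he ν =>
    rw [emb_e, emb_e, emb_eSum]
    refine D.eSum_congr fun μ => ?_
    have : (μ ∘ pos h') ∘ pos h = μ ∘ pos h'' := funext fun p => congrArg μ (hp p)
    rw [this]
  | hx p => rw [emb_x, emb_x, emb_x, hp]
  | ht l hl =>
    rw [emb_tau, emb_tau, emb_tau]
    congr 1; omega
  | hmul a b ha hb => simp only [map_mul, ha, hb]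
  | hadd a b ha hb => simp only [map_add, ha, hb]

/-- Strands added on opposite sides do not interact. This is what makes `x ⊗ y ↦ ι(x) ξ(y)` balanced
over `R(n)`. -/
theorem iota_xi (r : D.KLR n) : D.iota (n + 1) (D.xi n r) = D.xi (n + 1) (D.iota n r) :=
  (D.emb_emb _ _ (w := 1) (by omega) rfl r).trans (D.emb_emb _ _ (w := 1) (by omega) rfl r).symm

theorem pos_zero (h : 0 + n ≤ n + 1) (p : Fin n) : pos h p = p.castSucc :=
  Fin.ext (Nat.zero_add _)

theorem pos_one (h : 1 + n ≤ n + 1) (p : Fin n) : pos h p = p.succ :=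
  Fin.ext (Nat.add_comm _ _)

theorem iota_x (p : Fin n) : D.iota n (D.x p) = D.x p.castSucc := by
  rw [iota, emb_x, pos_zero]

theorem xi_x (p : Fin n) : D.xi n (D.x p) = D.x p.succ := by
  rw [xi, emb_x, pos_one]

theorem iota_tau (l : ℕ) (h : l + 1 < n) : D.iota n (D.tau l h) = D.tau l (by omega) := by
  rw [iota, emb_tau]
  congr 1
  omega

theorem xi_tau (l : ℕ) (h : l + 1 < n) : D.xi n (D.tau l h) = D.tau (l + 1) (by omega) := by
  rw [xi, emb_tau]
  congr 1
  omega

theorem iota_eSum (S : (Fin n → I) → Prop) [DecidablePred S] :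
    D.iota n (D.eSum S) = D.eSum (fun ν => S (fun p => ν p.castSucc)) := by
  rw [iota, emb_eSum]
  refine D.eSum_congr fun ν => ?_
  have : ν ∘ pos (by omega : 0 + n ≤ n + 1) = fun p : Fin n => ν p.castSucc :=
    funext fun p => congrArg ν (pos_zero _ p)
  rw [this]

theorem xi_eSum (S : (Fin n → I) → Prop) [DecidablePred S] :
    D.xi n (D.eSum S) = D.eSum (fun ν => S (fun p => ν p.succ)) := by
  rw [xi, emb_eSum]
  refine D.eSum_congr fun ν => ?_
  have : ν ∘ pos (by omega : 1 + n ≤ n + 1) = fun p : Fin n => ν p.succ :=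
    funext fun p => congrArg ν (pos_one _ p)
  rw [this]

theorem eSum_comm (S T : (Fin n → I) → Prop) [DecidablePred S] [DecidablePred T] :
    D.eSum S * D.eSum T = D.eSum T * D.eSum S := by
  rw [eSum_mul_eSum, eSum_mul_eSum]
  exact D.eSum_congr fun ν => and_comm

/-- The crossing involves only the two strands added at the end. -/
theorem tau_iota_iota (r : D.KLR n) :
    Commute (D.tau n (by omega)) (D.iota (n + 1) (D.iota n r)) := by
  have e : D.iota (n + 1) (D.iota n r) = D.emb (s := 0) (N := n + 2) (by omega) r :=
    D.emb_emb _ _ _ rfl r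
  rw [e]
  refine (D.emb_commute _ ?_ ?_ ?_ r).symm
  · intro ν
    refine (D.tau_eSum _ _ _ _ fun ν' => ?_).symm
    have h0 : 0 + n ≤ n + 2 := by omega
    have : (ν' ∘ adj n (by omega)) ∘ pos h0 = ν' ∘ pos h0 :=
      funext fun p => congrArg ν' (adj_of_ne _ _ (by simp only [pos]; omega)
        (by simp only [pos]; omega))
    rw [this]
  · intro p
    exact (D.tau_x_of_ne _ _ _ (by simp only [pos]; omega) (by simp only [pos]; omega)).symm
  · intro l hl
    exact D.tau_comm _ _ (by omega)

theorem tau_xi_xi (r : D.KLR n) :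
    Commute (D.tau 0 (by omega)) (D.xi (n + 1) (D.xi n r)) := by
  have e : D.xi (n + 1) (D.xi n r) = D.emb (s := 2) (N := n + 2) (by omega) r :=
    D.emb_emb _ _ _ rfl r
  rw [e]
  refine (D.emb_commute _ ?_ ?_ ?_ r).symm
  · intro ν
    refine (D.tau_eSum _ _ _ _ fun ν' => ?_).symm
    have h0 : 2 + n ≤ n + 2 := by omega
    have : (ν' ∘ adj 0 (by omega)) ∘ pos h0 = ν' ∘ pos h0 :=
      funext fun p => congrArg ν' (adj_of_ne _ _ (by simp only [pos]; omega)
        (by simp only [pos]; omega))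
    rw [this]
  · intro p
    exact (D.tau_x_of_ne _ _ _ (by simp only [pos]; omega) (by simp only [pos]; omega)).symm
  · intro l hl
    exact (D.tau_comm _ _ (by omega)).symm

theorem iota_x_last (r : D.KLR n) : Commute (D.iota n r) (D.x (Fin.last n)) := by
  refine D.emb_commute _ (fun ν => (D.x_eSum _ _).symm) (fun p => D.x_comm _ _) ?_ r
  intro l hl
  exact D.tau_x_of_ne _ _ _ (by simp; omega) (by simp; omega)

theorem xi_x_zero (r : D.KLR n) : Commute (D.xi n r) (D.x 0) := by
  refine D.emb_commute _ (fun ν => (D.x_eSum _ _).symm) (fun p => D.x_comm _ _) ?_ r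
  intro l hl
  exact D.tau_x_of_ne _ _ _ (by simp; omega) (by simp)

theorem tau_eSum_of_ne (l : ℕ) (h : l + 1 < n) (p : Fin n) (h1 : p.1 ≠ l) (h2 : p.1 ≠ l + 1)
    (i : I) : Commute (D.tau l h) (D.eSum (fun ν => ν p = i)) :=
  D.tau_eSum _ _ _ _ fun ν => by rw [Function.comp_apply, adj_of_ne l h h1 h2]

theorem iota_eLast (r : D.KLR n) (i : I) : Commute (D.iota n r) (D.eLast n i) := by
  refine D.emb_commute _ (fun ν => D.eSum_comm _ _) (fun p => D.x_eSum _ _) ?_ r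
  intro l hl
  exact D.tau_eSum_of_ne _ _ _ (by simp; omega) (by simp; omega) i

theorem xi_eFirst (r : D.KLR n) (i : I) : Commute (D.xi n r) (D.eFirst n i) := by
  refine D.emb_commute _ (fun ν => D.eSum_comm _ _) (fun p => D.x_eSum _ _) ?_ r
  intro l hl
  exact D.tau_eSum_of_ne _ _ _ (by simp; omega) (by simp) i

theorem tauDesc_zero : D.tauDesc 0 = 1 := rfl

theorem tauDesc_succ (n : ℕ) : D.tauDesc (n + 1) = D.xi (n + 1) (D.tauDesc n) * D.tau 0 (by omega) := by
  rw [tauDesc, tauDesc, List.finRange_succ, List.reverse_cons, List.map_append, List.prod_append,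
    map_list_prod]
  congr 1
  · rw [← List.map_reverse, List.map_map, List.map_map]
    congr 1
    refine List.map_congr_left fun l _ => ?_
    exact (D.xi_tau _ _).symm
  · exact List.prod_singleton

/-- Peeling off the leftmost crossing suits left multiplication and induction through `ι`, whereas
`tauDesc_succ`, which peels off the rightmost one, suits right multiplication by `τ_0` and induction
through `ξ`. -/
theorem tauDesc_succ' (n : ℕ) :
    D.tauDesc (n + 1) = D.tau n (by omega) * D.iota (n + 1) (D.tauDesc n) := by
  rw [tauDesc, tauDesc, List.finRange_succ_last, List.reverse_append, List.map_append,
    List.prod_append, map_list_prod]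
  congr 1
  · exact List.prod_singleton
  · rw [← List.map_reverse, List.map_map, List.map_map]
    congr 1
    refine List.map_congr_left fun l _ => ?_
    exact (D.iota_tau _ _).symm

/-- The element `τ_{n-1} ⋯ τ_a` of `R(n + 1)`. -/
def tauFrom : (n : ℕ) → Fin (n + 1) → D.KLR (n + 1)
  | 0 => fun _ => 1
  | n + 1 => Fin.cons (D.tauDesc (n + 1)) fun a => D.xi (n + 1) (tauFrom n a)

theorem tauFrom_zero (n : ℕ) : D.tauFrom n 0 = D.tauDesc n := by
  cases n <;> rfl

theorem tauFrom_succ (n : ℕ) (a : Fin (n + 1)) :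
    D.tauFrom (n + 1) a.succ = D.xi (n + 1) (D.tauFrom n a) := rfl

theorem tauFrom_last (n : ℕ) : D.tauFrom n (Fin.last n) = 1 := by
  induction n with
  | zero => rfl
  | succ n ih => rw [← Fin.succ_last, tauFrom_succ, ih, map_one]

/-- This recursion lowers the index `a` inside a fixed algebra, as needed for the downward induction
in `exists_rep_tauFrom`. -/
theorem tauFrom_castSucc (n : ℕ) (a : Fin n) :
    D.tauFrom n a.castSucc = D.tauFrom n a.succ * D.tau a.1 (by omega) := by
  induction n with
  | zero => exact a.elim0
  | succ n ih =>
    refine Fin.cases ?_ (fun b => ?_) a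
    · rw [Fin.castSucc_zero, tauFrom_zero, tauDesc_succ, tauFrom_succ, tauFrom_zero]
      rfl
    · rw [Fin.castSucc_succ, tauFrom_succ, tauFrom_succ, ih, map_mul, xi_tau]
      rfl

theorem sum_eLast (n : ℕ) : ∑ i, D.eLast n i = 1 := by
  refine D.ext_e' fun ν => ?_
  rw [Finset.sum_mul, one_mul, Finset.sum_eq_single (ν (Fin.last n))]
  · rw [eLast, eSum_mul_e, if_pos rfl]
  · intro i _ hi
    rw [eLast, eSum_mul_e, if_neg hi.symm]
  · simp

theorem eLast_mul_eLast (n : ℕ) (i j : I) :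
    D.eLast n i * D.eLast n j = if i = j then D.eLast n i else 0 := by
  refine D.ext_e' fun ν => ?_
  rw [mul_assoc, eLast, eLast, eSum_mul_e]
  by_cases hij : i = j
  · subst hij
    by_cases h : ν (Fin.last n) = i <;> simp [h, eSum_mul_e]
  · rw [if_neg hij]
    by_cases h : ν (Fin.last n) = j
    · rw [if_pos h, eSum_mul_e, if_neg (fun h' => hij (h'.symm.trans h)), zero_mul]
    · rw [if_neg h, mul_zero, zero_mul]

/-- Substitution of `x_n` into polynomials with coefficients in `R(n)`. -/
def evalLast (n : ℕ) : Polynomial (D.KLR n) →+* D.KLR (n + 1) :=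
  Polynomial.eval₂RingHom' (D.iota n).toRingHom (D.x (Fin.last n)) fun r => D.iota_x_last r

theorem evalLast_C (r : D.KLR n) : D.evalLast n (Polynomial.C r) = D.iota n r :=
  Polynomial.eval₂_C _ _

theorem evalLast_X : D.evalLast n Polynomial.X = D.x (Fin.last n) :=
  Polynomial.eval₂_X _ _

theorem evalLast_monomial (p : ℕ) (r : D.KLR n) :
    D.evalLast n (Polynomial.monomial p r) = D.iota n r * D.x (Fin.last n) ^ p :=
  Polynomial.eval₂_monomial _ _

theorem evalLast_eLast (f : Polynomial (D.KLR n)) (i : I) :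
    Commute (D.evalLast n f) (D.eLast n i) := by
  induction f using Polynomial.induction_on' with
  | add f g hf hg => rw [map_add]; exact hf.add_left hg
  | monomial p r =>
    rw [evalLast_monomial]
    exact (D.iota_eLast r i).mul_left (Commute.pow_left (D.x_eSum _ _) p)

/-- The homomorphism `R(n) ⊗ R(1) = ⨁ i, R(n) ⊗ k[t_i] → R(n + 1)`. -/
def theta (n : ℕ) : (I → Polynomial (D.KLR n)) →+ D.KLR (n + 1) where
  toFun f := ∑ i, D.evalLast n (f i) * D.eLast n i
  map_zero' := by simp
  map_add' f g := by simp [add_mul, Finset.sum_add_distrib]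

theorem theta_apply (f : I → Polynomial (D.KLR n)) :
    D.theta n f = ∑ i, D.evalLast n (f i) * D.eLast n i := rfl

theorem theta_mul_eLast (f : I → Polynomial (D.KLR n)) (i : I) :
    D.theta n f * D.eLast n i = D.evalLast n (f i) * D.eLast n i := by
  rw [theta_apply, Finset.sum_mul, Finset.sum_eq_single i]
  · rw [mul_assoc, eLast_mul_eLast, if_pos rfl]
  · intro j _ hj
    rw [mul_assoc, eLast_mul_eLast, if_neg hj, mul_zero]
  · simp

theorem theta_single (i : I) (f : Polynomial (D.KLR n)) :
    D.theta n (Pi.single i f) = D.evalLast n f * D.eLast n i := by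
  rw [theta_apply, Finset.sum_eq_single i]
  · rw [Pi.single_eq_same]
  · intro j _ hj
    rw [Pi.single_eq_of_ne hj, map_zero, zero_mul]
  · simp

theorem theta_one : D.theta n 1 = 1 := by
  simp only [theta_apply, Pi.one_apply, map_one, one_mul, sum_eLast]

/-- The orthogonal idempotents `e(n,i)` commute with the values of `evalLast`, so different
components do not interfere. -/
theorem theta_mul (f g : I → Polynomial (D.KLR n)) :
    D.theta n (f * g) = D.theta n f * D.theta n g := by
  rw [D.theta_apply g, Finset.mul_sum, theta_apply]
  refine Finset.sum_congr rfl fun i _ => ?_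
  rw [(D.evalLast_eLast (g i) i).eq, ← mul_assoc, theta_mul_eLast, mul_assoc,
    ← (D.evalLast_eLast (g i) i).eq, ← mul_assoc, Pi.mul_apply, map_mul]

theorem theta_C (r : D.KLR n) : D.theta n (fun _ => Polynomial.C r) = D.iota n r := by
  simp only [theta_apply, evalLast_C, ← Finset.mul_sum, sum_eLast, mul_one]

theorem theta_X : D.theta n (fun _ => Polynomial.X) = D.x (Fin.last n) := by
  simp only [theta_apply, evalLast_X, ← Finset.mul_sum, sum_eLast, mul_one]

theorem theta_single_one (i : I) : D.theta n (Pi.single i 1) = D.eLast n i := by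
  rw [theta_single, map_one, one_mul]

/-- The map `c ↦ ∑ a, θ(c_a) τ_{n-1} ⋯ τ_a`. -/
def psi (n : ℕ) : (Fin (n + 1) → I → Polynomial (D.KLR n)) →+ D.KLR (n + 1) where
  toFun c := ∑ a, D.theta n (c a) * D.tauFrom n a
  map_zero' := by simp
  map_add' f g := by simp [add_mul, Finset.sum_add_distrib]

theorem psi_apply (c : Fin (n + 1) → I → Polynomial (D.KLR n)) :
    D.psi n c = ∑ a, D.theta n (c a) * D.tauFrom n a := rfl

end Elements

end KLRDatum

end GKM

end

/-! ### Independence of the basis elements: adjoining a generic point. -/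

noncomputable section

set_option linter.unusedSectionVars false

namespace GKM

open MvPolynomial (aeval)

theorem map_ringInverse {A B : Type*} [CommRing A] [CommRing B] (f : A →+* B) {a : A}
    (h : IsUnit a) : f (Ring.inverse a) = Ring.inverse (f a) := by
  apply (h.map f).mul_left_cancel
  rw [← map_mul, Ring.mul_inverse_cancel _ h, map_one, Ring.mul_inverse_cancel _ (h.map f)]

section LeadingCoefficient

variable {k L : Type u} [CommRing k] [CommRing L] [Algebra k L]

/-- The vanishing hypotheses leave a single monomial with the top power of the second variable, and
it is a pure power with unit coefficient. Substituting `a` and `X` therefore gives degree `N` with a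
unit as top coefficient, and `c` is its inverse. -/
theorem exists_monic_aeval {p : MvPolynomial (Fin 2) k} {N : ℕ}
    (hlt : ∀ m, N < m 1 → p.coeff m = 0)
    (heq : ∀ m, m 1 = N → m 0 ≠ 0 → p.coeff m = 0)
    (hu : IsUnit (p.coeff (Finsupp.single 1 N))) (a : L) :
    ∃ c : L, (Polynomial.C c * aeval ![Polynomial.C a, Polynomial.X] p).Monic := by
  have hexp : aeval ![Polynomial.C a, Polynomial.X] p
      = ∑ m ∈ p.support, Polynomial.monomial (m 1) (algebraMap k L (p.coeff m) * a ^ m 0) := by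
    rw [MvPolynomial.aeval_def, MvPolynomial.eval₂_eq']
    refine Finset.sum_congr rfl fun m _ => ?_
    rw [Fin.prod_univ_two]
    change Polynomial.C (algebraMap k L _) * (Polynomial.C a ^ m 0 * Polynomial.X ^ m 1) = _
    rw [← Polynomial.C_pow, ← mul_assoc, ← Polynomial.C_mul, Polynomial.C_mul_X_pow_eq_monomial]
  obtain ⟨u, hu⟩ := hu
  refine ⟨algebraMap k L ↑u⁻¹, Polynomial.monic_of_natDegree_le_of_coeff_eq_one N ?_ ?_⟩
  · refine (Polynomial.natDegree_C_mul_le _ _).trans ?_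
    rw [hexp]
    refine Polynomial.natDegree_sum_le_of_forall_le _ _ fun m hm => ?_
    refine (Polynomial.natDegree_monomial_le _).trans ?_
    by_contra h
    exact MvPolynomial.mem_support_iff.mp hm (hlt m (by omega))
  · rw [Polynomial.coeff_C_mul, hexp, Polynomial.finsetSum_coeff,
      Finset.sum_eq_single (Finsupp.single 1 N)]
    · rw [Polynomial.coeff_monomial, ← hu]
      simp [← map_mul]
    · intro m hm hne
      rw [Polynomial.coeff_monomial, if_neg]
      intro hN
      refine MvPolynomial.mem_support_iff.mp hm (heq m hN fun h0 => hne ?_)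
      ext b
      fin_cases b
      · simpa using h0
      · simpa using hN
    · intro h
      rw [MvPolynomial.notMem_support_iff.mp h]
      simp

end LeadingCoefficient

namespace KLRDatum

section Faithful

variable {k I : Type u} [CommRing k] {𝓀 : ℕ → AddSubgroup k} (D : KLRDatum 𝓀 I)

theorem exists_monic_P {L : Type u} [CommRing L] [Algebra k L] (i : I) (a : L) :
    ∃ c : L, (Polynomial.C c * aeval ![Polynomial.C a, Polynomial.X] (D.P i)).Monic := by
  -- For diagonal entry 2 the polynomial `P` is a unit constant; for diagonal entry `2m ≤ 0` the
  -- extremal exponent is `1 - m`.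
  have hN : ∃ N : ℕ, 2 * (N : ℤ) = 2 - D.a i i := by
    rcases D.diag i with h | ⟨h, m, hm⟩
    · exact ⟨0, by rw [h]; rfl⟩
    · exact ⟨(1 - m).toNat, by rw [Int.toNat_of_nonneg (by omega)]; omega⟩
  obtain ⟨N, hN⟩ := hN
  refine exists_monic_aeval (N := N) (fun m hm => D.P_bound i m ?_)
    (fun m hm h0 => D.P_bound i m ?_) (D.P_lead_right i N hN) a
  · omega
  · omega

/-- The hypothesis concerns the first variable of `Q j i`, and the symmetry of `Q` turns it into one
on the second variable of `Q i j`. The exponent is then `-a j i`, and symmetrizability identifies `d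
j` times it with the degree bound, so no other monomial reaches this power of the second variable.
-/
theorem exists_monic_Q {L : Type u} [CommRing L] [Algebra k L] {i j : I} (hij : i ≠ j) (a : L) :
    ∃ c : L, (Polynomial.C c * aeval ![Polynomial.C a, Polynomial.X] (D.Q i j)).Monic := by
  obtain ⟨N, hN⟩ : ∃ N : ℕ, (N : ℤ) = -D.a j i :=
    ⟨(-D.a j i).toNat, Int.toNat_of_nonneg (by have := D.offDiag j i hij.symm; omega)⟩
  have hs : -(D.d i * D.a i j) = D.d j * N := by rw [D.symm, hN]; ring
  have hi := D.d_pos i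
  have hj := D.d_pos j
  refine exists_monic_aeval (N := N) (fun m hm => D.Q_bound i j hij m ?_)
    (fun m hm h0 => D.Q_bound i j hij m ?_) ?_ a
  · rw [hs]
    have h1 : D.d j * N < D.d j * m 1 := mul_lt_mul_of_pos_left (by exact_mod_cast hm) hj
    have h2 : 0 ≤ D.d i * m 0 := by positivity
    linarith
  · rw [hs, hm]
    have h2 : 0 < D.d i * m 0 := mul_pos hi (by exact_mod_cast Nat.pos_of_ne_zero h0)
    linarith
  · have h := D.Q_lead j i hij.symm N hN
    rw [D.Q_symm i j]
    have hinj : Function.Injective (![1, 0] : Fin 2 → Fin 2) := by decide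
    have h2 := MvPolynomial.coeff_rename_mapDomain _ hinj (D.Q j i) (Finsupp.single 0 N)
    rw [Finsupp.mapDomain_single] at h2
    change MvPolynomial.coeff (Finsupp.single 1 N) _ = _ at h2
    rwa [h2]

variable [Fintype I] [DecidableEq I] {n : ℕ}
variable {L L' : Type u} [CommRing L] [CommRing L'] [Algebra k L] [Algebra k L']
variable (j : Polynomial L →ₐ[k] L') (hu : ∀ f : Polynomial L, f.Monic → IsUnit (j f))

/-- The configuration over `L'` obtained from a configuration over `L` by adding the point `X` of
colour `i` at the end. -/
def addPoint (i : I) (s : Conf L I n) : Conf L' I (n + 1) where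
  pt := Fin.snoc (α := fun _ => L' × I) (fun p => (j (Polynomial.C (s.pt p).1), (s.pt p).2))
    (j Polynomial.X, i)
  isUnit_sub p q hpq := by
    induction p using Fin.lastCases with
    | last =>
      induction q using Fin.lastCases with
      | last => exact absurd rfl hpq
      | cast q =>
        simp only [Fin.snoc_last, Fin.snoc_castSucc, ← map_sub]
        exact hu _ (Polynomial.monic_X_sub_C _)
    | cast p =>
      induction q using Fin.lastCases with
      | last =>
        simp only [Fin.snoc_last, Fin.snoc_castSucc, ← map_sub]
        rw [← neg_sub, map_neg]
        exact (hu _ (Polynomial.monic_X_sub_C _)).neg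
      | cast q =>
        simp only [Fin.snoc_castSucc, ← map_sub]
        exact ((s.isUnit_sub p q fun h => hpq (congrArg _ h)).map Polynomial.C).map j

@[simp] theorem addPoint_last (i : I) (s : Conf L I n) :
    (addPoint j hu i s).pt (Fin.last n) = (j Polynomial.X, i) := by
  simp only [addPoint, Fin.snoc_last]

@[simp] theorem addPoint_castSucc (i : I) (s : Conf L I n) (p : Fin n) :
    (addPoint j hu i s).pt p.castSucc = (j (Polynomial.C (s.pt p).1), (s.pt p).2) := by
  simp only [addPoint, Fin.snoc_castSucc]

theorem addPoint_perm_adj (i : I) (s : Conf L I n) (l : ℕ) (h : l + 1 < n) :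
    (addPoint j hu i s).perm (adj l (by omega)) = addPoint j hu i (s.perm (adj l h)) := by
  have : ∀ p, ((addPoint j hu i s).perm (adj l (by omega))).pt p
      = (addPoint j hu i (s.perm (adj l h))).pt p := by
    intro p
    rw [Conf.perm_val]
    induction p using Fin.lastCases with
    | last => rw [adj_of_ne _ _ (by simp; omega) (by simp; omega), addPoint_last, addPoint_last]
    | cast p =>
      have : adj l (by omega) p.castSucc = (adj l h p).castSucc := by
        rw [adj_apply, adj_apply]
        simp only [Fin.val_castSucc]
        split_ifs <;> rfl
      rw [this, addPoint_castSucc, addPoint_castSucc, Conf.perm_val]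
  cases hs : (addPoint j hu i s).perm (adj l (by omega))
  cases ht : addPoint j hu i (s.perm (adj l h))
  simp only [hs, ht] at this
  simpa using funext this

theorem addPoint_injective (hj : Function.Injective j) (i : I) :
    Function.Injective (addPoint (n := n) j hu i) := by
  intro s t h
  have : ∀ p, s.pt p = t.pt p := by
    intro p
    have hp := congrArg (fun c => c.pt p.castSucc) h
    simp only [addPoint_castSucc, Prod.mk.injEq] at hp
    exact Prod.ext (Polynomial.C_injective (hj hp.1)) hp.2
  cases s; cases t
  simpa using funext this

theorem aeval_map2 {A B : Type u} [CommRing A] [CommRing B] [Algebra k A] [Algebra k B]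
    (f : A →ₐ[k] B) (a b : A) (p : MvPolynomial (Fin 2) k) :
    aeval ![f a, f b] p = f (aeval ![a, b] p) := by
  have : (![f a, f b] : Fin 2 → B) = fun c => f (![a, b] c) := by
    funext c; fin_cases c <;> rfl
  rw [this, ← MvPolynomial.comp_aeval_apply]

/-- The unit hypothesis is needed because a ring homomorphism need not preserve the default value of
`Ring.inverse` at non-units. -/
theorem exchA_map {A B : Type u} [CommRing A] [CommRing B] [Algebra k A] [Algebra k B]
    (f : A →ₐ[k] B) {y y' : A × I} (h : IsUnit (y.1 - y'.1)) :
    D.exchA B (f y.1, y.2) (f y'.1, y'.2) = f (D.exchA A y y') := by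
  simp only [exchA, aeval_map2, ← map_sub]
  split_ifs
  · rw [map_mul]
    congr 1
    exact (map_ringInverse f.toRingHom h).symm
  · rw [map_one]
  · rfl

theorem exchB_map {A B : Type u} [CommRing A] [CommRing B] [Algebra k A] [Algebra k B]
    (f : A →ₐ[k] B) {y y' : A × I} (h : IsUnit (y.1 - y'.1)) :
    D.exchB B (f y.1, y.2) (f y'.1, y'.2) = f (D.exchB A y y') := by
  rw [exchB, exchB, exchA_map _ _ h]
  split_ifs
  · rw [map_neg]
  · rw [map_zero]

-- An old point exchanged with `X` produces only `P(a,X)`, `a - X` and `Q(a,X)`, which are monic up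
-- to a scalar or a sign and hence invertible in `L'`. This is where the leading coefficient
-- hypotheses enter the proof.
include hu in
theorem isUnit_exchA (y : L × I) (i : I) :
    IsUnit (D.exchA L' (j (Polynomial.C y.1), y.2) (j Polynomial.X, i)) := by
  have key : ∀ f : Polynomial L, (∃ c, (Polynomial.C c * f).Monic) → IsUnit (j f) := by
    rintro f ⟨c, hc⟩
    have := hu _ hc
    rw [map_mul] at this
    exact isUnit_of_mul_isUnit_right this
  simp only [exchA, aeval_map2]
  split_ifs with h1 h2
  · refine (key _ (D.exists_monic_P _ _)).mul (IsUnit.ringInverse ?_)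
    rw [← neg_sub, ← map_sub]
    exact (hu _ (Polynomial.monic_X_sub_C _)).neg
  · exact isUnit_one
  · exact key _ (D.exists_monic_Q h1 _)

/-- `F` extends the function `G` on configurations over `L` to those with the point `X` added. -/
def Extends (i : I) (F : Conf L' I (n + 1) → L') (G : Conf L I n → L) : Prop :=
  ∀ s, F (addPoint j hu i s) = j (Polynomial.C (G s))

variable {j hu}

/-- Operators from `R(n)` leave the last point alone, and their coefficients at the old points are
constants in `X`. -/
theorem Extends.iota {i : I} (r : D.KLR n) : ∀ {F : Conf L' I (n + 1) → L'} {G : Conf L I n → L},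
    Extends j hu i F G → Extends j hu i (D.rep L' (n + 1) (D.iota n r) F) (D.rep L n r G) := by
  induction r using D.klr_induction with
  | hs c =>
    intro F G h s
    simp only [AlgHom.commutes, Module.algebraMap_end_apply, Pi.smul_apply, h s]
    rw [← map_smul, Polynomial.smul_C]
  | he ν =>
    intro F G h s
    have hc : (addPoint j hu i s).col ∘ pos (by omega : 0 + n ≤ n + 1) = s.col := by
      funext p
      rw [Function.comp_apply, pos_zero, Conf.col, addPoint_castSucc]
      rfl
    rw [KLRDatum.iota, emb_e, rep_eSum, rep_e, hc, h s]
    split_ifs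
    · rfl
    · rw [map_zero, map_zero]
  | hx p =>
    intro F G h s
    rw [iota_x, rep_x, rep_x, addPoint_castSucc, h s, map_mul, map_mul]
  | ht l hl =>
    intro F G h s
    have a0 : (addPoint j hu i s).pt ⟨l, by omega⟩ = _ := addPoint_castSucc j hu i s ⟨l, by omega⟩
    have a1 : (addPoint j hu i s).pt ⟨l + 1, by omega⟩ = _ :=
      addPoint_castSucc j hu i s ⟨l + 1, by omega⟩
    have hn : IsUnit ((s.pt ⟨l, by omega⟩).1 - (s.pt ⟨l + 1, hl⟩).1) :=
      s.isUnit_sub _ _ (by simp)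
    have eA := D.exchA_map (j.comp Polynomial.CAlgHom) hn
    have eB := D.exchB_map (j.comp Polynomial.CAlgHom) hn
    rw [iota_tau, rep_tau, rep_tau, a0, a1, addPoint_perm_adj _ _ _ _ _ hl, h, h]
    refine Eq.trans ?_ (by rw [map_add, map_add, map_mul, map_mul, map_mul, map_mul])
    congr 2
  | hmul a b ha hb =>
    intro F G h
    rw [map_mul, map_mul, map_mul]
    exact ha (hb h)
  | hadd a b ha hb =>
    intro F G h s
    simp only [map_add, LinearMap.add_apply, Pi.add_apply]
    rw [ha h s, hb h s]

/-- Only the component of the colour `i` of the last point survives, and `x_n` acts as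
multiplication by `X`. The value is thus a polynomial in `X` whose coefficients are the actions of
the coefficients of `f i`, which can be read off separately. -/
theorem Extends.theta {i : I} (f : I → Polynomial (D.KLR n)) {F : Conf L' I (n + 1) → L'}
    {G : Conf L I n → L} (h : Extends j hu i F G) (s : Conf L I n) :
    D.rep L' (n + 1) (D.theta n f) F (addPoint j hu i s)
      = j ((f i).sum fun p r => Polynomial.monomial p (D.rep L n r G s)) := by
  have h1 : D.rep L' (n + 1) (D.theta n f) F (addPoint j hu i s)
      = D.rep L' (n + 1) (D.evalLast n (f i)) F (addPoint j hu i s) := by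
    rw [theta_apply, map_sum, LinearMap.sum_apply, Finset.sum_apply, Finset.sum_eq_single i]
    · rw [(D.evalLast_eLast _ _).eq, map_mul, Module.End.mul_apply, eLast, rep_eSum, if_pos]
      rw [Conf.col, addPoint_last]
    · intro i' _ hi'
      rw [(D.evalLast_eLast _ _).eq, map_mul, Module.End.mul_apply, eLast, rep_eSum, if_neg]
      rw [Conf.col, addPoint_last]
      exact hi'.symm
    · simp
  rw [h1]
  generalize f i = g
  have hz : ∀ p : ℕ, Polynomial.monomial p (D.rep L n 0 G s) = 0 := by simp
  have ha : ∀ (p : ℕ) (a b : D.KLR n), Polynomial.monomial p (D.rep L n (a + b) G s)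
      = Polynomial.monomial p (D.rep L n a G s) + Polynomial.monomial p (D.rep L n b G s) := by
    intro p a b
    rw [map_add, LinearMap.add_apply, Pi.add_apply, map_add]
  induction g using Polynomial.induction_on' with
  | add g g' hg hg' =>
    rw [Polynomial.sum_add_index _ _ _ hz ha, map_add, map_add, map_add, LinearMap.add_apply,
      Pi.add_apply, hg, hg']
  | monomial p r =>
    have hx : ∀ (p : ℕ) (F' : Conf L' I (n + 1) → L'),
        D.rep L' (n + 1) (D.x (Fin.last n) ^ p) F' (addPoint j hu i s)
          = j Polynomial.X ^ p * F' (addPoint j hu i s) := by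
      intro p F'
      induction p with
      | zero => simp
      | succ p ih =>
        rw [pow_succ', map_mul, Module.End.mul_apply, rep_x, ih, addPoint_last]
        ring
    rw [Polynomial.sum_monomial_index _ _ (hz p), evalLast_monomial,
      ((D.iota_x_last r).pow_right p).eq, map_mul, Module.End.mul_apply, hx,
      Extends.iota D r h s, ← Polynomial.C_mul_X_pow_eq_monomial, map_mul, map_pow, mul_comm]

/-- Acting at a configuration whose last point is `X`, the factors of `τ_{n-1} ⋯ τ_a` move `X` step
by step down to position `a`. A diagonal term would leave it at a later position, where `F`
vanishes; only the full exchange remains, with a product of unit coefficients. -/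
theorem exists_rep_tauFrom (i : I) (a : Fin (n + 1)) :
    ∃ w : Equiv.Perm (Fin (n + 1)), w a = Fin.last n ∧ ∀ s : Conf L I n, ∃ u : L', IsUnit u ∧
      ∀ F : Conf L' I (n + 1) → L',
        (∀ (t : Conf L' I (n + 1)) (q : Fin (n + 1)), a < q → t.pt q = (j Polynomial.X, i) →
          F t = 0) →
        D.rep L' (n + 1) (D.tauFrom n a) F (addPoint j hu i s)
          = u * F ((addPoint j hu i s).perm w) := by
  induction a using Fin.reverseInduction with
  | last =>
    refine ⟨1, rfl, fun s => ⟨1, isUnit_one, fun F _ => ?_⟩⟩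
    rw [tauFrom_last, map_one, Module.End.one_apply, one_mul, Conf.perm_one]
  | cast a ih =>
    obtain ⟨w, hw, ih⟩ := ih
    have hl : a.1 + 1 < n + 1 := by omega
    refine ⟨w * adj a.1 hl, ?_, fun s => ?_⟩
    · rw [Equiv.Perm.mul_apply, ← hw]
      exact congrArg w (adj_self a.1 hl)
    · obtain ⟨u, hu', ih⟩ := ih s
      have hwa : w a.castSucc ≠ Fin.last n := by
        rw [← hw]
        exact fun h => (Fin.castSucc_lt_succ (i := a)).ne (w.injective h)
      obtain ⟨q, hq⟩ := Fin.exists_castSucc_eq.mpr hwa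
      refine ⟨u * D.exchA L' (j (Polynomial.C (s.pt q).1), (s.pt q).2) (j Polynomial.X, i),
        hu'.mul (D.isUnit_exchA j hu (s.pt q) i), fun F hF => ?_⟩
      have e0 : ((addPoint j hu i s).perm w).pt ⟨a.1, by omega⟩
          = (j (Polynomial.C (s.pt q).1), (s.pt q).2) := by
        rw [← addPoint_castSucc j hu i, hq]; rfl
      have e1 : ((addPoint j hu i s).perm w).pt ⟨a.1 + 1, hl⟩ = (j Polynomial.X, i) := by
        rw [← addPoint_last j hu i s, ← hw]; rfl
      rw [tauFrom_castSucc, map_mul, Module.End.mul_apply, ih, rep_tau, e0, e1,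
        hF _ ⟨a.1 + 1, hl⟩ Fin.castSucc_lt_succ e1, mul_zero, add_zero, Conf.perm_perm, mul_assoc]
      -- The inductive hypothesis is applied to the image of `F` under `τ_a`, which must vanish when
      -- `X` is beyond position `a + 1`; `τ_a` does not touch those positions.
      intro t q' hq' ht
      have hq2 : a.1 + 1 < q'.1 := hq'
      rw [rep_tau, hF t q' (Fin.castSucc_lt_succ.trans hq') ht,
        hF _ q' (Fin.castSucc_lt_succ.trans hq'), mul_zero, mul_zero, add_zero]
      rw [perm_adj_of_ne _ _ _ (by omega) (by omega), ht]

/-- Triangularity. Suppose the coordinates below `a` vanish. A function concentrated on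
configurations with `X` at position `a` is killed by the basis elements of index above `a`, and the
one of index `a` turns it into an extension of an arbitrary `G`. The coefficients of `c a i` then
act by zero on every `G`, and faithfulness over `L` gives `c a = 0`. -/
theorem psi_eq_zero_of_rep (hj : Function.Injective j)
    (hf : ∀ r : D.KLR n, D.rep L n r = 0 → r = 0) (c : Fin (n + 1) → I → Polynomial (D.KLR n))
    (hc : ∀ (i : I) (F : Conf L' I (n + 1) → L') (s : Conf L I n),
      D.rep L' (n + 1) (D.psi n c) F (addPoint j hu i s) = 0) : c = 0 := by
  classical
  have main : ∀ a, (∀ b, b < a → c b = 0) → c a = 0 := by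
    intro a ih
    funext i
    ext p
    apply hf
    refine LinearMap.ext fun G => funext fun s => ?_
    obtain ⟨w, hw, hs⟩ := exists_rep_tauFrom D (j := j) (hu := hu) i a
    choose u hunit hF using hs
    -- `F` is built so that `τ_{n-1} ⋯ τ_a` carries it to an extension of `G`: it lives on the
    -- permuted configurations and is divided in advance by the unit that the exchanges produce.
    let F : Conf L' I (n + 1) → L' := fun t =>
      if h : ∃ s, t = (addPoint j hu i s).perm w then
        Ring.inverse (u h.choose) * j (Polynomial.C (G h.choose)) else 0
    have hFw : ∀ s, F ((addPoint j hu i s).perm w) = Ring.inverse (u s) * j (Polynomial.C (G s)) := by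
      intro s
      have h : ∃ s', (addPoint j hu i s).perm w = (addPoint j hu i s').perm w := ⟨s, rfl⟩
      have h2 := congrArg (fun t => t.perm w⁻¹) h.choose_spec
      simp only [Conf.perm_perm, mul_inv_cancel, Conf.perm_one] at h2
      change (if h : _ then _ else _) = _
      rw [dif_pos h, ← addPoint_injective j hu hj i h2]
    have hvan : ∀ (t : Conf L' I (n + 1)) (q : Fin (n + 1)), a < q →
        t.pt q = (j Polynomial.X, i) → F t = 0 := by
      intro t q hq ht
      by_cases h : ∃ s, t = (addPoint j hu i s).perm w
      · obtain ⟨s, rfl⟩ := h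
        have hwq : w q ≠ Fin.last n := by
          rw [← hw]
          exact fun h => hq.ne' (w.injective h)
        obtain ⟨q', hq'⟩ := Fin.exists_castSucc_eq.mpr hwq
        rw [Conf.perm_val, ← hq', addPoint_castSucc, Prod.mk.injEq] at ht
        -- Here `X` would coincide with an old point. Their difference is a unit, so `L'` would be
        -- the zero ring and the claim holds trivially.
        have hunit := hu _ (Polynomial.monic_X_sub_C (s.pt q').1)
        rw [map_sub, ht.1, sub_self, isUnit_zero_iff] at hunit
        exact eq_zero_of_zero_eq_one hunit _
      · exact dif_neg h
    have hext : Extends j hu i (D.rep L' (n + 1) (D.tauFrom n a) F) G := by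
      intro s
      rw [hF s F hvan, hFw, ← mul_assoc, Ring.mul_inverse_cancel _ (hunit s), one_mul]
    -- Basis elements of larger index bring `X` to a position where `F` vanishes.
    have hext0 : ∀ b, a < b → Extends j hu i (D.rep L' (n + 1) (D.tauFrom n b) F) 0 := by
      intro b hb s
      obtain ⟨w', hw', hs'⟩ := exists_rep_tauFrom D (j := j) (hu := hu) i b
      obtain ⟨u', -, hu'⟩ := hs' s
      rw [hu' F fun t q hq => hvan t q (hb.trans hq), hvan _ b hb, mul_zero, Pi.zero_apply,
        map_zero, map_zero]
      rw [Conf.perm_val, hw', addPoint_last]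
    have h := hc i F s
    rw [psi_apply, map_sum, LinearMap.sum_apply, Finset.sum_apply, Finset.sum_eq_single a] at h
    · rw [map_mul, Module.End.mul_apply, hext.theta] at h
      have h2 := congrArg (fun g => Polynomial.coeff g p) (hj (h.trans (map_zero j).symm))
      simp only [Polynomial.sum_def, Polynomial.finsetSum_coeff, Polynomial.coeff_monomial,
        Polynomial.coeff_zero] at h2
      rw [Finset.sum_ite_eq'] at h2
      split_ifs at h2 with hp
      · exact h2
      · rw [Polynomial.notMem_support_iff.mp hp, map_zero]
    · intro b _ hb
      rcases lt_or_gt_of_ne hb with hlt | hlt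
      · rw [ih b hlt, map_zero, zero_mul, map_zero]
        rfl
      · rw [map_mul, Module.End.mul_apply, (hext0 b hlt).theta]
        simp [Polynomial.sum_def]
    · simp
  funext a
  induction a using WellFoundedLT.induction with
  | ind a ih => exact main a ih

end Faithful

end KLRDatum

end GKM

end

noncomputable section

set_option linter.unusedSectionVars false

namespace GKM

namespace KLRDatum

section Spanning

variable {k I : Type u} [CommRing k] {𝓀 : ℕ → AddSubgroup k} (D : KLRDatum 𝓀 I)
variable [Fintype I] [DecidableEq I] {n : ℕ}

/-! ### Spanning sets -/

/-- The image of `R(n) ⊗ R(n) → R(n + 1)`, `a ⊗ b ↦ ι(a) ξ(b)`, for `n ≥ 1`. -/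
def mixed : (n : ℕ) → AddSubgroup (D.KLR (n + 1))
  | 0 => ⊥
  | n + 1 => AddSubgroup.closure {r | ∃ a b, r = D.iota (n + 1) a * D.xi (n + 1) b}

theorem iota_mul_xi_mem (a b : D.KLR (n + 1)) :
    D.iota (n + 1) a * D.xi (n + 1) b ∈ D.mixed (n + 1) :=
  AddSubgroup.subset_closure ⟨a, b, rfl⟩

theorem iota_mem (a : D.KLR (n + 1)) : D.iota (n + 1) a ∈ D.mixed (n + 1) := by
  have := D.iota_mul_xi_mem a 1
  rwa [map_one, mul_one] at this

theorem xi_mem (a : D.KLR (n + 1)) : D.xi (n + 1) a ∈ D.mixed (n + 1) := by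
  have := D.iota_mul_xi_mem 1 a
  rwa [map_one, one_mul] at this

theorem mul_mem_mixed {z : D.KLR (n + 1 + 1)} {s : D.KLR (n + 1 + 1)} (hs : s ∈ D.mixed (n + 1))
    (h : ∀ a b, z * (D.iota (n + 1) a * D.xi (n + 1) b) ∈ D.mixed (n + 1)) :
    z * s ∈ D.mixed (n + 1) := by
  induction hs using AddSubgroup.closure_induction with
  | mem r hr =>
    obtain ⟨a, b, rfl⟩ := hr
    exact h a b
  | zero => rw [mul_zero]; exact zero_mem _
  | add x y _ _ hx hy => rw [mul_add]; exact add_mem hx hy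
  | neg x _ hx => rw [mul_neg]; exact neg_mem hx

theorem mem_mixed_mul {z : D.KLR (n + 1 + 1)} {s : D.KLR (n + 1 + 1)} (hs : s ∈ D.mixed (n + 1))
    (h : ∀ a b, D.iota (n + 1) a * D.xi (n + 1) b * z ∈ D.mixed (n + 1)) :
    s * z ∈ D.mixed (n + 1) := by
  induction hs using AddSubgroup.closure_induction with
  | mem r hr =>
    obtain ⟨a, b, rfl⟩ := hr
    exact h a b
  | zero => rw [zero_mul]; exact zero_mem _
  | add x y _ _ hx hy => rw [add_mul]; exact add_mem hx hy
  | neg x _ hx => rw [neg_mul]; exact neg_mem hx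

theorem eLast_eq_xi (i : I) : D.eLast (n + 1) i = D.xi (n + 1) (D.eLast n i) := by
  rw [eLast, eLast, xi_eSum]
  rfl

theorem eFirst_eq_iota (i : I) : D.eFirst (n + 1) i = D.iota (n + 1) (D.eFirst n i) := by
  rw [eFirst, eFirst, iota_eSum]
  rfl

theorem x_last_eq_xi : D.x (Fin.last (n + 1)) = D.xi (n + 1) (D.x (Fin.last n)) := by
  rw [xi_x]; rfl

theorem x_zero_eq_iota : D.x (0 : Fin (n + 2)) = D.iota (n + 1) (D.x 0) := by
  rw [iota_x]; rfl

theorem iota_mul_mixed (c : D.KLR n) {s : D.KLR (n + 1)} (hs : s ∈ D.mixed n) :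
    D.iota n c * s ∈ D.mixed n := by
  cases n with
  | zero => rw [AddSubgroup.mem_bot.mp hs, mul_zero]; exact zero_mem _
  | succ n =>
    refine D.mul_mem_mixed hs fun a b => ?_
    rw [← mul_assoc, ← map_mul]
    exact D.iota_mul_xi_mem _ _

theorem mixed_mul_xi (c : D.KLR n) {s : D.KLR (n + 1)} (hs : s ∈ D.mixed n) :
    s * D.xi n c ∈ D.mixed n := by
  cases n with
  | zero => rw [AddSubgroup.mem_bot.mp hs, zero_mul]; exact zero_mem _
  | succ n =>
    refine D.mem_mixed_mul hs fun a b => ?_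
    rw [mul_assoc, ← map_mul]
    exact D.iota_mul_xi_mem _ _

/-- The last variable commutes with the factor `ι(a)` and lies in the image of `ξ`, so the second
factor absorbs it. The idempotents `e(n,i)` are absorbed in the same way, and `x_0` and `e(i,n)` are
absorbed by the first factor from the right. -/
theorem x_last_mul_mixed {s : D.KLR (n + 1)} (hs : s ∈ D.mixed n) :
    D.x (Fin.last n) * s ∈ D.mixed n := by
  cases n with
  | zero => rw [AddSubgroup.mem_bot.mp hs, mul_zero]; exact zero_mem _
  | succ n =>
    refine D.mul_mem_mixed hs fun a b => ?_
    rw [← mul_assoc, ← (D.iota_x_last a).eq, mul_assoc, x_last_eq_xi, ← map_mul]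
    exact D.iota_mul_xi_mem _ _

theorem eLast_mul_mixed (i : I) {s : D.KLR (n + 1)} (hs : s ∈ D.mixed n) :
    D.eLast n i * s ∈ D.mixed n := by
  cases n with
  | zero => rw [AddSubgroup.mem_bot.mp hs, mul_zero]; exact zero_mem _
  | succ n =>
    refine D.mul_mem_mixed hs fun a b => ?_
    rw [← mul_assoc, ← (D.iota_eLast a i).eq, mul_assoc, eLast_eq_xi, ← map_mul]
    exact D.iota_mul_xi_mem _ _

theorem mixed_mul_x_zero {s : D.KLR (n + 1)} (hs : s ∈ D.mixed n) : s * D.x 0 ∈ D.mixed n := by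
  cases n with
  | zero => rw [AddSubgroup.mem_bot.mp hs, zero_mul]; exact zero_mem _
  | succ n =>
    refine D.mem_mixed_mul hs fun a b => ?_
    rw [mul_assoc, (D.xi_x_zero b).eq, ← mul_assoc, x_zero_eq_iota, ← map_mul]
    exact D.iota_mul_xi_mem _ _

theorem mixed_mul_eFirst (i : I) {s : D.KLR (n + 1)} (hs : s ∈ D.mixed n) :
    s * D.eFirst n i ∈ D.mixed n := by
  cases n with
  | zero => rw [AddSubgroup.mem_bot.mp hs, zero_mul]; exact zero_mem _
  | succ n =>
    refine D.mem_mixed_mul hs fun a b => ?_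
    rw [mul_assoc, (D.xi_eFirst b i).eq, ← mul_assoc, eFirst_eq_iota, ← map_mul]
    exact D.iota_mul_xi_mem _ _

theorem evalLast_mul_mixed (f : Polynomial (D.KLR n)) {s : D.KLR (n + 1)} (hs : s ∈ D.mixed n) :
    D.evalLast n f * s ∈ D.mixed n := by
  induction f using Polynomial.induction_on' with
  | add f g hf hg => rw [map_add, add_mul]; exact add_mem hf hg
  | monomial p r =>
    rw [evalLast_monomial, mul_assoc]
    refine D.iota_mul_mixed r ?_
    induction p with
    | zero => rwa [pow_zero, one_mul]
    | succ p ih => rw [pow_succ', mul_assoc]; exact D.x_last_mul_mixed ih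

theorem theta_mul_mixed (f : I → Polynomial (D.KLR n)) {s : D.KLR (n + 1)} (hs : s ∈ D.mixed n) :
    D.theta n f * s ∈ D.mixed n := by
  rw [theta_apply, Finset.sum_mul]
  refine sum_mem fun i _ => ?_
  rw [mul_assoc]
  exact D.evalLast_mul_mixed _ (D.eLast_mul_mixed i hs)

theorem e_eq_iota (ν : Fin (n + 1) → I) :
    D.e ν = D.iota n (D.e fun p : Fin n => ν p.castSucc) * D.eLast n (ν (Fin.last n)) := by
  refine D.ext_e' fun μ => ?_
  have h1 : D.iota n (D.e fun p : Fin n => ν p.castSucc)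
      = D.eSum (fun μ : Fin (n + 1) → I => (fun p : Fin n => μ p.castSucc) = fun p : Fin n => ν p.castSucc) := by
    rw [← D.iota_eSum (fun μ : Fin n → I => μ = fun p : Fin n => ν (Fin.castSucc p))]
    simp [eSum, Finset.filter_eq']
  rw [h1, eLast, eSum_mul_eSum, eSum_mul_e, e_mul]
  have : ν = μ ↔ ((fun p : Fin n => μ p.castSucc) = fun p : Fin n => ν p.castSucc)
      ∧ μ (Fin.last n) = ν (Fin.last n) := by
    constructor
    · rintro rfl; exact ⟨rfl, rfl⟩
    · rintro ⟨h2, h3⟩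
      funext p
      induction p using Fin.lastCases with
      | last => exact h3.symm
      | cast p => exact (congrFun h2 p).symm
  simp only [← this]
  split_ifs with h
  · rw [h]
  · rfl

theorem e_eq_xi (ν : Fin (n + 1) → I) :
    D.e ν = D.eFirst n (ν 0) * D.xi n (D.e fun p => ν p.succ) := by
  refine D.ext_e' fun μ => ?_
  have h1 : D.xi n (D.e fun p : Fin n => ν p.succ)
      = D.eSum (fun μ : Fin (n + 1) → I => (fun p : Fin n => μ p.succ) = fun p : Fin n => ν p.succ) := by
    rw [← D.xi_eSum (fun μ : Fin n → I => μ = fun p : Fin n => ν (Fin.succ p))]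
    simp [eSum, Finset.filter_eq']
  rw [h1, eFirst, eSum_mul_eSum, eSum_mul_e, e_mul]
  have : ν = μ ↔ μ 0 = ν 0 ∧ ((fun p : Fin n => μ p.succ) = fun p : Fin n => ν p.succ) := by
    constructor
    · rintro rfl; exact ⟨rfl, rfl⟩
    · rintro ⟨h2, h3⟩
      funext p
      induction p using Fin.cases with
      | zero => exact h2.symm
      | succ p => exact (congrFun h3 p).symm
  simp only [← this]
  split_ifs with h
  · rw [h]
  · rfl

theorem e_cons (i : I) (μ : Fin n → I) :
    D.e (Fin.cons i μ : Fin (n + 1) → I) = D.eFirst n i * D.xi n (D.e μ) :=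
  D.e_eq_xi _

theorem e_mul_mixed (ν : Fin (n + 1) → I) {s : D.KLR (n + 1)} (hs : s ∈ D.mixed n) :
    D.e ν * s ∈ D.mixed n := by
  rw [e_eq_iota, mul_assoc]
  exact D.iota_mul_mixed _ (D.eLast_mul_mixed _ hs)

theorem x_mul_mixed (p : Fin (n + 1)) {s : D.KLR (n + 1)} (hs : s ∈ D.mixed n) :
    D.x p * s ∈ D.mixed n := by
  induction p using Fin.lastCases with
  | last => exact D.x_last_mul_mixed hs
  | cast p => rw [← iota_x]; exact D.iota_mul_mixed _ hs

theorem mixed_mul_x (p : Fin (n + 1)) {s : D.KLR (n + 1)} (hs : s ∈ D.mixed n) :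
    s * D.x p ∈ D.mixed n := by
  induction p using Fin.cases with
  | zero => exact D.mixed_mul_x_zero hs
  | succ p => rw [← xi_x]; exact D.mixed_mul_xi _ hs

theorem list_prod_mem {A : Type u} [Ring A] {G : AddSubgroup A} (L : List A)
    (hL : ∀ y ∈ L, ∀ s ∈ G, y * s ∈ G) {s : A} (hs : s ∈ G) : L.prod * s ∈ G := by
  induction L with
  | nil => rwa [List.prod_nil, one_mul]
  | cons y L ih =>
    rw [List.prod_cons, mul_assoc]
    exact hL y (by simp) _ (ih fun z hz => hL z (by simp [hz]))

theorem list_prod_mem' {A : Type u} [Ring A] {G : AddSubgroup A} (L : List A)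
    (hL : ∀ y ∈ L, ∀ s ∈ G, s * y ∈ G) {s : A} (hs : s ∈ G) : s * L.prod ∈ G := by
  induction L generalizing s with
  | nil => rwa [List.prod_nil, mul_one]
  | cons y L ih =>
    rw [List.prod_cons, ← mul_assoc]
    exact ih (fun z hz => hL z (by simp [hz])) (hL y (by simp) _ hs)

theorem ncEval_mul_mixed {r : ℕ} (P : MvPolynomial (Fin r) k) (pos : Fin r → Fin (n + 1))
    {s : D.KLR (n + 1)} (hs : s ∈ D.mixed n) :
    ncEval P (fun a => D.x (pos a)) * s ∈ D.mixed n := by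
  rw [ncEval, Finset.sum_mul]
  refine sum_mem fun m _ => ?_
  rw [Algebra.smul_def, ← (D.iota n).commutes, mul_assoc]
  refine D.iota_mul_mixed _ (list_prod_mem _ ?_ hs)
  intro y hy s hs
  obtain ⟨a, _, rfl⟩ := List.mem_map.mp hy
  generalize m a = e
  induction e with
  | zero => rwa [pow_zero, one_mul]
  | succ e ih => rw [pow_succ', mul_assoc]; exact D.x_mul_mixed _ ih

theorem mixed_mul_ncEval {r : ℕ} (P : MvPolynomial (Fin r) k) (pos : Fin r → Fin (n + 1))
    {s : D.KLR (n + 1)} (hs : s ∈ D.mixed n) :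
    s * ncEval P (fun a => D.x (pos a)) ∈ D.mixed n := by
  rw [ncEval, Finset.mul_sum]
  refine sum_mem fun m _ => ?_
  rw [Algebra.smul_def, ← (D.iota n).commutes, ← mul_assoc, (D.iota n).commutes,
    ← Algebra.commutes, ← (D.iota n).commutes]
  refine list_prod_mem' _ ?_ (D.iota_mul_mixed _ hs)
  intro y hy s hs
  obtain ⟨a, _, rfl⟩ := List.mem_map.mp hy
  generalize m a = e
  induction e with
  | zero => rwa [pow_zero, mul_one]
  | succ e ih => rw [pow_succ, ← mul_assoc]; exact D.mixed_mul_x _ ih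

/-- The defining relations hold after multiplication by a single `e(ν)`; inserting `1 = ∑ e(ν)`
allows them to be used one at a time. -/
theorem mem_mixed_of_mul_e {z s : D.KLR (n + 1)} (h : ∀ ν, z * D.e ν * s ∈ D.mixed n) :
    z * s ∈ D.mixed n := by
  have : z * s = ∑ ν, z * D.e ν * s := by
    rw [← Finset.sum_mul, ← Finset.mul_sum, e_sum, mul_one]
  rw [this]
  exact sum_mem fun ν _ => h ν

/-! ### Commutation relations modulo `mixed` -/

/-- For `s = ι(a) ξ(b)` the crossing passes through `ι(ι(a))` and is then a crossing in the image of
`ξ`, so it joins the second factor. -/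
theorem tau_iota_mixed {s : D.KLR (n + 1)} (hs : s ∈ D.mixed n) :
    D.tau n (by omega) * D.iota (n + 1) s ∈ D.mixed (n + 1) := by
  cases n with
  | zero => rw [AddSubgroup.mem_bot.mp hs, map_zero, mul_zero]; exact zero_mem _
  | succ n =>
    induction hs using AddSubgroup.closure_induction with
    | mem r hr =>
      obtain ⟨a, b, rfl⟩ := hr
      rw [map_mul, ← mul_assoc, (D.tau_iota_iota a).eq, iota_xi, mul_assoc,
        ← D.xi_tau n (by omega), ← map_mul]
      exact D.iota_mul_xi_mem _ _
    | zero => rw [map_zero, mul_zero]; exact zero_mem _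
    | add x y _ _ hx hy => rw [map_add, mul_add]; exact add_mem hx hy
    | neg x _ hx => rw [map_neg, mul_neg]; exact neg_mem hx

/-- The correction is a polynomial in the `x_p` times `e(ν) ι(c)`, and `mixed` is stable under left
multiplication by such polynomials. -/
theorem tau_x_left_iota (c : D.KLR (n + 1)) :
    (D.tau n (by omega) * D.x (Fin.last n).castSucc - D.x (Fin.last (n + 1)) * D.tau n (by omega))
      * D.iota (n + 1) c ∈ D.mixed (n + 1) := by
  refine D.mem_mixed_of_mul_e fun ν => ?_
  by_cases hν : ν ⟨n, by omega⟩ = ν ⟨n + 1, by omega⟩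
  · have h := D.klrMk_rel (Rel.tau_x_left (D := D) n (by omega) ν hν)
    simp only [map_mul, map_sub, map_neg, klrMk_ncEval2, klrMk_fe, klrMk_fx, klrMk_ft] at h
    change (D.tau n _ * D.x ⟨n, _⟩ - D.x ⟨n + 1, _⟩ * D.tau n _) * D.e ν * _ ∈ _
    rw [h, neg_mul, mul_assoc]
    exact neg_mem (D.ncEval_mul_mixed _ _ (D.e_mul_mixed _ (D.iota_mem _)))
  · have h := D.klrMk_rel (Rel.tau_x_other (D := D) n (by omega) ⟨n, by omega⟩ ν
      (fun h => hν h.2))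
    simp only [map_mul, map_sub, map_zero, klrMk_fe, klrMk_fx, klrMk_ft, adj_self] at h
    change (D.tau n _ * D.x ⟨n, _⟩ - D.x ⟨n + 1, _⟩ * D.tau n _) * D.e ν * _ ∈ _
    rw [h, zero_mul]
    exact zero_mem _

theorem tau_x_right_iota (c : D.KLR (n + 1)) :
    (D.tau n (by omega) * D.x (Fin.last (n + 1)) - D.x (Fin.last n).castSucc * D.tau n (by omega))
      * D.iota (n + 1) c ∈ D.mixed (n + 1) := by
  refine D.mem_mixed_of_mul_e fun ν => ?_
  by_cases hν : ν ⟨n, by omega⟩ = ν ⟨n + 1, by omega⟩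
  · have h := D.klrMk_rel (Rel.tau_x_right (D := D) n (by omega) ν hν)
    simp only [map_mul, map_sub, klrMk_ncEval2, klrMk_fe, klrMk_fx, klrMk_ft] at h
    change (D.tau n _ * D.x ⟨n + 1, _⟩ - D.x ⟨n, _⟩ * D.tau n _) * D.e ν * _ ∈ _
    rw [h, mul_assoc]
    exact D.ncEval_mul_mixed _ _ (D.e_mul_mixed _ (D.iota_mem _))
  · have h := D.klrMk_rel (Rel.tau_x_other (D := D) n (by omega) ⟨n + 1, by omega⟩ ν
      (fun h => hν h.2))
    simp only [map_mul, map_sub, map_zero, klrMk_fe, klrMk_fx, klrMk_ft, adj_succ] at h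
    change (D.tau n _ * D.x ⟨n + 1, _⟩ - D.x ⟨n, _⟩ * D.tau n _) * D.e ν * _ ∈ _
    rw [h, zero_mul]
    exact zero_mem _

/-- The corrections contain at most one crossing. The crossing `τ_n` belongs to the image of `ι`;
`τ_{n+1}` commutes with `ι(ι(c))` and belongs to the image of `ξ`. -/
theorem braid_iota_iota (c : D.KLR (n + 1)) :
    (D.tau (n + 1) (by omega) * D.tau n (by omega) * D.tau (n + 1) (by omega)
      - D.tau n (by omega) * D.tau (n + 1) (by omega) * D.tau n (by omega))
      * D.iota (n + 2) (D.iota (n + 1) c) ∈ D.mixed (n + 2) := by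
  refine D.mem_mixed_of_mul_e fun ν => ?_
  by_cases hν : ν ⟨n, by omega⟩ = ν ⟨n + 2, by omega⟩
  · by_cases hν' : ν ⟨n, by omega⟩ = ν ⟨n + 1, by omega⟩
    · have h := D.klrMk_rel (Rel.braid_P (D := D) n (by omega) ν hν hν')
      simp only [map_mul, map_sub, map_add, klrMk_ncEval3, klrMk_fe, klrMk_ft] at h
      rw [h, add_mul, mul_assoc, mul_assoc, mul_assoc, mul_assoc]
      refine add_mem (D.ncEval_mul_mixed _ _ ?_) (D.ncEval_mul_mixed _ _ ?_)
      · rw [← D.iota_tau n (by omega)]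
        exact D.iota_mul_mixed _ (D.e_mul_mixed _ (D.iota_mem _))
      · rw [← mul_assoc, tau_e, mul_assoc, (D.tau_iota_iota c).eq, ← D.xi_tau n (by omega)]
        exact D.e_mul_mixed _ (D.iota_mul_xi_mem _ _)
    · have h := D.klrMk_rel (Rel.braid_Q (D := D) n (by omega) ν hν hν')
      simp only [map_mul, map_sub, klrMk_ncEval2, klrMk_ncEval3, klrMk_fe, klrMk_ft] at h
      rw [h, mul_assoc, mul_assoc]
      exact D.ncEval_mul_mixed _ _ (D.ncEval_mul_mixed _ _ (D.e_mul_mixed _ (D.iota_mem _)))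
  · have h := D.klrMk_rel (Rel.braid_zero (D := D) n (by omega) ν hν)
    simp only [map_mul, map_sub, map_zero, klrMk_fe, klrMk_ft] at h
    rw [h, zero_mul]
    exact zero_mem _

theorem tauDesc_e (i : I) (μ : Fin n → I) :
    D.tauDesc n * D.e (Fin.cons i μ : Fin (n + 1) → I)
      = D.e (Fin.snoc μ i : Fin (n + 1) → I) * D.tauDesc n := by
  induction n with
  | zero =>
    rw [tauDesc_zero, one_mul, mul_one]
    congr 1
    funext p
    obtain rfl : p = 0 := Fin.ext (by omega)
    rfl
  | succ n ih =>
    obtain ⟨j, ρ, rfl⟩ : ∃ j ρ, μ = Fin.cons j ρ := ⟨μ 0, fun p => μ p.succ, (Fin.cons_self_tail μ).symm⟩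
    have h1 : (Fin.cons i (Fin.cons j ρ : Fin (n + 1) → I) : Fin (n + 2) → I) ∘ adj 0 (by omega)
        = Fin.cons j (Fin.cons i ρ : Fin (n + 1) → I) := by
      funext p
      induction p using Fin.cases with
      | zero =>
        rw [Function.comp_apply, show adj 0 (by omega) (0 : Fin (n + 2)) = 1 from adj_self 0 _]
        rfl
      | succ p =>
        induction p using Fin.cases with
        | zero =>
          rw [Function.comp_apply,
            show adj 0 (by omega) (Fin.succ 0 : Fin (n + 2)) = 0 from adj_succ 0 _]
          rfl
        | succ p =>
          rw [Function.comp_apply, adj_of_ne 0 (by omega) (by simp) (by simp)]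
          rfl
    rw [tauDesc_succ, mul_assoc, tau_e, h1, ← mul_assoc, D.e_cons j,
      ← mul_assoc, (D.xi_eFirst _ _).eq, mul_assoc (D.eFirst _ _), ← map_mul, ih, map_mul,
      ← mul_assoc, ← mul_assoc, ← e_cons, Fin.cons_snoc_eq_snoc_cons]

theorem tauDesc_eSum (S T : (Fin (n + 1) → I) → Prop) [DecidablePred S] [DecidablePred T]
    (h : ∀ i (μ : Fin n → I), S (Fin.cons i μ) ↔ T (Fin.snoc μ i)) :
    D.tauDesc n * D.eSum S = D.eSum T * D.tauDesc n := by
  refine D.ext_e' fun ν => ?_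
  obtain ⟨i, μ, rfl⟩ : ∃ i μ, ν = Fin.cons i μ :=
    ⟨ν 0, fun p => ν p.succ, (Fin.cons_self_tail ν).symm⟩
  rw [mul_assoc, mul_assoc, eSum_mul_e, tauDesc_e, ← mul_assoc, eSum_mul_e]
  by_cases hS : S (Fin.cons i μ)
  · rw [if_pos hS, if_pos ((h i μ).mp hS), tauDesc_e]
  · rw [if_neg hS, if_neg (fun hT => hS ((h i μ).mpr hT)), zero_mul, mul_zero]

theorem tauDesc_eFirst (i : I) : D.tauDesc n * D.eFirst n i = D.eLast n i * D.tauDesc n :=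
  D.tauDesc_eSum _ _ fun j μ => by rw [Fin.cons_zero, Fin.snoc_last]

theorem tauDesc_xi_eSum (S : (Fin n → I) → Prop) [DecidablePred S] :
    D.tauDesc n * D.xi n (D.eSum S) = D.iota n (D.eSum S) * D.tauDesc n := by
  rw [xi_eSum, iota_eSum]
  exact D.tauDesc_eSum _ _ fun j μ => by simp only [Fin.cons_succ, Fin.snoc_castSucc]

theorem eSum_eq_e (ν : Fin n → I) : D.eSum (fun ν' => ν' = ν) = D.e ν := by
  simp [eSum, Finset.filter_eq']

/-- Sliding `a` through the strand that runs from first to last costs only terms with fewer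
crossings. By induction on `n` this holds for the elements coming from `R(n)`; the two new
generators, the last `x` and the last `τ`, are governed by `tau_x_right_iota` and `braid_iota_iota`.
This congruence is what makes `φ` right linear. -/
theorem tauDesc_mul_xi (n : ℕ) (a : D.KLR n) :
    D.tauDesc n * D.xi n a - D.iota n a * D.tauDesc n ∈ D.mixed n := by
  induction n with
  | zero =>
    induction a using D.klr_induction with
    | hs c =>
      rw [AlgHom.commutes, AlgHom.commutes, Algebra.commutes, sub_self]; exact zero_mem _
    | he ν => rw [← eSum_eq_e, tauDesc_xi_eSum, sub_self]; exact zero_mem _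
    | hx p => exact p.elim0
    | ht l h => omega
    | hadd a b ha hb =>
      rw [map_add, map_add, mul_add, add_mul, add_sub_add_comm]; exact add_mem ha hb
    | hmul a b ha hb =>
      -- A Leibniz identity: the defect of `a * b` is the defect of `a` times `ξ(b)` plus `ι(a)`
      -- times the defect of `b`.
      have h1 := D.mixed_mul_xi b ha
      have h2 := D.iota_mul_mixed a hb
      rw [map_mul, map_mul]
      convert add_mem h1 h2 using 1
      noncomm_ring
  | succ n ih =>
    have hι : ∀ a : D.KLR n, D.tauDesc (n + 1) * D.xi (n + 1) (D.iota n a)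
        - D.iota (n + 1) (D.iota n a) * D.tauDesc (n + 1) ∈ D.mixed (n + 1) := by
      intro a
      have h := D.tau_iota_mixed (ih a)
      rw [map_sub, map_mul, map_mul, mul_sub, ← mul_assoc, ← mul_assoc, (D.tau_iota_iota a).eq,
        mul_assoc (D.iota _ (D.iota _ a)), ← tauDesc_succ', iota_xi] at h
      exact h
    induction a using D.klr_induction with
    | hs c =>
      rw [AlgHom.commutes, AlgHom.commutes, Algebra.commutes, sub_self]; exact zero_mem _
    | he ν => rw [← eSum_eq_e, tauDesc_xi_eSum, sub_self]; exact zero_mem _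
    | hx p =>
      induction p using Fin.lastCases with
      | last =>
        have h := D.tau_x_right_iota (D.tauDesc n)
        rw [xi_x, iota_x, tauDesc_succ', mul_assoc, Fin.succ_last, (D.iota_x_last _).eq]
        rwa [sub_mul, mul_assoc, mul_assoc] at h
      | cast p => rw [← iota_x]; exact hι _
    | ht l h =>
      -- Either the crossing already lies in `R(n)`, or it is the last one and the braid relation is
      -- required.
      by_cases hl : l + 1 < n
      · rw [← D.iota_tau l hl]; exact hι _
      · obtain rfl : l + 1 = n := by omega
        have h := D.braid_iota_iota (D.tauDesc l)
        rw [xi_tau, iota_tau, tauDesc_succ', tauDesc_succ', map_mul, D.iota_tau l (by omega)]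
        convert h using 1
        have hc := (D.tau_iota_iota (D.tauDesc l)).eq
        rw [sub_mul]
        congr 1
        · rw [mul_assoc, mul_assoc, mul_assoc, mul_assoc]
          congr 2
          exact (D.tau_iota_iota (D.tauDesc l)).eq.symm
        · simp only [mul_assoc]
    | hadd a b ha hb =>
      rw [map_add, map_add, mul_add, add_mul, add_sub_add_comm]; exact add_mem ha hb
    | hmul a b ha hb =>
      have h1 := D.mixed_mul_xi b ha
      have h2 := D.iota_mul_mixed a hb
      rw [map_mul, map_mul]
      convert add_mem h1 h2 using 1
      noncomm_ring

/-- The dot slides along the long strand: the leftmost crossing carries the inductive defect into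
`mixed`, and its own correction is that of `tau_x_left_iota`. -/
theorem tauDesc_mul_x_zero (n : ℕ) :
    D.tauDesc n * D.x 0 - D.x (Fin.last n) * D.tauDesc n ∈ D.mixed n := by
  induction n with
  | zero =>
    rw [tauDesc_zero, one_mul, mul_one]
    simp
  | succ n ih =>
    have h := add_mem (D.tau_iota_mixed ih) (D.tau_x_left_iota (D.tauDesc n))
    convert h using 1
    rw [tauDesc_succ', map_sub, map_mul, map_mul, iota_x, iota_x, Fin.castSucc_zero]
    noncomm_ring

end Spanning

end KLRDatum

end GKM

end

/-! ### Straightening, the basis theorem and the map `φ`. -/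

noncomputable section

set_option linter.unusedSectionVars false

namespace GKM

namespace KLRDatum

section Spanned

variable {k I : Type u} [CommRing k] {𝓀 : ℕ → AddSubgroup k} (D : KLRDatum 𝓀 I)
variable [Fintype I] [DecidableEq I] {n : ℕ}

/-- The elements of `R(n + 1)` of the form `θ(f) τ_{n-1} ⋯ τ_0 + s`, where `s ∈ mixed`. -/
def spanned (n : ℕ) : AddSubgroup (D.KLR (n + 1)) where
  carrier := {r | ∃ f, r - D.theta n f * D.tauDesc n ∈ D.mixed n}
  zero_mem' := ⟨0, by rw [map_zero, zero_mul, sub_zero]; exact zero_mem _⟩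
  add_mem' := by
    rintro a b ⟨f, hf⟩ ⟨g, hg⟩
    refine ⟨f + g, ?_⟩
    rw [map_add, add_mul, add_sub_add_comm]
    exact add_mem hf hg
  neg_mem' := by
    rintro a ⟨f, hf⟩
    refine ⟨-f, ?_⟩
    rw [map_neg, neg_mul, neg_sub_neg, ← neg_sub]
    exact neg_mem hf

theorem mixed_le_spanned : D.mixed n ≤ D.spanned n := fun r hr =>
  ⟨0, by rwa [map_zero, zero_mul, sub_zero]⟩

theorem theta_tauDesc_mem (f : I → Polynomial (D.KLR n)) :
    D.theta n f * D.tauDesc n ∈ D.spanned n :=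
  ⟨f, by rw [sub_self]; exact zero_mem _⟩

theorem theta_mul_spanned (f : I → Polynomial (D.KLR n)) {r : D.KLR (n + 1)}
    (hr : r ∈ D.spanned n) : D.theta n f * r ∈ D.spanned n := by
  obtain ⟨g, hg⟩ := hr
  refine ⟨f * g, ?_⟩
  rw [theta_mul, mul_assoc, ← mul_sub]
  exact D.theta_mul_mixed f hg

/-- Stability under right multiplication need only be tested on the longest element and on `mixed`,
because `θ` acts on the set from the left. -/
theorem spanned_mul {z : D.KLR (n + 1)} (h1 : D.tauDesc n * z ∈ D.spanned n)
    (h2 : ∀ s ∈ D.mixed n, s * z ∈ D.spanned n) {r : D.KLR (n + 1)} (hr : r ∈ D.spanned n) :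
    r * z ∈ D.spanned n := by
  obtain ⟨f, hf⟩ := hr
  have := add_mem (h2 _ hf) (D.theta_mul_spanned f h1)
  rwa [sub_mul, mul_assoc, sub_add_cancel] at this

theorem spanned_mul_xi (a : D.KLR n) {r : D.KLR (n + 1)} (hr : r ∈ D.spanned n) :
    r * D.xi n a ∈ D.spanned n := by
  refine D.spanned_mul ⟨fun _ => Polynomial.C a, ?_⟩
    (fun s hs => D.mixed_le_spanned (D.mixed_mul_xi a hs)) hr
  rw [theta_C]
  exact D.tauDesc_mul_xi n a

theorem spanned_mul_x_zero {r : D.KLR (n + 1)} (hr : r ∈ D.spanned n) :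
    r * D.x 0 ∈ D.spanned n := by
  refine D.spanned_mul ⟨fun _ => Polynomial.X, ?_⟩
    (fun s hs => D.mixed_le_spanned (D.mixed_mul_x_zero hs)) hr
  rw [theta_X]
  exact D.tauDesc_mul_x_zero n

theorem spanned_mul_eFirst (i : I) {r : D.KLR (n + 1)} (hr : r ∈ D.spanned n) :
    r * D.eFirst n i ∈ D.spanned n := by
  refine D.spanned_mul ⟨Pi.single i 1, ?_⟩
    (fun s hs => D.mixed_le_spanned (D.mixed_mul_eFirst i hs)) hr
  rw [theta_single_one, tauDesc_eFirst, sub_self]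
  exact zero_mem _

theorem spanned_mul_e (ν : Fin (n + 1) → I) {r : D.KLR (n + 1)} (hr : r ∈ D.spanned n) :
    r * D.e ν ∈ D.spanned n := by
  rw [e_eq_xi, ← mul_assoc]
  exact D.spanned_mul_xi _ (D.spanned_mul_eFirst _ hr)

theorem xi_evalLast (f : Polynomial (D.KLR n)) :
    D.xi (n + 1) (D.evalLast n f) = D.evalLast (n + 1) (f.map (D.xi n).toRingHom) := by
  induction f using Polynomial.induction_on' with
  | add f g hf hg => simp only [map_add, Polynomial.map_add, hf, hg]
  | monomial p r =>
    rw [Polynomial.map_monomial, evalLast_monomial, evalLast_monomial, map_mul, map_pow, xi_x,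
      ← iota_xi]
    rfl

theorem xi_theta (f : I → Polynomial (D.KLR n)) :
    D.xi (n + 1) (D.theta n f) = D.theta (n + 1) fun i => (f i).map (D.xi n).toRingHom := by
  simp only [theta_apply, map_sum, map_mul, xi_evalLast, ← eLast_eq_xi]

/-- Straighten `b` in the smaller algebra. Its leading part followed by `τ_0` becomes the next
longest element, since `ξ(τ_{n-1} ⋯ τ_0) τ_0` is `τ_n ⋯ τ_0`. In the remainder `τ_0` commutes with
`ξ(ξ(d))` and is absorbed into the image of `ι`. -/
theorem iota_xi_tau_mem (h : ∀ b : D.KLR (n + 1), b ∈ D.spanned n) (a b : D.KLR (n + 1)) :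
    D.iota (n + 1) a * D.xi (n + 1) b * D.tau 0 (by omega) ∈ D.spanned (n + 1) := by
  obtain ⟨f, hf⟩ := h b
  have h1 : ∀ s ∈ D.mixed n,
      D.iota (n + 1) a * D.xi (n + 1) s * D.tau 0 (by omega) ∈ D.mixed (n + 1) := by
    intro s hs
    cases n with
    | zero => rw [AddSubgroup.mem_bot.mp hs, map_zero, mul_zero, zero_mul]; exact zero_mem _
    | succ n =>
      induction hs using AddSubgroup.closure_induction with
      | mem r hr =>
        obtain ⟨c, d, rfl⟩ := hr
        rw [map_mul, mul_assoc, mul_assoc, ← (D.tau_xi_xi d).eq, ← iota_xi,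
          ← D.iota_tau 0 (by omega), ← mul_assoc, ← mul_assoc, ← map_mul, ← map_mul]
        exact D.iota_mul_xi_mem _ _
      | zero => rw [map_zero, mul_zero, zero_mul]; exact zero_mem _
      | add x y _ _ hx hy => rw [map_add, mul_add, add_mul]; exact add_mem hx hy
      | neg x _ hx => rw [map_neg, mul_neg, neg_mul]; exact neg_mem hx
  have h2 := add_mem (D.mixed_le_spanned (h1 _ hf)) (D.theta_tauDesc_mem
    ((fun _ => Polynomial.C a) * fun i => (f i).map (D.xi n).toRingHom))
  rw [theta_mul, ← xi_theta, theta_C, tauDesc_succ] at h2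
  convert h2 using 1
  rw [map_sub, map_mul]
  noncomm_ring

/-- On `mixed` this is the preceding lemma. On the longest element a factor `τ_0²` appears, and the
quadratic relation lowers it to at most one `τ_0` preceded by an element of `mixed`. -/
theorem spanned_mul_tau_zero (h : ∀ b : D.KLR (n + 1), b ∈ D.spanned n)
    {r : D.KLR (n + 1 + 1)} (hr : r ∈ D.spanned (n + 1)) :
    r * D.tau 0 (by omega) ∈ D.spanned (n + 1) := by
  have h1 : ∀ s ∈ D.mixed (n + 1), s * D.tau 0 (by omega) ∈ D.spanned (n + 1) := by
    intro s hs
    induction hs using AddSubgroup.closure_induction with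
    | mem r hr =>
      obtain ⟨a, b, rfl⟩ := hr
      exact D.iota_xi_tau_mem h a b
    | zero => rw [zero_mul]; exact zero_mem _
    | add x y _ _ hx hy => rw [add_mul]; exact add_mem hx hy
    | neg x _ hx => rw [neg_mul]; exact neg_mem hx
  refine D.spanned_mul ?_ h1 hr
  rw [tauDesc_succ]
  have h2 : D.xi (n + 1) (D.tauDesc n) * D.tau 0 (by omega) * D.tau 0 (by omega)
      = ∑ ν, D.xi (n + 1) (D.tauDesc n) * D.tau 0 (by omega) * D.tau 0 (by omega) * D.e ν := by
    rw [← Finset.mul_sum, e_sum, mul_one]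
  rw [h2]
  refine sum_mem fun ν _ => ?_
  rw [mul_assoc, mul_assoc]
  by_cases hν : ν ⟨0, by omega⟩ = ν ⟨1, by omega⟩
  · have h := D.klrMk_rel (Rel.tau_sq_eq (D := D) 0 (by omega) ν hν)
    simp only [map_mul, klrMk_ncEval2, klrMk_fe, klrMk_ft] at h
    rw [mul_assoc] at h
    rw [h, ← mul_assoc, ← mul_assoc]
    exact D.spanned_mul_e ν (h1 _ (D.mixed_mul_ncEval _ _ (D.xi_mem _)))
  · have h := D.klrMk_rel (Rel.tau_sq_ne (D := D) 0 (by omega) ν hν)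
    simp only [map_mul, klrMk_ncEval2, klrMk_fe, klrMk_ft] at h
    rw [mul_assoc] at h
    rw [h, ← mul_assoc]
    exact D.spanned_mul_e ν (D.mixed_le_spanned (D.mixed_mul_ncEval _ _ (D.xi_mem _)))

theorem one_mem_spanned : (1 : D.KLR (n + 1)) ∈ D.spanned n := by
  cases n with
  | zero =>
    have := D.theta_tauDesc_mem (n := 0) 1
    rwa [theta_one, tauDesc_zero, mul_one] at this
  | succ n =>
    refine D.mixed_le_spanned ?_
    have := D.iota_mem (n := n) 1
    rwa [map_one] at this

theorem mem_spanned (n : ℕ) (r : D.KLR (n + 1)) : r ∈ D.spanned n := by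
  have main : ∀ n, (∀ (h : 0 + 1 < n + 1) (r : D.KLR (n + 1)), r ∈ D.spanned n →
      r * D.tau 0 h ∈ D.spanned n) → ∀ r : D.KLR (n + 1), r ∈ D.spanned n := by
    intro n hτ r
    -- Formulated for an arbitrary left factor, the property passes to products of generators.
    suffices ∀ z ∈ D.spanned n, z * r ∈ D.spanned n by
      have := this 1 D.one_mem_spanned
      rwa [one_mul] at this
    induction r using D.klr_induction with
    | hs c =>
      intro z hz
      rw [← (D.xi n).commutes]
      exact D.spanned_mul_xi _ hz
    | he ν => exact fun z hz => D.spanned_mul_e ν hz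
    | hx p =>
      intro z hz
      induction p using Fin.cases with
      | zero => exact D.spanned_mul_x_zero hz
      | succ p => rw [← xi_x]; exact D.spanned_mul_xi _ hz
    | ht l h =>
      intro z hz
      cases l with
      | zero => exact hτ h z hz
      | succ l => rw [← D.xi_tau l (by omega)]; exact D.spanned_mul_xi _ hz
    | hmul a b ha hb => exact fun z hz => by rw [← mul_assoc]; exact hb _ (ha _ hz)
    | hadd a b ha hb => exact fun z hz => by rw [mul_add]; exact add_mem (ha _ hz) (hb _ hz)
  induction n with
  | zero => exact main 0 (fun h => absurd h (by omega)) r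
  | succ n ih => exact main (n + 1) (fun h r hr => D.spanned_mul_tau_zero ih hr) r

/-! ### The basis theorem -/

theorem psi_cons (f : I → Polynomial (D.KLR (n + 1)))
    (c : Fin (n + 1) → I → Polynomial (D.KLR (n + 1))) :
    D.psi (n + 1) (Fin.cons f c) = D.theta (n + 1) f * D.tauDesc (n + 1)
      + ∑ a, D.theta (n + 1) (c a) * D.xi (n + 1) (D.tauFrom n a) := by
  rw [psi_apply, Fin.sum_univ_succ, Fin.cons_zero, tauFrom_zero]
  rfl

/-- `ξ` raises the index of a basis element by one, while `ι(a)` and `ξ(θ(f))` are values of `θ`. A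
product `ι(a) ξ(b)` therefore has no component at index 0, the index of the longest element. -/
theorem iota_mul_xi_psi (a : D.KLR (n + 1)) (c : Fin (n + 1) → I → Polynomial (D.KLR n)) :
    D.iota (n + 1) a * D.xi (n + 1) (D.psi n c) = D.psi (n + 1) (Fin.cons 0
      fun b i => Polynomial.C a * (c b i).map (D.xi n).toRingHom) := by
  rw [psi_cons, map_zero, zero_mul, zero_add, psi_apply, map_sum, Finset.mul_sum]
  refine Finset.sum_congr rfl fun b _ => ?_
  rw [map_mul, xi_theta, ← mul_assoc, ← theta_C, ← theta_mul]
  rfl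

/-- The hypothesis is the inductive one, vacuous for `n = 0`, where `mixed` is zero. -/
theorem exists_psi_of_mem_mixed (h : 0 < n → Function.Surjective (D.psi (n - 1)))
    {s : D.KLR (n + 1)} (hs : s ∈ D.mixed n) : ∃ c, c 0 = 0 ∧ D.psi n c = s := by
  cases n with
  | zero => exact ⟨0, rfl, by rw [map_zero, AddSubgroup.mem_bot.mp hs]⟩
  | succ n =>
    induction hs using AddSubgroup.closure_induction with
    | mem r hr =>
      obtain ⟨a, b, rfl⟩ := hr
      obtain ⟨c, rfl⟩ := h (by omega) b
      exact ⟨_, rfl, (D.iota_mul_xi_psi a c).symm⟩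
    | zero => exact ⟨0, rfl, map_zero _⟩
    | add x y _ _ hx hy =>
      obtain ⟨c, hc, rfl⟩ := hx
      obtain ⟨d, hd, rfl⟩ := hy
      exact ⟨c + d, by rw [Pi.add_apply, hc, hd, add_zero], map_add _ _ _⟩
    | neg x _ hx =>
      obtain ⟨c, hc, rfl⟩ := hx
      exact ⟨-c, by rw [Pi.neg_apply, hc, neg_zero], map_neg _ _⟩

theorem psi_single_zero (f : I → Polynomial (D.KLR n)) :
    D.psi n (Pi.single 0 f) = D.theta n f * D.tauDesc n := by
  rw [psi_apply, Finset.sum_eq_single 0, Pi.single_eq_same, tauFrom_zero]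
  · intro a _ ha
    rw [Pi.single_eq_of_ne ha, map_zero, zero_mul]
  · simp

theorem psi_surjective (n : ℕ) : Function.Surjective (D.psi n) := by
  have main : ∀ n, (0 < n → Function.Surjective (D.psi (n - 1))) →
      Function.Surjective (D.psi n) := by
    intro n h r
    obtain ⟨f, hf⟩ := D.mem_spanned n r
    obtain ⟨c, -, hc⟩ := D.exists_psi_of_mem_mixed h hf
    exact ⟨c + Pi.single 0 f, by rw [map_add, hc, psi_single_zero, sub_add_cancel]⟩
  induction n with
  | zero => exact main 0 (fun h => absurd h (by omega))
  | succ n ih => exact main (n + 1) fun _ => ih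

theorem exists_algebraMap_eq (r : D.KLR 0) : ∃ c : k, algebraMap k _ c = r := by
  induction r using D.klr_induction with
  | hs c => exact ⟨c, rfl⟩
  | he ν =>
    refine ⟨1, ?_⟩
    rw [map_one, ← e_sum, Fintype.sum_subsingleton _ ν]
  | hx p => exact p.elim0
  | ht l h => exact absurd h (by omega)
  | hmul a b ha hb =>
    obtain ⟨c, rfl⟩ := ha
    obtain ⟨d, rfl⟩ := hb
    exact ⟨c * d, map_mul _ _ _⟩
  | hadd a b ha hb =>
    obtain ⟨c, rfl⟩ := ha
    obtain ⟨d, rfl⟩ := hb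
    exact ⟨c + d, map_add _ _ _⟩

/-- `L` need not be a domain: `FractionRing` inverts the non-zero-divisors, among which are the
monic polynomials. -/
theorem monic_isUnit_algebraMap (L : Type u) [CommRing L] (f : Polynomial L) (hf : f.Monic) :
    IsUnit (algebraMap (Polynomial L) (FractionRing (Polynomial L)) f) :=
  IsLocalization.map_units (M := nonZeroDivisors (Polynomial L)) _
    ⟨f, hf.mem_nonZeroDivisors⟩

theorem psi_injective_of_rep (L : Type u) [CommRing L] [Algebra k L]
    (hf : ∀ r : D.KLR n, D.rep L n r = 0 → r = 0) (c : Fin (n + 1) → I → Polynomial (D.KLR n))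
    (hc : D.rep (FractionRing (Polynomial L)) (n + 1) (D.psi n c) = 0) : c = 0 := by
  refine D.psi_eq_zero_of_rep
    (j := IsScalarTower.toAlgHom k (Polynomial L) (FractionRing (Polynomial L)))
    (hu := monic_isUnit_algebraMap L) (IsFractionRing.injective _ _) hf c fun i F s => ?_
  rw [hc]
  rfl

/-- Induction on `n`, passing from `L` to the fractions of `L[X]`. Surjectivity of `psi` writes an
element acting by zero as `psi c`, and the triangularity argument then gives `c = 0`. -/
theorem exists_faithful (n : ℕ) : ∃ (L : Type u) (_ : CommRing L) (_ : Algebra k L),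
    ∀ r : D.KLR n, D.rep L n r = 0 → r = 0 := by
  induction n with
  | zero =>
    refine ⟨k, inferInstance, inferInstance, fun r hr => ?_⟩
    obtain ⟨c, rfl⟩ := D.exists_algebraMap_eq r
    rw [AlgHom.commutes] at hr
    -- `R(0)` consists of scalars; the constant function 1 at the empty configuration recovers the
    -- scalar.
    have h1 := congrFun (LinearMap.congr_fun hr 1) ⟨fun p => p.elim0, fun p => p.elim0⟩
    have h2 : c * 1 = 0 := h1
    rw [← mul_one c, h2, map_zero]
  | succ n ih =>
    obtain ⟨L, _, _, hL⟩ := ih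
    refine ⟨FractionRing (Polynomial L), inferInstance, inferInstance, fun r hr => ?_⟩
    obtain ⟨c, rfl⟩ := D.psi_surjective n r
    rw [D.psi_injective_of_rep L hL c hr, map_zero]

theorem psi_injective (n : ℕ) : Function.Injective (D.psi n) := by
  obtain ⟨L, _, _, hL⟩ := D.exists_faithful n
  refine (injective_iff_map_eq_zero _).mpr fun c hc => D.psi_injective_of_rep L hL c ?_
  rw [hc, map_zero]

/-- The isomorphism `c ↦ ∑ a, θ(c_a) τ_{n-1} ⋯ τ_a`. -/
def psiEquiv (n : ℕ) : (Fin (n + 1) → I → Polynomial (D.KLR n)) ≃+ D.KLR (n + 1) :=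
  AddEquiv.ofBijective (D.psi n) ⟨D.psi_injective n, D.psi_surjective n⟩

/-- The coefficient of `τ_{n-1} ⋯ τ_0` in `R(n + 1)`. -/
def tauCoeff (n : ℕ) : D.KLR (n + 1) →+ (I → Polynomial (D.KLR n)) :=
  (Pi.evalAddMonoidHom (fun _ : Fin (n + 1) => I → Polynomial (D.KLR n)) 0).comp
    (D.psiEquiv n).symm.toAddMonoidHom

theorem tauCoeff_psi (c : Fin (n + 1) → I → Polynomial (D.KLR n)) :
    D.tauCoeff n (D.psi n c) = c 0 :=
  congrFun ((D.psiEquiv n).symm_apply_apply c) 0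

theorem tauCoeff_mixed {s : D.KLR (n + 1)} (hs : s ∈ D.mixed n) : D.tauCoeff n s = 0 := by
  obtain ⟨c, hc, rfl⟩ := D.exists_psi_of_mem_mixed (fun _ => D.psi_surjective _) hs
  rw [tauCoeff_psi, hc]

theorem tauCoeff_theta (f : I → Polynomial (D.KLR n)) :
    D.tauCoeff n (D.theta n f * D.tauDesc n) = f := by
  rw [← psi_single_zero, tauCoeff_psi, Pi.single_eq_same]

theorem sub_tauCoeff_mem (r : D.KLR (n + 1)) :
    r - D.theta n (D.tauCoeff n r) * D.tauDesc n ∈ D.mixed n := by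
  obtain ⟨f, hf⟩ := D.mem_spanned n r
  have h := D.tauCoeff_mixed hf
  rw [map_sub, tauCoeff_theta, sub_eq_zero] at h
  rwa [h]

/-- Uniqueness of straightening: properties of `φ` reduce to congruences modulo `mixed`. -/
theorem tauCoeff_eq_of_sub_mem {r : D.KLR (n + 1)} {f : I → Polynomial (D.KLR n)}
    (h : r - D.theta n f * D.tauDesc n ∈ D.mixed n) : D.tauCoeff n r = f := by
  have := D.tauCoeff_mixed h
  rwa [map_sub, tauCoeff_theta, sub_eq_zero] at this

theorem tauCoeff_eq_zero_iff {r : D.KLR (n + 1)} : D.tauCoeff n r = 0 ↔ r ∈ D.mixed n := by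
  refine ⟨fun h => ?_, D.tauCoeff_mixed⟩
  have := D.sub_tauCoeff_mem r
  rwa [h, map_zero, zero_mul, sub_zero] at this

theorem tauCoeff_surjective : Function.Surjective (D.tauCoeff n) :=
  fun f => ⟨_, D.tauCoeff_theta f⟩

theorem tauCoeff_injective_zero : Function.Injective (D.tauCoeff 0) :=
  (injective_iff_map_eq_zero _).mpr fun _ hr =>
    AddSubgroup.mem_bot.mp (D.tauCoeff_eq_zero_iff.mp hr)

theorem tauCoeff_theta_mul (f : I → Polynomial (D.KLR n)) (r : D.KLR (n + 1)) :
    D.tauCoeff n (D.theta n f * r) = f * D.tauCoeff n r := by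
  refine D.tauCoeff_eq_of_sub_mem ?_
  rw [theta_mul, mul_assoc, ← mul_sub]
  exact D.theta_mul_mixed f (D.sub_tauCoeff_mem r)

/-- Write `r ≡ θ(φ(r)) τ_{n-1} ⋯ τ_0`; moving `z` to the left through the longest element turns it
into `θ(g)`. -/
theorem tauCoeff_mul {z : D.KLR (n + 1)} {g : I → Polynomial (D.KLR n)}
    (h1 : D.tauDesc n * z - D.theta n g * D.tauDesc n ∈ D.mixed n)
    (h2 : ∀ s ∈ D.mixed n, s * z ∈ D.mixed n) (r : D.KLR (n + 1)) :
    D.tauCoeff n (r * z) = D.tauCoeff n r * g := by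
  refine D.tauCoeff_eq_of_sub_mem ?_
  have h3 := add_mem (h2 _ (D.sub_tauCoeff_mem r)) (D.theta_mul_mixed (D.tauCoeff n r) h1)
  convert h3 using 1
  rw [theta_mul]
  noncomm_ring

theorem isTauCoeff (n : ℕ) : D.IsTauCoeff (D.tauCoeff n) where
  iota_mul a r i := by rw [← theta_C, tauCoeff_theta_mul, Pi.mul_apply]
  mul_xi r a i := by
    rw [D.tauCoeff_mul (g := fun _ => Polynomial.C a) (by rw [theta_C]; exact D.tauDesc_mul_xi n a)
      (fun s hs => D.mixed_mul_xi a hs), Pi.mul_apply]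
  x_last_mul r i := by rw [← theta_X, tauCoeff_theta_mul, Pi.mul_apply]
  mul_x_first r i := by
    rw [D.tauCoeff_mul (g := fun _ => Polynomial.X)
      (by rw [theta_X]; exact D.tauDesc_mul_x_zero n) (fun s hs => D.mixed_mul_x_zero hs),
      Pi.mul_apply]
  eLast_mul i r := by
    rw [← theta_single_one, tauCoeff_theta_mul]
    funext j
    by_cases h : j = i
    · subst h; simp
    · simp [h]
  mul_eFirst i r := by
    rw [D.tauCoeff_mul (g := Pi.single i 1)
      (by rw [theta_single_one, tauDesc_eFirst, sub_self]; exact zero_mem _)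
      (fun s hs => D.mixed_mul_eFirst i hs)]
    funext j
    by_cases h : j = i
    · subst h; simp
    · simp [h]
  tauDesc := by
    have := D.tauCoeff_theta (n := n) 1
    rwa [theta_one, one_mul] at this

end Spanned

end KLRDatum

end GKM

end

/-! ### Balanced tensor products and the injectivity of `Φ`. -/

noncomputable section

set_option linter.unusedSectionVars false

namespace GKM

section BalTensor

variable {A B X N G : Type u} [Ring A] [AddCommGroup X] [Module A X] [AddCommGroup N]
variable [AddCommGroup G] {rX : X → B → X} {lN : B → N → N}

theorem BalTensor.add_tmul (x y : X) (n : N) :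
    (BalTensor.tmul A (x + y) n : BalTensor A rX lN)
      = BalTensor.tmul A x n + BalTensor.tmul A y n := by
  simp only [BalTensor.tmul, TensorProduct.add_tmul]; rfl

theorem BalTensor.tmul_add (x : X) (n m : N) :
    (BalTensor.tmul A x (n + m) : BalTensor A rX lN)
      = BalTensor.tmul A x n + BalTensor.tmul A x m := by
  simp only [BalTensor.tmul, TensorProduct.tmul_add]; rfl

variable (A rX lN) in
/-- The pure tensors as a biadditive map. -/
def balMk : X →+ N →+ BalTensor A rX lN :=
  AddMonoidHom.mk' (fun x => AddMonoidHom.mk' (fun n => BalTensor.tmul A x n)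
    (BalTensor.tmul_add x)) fun x y => AddMonoidHom.ext (BalTensor.add_tmul x y)

theorem BalTensor.tmul_balanced (x : X) (b : B) (n : N) :
    (BalTensor.tmul A (rX x b) n : BalTensor A rX lN) = BalTensor.tmul A x (lN b n) :=
  (Submodule.Quotient.eq _).mpr (Submodule.subset_span ⟨x, b, n, rfl⟩)

theorem BalTensor.smul_tmul (a : A) (x : X) (n : N) :
    a • (BalTensor.tmul A x n : BalTensor A rX lN) = BalTensor.tmul A (a • x) n := rfl

theorem BalTensor.induction {p : BalTensor A rX lN → Prop} (h0 : p 0)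
    (hadd : ∀ x y, p x → p y → p (x + y)) (ht : ∀ x n, p (BalTensor.tmul A x n))
    (t : BalTensor A rX lN) : p t := by
  obtain ⟨t, rfl⟩ := Submodule.Quotient.mk_surjective _ t
  induction t using TensorProduct.induction_on with
  | zero => exact h0
  | tmul x y => exact ht x y
  | add x y hx hy => exact hadd _ _ hx hy

/-- The additive map out of a balanced tensor product given by a balanced biadditive map. -/
def balLift (hr : ∀ (a : A) (x : X) (b : B), rX (a • x) b = a • rX x b) (f : X →+ N →+ G)
    (hf : ∀ x b n, f (rX x b) n = f x (lN b n)) : BalTensor A rX lN →+ G :=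
  QuotientAddGroup.lift (balSub A rX lN).toAddSubgroup
    (TensorProduct.liftAddHom f fun r m n => by simp) (by
      -- The relations are generated as an `A`-submodule while the map is only additive, so
      -- vanishing is proved for all multiples `a • t` at once.
      have key : ∀ t ∈ balSub A rX lN, ∀ a : A,
          TensorProduct.liftAddHom f (fun (r : ℤ) m n => by simp) (a • t) = 0 := by
        intro t ht
        induction ht using Submodule.span_induction with
        | mem t ht =>
          obtain ⟨x, b, n, rfl⟩ := ht
          intro a
          rw [smul_sub, TensorProduct.smul_tmul', TensorProduct.smul_tmul', map_sub, ← hr,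
            TensorProduct.liftAddHom_tmul, TensorProduct.liftAddHom_tmul, hf, sub_self]
        | zero => simp
        | add x y _ _ hx hy => intro a; rw [smul_add, map_add, hx, hy, add_zero]
        | smul b x _ hx => intro a; rw [smul_smul]; exact hx _
      intro t ht
      have := key t ht 1
      rwa [one_smul] at this)

end BalTensor

namespace KLRDatum

section TensorSq

variable {k I : Type u} [CommRing k] {𝓀 : ℕ → AddSubgroup k} (D : KLRDatum 𝓀 I)
variable [Fintype I] [DecidableEq I] {n : ℕ}

/-- The map `x ⊗ y ↦ ι(x) ξ(y)`. -/
def tsMul (n : ℕ) : D.TensorSq n →+ D.KLR (n + 2) :=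
  balLift (fun a x b => by rw [smul_eq_mul, smul_eq_mul, mul_assoc])
    ((AddMonoidHom.mul.comp (D.iota (n + 1)).toRingHom.toAddMonoidHom).compl₂
      (D.xi (n + 1)).toRingHom.toAddMonoidHom) (by
    intro x b y
    change D.iota (n + 1) (x * D.xi n b) * D.xi (n + 1) y
      = D.iota (n + 1) x * D.xi (n + 1) (D.iota n b * y)
    rw [map_mul, map_mul, iota_xi, mul_assoc])

theorem tsMul_tsMk (x y : D.KLR (n + 1)) :
    D.tsMul n (D.tsMk x y) = D.iota (n + 1) x * D.xi (n + 1) y := rfl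

theorem tsMul_mem (t : D.TensorSq n) : D.tsMul n t ∈ D.mixed (n + 1) := by
  induction t using BalTensor.induction with
  | h0 => rw [map_zero]; exact zero_mem _
  | hadd x y hx hy => rw [map_add]; exact add_mem hx hy
  | ht x y => exact D.iota_mul_xi_mem x y

theorem exists_tsMul {s : D.KLR (n + 2)} (hs : s ∈ D.mixed (n + 1)) : ∃ t, D.tsMul n t = s := by
  induction hs using AddSubgroup.closure_induction with
  | mem r hr => obtain ⟨a, b, rfl⟩ := hr; exact ⟨D.tsMk a b, rfl⟩
  | zero => exact ⟨0, map_zero _⟩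
  | add x y _ _ hx hy =>
    obtain ⟨s, rfl⟩ := hx
    obtain ⟨t, rfl⟩ := hy
    exact ⟨s + t, map_add _ _ _⟩
  | neg x _ hx => obtain ⟨s, rfl⟩ := hx; exact ⟨-s, map_neg _ _⟩

/-- The pure tensors as a biadditive map. -/
def tsBi (n : ℕ) : D.KLR (n + 1) →+ D.KLR (n + 1) →+ D.TensorSq n := balMk _ _ _

theorem tsMk_mul_xi (x y : D.KLR (n + 1)) (b : D.KLR n) :
    D.tsMk (x * D.xi n b) y = D.tsMk x (D.iota n b * y) :=
  BalTensor.tmul_balanced x b y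

/-- The map `c ↦ ∑ c_{a,i,p} ⊗ x_n ^ p e(n, i) τ_{n-1} ⋯ τ_a`. -/
def tsBasis (n : ℕ) : (Fin (n + 1) → I → Polynomial (D.KLR (n + 1))) →+ D.TensorSq n where
  toFun c := ∑ a, ∑ i, (c a i).sum fun p r =>
    D.tsBi n r (D.x (Fin.last n) ^ p * D.eLast n i * D.tauFrom n a)
  map_zero' := by simp
  map_add' c d := by
    simp only [Pi.add_apply, ← Finset.sum_add_distrib]
    refine Finset.sum_congr rfl fun a _ => Finset.sum_congr rfl fun i _ => ?_
    refine Polynomial.sum_add_index _ _ _ (fun p => ?_) (fun p r s => ?_)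
    · rw [map_zero, AddMonoidHom.zero_apply]
    · rw [map_add, AddMonoidHom.add_apply]

theorem tsBasis_apply (c : Fin (n + 1) → I → Polynomial (D.KLR (n + 1))) :
    D.tsBasis n c = ∑ a, ∑ i, (c a i).sum fun p r =>
      D.tsBi n r (D.x (Fin.last n) ^ p * D.eLast n i * D.tauFrom n a) := rfl

theorem tsBasis_single (a : Fin (n + 1)) (i : I) (p : ℕ) (r : D.KLR (n + 1)) :
    D.tsBasis n (Pi.single a (Pi.single i (Polynomial.monomial p r)))
      = D.tsMk r (D.x (Fin.last n) ^ p * D.eLast n i * D.tauFrom n a) := by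
  rw [tsBasis_apply, Finset.sum_eq_single a, Finset.sum_eq_single i, Pi.single_eq_same, Pi.single_eq_same,
    Polynomial.sum_monomial_index]
  · rfl
  · rw [map_zero, AddMonoidHom.zero_apply]
  · intro j _ hj
    rw [Pi.single_eq_same, Pi.single_eq_of_ne hj, Polynomial.sum_zero_index]
  · simp
  · intro b _ hb
    rw [Pi.single_eq_of_ne hb]
    simp
  · simp

/-- Expand the second factor in the basis of `R(n+1)`; each coefficient `ι(r)` then crosses the
tensor sign and becomes `ξ(r)` in the first factor. -/
theorem tsBasis_surjective : Function.Surjective (D.tsBasis n) := by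
  rw [← AddMonoidHom.range_eq_top, eq_top_iff]
  rintro t -
  induction t using BalTensor.induction with
  | h0 => exact zero_mem _
  | hadd x y hx hy => exact add_mem hx hy
  | ht x y =>
    obtain ⟨c, rfl⟩ := D.psi_surjective n y
    have h1 : (BalTensor.tmul _ x (D.psi n c) : D.TensorSq n) = D.tsBi n x (D.psi n c) := rfl
    rw [h1, psi_apply, map_sum]
    refine sum_mem fun a _ => ?_
    rw [theta_apply, Finset.sum_mul, map_sum]
    refine sum_mem fun i _ => ?_
    induction c a i using Polynomial.induction_on' with
    | add f g hf hg => rw [map_add, add_mul, add_mul, map_add]; exact add_mem hf hg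
    | monomial p r =>
      refine ⟨Pi.single a (Pi.single i (Polynomial.monomial p (x * D.xi n r))), ?_⟩
      rw [tsBasis_single, tsMk_mul_xi, evalLast_monomial]
      simp only [mul_assoc]
      rfl

theorem tsMul_tsBasis (c : Fin (n + 1) → I → Polynomial (D.KLR (n + 1))) :
    D.tsMul n (D.tsBasis n c) = D.psi (n + 1) (Fin.cons 0 c) := by
  rw [psi_cons, map_zero, zero_mul, zero_add, tsBasis_apply, map_sum]
  refine Finset.sum_congr rfl fun a _ => ?_
  rw [map_sum, theta_apply, Finset.sum_mul]
  refine Finset.sum_congr rfl fun i _ => ?_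
  induction c a i using Polynomial.induction_on' with
  | add f g hf hg =>
    rw [map_add, add_mul, add_mul, ← hf, ← hg, ← map_add]
    congr 1
    refine Polynomial.sum_add_index _ _ _ (fun p => ?_) (fun p r s => ?_)
    · rw [map_zero, AddMonoidHom.zero_apply]
    · rw [map_add, AddMonoidHom.add_apply]
  | monomial p r =>
    rw [Polynomial.sum_monomial_index, evalLast_monomial]
    · change D.iota (n + 1) r * D.xi (n + 1) _ = _
      rw [map_mul, map_mul, map_pow, ← x_last_eq_xi, ← eLast_eq_xi]
      simp only [mul_assoc]
    · rw [map_zero, AddMonoidHom.zero_apply]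

/-- The generators of the tensor square supplied by `tsBasis` are sent by `Φ` to basis elements of
index at least 1. A relation in the image is thus a relation among basis elements, and the
injectivity of `psi` excludes it. -/
theorem tsMul_injective : Function.Injective (D.tsMul n) := by
  refine (injective_iff_map_eq_zero _).mpr fun t ht => ?_
  obtain ⟨c, rfl⟩ := D.tsBasis_surjective t
  rw [tsMul_tsBasis] at ht
  have h := D.psi_injective (n + 1) (ht.trans (map_zero _).symm)
  have hc : c = 0 := by
    have := congrArg Fin.tail h
    rwa [Fin.tail_cons] at this
  rw [hc, map_zero]

theorem tsMul_exact : Function.Exact (D.tsMul n) (D.tauCoeff (n + 1)) := fun r => by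
  rw [tauCoeff_eq_zero_iff]
  exact ⟨D.exists_tsMul, fun ⟨t, ht⟩ => ht ▸ D.tsMul_mem t⟩

end TensorSq

end KLRDatum

end GKM

end

noncomputable section

set_option linter.unusedSectionVars false

namespace GKM

open GrMod

namespace KLRDatum

section Induction

variable {k I : Type u} [CommRing k] {𝓀 : ℕ → AddSubgroup k} (D : KLRDatum 𝓀 I)
variable [Fintype I] [DecidableEq I] [GradedRing 𝓀] {n : ℕ} {i j : I} {β γ δ ε : I →₀ ℕ}

/-! ### Blocks -/

theorem wt_eq_castSucc (ν : Fin (n + 1) → I) :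
    wt ν = wt (fun p : Fin n => ν p.castSucc) + Finsupp.single (ν (Fin.last n)) 1 :=
  Fin.sum_univ_castSucc _

theorem wt_eq_succ (ν : Fin (n + 1) → I) :
    wt ν = wt (fun p : Fin n => ν p.succ) + Finsupp.single (ν 0) 1 :=
  (Fin.sum_univ_succ _).trans (add_comm _ _)

theorem toBlock_coe (r : D.KLR n) : (D.toBlock n β r).1 = r * D.eBlock n β := by
  change D.eBlock n β * r * D.eBlock n β = _
  rw [← eBlock_comm, mul_assoc, (D.eBlock_idem n β).eq]

theorem toBlock_mul (a b : D.KLR n) :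
    D.toBlock n β (a * b) = D.toBlock n β a * D.toBlock n β b := by
  refine Subtype.ext ?_
  change _ = (D.toBlock n β a).1 * (D.toBlock n β b).1
  rw [toBlock_coe, toBlock_coe, toBlock_coe, mul_assoc a (D.eBlock n β), ← mul_assoc (D.eBlock n β),
    ← eBlock_comm, mul_assoc b, (D.eBlock_idem n β).eq, mul_assoc]

theorem toBlock_one : D.toBlock n β 1 = 1 := by
  refine Subtype.ext ?_
  rw [toBlock_coe, one_mul]
  rfl

theorem toBlock_eBlock : D.toBlock n β (D.eBlock n β) = 1 := by
  refine Subtype.ext ?_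
  rw [toBlock_coe, (D.eBlock_idem n β).eq]
  rfl

/-- Once the first colour is fixed, the weight of the other strands and the weight of the whole
sequence determine each other. -/
theorem xi_eBlock_mul_eFirst (hε : ε = β + Finsupp.single j 1) :
    D.xi n (D.eBlock n β) * D.eFirst n j = D.eBlock (n + 1) ε * D.eFirst n j := by
  rw [eBlock, eBlock, xi_eSum, eFirst, eSum_mul_eSum, eSum_mul_eSum]
  refine D.eSum_congr fun ν => and_congr_left fun h => ?_
  rw [wt_eq_succ ν, h, hε, add_left_inj]

theorem iota_eBlock_mul_eLast (hε : ε = β + Finsupp.single i 1) :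
    D.iota n (D.eBlock n β) * D.eLast n i = D.eBlock (n + 1) ε * D.eLast n i := by
  rw [eBlock, eBlock, iota_eSum, eLast, eSum_mul_eSum, eSum_mul_eSum]
  refine D.eSum_congr fun ν => and_congr_left fun h => ?_
  rw [wt_eq_castSucc ν, h, hε, add_left_inj]

theorem homF_coe (hε : ε = β + Finsupp.single j 1) (b : D.Block n β) :
    (D.homF n j β ε b).1 = D.xi n b.1 * D.eFirst n j := by
  change D.xi n b.1 * _ = _
  rw [← D.eSum_mul_eSum (fun ν => wt ν = ε) (fun ν => ν 0 = j)]
  change D.xi n b.1 * (D.eBlock (n + 1) ε * D.eFirst n j) = _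
  rw [← D.xi_eBlock_mul_eFirst hε, ← mul_assoc, ← map_mul, val_mul_eBlock]

theorem homE_coe (hε : ε = β + Finsupp.single i 1) (b : D.Block n β) :
    (D.homE n i β ε b).1 = D.iota n b.1 * D.eLast n i := by
  change D.iota n b.1 * _ = _
  rw [← D.eSum_mul_eSum (fun ν => wt ν = ε) (fun ν => ν (Fin.last n) = i)]
  change D.iota n b.1 * (D.eBlock (n + 1) ε * D.eLast n i) = _
  rw [← D.iota_eBlock_mul_eLast hε, ← mul_assoc, ← map_mul, val_mul_eBlock]

theorem homE_toBlock (hε : ε = β + Finsupp.single i 1) (r : D.KLR n) :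
    D.homE n i β ε (D.toBlock n β r) = D.toBlock (n + 1) ε (D.iota n r * D.eLast n i) := by
  refine Subtype.ext ?_
  rw [homE_coe D hε, toBlock_coe, toBlock_coe, map_mul, mul_assoc, iota_eBlock_mul_eLast D hε,
    ← eBlock_comm, mul_assoc]

theorem homE_one' (hε : ε = β + Finsupp.single i 1) :
    D.homE n i β ε 1 = D.toBlock (n + 1) ε (D.eLast n i) := by
  rw [← toBlock_one, homE_toBlock D hε, map_one, one_mul]

theorem homE_eq_toBlock (hε : ε = β + Finsupp.single i 1) (b : D.Block n β) :
    D.homE n i β ε b = D.toBlock (n + 1) ε (D.iota n b.1 * D.eLast n i) := by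
  rw [← homE_toBlock D hε, toBlock_val]

theorem homF_toBlock (hε : ε = β + Finsupp.single j 1) (r : D.KLR n) :
    D.homF n j β ε (D.toBlock n β r) = D.toBlock (n + 1) ε (D.xi n r * D.eFirst n j) := by
  refine Subtype.ext ?_
  rw [homF_coe D hε, toBlock_coe, toBlock_coe, map_mul, mul_assoc, xi_eBlock_mul_eFirst D hε,
    ← eBlock_comm, mul_assoc]

theorem homF_one' (hε : ε = β + Finsupp.single j 1) :
    D.homF n j β ε 1 = D.toBlock (n + 1) ε (D.eFirst n j) := by
  rw [← toBlock_one, homF_toBlock D hε, map_one, one_mul]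

theorem eFirst_mul_eFirst (n : ℕ) (i j : I) :
    D.eFirst n i * D.eFirst n j = if i = j then D.eFirst n i else 0 := by
  rw [eFirst, eFirst, eSum_mul_eSum]
  split_ifs with h
  · subst h
    exact D.eSum_congr fun ν => and_self_iff
  · rw [D.eSum_congr (T := fun _ => False) fun ν => ⟨fun h' => h (h'.1.symm.trans h'.2), False.elim⟩]
    simp [eSum]

/-! ### The functor `F̄_j` on generators -/

variable {M : Type u} [AddCommGroup M] [Module (D.Block n β) M]

/-- The element `r e(j, β) ⊗ m` of `F̄_j M`, for `r ∈ R(n + 1)`. -/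
def indBr (n : ℕ) (j : I) (β ε : I →₀ ℕ) (M : Type u) [AddCommGroup M] [Module (D.Block n β) M] :
    D.KLR (n + 1) →+ M →+ IndCarrier (D.homF n j β ε) M :=
  (balMk _ _ _).comp ((indProj (D.homF n j β ε)).comp (D.toBlock (n + 1) ε))

theorem indBr_apply (r : D.KLR (n + 1)) (m : M) : D.indBr n j β ε M r m
    = indTmul (D.homF n j β ε) (indProj (D.homF n j β ε) (D.toBlock (n + 1) ε r)) m := rfl

theorem indProj_toBlock (hε : ε = β + Finsupp.single j 1) (r : D.KLR (n + 1)) :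
    (indProj (D.homF n j β ε) (D.toBlock (n + 1) ε r)).1
      = D.toBlock (n + 1) ε (r * D.eFirst n j) := by
  change D.toBlock (n + 1) ε r * D.homF n j β ε 1 = _
  rw [homF_one' D hε, toBlock_mul]

theorem indIdeal_mul_eFirst (hε : ε = β + Finsupp.single j 1) (x : indIdeal (D.homF n j β ε)) :
    x.1 * D.toBlock (n + 1) ε (D.eFirst n j) = x.1 := by
  have h : x.1 * D.homF n j β ε 1 = x.1 := x.2
  rwa [homF_one' D hε] at h

/-- Every pure tensor is represented by an element of the whole algebra `R(n+1)`, so calculations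
can ignore the corner and the ideal. -/
theorem indTmul_eq_indBr (hε : ε = β + Finsupp.single j 1) (x : indIdeal (D.homF n j β ε))
    (m : M) : indTmul (D.homF n j β ε) x m = D.indBr n j β ε M x.1.1 m := by
  rw [indBr_apply]
  congr 1
  refine Subtype.ext ?_
  rw [indProj_toBlock D hε, toBlock_mul, toBlock_val, indIdeal_mul_eFirst D hε]

theorem indBr_mul_eFirst (hε : ε = β + Finsupp.single j 1) (r : D.KLR (n + 1)) (m : M) :
    D.indBr n j β ε M (r * D.eFirst n j) m = D.indBr n j β ε M r m := by
  rw [indBr_apply, indBr_apply]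
  congr 1
  refine Subtype.ext ?_
  rw [indProj_toBlock D hε, indProj_toBlock D hε, mul_assoc, eFirst_mul_eFirst, if_pos rfl]

theorem indBr_mul_eFirst_of_ne (hε : ε = β + Finsupp.single j 1) (hij : i ≠ j)
    (r : D.KLR (n + 1)) (m : M) : D.indBr n j β ε M (r * D.eFirst n i) m = 0 := by
  rw [← indBr_mul_eFirst D hε, mul_assoc, eFirst_mul_eFirst, if_neg hij, mul_zero, map_zero,
    AddMonoidHom.zero_apply]

theorem indBr_mul_xi (hε : ε = β + Finsupp.single j 1) (r : D.KLR (n + 1)) (b : D.KLR n) (m : M) :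
    D.indBr n j β ε M (r * D.xi n b) m = D.indBr n j β ε M r (D.toBlock n β b • m) := by
  rw [indBr_apply, indBr_apply]
  refine Eq.trans ?_ (BalTensor.tmul_balanced (A := D.Block (n + 1) ε)
    (rX := indRight (D.homF n j β ε)) (lN := fun b (m : M) => b • m) _ (D.toBlock n β b) m)
  congr 1
  refine Subtype.ext ?_
  rw [indProj_toBlock D hε]
  change _ = (indProj (D.homF n j β ε) (D.toBlock (n + 1) ε r)).1
    * D.homF n j β ε (D.toBlock n β b)
  rw [indProj_toBlock D hε, homF_toBlock D hε, ← toBlock_mul]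
  congr 1
  rw [(D.xi_eFirst b j).eq, mul_assoc r (D.eFirst n j), ← mul_assoc (D.eFirst n j),
    eFirst_mul_eFirst, if_pos rfl, ← (D.xi_eFirst b j).eq, mul_assoc]

theorem smul_indBr (r s : D.KLR (n + 1)) (m : M) :
    D.toBlock (n + 1) ε r • D.indBr n j β ε M s m = D.indBr n j β ε M (r * s) m := by
  rw [indBr_apply, indBr_apply, indTmul, indTmul, BalTensor.smul_tmul]
  congr 1
  refine Subtype.ext ?_
  change D.toBlock (n + 1) ε r * (D.toBlock (n + 1) ε s * D.homF n j β ε 1)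
    = D.toBlock (n + 1) ε (r * s) * D.homF n j β ε 1
  rw [toBlock_mul, mul_assoc]

theorem indBr_val_mul (r : D.Block (n + 1) ε) (s : D.KLR (n + 1)) (m : M) :
    r • D.indBr n j β ε M s m = D.indBr n j β ε M (r.1 * s) m := by
  rw [← smul_indBr, toBlock_val]

theorem indBr_one_smul (m : M) (r : D.Block (n + 1) ε) :
    r • D.indBr n j β ε M 1 m = D.indBr n j β ε M r.1 m := by
  rw [indBr_val_mul, mul_one]

theorem indBr_induction (hε : ε = β + Finsupp.single j 1)
    {p : IndCarrier (D.homF n j β ε) M → Prop} (h0 : p 0)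
    (hadd : ∀ x y, p x → p y → p (x + y)) (ht : ∀ r m, p (D.indBr n j β ε M r m))
    (t : IndCarrier (D.homF n j β ε) M) : p t :=
  ind_induction _ h0 hadd (fun a m => by rw [indTmul_eq_indBr D hε]; exact ht _ _) t

variable {G : Type u} [AddCommGroup G]

/-- Additive maps out of `F̄_j M`. -/
def indLift (hε : ε = β + Finsupp.single j 1) (h : D.KLR (n + 1) →+ M →+ G)
    (h1 : ∀ r b m, h (r * D.xi n b) m = h r (D.toBlock n β b • m))
    (h2 : ∀ r m, h (r * D.eFirst n j) m = h r m) :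
    IndCarrier (D.homF n j β ε) M →+ G :=
  balLift (fun a x b => Subtype.ext (mul_assoc a x.1 _))
    (h.comp ((D.blockVal (n + 1) ε).comp (indIdeal (D.homF n j β ε)).toAddSubgroup.subtype)) (by
    intro x b m
    change h (x.1.1 * (D.homF n j β ε b).1) m = h x.1.1 (b • m)
    rw [homF_coe D hε, ← mul_assoc, h2, h1, toBlock_val])

theorem indLift_indBr (hε : ε = β + Finsupp.single j 1) (h : D.KLR (n + 1) →+ M →+ G)
    (h1 : ∀ r b m, h (r * D.xi n b) m = h r (D.toBlock n β b • m))
    (h2 : ∀ r m, h (r * D.eFirst n j) m = h r m) (r : D.KLR (n + 1)) (m : M) :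
    D.indLift hε h h1 h2 (D.indBr n j β ε M r m) = h r m := by
  change h (indProj (D.homF n j β ε) (D.toBlock (n + 1) ε r)).1.1 m = _
  -- The block idempotent is moved through `ξ` onto `m`, where it acts as the identity.
  rw [indProj_toBlock D hε, toBlock_coe, mul_assoc, eBlock_comm, ← xi_eBlock_mul_eFirst D hε,
    ← mul_assoc, h2, h1, toBlock_eBlock, one_smul]

/-! ### The functor `E_i` -/

theorem eLast_smul_resSub (hε : ε = β + Finsupp.single i 1) {M : Type u} [AddCommGroup M]
    [Module (D.Block (n + 1) ε) M] (m : resSub (D.homE n i β ε) M) :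
    D.toBlock (n + 1) ε (D.eLast n i) • m.1 = m.1 := by
  have h : D.homE n i β ε 1 • m.1 = m.1 := m.2
  rwa [homE_one' D hε] at h

theorem toBlock_iota_smul (hε : ε = β + Finsupp.single i 1) {M : Type u} [AddCommGroup M]
    [Module (D.Block (n + 1) ε) M] (b : D.KLR n) (m : resSub (D.homE n i β ε) M) :
    (D.toBlock n β b • m).1 = D.toBlock (n + 1) ε (D.iota n b) • m.1 := by
  change D.homE n i β ε (D.toBlock n β b) • m.1 = _
  rw [homE_toBlock D hε, toBlock_mul, mul_smul, eLast_smul_resSub D hε]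

theorem resProj_val (hε : ε = β + Finsupp.single i 1) {M : Type u} [AddCommGroup M]
    [Module (D.Block (n + 1) ε) M] (m : M) :
    (resProj (D.homE n i β ε) M m).1 = D.toBlock (n + 1) ε (D.eLast n i) • m := by
  rw [← homE_one' D hε]
  rfl

end Induction

end KLRDatum

end GKM

end

noncomputable section

set_option linter.unusedSectionVars false

namespace GKM

open GrMod

namespace KLRDatum

section Splitting

variable {k I : Type u} [CommRing k] {𝓀 : ℕ → AddSubgroup k} (D : KLRDatum 𝓀 I)
variable [Fintype I] [DecidableEq I] {n : ℕ}

/-! ### A right linear section of `φ` -/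

/-- The map `a t_i ^ p ↦ x_n ^ p e(n, i) τ_{n-1} ⋯ τ_0 ξ(a)`. -/
def secOne (n : ℕ) (i : I) : Polynomial (D.KLR n) →+ D.KLR (n + 1) where
  toFun f := f.sum fun p r => D.x (Fin.last n) ^ p * D.eLast n i * D.tauDesc n * D.xi n r
  map_zero' := Polynomial.sum_zero_index _
  map_add' f g := Polynomial.sum_add_index _ _ _ (fun p => by rw [map_zero, mul_zero])
    fun p r s => by rw [map_add, mul_add]

theorem secOne_monomial (i : I) (p : ℕ) (r : D.KLR n) :
    D.secOne n i (Polynomial.monomial p r)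
      = D.x (Fin.last n) ^ p * D.eLast n i * D.tauDesc n * D.xi n r :=
  Polynomial.sum_monomial_index r
    (fun p r => D.x (Fin.last n) ^ p * D.eLast n i * D.tauDesc n * D.xi n r)
    (by rw [map_zero, mul_zero])

theorem tauCoeff_x_pow_mul (p : ℕ) (r : D.KLR (n + 1)) (i : I) :
    D.tauCoeff n (D.x (Fin.last n) ^ p * r) i = Polynomial.X ^ p * D.tauCoeff n r i := by
  induction p with
  | zero => rw [pow_zero, pow_zero, one_mul, one_mul]
  | succ p ih => rw [pow_succ', mul_assoc, (D.isTauCoeff n).x_last_mul, ih, pow_succ', mul_assoc]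

/-- The obvious section `θ(f) τ_{n-1} ⋯ τ_0` has its coefficients on the left. Placing them on the
right as `ξ(r)` yields the same image under `φ`, by right linearity, and makes the section itself
right linear. -/
theorem tauCoeff_secOne (i : I) (f : Polynomial (D.KLR n)) :
    D.tauCoeff n (D.secOne n i f) = Pi.single i f := by
  induction f using Polynomial.induction_on' with
  | add f g hf hg => rw [map_add, map_add, hf, hg, Pi.single_add]
  | monomial p r =>
    funext j
    rw [secOne_monomial, (D.isTauCoeff n).mul_xi, mul_assoc, tauCoeff_x_pow_mul,
      (D.isTauCoeff n).eLast_mul, (D.isTauCoeff n).tauDesc]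
    by_cases h : j = i
    · subst h
      rw [Pi.single_eq_same, Pi.single_eq_same, Pi.one_apply, mul_one, Polynomial.X_pow_mul_C,
        Polynomial.C_mul_X_pow_eq_monomial]
    · rw [Pi.single_eq_of_ne h, Pi.single_eq_of_ne h, mul_zero, zero_mul]

theorem secOne_mul_C (i : I) (f : Polynomial (D.KLR n)) (b : D.KLR n) :
    D.secOne n i (f * Polynomial.C b) = D.secOne n i f * D.xi n b := by
  induction f using Polynomial.induction_on' with
  | add f g hf hg => rw [add_mul, map_add, map_add, hf, hg, add_mul]
  | monomial p r =>
    rw [Polynomial.monomial_mul_C, secOne_monomial, secOne_monomial, map_mul, ← mul_assoc]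

theorem eLast_mul_secOne (i j : I) (f : Polynomial (D.KLR n)) :
    D.eLast n j * D.secOne n i f = if j = i then D.secOne n i f else 0 := by
  induction f using Polynomial.induction_on' with
  | add f g hf hg =>
    rw [map_add, mul_add, hf, hg]
    split_ifs <;> simp
  | monomial p r =>
    have h : D.eLast n j * D.x (Fin.last n) ^ p = D.x (Fin.last n) ^ p * D.eLast n j :=
      (Commute.pow_left (D.x_eSum _ _) p).eq.symm
    rw [secOne_monomial, ← mul_assoc, ← mul_assoc, ← mul_assoc, h, mul_assoc (_ ^ p),
      eLast_mul_eLast]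
    split_ifs with hij
    · rw [hij]
    · simp

theorem secOne_mul_eFirst (i j : I) (f : Polynomial (D.KLR n)) :
    D.secOne n i f * D.eFirst n j = if i = j then D.secOne n i f else 0 := by
  induction f using Polynomial.induction_on' with
  | add f g hf hg =>
    rw [map_add, add_mul, hf, hg]
    split_ifs <;> simp
  | monomial p r =>
    rw [secOne_monomial, mul_assoc, (D.xi_eFirst r j).eq, ← mul_assoc, mul_assoc _ (D.tauDesc n),
      tauDesc_eFirst, ← mul_assoc, mul_assoc _ (D.eLast n i), eLast_mul_eLast]
    split_ifs with hij
    · rfl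
    · simp

/-- The section of `φ` which is linear with respect to the right action of `R(n)`. -/
def tauSec (n : ℕ) : (I → Polynomial (D.KLR n)) →+ D.KLR (n + 1) where
  toFun f := ∑ i, D.secOne n i (f i)
  map_zero' := by simp
  map_add' f g := by simp [Finset.sum_add_distrib]

theorem tauSec_apply (f : I → Polynomial (D.KLR n)) :
    D.tauSec n f = ∑ i, D.secOne n i (f i) := rfl

theorem eLast_mul_tauSec (i : I) (f : I → Polynomial (D.KLR n)) :
    D.eLast n i * D.tauSec n f = D.secOne n i (f i) := by
  rw [tauSec_apply, Finset.mul_sum, Finset.sum_eq_single i]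
  · rw [eLast_mul_secOne, if_pos rfl]
  · intro j _ hj
    rw [eLast_mul_secOne, if_neg hj.symm]
  · simp

theorem tauSec_mul_eFirst (i : I) (f : I → Polynomial (D.KLR n)) :
    D.tauSec n f * D.eFirst n i = D.secOne n i (f i) := by
  rw [tauSec_apply, Finset.sum_mul, Finset.sum_eq_single i]
  · rw [secOne_mul_eFirst, if_pos rfl]
  · intro j _ hj
    rw [secOne_mul_eFirst, if_neg hj]
  · simp

theorem tauSec_single (i : I) (f : Polynomial (D.KLR n)) :
    D.tauSec n (Pi.single i f) = D.secOne n i f := by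
  rw [tauSec_apply, Finset.sum_eq_single i]
  · rw [Pi.single_eq_same]
  · intro j _ hj
    rw [Pi.single_eq_of_ne hj, map_zero]
  · simp

theorem tauCoeff_tauSec (f : I → Polynomial (D.KLR n)) : D.tauCoeff n (D.tauSec n f) = f := by
  rw [tauSec_apply, map_sum]
  simp only [tauCoeff_secOne]
  exact Finset.univ_sum_single f

theorem sub_tauSec_mem (r : D.KLR (n + 1)) : r - D.tauSec n (D.tauCoeff n r) ∈ D.mixed n := by
  rw [← tauCoeff_eq_zero_iff, map_sub, tauCoeff_tauSec, sub_self]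

theorem tauSec_mul_xi (r : D.KLR (n + 1)) (b : D.KLR n) :
    D.tauSec n (D.tauCoeff n (r * D.xi n b)) = D.tauSec n (D.tauCoeff n r) * D.xi n b := by
  rw [tauSec_apply, tauSec_apply, Finset.sum_mul]
  refine Finset.sum_congr rfl fun i _ => ?_
  rw [(D.isTauCoeff n).mul_xi, secOne_mul_C]

theorem tauSec_tauCoeff_mul_eFirst (r : D.KLR (n + 1)) (j : I) :
    D.tauSec n (D.tauCoeff n (r * D.eFirst n j)) = D.tauSec n (D.tauCoeff n r) * D.eFirst n j := by
  rw [(D.isTauCoeff n).mul_eFirst, tauSec_single, tauSec_mul_eFirst]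

/-- The right action of `R(n + 1)` on `R(n + 1) ⊗ R(n + 1)`. -/
def tsRight (b : D.KLR (n + 1)) : D.TensorSq n →+ D.TensorSq n :=
  balLift (fun a x b => by rw [smul_eq_mul, smul_eq_mul, mul_assoc])
    ((D.tsBi n).compl₂ (AddMonoidHom.mulRight b)) fun x c y => by
      change D.tsMk (x * D.xi n c) (y * b) = D.tsMk x (D.iota n c * y * b)
      rw [tsMk_mul_xi, mul_assoc]

theorem tsMul_tsRight (b : D.KLR (n + 1)) (t : D.TensorSq n) :
    D.tsMul n (D.tsRight b t) = D.tsMul n t * D.xi (n + 1) b := by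
  induction t using BalTensor.induction with
  | h0 => rw [map_zero, map_zero, zero_mul]
  | hadd x y hx hy => rw [map_add, map_add, map_add, hx, hy, add_mul]
  | ht x y =>
    change D.iota _ x * D.xi _ (y * b) = D.iota _ x * D.xi _ y * D.xi _ b
    rw [map_mul, mul_assoc]

/-- The map `x ⊗ y ↦ x e(j, n) ⊗ y`. -/
def tsFirst (j : I) : D.TensorSq n →+ D.TensorSq n :=
  balLift (fun a x b => by rw [smul_eq_mul, smul_eq_mul, mul_assoc])
    ((D.tsBi n).comp (AddMonoidHom.mulRight (D.eFirst n j))) fun x c y => by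
      change D.tsMk (x * D.xi n c * D.eFirst n j) y = D.tsMk (x * D.eFirst n j) (D.iota n c * y)
      rw [← tsMk_mul_xi, mul_assoc, mul_assoc, (D.xi_eFirst c j).eq]

theorem tsMul_tsFirst (j : I) (t : D.TensorSq n) :
    D.tsMul n (D.tsFirst j t) = D.tsMul n t * D.eFirst (n + 1) j := by
  induction t using BalTensor.induction with
  | h0 => rw [map_zero, map_zero, zero_mul]
  | hadd x y hx hy => rw [map_add, map_add, map_add, hx, hy, add_mul]
  | ht x y =>
    change D.iota _ (x * D.eFirst n j) * D.xi _ y = D.iota _ x * D.xi _ y * D.eFirst _ j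
    rw [map_mul, mul_assoc, mul_assoc, (D.xi_eFirst y j).eq, eFirst_eq_iota]

/-- Subtracting the section leaves an element of the image of `Φ`. Injectivity of `Φ` makes the
preimage unique, so the chosen preimages depend additively on `r`. -/
theorem exists_retraction (n : ℕ) : ∃ ρ : D.KLR (n + 2) →+ D.TensorSq n,
    ∀ r, D.tsMul n (ρ r) = r - D.tauSec (n + 1) (D.tauCoeff (n + 1) r) := by
  choose ρ hρ using fun r => D.exists_tsMul (D.sub_tauSec_mem (n := n + 1) r)
  refine ⟨AddMonoidHom.mk' ρ fun r s => D.tsMul_injective ?_, hρ⟩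
  rw [map_add, hρ, hρ, hρ, map_add, map_add, add_sub_add_comm]

/-- The retraction `R(n + 2) → R(n + 1) ⊗ R(n + 1)` associated with the section of `φ`. -/
def tsRetr (n : ℕ) : D.KLR (n + 2) →+ D.TensorSq n := (D.exists_retraction n).choose

theorem tsMul_tsRetr (r : D.KLR (n + 2)) :
    D.tsMul n (D.tsRetr n r) = r - D.tauSec (n + 1) (D.tauCoeff (n + 1) r) :=
  (D.exists_retraction n).choose_spec r

/-- The right linearity of the section passes to the retraction because `Φ` is injective and right
linear. It is what allows the splitting to be tensored with a module. -/
theorem tsRetr_mul_xi (r : D.KLR (n + 2)) (b : D.KLR (n + 1)) :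
    D.tsRetr n (r * D.xi (n + 1) b) = D.tsRight b (D.tsRetr n r) := by
  apply D.tsMul_injective
  rw [tsMul_tsRight, tsMul_tsRetr, tsMul_tsRetr, tauSec_mul_xi, sub_mul]

theorem tsRetr_mul_eFirst (r : D.KLR (n + 2)) (j : I) :
    D.tsRetr n (r * D.eFirst (n + 1) j) = D.tsFirst j (D.tsRetr n r) := by
  apply D.tsMul_injective
  rw [tsMul_tsFirst, tsMul_tsRetr, tsMul_tsRetr, tauSec_tauCoeff_mul_eFirst, sub_mul]

theorem tauCoeff_iota (r : D.KLR (n + 1)) : D.tauCoeff (n + 1) (D.iota (n + 1) r) = 0 :=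
  D.tauCoeff_mixed (D.iota_mem r)

theorem tsRetr_iota (r : D.KLR (n + 1)) :
    D.tsRetr n (D.iota (n + 1) r) = D.tsMk r 1 := by
  apply D.tsMul_injective
  rw [tsMul_tsRetr, tauCoeff_iota, map_zero, sub_zero, tsMul_tsMk, map_one, mul_one]

end Splitting

section Maps

variable {k I : Type u} [CommRing k] {𝓀 : ℕ → AddSubgroup k} (D : KLRDatum 𝓀 I)
variable [Fintype I] [DecidableEq I] [GradedRing 𝓀] {n : ℕ} {i j : I} {β γ δ ε : I →₀ ℕ}

theorem toBlock_zero_smul {M : Type u} [AddCommGroup M] [Module (D.Block n β) M] (m : M) :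
    D.toBlock n β 0 • m = 0 := by
  rw [map_zero]
  exact zero_smul (D.Block n β) m

/-! ### The map `g` -/

section Poly

variable {M : Type u} [AddCommGroup M] [Module (D.Block n β) M]

/-- The map `R(n) ⊗ 𝐤[t] × M → M ⊗ 𝐤[t]`. -/
def polyAct (n : ℕ) (β : I →₀ ℕ) (M : Type u) [AddCommGroup M] [Module (D.Block n β) M] :
    Polynomial (D.KLR n) →+ M →+ (ℕ →₀ M) :=
  AddMonoidHom.mk' (fun f => AddMonoidHom.mk' (fun m => Finsupp.onFinset f.support
      (fun p => D.toBlock n β (f.coeff p) • m) fun p h => by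
        rw [Polynomial.mem_support_iff]
        rintro h'
        rw [h'] at h
        exact h (D.toBlock_zero_smul m))
      fun m m' => Finsupp.ext fun p => smul_add _ _ _)
    fun f g => AddMonoidHom.ext fun m => Finsupp.ext fun p => by
      change D.toBlock n β ((f + g).coeff p) • m
        = D.toBlock n β (f.coeff p) • m + D.toBlock n β (g.coeff p) • m
      rw [Polynomial.coeff_add, map_add, add_smul]

theorem polyAct_coe (f : Polynomial (D.KLR n)) (m : M) (p : ℕ) :
    D.polyAct n β M f m p = D.toBlock n β (f.coeff p) • m := rfl

/-- The map `F̄_i M → M ⊗ 𝐤[t_i]` induced by `φ`. -/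
def gMap (hε : ε = β + Finsupp.single i 1) (M : Type u) [AddCommGroup M]
    [Module (D.Block n β) M] : IndCarrier (D.homF n i β ε) M →+ (ℕ →₀ M) :=
  D.indLift hε ((D.polyAct n β M).comp
      ((Pi.evalAddMonoidHom (fun _ : I => Polynomial (D.KLR n)) i).comp (D.tauCoeff n)))
    (fun r b m => Finsupp.ext fun p => by
      change D.toBlock n β ((D.tauCoeff n (r * D.xi n b) i).coeff p) • m
        = D.toBlock n β ((D.tauCoeff n r i).coeff p) • D.toBlock n β b • m
      rw [(D.isTauCoeff n).mul_xi, Polynomial.coeff_mul_C, toBlock_mul, mul_smul])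
    (fun r m => by
      change D.polyAct n β M (D.tauCoeff n (r * D.eFirst n i) i) m
        = D.polyAct n β M (D.tauCoeff n r i) m
      rw [(D.isTauCoeff n).mul_eFirst, Pi.single_eq_same])

theorem gMap_indBr (hε : ε = β + Finsupp.single i 1) (r : D.KLR (n + 1)) (m : M) :
    D.gMap hε M (D.indBr n i β ε M r m) = D.polyAct n β M (D.tauCoeff n r i) m :=
  D.indLift_indBr hε _ _ _ r m

theorem gMap_homE_smul (hε : ε = β + Finsupp.single i 1) (b : D.Block n β)
    (t : IndCarrier (D.homF n i β ε) M) (p : ℕ) :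
    D.gMap hε M (D.homE n i β ε b • t) p = b • D.gMap hε M t p := by
  induction t using D.indBr_induction hε with
  | h0 => rw [smul_zero, map_zero, Finsupp.zero_apply, smul_zero]
  | hadd x y hx hy => rw [smul_add, map_add, map_add, Finsupp.add_apply, hx, hy,
      Finsupp.add_apply, smul_add]
  | ht r m =>
    rw [homE_eq_toBlock D hε, smul_indBr, gMap_indBr, gMap_indBr, polyAct_coe, polyAct_coe,
      mul_assoc, (D.isTauCoeff n).iota_mul, (D.isTauCoeff n).eLast_mul, Pi.single_eq_same,
      Polynomial.coeff_C_mul, toBlock_mul, mul_smul, toBlock_val]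

/-- The map `m ⊗ t_i ^ p ↦ x_n ^ p e(n, i) τ_{n-1} ⋯ τ_0 ⊗ m`. -/
def secMap (i : I) (ε : I →₀ ℕ) (M : Type u) [AddCommGroup M] [Module (D.Block n β) M] :
    (ℕ →₀ M) →+ IndCarrier (D.homF n i β ε) M :=
  Finsupp.liftAddHom fun p =>
    D.indBr n i β ε M (D.x (Fin.last n) ^ p * D.eLast n i * D.tauDesc n)

theorem secMap_single (p : ℕ) (m : M) :
    D.secMap (n := n) (β := β) i ε M (Finsupp.single p m)
    = D.indBr n i β ε M (D.secOne n i (Polynomial.monomial p 1)) m := by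
  rw [secMap, Finsupp.liftAddHom_apply_single, secOne_monomial, map_one, mul_one]

theorem polyAct_monomial (p : ℕ) (r : D.KLR n) (m : M) :
    D.polyAct n β M (Polynomial.monomial p r) m = Finsupp.single p (D.toBlock n β r • m) := by
  refine Finsupp.ext fun q => ?_
  rw [polyAct_coe, Polynomial.coeff_monomial, Finsupp.single_apply]
  split_ifs
  · rfl
  · exact D.toBlock_zero_smul m

theorem secMap_polyAct (hε : ε = β + Finsupp.single i 1) (f : Polynomial (D.KLR n)) (m : M) :
    D.secMap (n := n) (β := β) i ε M (D.polyAct n β M f m) = D.indBr n i β ε M (D.secOne n i f) m := by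
  induction f using Polynomial.induction_on' with
  | add f g hf hg =>
    simp only [map_add, AddMonoidHom.add_apply, hf, hg]
  | monomial p r =>
    rw [polyAct_monomial, secMap_single, ← indBr_mul_xi D hε, ← secOne_mul_C,
      Polynomial.monomial_mul_C, one_mul]

theorem gMap_secMap (hε : ε = β + Finsupp.single i 1) (z : ℕ →₀ M) :
    D.gMap hε M (D.secMap (n := n) i ε M z) = z := by
  induction z using Finsupp.induction_linear with
  | zero => rw [map_zero, map_zero]
  | add f g hf hg => rw [map_add, map_add, hf, hg]
  | single p m =>
    rw [secMap_single, gMap_indBr, tauCoeff_secOne, Pi.single_eq_same, polyAct_monomial,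
      toBlock_one, one_smul]

theorem eLast_smul_secMap (z : ℕ →₀ M) :
    D.toBlock (n + 1) ε (D.eLast n i) • D.secMap (n := n) (β := β) i ε M z
      = D.secMap (n := n) (β := β) i ε M z := by
  induction z using Finsupp.induction_linear with
  | zero => rw [map_zero, smul_zero]
  | add f g hf hg => rw [map_add, smul_add, hf, hg]
  | single p m => rw [secMap_single, smul_indBr, eLast_mul_secOne, if_pos rfl]

/-- Split `r` into the part in the image of `Φ` and the part in the image of the section; on the
latter, `e(n,i)` selects the component of `i`, which is what `secMap` and `gMap` compute. -/
theorem eLast_smul_indBr (hε : ε = β + Finsupp.single i 1) (r : D.KLR (n + 1)) (m : M) :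
    D.toBlock (n + 1) ε (D.eLast n i) • D.indBr n i β ε M r m
      = D.toBlock (n + 1) ε (D.eLast n i) • D.indBr n i β ε M
          (r - D.tauSec n (D.tauCoeff n r)) m
        + D.secMap i ε M (D.gMap hε M (D.indBr n i β ε M r m)) := by
  rw [gMap_indBr, secMap_polyAct D hε, smul_indBr, smul_indBr, mul_sub, eLast_mul_tauSec, map_sub,
    AddMonoidHom.sub_apply, sub_add_cancel]

theorem eBlock_mul_eLast_of_eq_zero (hβ : β i = 0) : D.eBlock (n + 1) β * D.eLast n i = 0 := by
  rw [eBlock, eLast, eSum_mul_eSum, D.eSum_congr (T := fun _ => False)]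
  · simp [eSum]
  · rintro ν
    refine ⟨fun ⟨h1, h2⟩ => ?_, False.elim⟩
    have := DFunLike.congr_fun h1 i
    rw [wt_eq_castSucc, h2, Finsupp.add_apply, Finsupp.single_eq_same, hβ] at this
    omega

theorem toBlock_eLast_of_eq_zero (hβ : β i = 0) : D.toBlock (n + 1) β (D.eLast n i) = 0 := by
  refine Subtype.ext ?_
  rw [toBlock_coe, eBlock_comm, eBlock_mul_eLast_of_eq_zero D hβ]
  rfl

/-- `e(n,i)` passes through `ι(a)`, becomes `ξ` of an idempotent and is transferred to `M`. There it
acts by zero, as no sequence of weight `β` ends in `i`. -/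
theorem eLast_smul_mixed_of_eq_zero (hβ : β i = 0) (hε : ε = β + Finsupp.single i 1)
    {s : D.KLR (n + 1)} (hs : s ∈ D.mixed n) (m : M) :
    D.toBlock (n + 1) ε (D.eLast n i) • D.indBr n i β ε M s m = 0 := by
  cases n with
  | zero => rw [AddSubgroup.mem_bot.mp hs, map_zero, AddMonoidHom.zero_apply, smul_zero]
  | succ n =>
    induction hs using AddSubgroup.closure_induction with
    | mem r hr =>
      obtain ⟨a, b, rfl⟩ := hr
      rw [smul_indBr, ← mul_assoc, ← (D.iota_eLast a i).eq, mul_assoc, eLast_eq_xi, ← map_mul,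
        indBr_mul_xi D hε, toBlock_mul, mul_smul, toBlock_eLast_of_eq_zero D hβ,
        ← (D.toBlock (n + 1) β).map_zero, toBlock_zero_smul, map_zero]
    | zero => rw [map_zero, AddMonoidHom.zero_apply, smul_zero]
    | add x y _ _ hx hy => rw [map_add, AddMonoidHom.add_apply, smul_add, hx, hy, add_zero]
    | neg x _ hx => rw [map_neg, AddMonoidHom.neg_apply, smul_neg, hx, neg_zero]

theorem eLast_smul_of_eq_zero (hβ : β i = 0) (hε : ε = β + Finsupp.single i 1)
    (t : IndCarrier (D.homF n i β ε) M) :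
    D.toBlock (n + 1) ε (D.eLast n i) • t = D.secMap i ε M (D.gMap hε M t) := by
  induction t using D.indBr_induction hε with
  | h0 => rw [smul_zero, map_zero, map_zero]
  | hadd x y hx hy => rw [smul_add, map_add, map_add, hx, hy]
  | ht r m =>
    rw [eLast_smul_indBr D hε, eLast_smul_mixed_of_eq_zero D hβ hε (D.sub_tauSec_mem r), zero_add]

end Poly

/-! ### The map `f` and its retraction -/

variable (hβ : β = γ + Finsupp.single i 1) (hδ : δ = γ + Finsupp.single j 1)
variable (hε : ε = β + Finsupp.single j 1)
variable (M : Type u) [AddCommGroup M] [Module (D.Block (n + 1) β) M]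

/-- The map `F̄_j E_i M → F̄_j M`, `r ⊗ m ↦ ι(r) ⊗ m`. -/
def fMap : IndCarrier (D.homF n j γ δ) (resSub (D.homE n i γ β) M) →+
    IndCarrier (D.homF (n + 1) j β ε) M :=
  D.indLift hδ (((D.indBr (n + 1) j β ε M).comp
      (D.iota (n + 1)).toRingHom.toAddMonoidHom).compl₂ (resSub (D.homE n i γ β) M).subtype)
    (fun r b m => by
      change D.indBr (n + 1) j β ε M (D.iota _ (r * D.xi n b)) m.1
        = D.indBr (n + 1) j β ε M (D.iota _ r) (D.toBlock n γ b • m).1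
      rw [map_mul, iota_xi, indBr_mul_xi D hε, toBlock_iota_smul D hβ])
    (fun r m => by
      change D.indBr (n + 1) j β ε M (D.iota _ (r * D.eFirst n j)) m.1
        = D.indBr (n + 1) j β ε M (D.iota _ r) m.1
      rw [map_mul, ← eFirst_eq_iota, indBr_mul_eFirst D hε])

variable {M}

theorem fMap_indBr (r : D.KLR (n + 1)) (m : resSub (D.homE n i γ β) M) :
    D.fMap hβ hδ hε M (D.indBr n j γ δ _ r m) = D.indBr (n + 1) j β ε M (D.iota (n + 1) r) m.1 :=
  D.indLift_indBr hδ _ _ _ r m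

/-- The map `x ⊗ y, m ↦ x ⊗ e(n, i) y m`. -/
def kapMap (γ δ : I →₀ ℕ) (hβ : β = γ + Finsupp.single i 1) (hδ : δ = γ + Finsupp.single j 1)
    (M : Type u) [AddCommGroup M] [Module (D.Block (n + 1) β) M] :
    D.TensorSq n →+ M →+ IndCarrier (D.homF n j γ δ) (resSub (D.homE n i γ β) M) :=
  balLift (fun a x b => by rw [smul_eq_mul, smul_eq_mul, mul_assoc])
    (AddMonoidHom.mk' (fun x => AddMonoidHom.mk' (fun y => AddMonoidHom.mk'
      (fun m => D.indBr n j γ δ _ x (resProj (D.homE n i γ β) M (D.toBlock (n + 1) β y • m)))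
      fun m m' => by rw [smul_add, map_add, map_add])
      fun y y' => AddMonoidHom.ext fun m => by
        simp only [AddMonoidHom.mk'_apply, AddMonoidHom.add_apply, map_add, add_smul])
      fun x x' => AddMonoidHom.ext fun y => AddMonoidHom.ext fun m => by
        simp only [AddMonoidHom.mk'_apply, AddMonoidHom.add_apply, map_add])
    (fun x b y => AddMonoidHom.ext fun m => by
      change D.indBr n j γ δ _ (x * D.xi n b) (resProj _ M (D.toBlock (n + 1) β y • m))
        = D.indBr n j γ δ _ x (resProj _ M (D.toBlock (n + 1) β (D.iota n b * y) • m))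
      rw [indBr_mul_xi D hδ]
      congr 1
      refine Subtype.ext ?_
      rw [toBlock_iota_smul D hβ, resProj_val D hβ, resProj_val D hβ, ← mul_smul, ← mul_smul,
        ← mul_smul, ← toBlock_mul, ← toBlock_mul, ← toBlock_mul, ← mul_assoc, (D.iota_eLast b i).eq,
        mul_assoc])

theorem kapMap_tsMk (x y : D.KLR (n + 1)) (m : M) : D.kapMap γ δ hβ hδ M (D.tsMk x y) m
    = D.indBr n j γ δ _ x (resProj (D.homE n i γ β) M (D.toBlock (n + 1) β y • m)) := rfl

theorem kapMap_tsRight (b : D.KLR (n + 1)) (t : D.TensorSq n) (m : M) :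
    D.kapMap γ δ hβ hδ M (D.tsRight b t) m
      = D.kapMap γ δ hβ hδ M t (D.toBlock (n + 1) β b • m) := by
  induction t using BalTensor.induction with
  | h0 => simp only [map_zero, AddMonoidHom.zero_apply]
  | hadd x y hx hy => simp only [map_add, AddMonoidHom.add_apply, hx, hy]
  | ht x y =>
    change D.kapMap γ δ hβ hδ M (D.tsMk x (y * b)) m
      = D.kapMap γ δ hβ hδ M (D.tsMk x y) (D.toBlock (n + 1) β b • m)
    rw [kapMap_tsMk, kapMap_tsMk, toBlock_mul, mul_smul]

theorem kapMap_tsFirst (t : D.TensorSq n) (m : M) :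
    D.kapMap γ δ hβ hδ M (D.tsFirst j t) m = D.kapMap γ δ hβ hδ M t m := by
  induction t using BalTensor.induction with
  | h0 => simp only [map_zero, AddMonoidHom.zero_apply]
  | hadd x y hx hy => simp only [map_add, AddMonoidHom.add_apply, hx, hy]
  | ht x y =>
    change D.kapMap γ δ hβ hδ M (D.tsMk (x * D.eFirst n j) y) m
      = D.kapMap γ δ hβ hδ M (D.tsMk x y) m
    rw [kapMap_tsMk, kapMap_tsMk, indBr_mul_eFirst D hδ]

/-- Tensored with `M`, the map `Φ` factors through `F̄_j E_i M` up to the idempotent `e(n,i)`. Hence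
`kapMap` composed with `tsRetr` is the candidate for the inverse. -/
theorem fMap_kapMap (t : D.TensorSq n) (m : M) :
    D.fMap hβ hδ hε M (D.kapMap γ δ hβ hδ M t m)
      = D.indBr (n + 1) j β ε M (D.eLast (n + 1) i * D.tsMul n t) m := by
  induction t using BalTensor.induction with
  | h0 => simp only [map_zero, AddMonoidHom.zero_apply, mul_zero]
  | hadd x y hx hy => simp only [map_add, AddMonoidHom.add_apply, hx, hy, mul_add]
  | ht x y =>
    change D.fMap hβ hδ hε M (D.kapMap γ δ hβ hδ M (D.tsMk x y) m)
      = D.indBr (n + 1) j β ε M (D.eLast (n + 1) i * (D.iota _ x * D.xi _ y)) m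
    rw [kapMap_tsMk, fMap_indBr, resProj_val D hβ, ← mul_smul, ← toBlock_mul, ← indBr_mul_xi D hε,
      map_mul (D.xi (n + 1)), ← eLast_eq_xi, ← mul_assoc, ← mul_assoc, (D.iota_eLast x i).eq]

variable (M) in
/-- The retraction of `F̄_j E_i M → E_i F̄_j M`. -/
def fInv : IndCarrier (D.homF (n + 1) j β ε) M →+
    IndCarrier (D.homF n j γ δ) (resSub (D.homE n i γ β) M) :=
  D.indLift hε ((D.kapMap γ δ hβ hδ M).comp (D.tsRetr n))
    (fun r b m => by
      change D.kapMap γ δ hβ hδ M (D.tsRetr n (r * D.xi (n + 1) b)) m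
        = D.kapMap γ δ hβ hδ M (D.tsRetr n r) (D.toBlock (n + 1) β b • m)
      rw [tsRetr_mul_xi, kapMap_tsRight])
    (fun r m => by
      change D.kapMap γ δ hβ hδ M (D.tsRetr n (r * D.eFirst (n + 1) j)) m
        = D.kapMap γ δ hβ hδ M (D.tsRetr n r) m
      rw [tsRetr_mul_eFirst, kapMap_tsFirst])

theorem fInv_indBr (r : D.KLR (n + 2)) (m : M) :
    D.fInv hβ hδ hε M (D.indBr (n + 1) j β ε M r m)
      = D.kapMap γ δ hβ hδ M (D.tsRetr n r) m :=
  D.indLift_indBr hε _ _ _ r m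

/-- `φ` kills `ι(r)`, so the retraction sends `ι(r)` to `r ⊗ 1`. Injectivity of the first map thus
comes from the splitting and requires no flatness of the bimodules. -/
theorem fInv_fMap (t : IndCarrier (D.homF n j γ δ) (resSub (D.homE n i γ β) M)) :
    D.fInv hβ hδ hε M (D.fMap hβ hδ hε M t) = t := by
  induction t using D.indBr_induction hδ with
  | h0 => rw [map_zero, map_zero]
  | hadd x y hx hy => rw [map_add, map_add, hx, hy]
  | ht r m =>
    rw [fMap_indBr, fInv_indBr, tsRetr_iota, kapMap_tsMk, toBlock_one, one_smul]
    congr 1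
    refine Subtype.ext ?_
    rw [resProj_val D hβ, eLast_smul_resSub D hβ]

theorem fMap_fInv_indBr (r : D.KLR (n + 2)) (m : M) :
    D.fMap hβ hδ hε M (D.fInv hβ hδ hε M (D.indBr (n + 1) j β ε M r m))
      = D.toBlock (n + 2) ε (D.eLast (n + 1) i) • D.indBr (n + 1) j β ε M
        (r - D.tauSec (n + 1) (D.tauCoeff (n + 1) r)) m := by
  rw [fInv_indBr, fMap_kapMap, tsMul_tsRetr, smul_indBr]

/-- After multiplication by `e(n,i)` the section takes values in elements ending in `e(i,n)` on the
right, and these die in `F̄_j M` for `j ≠ i`. -/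
theorem fMap_fInv_of_ne (hij : i ≠ j) (t : IndCarrier (D.homF (n + 1) j β ε) M) :
    D.fMap hβ hδ hε M (D.fInv hβ hδ hε M t) = D.toBlock (n + 2) ε (D.eLast (n + 1) i) • t := by
  induction t using D.indBr_induction hε with
  | h0 => rw [map_zero, map_zero, smul_zero]
  | hadd x y hx hy => rw [map_add, map_add, hx, hy, smul_add]
  | ht r m =>
    rw [fMap_fInv_indBr, map_sub, AddMonoidHom.sub_apply, smul_sub, sub_eq_self, smul_indBr,
      eLast_mul_tauSec]
    have h := D.secOne_mul_eFirst i i (D.tauCoeff (n + 1) r i)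
    rw [if_pos rfl] at h
    rw [← h, indBr_mul_eFirst_of_ne D hε hij]

/-- The splitting of the bimodule sequence, tensored with `M` and cut by `e(n,i)`. Together with
`gMap_fMap` it gives exactness in the middle. -/
theorem fMap_fInv_add (hβ : β = γ + Finsupp.single i 1) (hε : ε = β + Finsupp.single i 1)
    (t : IndCarrier (D.homF (n + 1) i β ε) M) :
    D.fMap hβ hβ hε M (D.fInv hβ hβ hε M t) + D.secMap i ε M (D.gMap hε M t)
      = D.toBlock (n + 2) ε (D.eLast (n + 1) i) • t := by
  induction t using D.indBr_induction hε with
  | h0 => simp only [map_zero, smul_zero, add_zero]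
  | hadd x y hx hy =>
    rw [smul_add, ← hx, ← hy]
    simp only [map_add]
    abel
  | ht r m =>
    rw [fMap_fInv_indBr]
    exact (D.eLast_smul_indBr (n := n + 1) hε r m).symm

theorem gMap_fMap (hβ : β = γ + Finsupp.single i 1) (hε : ε = β + Finsupp.single i 1)
    (t : IndCarrier (D.homF n i γ β) (resSub (D.homE n i γ β) M)) :
    D.gMap hε M (D.fMap hβ hβ hε M t) = 0 := by
  induction t using D.indBr_induction hβ with
  | h0 => rw [map_zero, map_zero]
  | hadd x y hx hy => rw [map_add, map_add, hx, hy, add_zero]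
  | ht r m =>
    rw [fMap_indBr, gMap_indBr, tauCoeff_iota, Pi.zero_apply, map_zero, AddMonoidHom.zero_apply]

theorem fMap_smul (hε' : ε = δ + Finsupp.single i 1) (r : D.Block (n + 1) δ)
    (t : IndCarrier (D.homF n j γ δ) (resSub (D.homE n i γ β) M)) :
    D.fMap hβ hδ hε M (r • t) = D.homE (n + 1) i δ ε r • D.fMap hβ hδ hε M t := by
  induction t using D.indBr_induction hδ with
  | h0 => rw [smul_zero, map_zero, smul_zero]
  | hadd x y hx hy => rw [smul_add, map_add, map_add, hx, hy, smul_add]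
  | ht s m =>
    rw [indBr_val_mul, D.fMap_indBr hβ hδ hε (r.1 * s) m, D.fMap_indBr hβ hδ hε s m,
      homE_eq_toBlock D hε', smul_indBr, mul_assoc, ← (D.iota_eLast s i).eq, ← mul_assoc, ← map_mul, eLast_eq_xi, indBr_mul_xi D hε,
      eLast_smul_resSub D hβ]

theorem eLast_smul_fMap (t : IndCarrier (D.homF n j γ δ) (resSub (D.homE n i γ β) M)) :
    D.toBlock (n + 2) ε (D.eLast (n + 1) i) • D.fMap hβ hδ hε M t = D.fMap hβ hδ hε M t := by
  induction t using D.indBr_induction hδ with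
  | h0 => rw [map_zero, smul_zero]
  | hadd x y hx hy => rw [map_add, smul_add, hx, hy]
  | ht s m =>
    rw [fMap_indBr, smul_indBr, ← (D.iota_eLast s i).eq, eLast_eq_xi, indBr_mul_xi D hε,
      eLast_smul_resSub D hβ]

end Maps

end KLRDatum

end GKM

end

noncomputable section

set_option linter.unusedSectionVars false

namespace GKM

open GrMod

/-! ### Gradings -/

/-- The homogeneous components of an element of the sum of the `H d` lie in the `H d`. A property of
homogeneous elements that cuts out subgroups thus holds for all of them once those having it span.
-/
theorem le_of_iSup_eq_top {M : Type u} [AddCommGroup M] {ℳ H : ℤ → AddSubgroup M}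
    (hM : DirectSum.IsInternal ℳ) (hle : ∀ d, H d ≤ ℳ d) (htop : ∀ m, m ∈ ⨆ d, H d) (d : ℤ) :
    ℳ d ≤ H d := by
  obtain ⟨c, hc⟩ := exists_coaction hM
  have key : ∀ m ∈ ⨆ d, H d, ∀ d, c m d ∈ H d := by
    intro m hm
    induction hm using AddSubgroup.iSup_induction' with
    | hp e m hm =>
      intro d
      rw [hc e m (hle e hm), Finsupp.single_apply]
      split_ifs with h
      · exact h ▸ hm
      · exact zero_mem _
    | h1 => intro d; rw [map_zero]; exact zero_mem _
    | hadd x y _ _ hx hy => intro d; rw [map_add]; exact add_mem (hx d) (hy d)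
  intro m hm
  have := key m (htop m) d
  rwa [hc d m hm, Finsupp.single_eq_same] at this

/-- The inverse preserves degrees: the homogeneous elements with preimage of the same degree span,
since every element is the image of a sum of homogeneous ones. -/
theorem GrMod.isIso_of_bijective {A : Type u} [Ring A] {𝒜 : ℤ → AddSubgroup A} {M N : GrMod 𝒜}
    (f : M ⟶ N) (hf : Function.Bijective (Hom.toLin f)) : CategoryTheory.IsIso f := by
  let e := LinearEquiv.ofBijective (Hom.toLin f) hf
  have he : ∀ m, e.symm (Hom.toLin f m) = m := fun m => e.symm_apply_apply m
  have hdeg : ∀ d, N.gr d ≤ N.gr d ⊓ (M.gr d).comap e.symm.toLinearMap.toAddMonoidHom := by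
    refine le_of_iSup_eq_top N.internal (fun d => inf_le_left) fun n => ?_
    obtain ⟨m, rfl⟩ := hf.2 n
    have hm := mem_iSup_of_isInternal M.internal m
    induction hm using AddSubgroup.iSup_induction' with
    | hp d m hm =>
      refine AddSubgroup.mem_iSup_of_mem d ⟨Hom.map_mem f hm, ?_⟩
      change e.symm (Hom.toLin f m) ∈ M.gr d
      rwa [he]
    | h1 => rw [map_zero]; exact zero_mem _
    | hadd x y _ _ hx hy => rw [map_add]; exact add_mem hx hy
  refine ⟨⟨e.symm.toLinearMap, fun {d n} hn => (hdeg d hn).2⟩, ?_, ?_⟩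
  · exact hom_ext fun m => e.symm_apply_apply m
  · exact hom_ext fun n => e.apply_symm_apply n

/-! ### Degrees of the longest element and of `φ`. -/

namespace KLRDatum

section Degrees

variable {k I : Type u} [CommRing k] {𝓀 : ℕ → AddSubgroup k} (D : KLRDatum 𝓀 I)
variable [Fintype I] [DecidableEq I] [GradedRing 𝓀] {n : ℕ}

theorem e_snoc (i : I) (μ : Fin n → I) :
    D.e (Fin.snoc μ i : Fin (n + 1) → I) = D.iota n (D.e μ) * D.eLast n i := by
  rw [e_eq_iota]
  simp only [Fin.snoc_castSucc, Fin.snoc_last]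

theorem mul_mem_gr {a b : D.KLR n} {s t : ℤ} (ha : a ∈ D.gr n s) (hb : b ∈ D.gr n t) :
    a * b ∈ D.gr n (s + t) := IsHomog.mul ha hb

/-- The strand of colour `i` crosses every other strand exactly once, and the degrees of these
crossings add up. -/
theorem tauDesc_e_mem (i : I) (μ : Fin n → I) :
    D.tauDesc n * D.e (Fin.cons i μ : Fin (n + 1) → I)
      ∈ D.gr (n + 1) (∑ q, -(D.d i * D.a i (μ q))) := by
  induction n with
  | zero =>
    rw [tauDesc_zero, one_mul, Fin.sum_univ_zero]
    exact IsHomog.e _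
  | succ n ih =>
    obtain ⟨μ, j, rfl⟩ : ∃ (ρ : Fin n → I) (j : I), μ = Fin.snoc ρ j :=
      ⟨_, _, (Fin.snoc_init_self μ).symm⟩
    have h1 : D.tauDesc n * D.e (Fin.cons i μ : Fin (n + 1) → I)
        = D.e (Fin.snoc μ i : Fin (n + 1) → I)
          * (D.tauDesc n * D.e (Fin.cons i μ : Fin (n + 1) → I)) := by
      rw [← mul_assoc, ← tauDesc_e, mul_assoc, D.e_idem]
    -- The leftmost crossing is separated together with the idempotent it meets, so that both
    -- factors are visibly homogeneous.
    have h2 : D.tauDesc (n + 1) * D.e (Fin.cons i (Fin.snoc μ j : Fin (n + 1) → I) : Fin (n + 2) → I)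
        = D.tau n (by omega) * D.e (Fin.snoc (Fin.snoc μ i : Fin (n + 1) → I) j : Fin (n + 2) → I)
          * D.iota (n + 1) (D.tauDesc n * D.e (Fin.cons i μ : Fin (n + 1) → I)) := by
      rw [Fin.cons_snoc_eq_snoc_cons, e_snoc, tauDesc_succ', mul_assoc, ← mul_assoc (D.iota _ _),
        ← map_mul]
      conv_lhs => rw [h1]
      rw [map_mul, mul_assoc (D.iota _ _), (D.iota_eLast (_ * _) j).eq, ← mul_assoc (D.iota _ _),
        ← e_snoc, mul_assoc]
    rw [h2, Fin.sum_univ_castSucc, add_comm (Finset.sum _ _)]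
    refine D.mul_mem_gr ?_ (D.emb_mem_gr _ ?_)
    · have h := IsHomog.tau (D := D) n (by omega)
        (Fin.snoc (Fin.snoc μ i : Fin (n + 1) → I) j : Fin (n + 2) → I)
      have e1 : (Fin.snoc (Fin.snoc μ i : Fin (n + 1) → I) j : Fin (n + 2) → I) ⟨n, by omega⟩ = i :=
        (Fin.snoc_castSucc (α := fun _ => I) j (Fin.snoc μ i) (Fin.last n)).trans
          (Fin.snoc_last (α := fun _ => I) i μ)
      have e2 : (Fin.snoc (Fin.snoc μ i : Fin (n + 1) → I) j : Fin (n + 2) → I) ⟨n + 1, by omega⟩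
          = j := Fin.snoc_last (α := fun _ => I) j (Fin.snoc μ i)
      rw [degTau, e1, e2] at h
      rw [Fin.snoc_last]
      exact h
    · simp only [Fin.snoc_castSucc]
      exact ih μ

theorem x_pow_e_mem (p : Fin n) (ν : Fin n → I) (q : ℕ) :
    D.x p ^ q * D.e ν ∈ D.gr n (2 * D.d (ν p) * q) := by
  induction q with
  | zero =>
    rw [pow_zero, one_mul, Nat.cast_zero, mul_zero]
    exact IsHomog.e ν
  | succ q ih =>
    have h : D.x p ^ (q + 1) * D.e ν = (D.x p * D.e ν) * (D.x p ^ q * D.e ν) := by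
      have hc : D.x p ^ q * D.e ν = D.e ν * D.x p ^ q := by
        have := Commute.pow_left (D.x_eSum p fun ν' => ν' = ν) q
        rwa [eSum_eq_e] at this
      rw [mul_assoc, hc, ← mul_assoc (D.e ν), D.e_idem, ← hc, pow_succ', mul_assoc]
    rw [h, Nat.cast_succ, mul_add, mul_one, add_comm]
    exact D.mul_mem_gr (IsHomog.x p ν) ih

theorem sum_comp_eq_wt_sum (f : I → ℤ) (μ : Fin n → I) :
    ∑ q, f (μ q) = (wt μ).sum fun j m => (m : ℤ) * f j := by
  rw [wt, ← Finsupp.sum_finsetSum_index]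
  · simp
  · simp
  · intro j a b; push_cast; ring

theorem eBlock_mul_e (β : I →₀ ℕ) (ν : Fin n → I) :
    D.eBlock n β * D.e ν = if wt ν = β then D.e ν else 0 := by
  rw [eBlock, eSum_mul_e]

/-- The coefficient of `t_i ^ p` in `φ(r)`, projected to `R(β)`. -/
def tauCoeffBlock (n : ℕ) (i : I) (β : I →₀ ℕ) (p : ℕ) : D.KLR (n + 1) →+ D.Block n β :=
  (D.toBlock n β).comp ((Polynomial.lcoeff (D.KLR n) p).toAddMonoidHom.comp
    ((Pi.evalAddMonoidHom (fun _ : I => Polynomial (D.KLR n)) i).comp (D.tauCoeff n)))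

theorem tauCoeffBlock_apply (i : I) (β : I →₀ ℕ) (p : ℕ) (r : D.KLR (n + 1)) :
    D.tauCoeffBlock n i β p r = D.toBlock n β ((D.tauCoeff n r i).coeff p) := rfl

theorem toBlock_mem {β : I →₀ ℕ} {r : D.KLR n} {d : ℤ} (hr : r ∈ D.gr n d) :
    D.toBlock n β r ∈ D.blockGr n β d := by
  change (D.toBlock n β r).1 ∈ D.gr n d
  rw [toBlock_coe]
  have := D.mul_mem_gr hr (D.eSum_isHomog (fun ν : Fin n → I => wt ν = β))
  rwa [add_zero] at this

/-- The elements of degree `d` whose image under `φ` has the expected degree. -/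
def goodGr (n : ℕ) (i : I) (β : I →₀ ℕ) (d : ℤ) : AddSubgroup (D.KLR (n + 1)) :=
  D.gr (n + 1) d ⊓ ⨅ p : ℕ, (D.blockGr n β
    (d + (β.sum fun j m => m * (D.d i * D.a i j)) - 2 * D.d i * p)).comap (D.tauCoeffBlock n i β p)

theorem mem_goodGr {i : I} {β : I →₀ ℕ} {d : ℤ} {r : D.KLR (n + 1)} :
    r ∈ D.goodGr n i β d ↔ r ∈ D.gr (n + 1) d ∧ ∀ p : ℕ, D.tauCoeffBlock n i β p r ∈ D.blockGr n β
      (d + (β.sum fun j m => m * (D.d i * D.a i j)) - 2 * D.d i * p) := by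
  rw [goodGr, AddSubgroup.mem_inf, AddSubgroup.mem_iInf]
  rfl

theorem mixed_le_iSup_goodGr (i : I) (β : I →₀ ℕ) {s : D.KLR (n + 1)} (hs : s ∈ D.mixed n) :
    s ∈ ⨆ d, D.goodGr n i β d := by
  cases n with
  | zero => rw [AddSubgroup.mem_bot.mp hs]; exact zero_mem _
  | succ n =>
    refine AddSubgroup.closure_le _ |>.mpr ?_ hs
    rintro _ ⟨a, b, rfl⟩
    have ha := D.mem_iSup_gr a
    have hb := D.mem_iSup_gr b
    induction ha using AddSubgroup.iSup_induction' with
    | h1 => rw [map_zero, zero_mul]; exact zero_mem _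
    | hadd x y _ _ hx hy => rw [map_add, add_mul]; exact add_mem hx hy
    | hp d a ha =>
      induction hb using AddSubgroup.iSup_induction' with
      | h1 => rw [map_zero, mul_zero]; exact zero_mem _
      | hadd x y _ _ hx hy => rw [map_add, mul_add]; exact add_mem hx hy
      | hp e b hb =>
        refine AddSubgroup.mem_iSup_of_mem (d + e) (D.mem_goodGr.mpr
          ⟨D.mul_mem_gr (D.emb_mem_gr _ ha) (D.emb_mem_gr _ hb), fun p => ?_⟩)
        rw [tauCoeffBlock_apply, D.tauCoeff_mixed (D.iota_mul_xi_mem a b), Pi.zero_apply,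
          Polynomial.coeff_zero, map_zero]
        exact zero_mem _

/-- The dots contribute `2 d_j p`, the long strand contributes minus the pairing of `α_j` with the
weight of `ν`, and `r` contributes `d`. Since `φ` returns `e(ν) r t_j ^ p`, the coefficient has the
expected degree; its projection to `R(β)` is zero unless `ν` has weight `β`. -/
theorem secOne_e_mem_goodGr (i j : I) (β : I →₀ ℕ) (ν : Fin n → I) (p : ℕ) {r : D.KLR n} {d : ℤ}
    (hr : r ∈ D.gr n d) : D.secOne n j (Polynomial.monomial p (D.e ν * r))
      ∈ D.goodGr n i β (2 * D.d j * p + ∑ q, -(D.d j * D.a j (ν q)) + d) := by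
  refine D.mem_goodGr.mpr ⟨?_, fun q => ?_⟩
  · have h1 : D.eLast n j * D.tauDesc n * D.xi n (D.e ν) = D.e (Fin.snoc ν j : Fin (n + 1) → I)
        * (D.tauDesc n * D.e (Fin.cons j ν : Fin (n + 1) → I)) := by
      rw [tauDesc_e, ← mul_assoc, D.e_idem, ← eSum_eq_e D ν, mul_assoc, tauDesc_xi_eSum, eSum_eq_e,
        ← mul_assoc, ← (D.iota_eLast _ j).eq, e_snoc]
    have h2 : D.secOne n j (Polynomial.monomial p (D.e ν * r))
        = (D.x (Fin.last n) ^ p * D.e (Fin.snoc ν j : Fin (n + 1) → I))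
          * (D.tauDesc n * D.e (Fin.cons j ν : Fin (n + 1) → I)) * D.xi n r := by
      rw [secOne_monomial, map_mul, mul_assoc (D.x _ ^ p) (D.e _), ← h1]
      simp only [mul_assoc]
    rw [h2]
    refine D.mul_mem_gr (D.mul_mem_gr ?_ (D.tauDesc_e_mem j ν)) (D.emb_mem_gr _ hr)
    have h3 := D.x_pow_e_mem (Fin.last n) (Fin.snoc ν j : Fin (n + 1) → I) p
    rwa [Fin.snoc_last] at h3
  · rw [tauCoeffBlock_apply, tauCoeff_secOne]
    by_cases hij : i = j
    · subst hij
      rw [Pi.single_eq_same, Polynomial.coeff_monomial]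
      split_ifs with hpq
      · subst hpq
        by_cases hν : wt ν = β
        · have h := D.toBlock_mem (β := β) (D.mul_mem_gr (IsHomog.e ν) hr)
          convert h using 2
          rw [← hν, Finset.sum_neg_distrib, sum_comp_eq_wt_sum (fun j => D.d i * D.a i j)]
          ring
        · have h : D.toBlock n β (D.e ν * r) = 0 := by
            refine Subtype.ext ?_
            rw [toBlock_coe, eBlock_comm, ← mul_assoc, eBlock_mul_e, if_neg hν, zero_mul]
            rfl
          rw [h]
          exact zero_mem _
      · rw [map_zero]; exact zero_mem _
    · rw [Pi.single_eq_of_ne hij, Polynomial.coeff_zero, map_zero]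
      exact zero_mem _

/-- Every element is one of `mixed`, where `φ` vanishes, plus a value of the section, which splits
into the homogeneous pieces just treated. -/
theorem mem_iSup_goodGr (i : I) (β : I →₀ ℕ) (r : D.KLR (n + 1)) :
    r ∈ ⨆ d, D.goodGr n i β d := by
  rw [← sub_add_cancel r (D.tauSec n (D.tauCoeff n r))]
  refine add_mem (D.mixed_le_iSup_goodGr i β (D.sub_tauSec_mem r)) ?_
  rw [tauSec_apply]
  refine sum_mem fun j _ => ?_
  induction D.tauCoeff n r j using Polynomial.induction_on' with
  | add f g hf hg => rw [map_add]; exact add_mem hf hg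
  | monomial p s =>
    rw [← one_mul s, ← D.e_sum, Finset.sum_mul, map_sum, map_sum]
    refine sum_mem fun ν _ => ?_
    have hs := D.mem_iSup_gr s
    induction hs using AddSubgroup.iSup_induction' with
    | h1 => rw [mul_zero, map_zero, map_zero]; exact zero_mem _
    | hadd x y _ _ hx hy => rw [mul_add, map_add, map_add]; exact add_mem hx hy
    | hp d s hs => exact AddSubgroup.mem_iSup_of_mem _ (D.secOne_e_mem_goodGr i j β ν p hs)

/-- Elements with the right behaviour span `R(n+1)`, so by `le_of_iSup_eq_top` they make up each
homogeneous part. The shift of degree is the source of the twist by `q` in the exact sequence. -/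
theorem tauCoeffBlock_mem (i : I) (β : I →₀ ℕ) {r : D.KLR (n + 1)} {d : ℤ}
    (hr : r ∈ D.gr (n + 1) d) (p : ℕ) : D.tauCoeffBlock n i β p r ∈ D.blockGr n β
      (d + (β.sum fun j m => m * (D.d i * D.a i j)) - 2 * D.d i * p) :=
  (D.mem_goodGr.mp (le_of_iSup_eq_top (D.gr_internal (n + 1)) (fun _ => inf_le_left)
    (D.mem_iSup_goodGr i β) d hr)).2 p

end Degrees

end KLRDatum

end GKM

end

noncomputable section

set_option linter.unusedSectionVars false

namespace GKM

open GrMod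

namespace KLRDatum

section Functors

variable {k I : Type u} [CommRing k] {𝓀 : ℕ → AddSubgroup k} (D : KLRDatum 𝓀 I)
variable [Fintype I] [DecidableEq I] [GradedRing 𝓀] {n : ℕ} {i j : I} {β γ δ ε : I →₀ ℕ}

/-! ### Degrees and naturality -/

theorem indBr_mem (hε : ε = β + Finsupp.single j 1) (M : D.ModR n β) {r : D.KLR (n + 1)}
    {m : M.carrier} {a b : ℤ} (hr : r ∈ D.gr (n + 1) a) (hm : m ∈ M.gr b) :
    D.indBr n j β ε M.carrier r m
      ∈ indGr (D.blockGr (n + 1) ε) (D.homF n j β ε) M (a + b) := by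
  refine AddSubgroup.subset_closure ⟨a, b, _, m, ?_, hm, rfl, rfl⟩
  change (indProj (D.homF n j β ε) (D.toBlock (n + 1) ε r)).1 ∈ _
  rw [indProj_toBlock D hε]
  have := D.mul_mem_gr hr (D.eSum_isHomog (fun ν : Fin (n + 1) → I => ν 0 = j))
  rw [add_zero] at this
  exact D.toBlock_mem this

theorem fMap_mem (hβ : β = γ + Finsupp.single i 1) (hδ : δ = γ + Finsupp.single j 1)
    (hε : ε = β + Finsupp.single j 1) (M : D.ModR (n + 1) β) {d : ℤ}
    {t : IndCarrier (D.homF n j γ δ) (resSub (D.homE n i γ β) M.carrier)}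
    (ht : t ∈ indGr (D.blockGr (n + 1) δ) (D.homF n j γ δ) ((D.E n i β γ).obj M) d) :
    D.fMap hβ hδ hε M.carrier t
      ∈ indGr (D.blockGr (n + 2) ε) (D.homF (n + 1) j β ε) M d := by
  have key : ∀ (a b : ℤ) (x : indIdeal (D.homF n j γ δ)) (m : resSub (D.homE n i γ β) M.carrier),
      x.1 ∈ D.blockGr (n + 1) δ a → m.1 ∈ M.gr b → D.fMap hβ hδ hε M.carrier (indTmul _ x m)
        ∈ indGr (D.blockGr (n + 2) ε) (D.homF (n + 1) j β ε) M (a + b) := by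
    intro a b x m hx hm
    rw [indTmul_eq_indBr D hδ, fMap_indBr]
    exact D.indBr_mem hε M (D.emb_mem_gr _ hx) hm
  refine (AddSubgroup.closure_le ((indGr (D.blockGr (n + 2) ε) (D.homF (n + 1) j β ε) M d).comap
    (D.fMap hβ hδ hε M.carrier))).mpr ?_ ht
  rintro _ ⟨a, b, x, m, hx, hm, rfl, rfl⟩
  exact key a b x m hx hm

theorem gMap_mem (hε : ε = β + Finsupp.single i 1) (M : D.ModR n β) {d : ℤ}
    {t : IndCarrier (D.homF n i β ε) M.carrier}
    (ht : t ∈ indGr (D.blockGr (n + 1) ε) (D.homF n i β ε) M d) (p : ℕ) :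
    D.gMap hε M.carrier t p
      ∈ M.gr (d - -(β.sum fun j m => m * (D.d i * D.a i j)) - 2 * D.d i * p) := by
  induction ht using AddSubgroup.closure_induction with
  | mem t ht =>
    obtain ⟨a, b, x, m, hx, hm, rfl, rfl⟩ := ht
    rw [D.indTmul_eq_indBr hε x m, gMap_indBr, polyAct_coe]
    have h := M.smul_mem (D.tauCoeffBlock_mem i β hx p) hm
    have e : a + b - -(β.sum fun j m => m * (D.d i * D.a i j)) - 2 * D.d i * p
        = a + (β.sum fun j m => m * (D.d i * D.a i j)) - 2 * D.d i * p + b := by ring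
    rw [e]
    exact h
  | zero => rw [map_zero]; exact zero_mem _
  | add x y _ _ hx hy => rw [map_add]; exact add_mem hx hy
  | neg x _ hx => rw [map_neg]; exact neg_mem hx

variable {M N : Type u} [AddCommGroup M] [AddCommGroup N]

theorem indMap_indBr [Module (D.Block n β) M] [Module (D.Block n β) N] (u : M →ₗ[D.Block n β] N)
    (r : D.KLR (n + 1)) (m : M) :
    indMap (D.homF n j β ε) u (D.indBr n j β ε M r m) = D.indBr n j β ε N r (u m) := rfl

theorem gMap_natural [Module (D.Block n β) M] [Module (D.Block n β) N]
    (hε : ε = β + Finsupp.single i 1) (u : M →ₗ[D.Block n β] N)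
    (t : IndCarrier (D.homF n i β ε) M) (p : ℕ) :
    D.gMap hε N (indMap (D.homF n i β ε) u t) p = u (D.gMap hε M t p) := by
  induction t using D.indBr_induction hε with
  | h0 => simp only [map_zero, Finsupp.zero_apply]
  | hadd x y hx hy => simp only [map_add, Finsupp.add_apply, hx, hy]
  | ht r m => rw [indMap_indBr, gMap_indBr, gMap_indBr, polyAct_coe, polyAct_coe, map_smul]

theorem fMap_natural [Module (D.Block (n + 1) β) M] [Module (D.Block (n + 1) β) N]
    (hβ : β = γ + Finsupp.single i 1) (hδ : δ = γ + Finsupp.single j 1)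
    (hε : ε = β + Finsupp.single j 1) (u : M →ₗ[D.Block (n + 1) β] N)
    (v : resSub (D.homE n i γ β) M →ₗ[D.Block n γ] resSub (D.homE n i γ β) N)
    (hv : ∀ m, (v m).1 = u m.1)
    (t : IndCarrier (D.homF n j γ δ) (resSub (D.homE n i γ β) M)) :
    D.fMap hβ hδ hε N (indMap (D.homF n j γ δ) v t)
      = indMap (D.homF (n + 1) j β ε) u (D.fMap hβ hδ hε M t) := by
  induction t using D.indBr_induction hδ with
  | h0 => simp only [map_zero]
  | hadd x y hx hy => simp only [map_add, hx, hy]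
  | ht r m => rw [indMap_indBr, fMap_indBr, fMap_indBr, indMap_indBr, hv]

/-! ### The natural transformations -/

theorem homE_one_smul_fMap (hβ : β = γ + Finsupp.single i 1) (hδ : δ = γ + Finsupp.single j 1)
    (hε : ε = β + Finsupp.single j 1) (hε' : ε = δ + Finsupp.single i 1)
    [Module (D.Block (n + 1) β) M]
    (t : IndCarrier (D.homF n j γ δ) (resSub (D.homE n i γ β) M)) :
    D.homE (n + 1) i δ ε 1 • D.fMap hβ hδ hε M t = D.fMap hβ hδ hε M t := by
  rw [homE_one' D hε']
  exact D.eLast_smul_fMap hβ hδ hε t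

/-- The morphism `F̄_j E_i M → E_i F̄_j M`. -/
def fHom (hβ : β = γ + Finsupp.single i 1) (hδ : δ = γ + Finsupp.single j 1)
    (hε : ε = β + Finsupp.single j 1) (hε' : ε = δ + Finsupp.single i 1) (M : D.ModR (n + 1) β) :
    ((D.E n i β γ).comp (D.Fbar n j γ δ)).obj M
      ⟶ ((D.Fbar (n + 1) j β ε).comp (D.E (n + 1) i ε δ)).obj M where
  toLin :=
    { toFun := fun t => ⟨D.fMap hβ hδ hε M.carrier t, D.homE_one_smul_fMap hβ hδ hε hε' t⟩
      map_add' := fun x y => Subtype.ext (map_add (D.fMap hβ hδ hε M.carrier) x y)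
      map_smul' := fun r t => Subtype.ext (D.fMap_smul hβ hδ hε hε' r t) }
  map_mem := fun {_ _} ht => D.fMap_mem hβ hδ hε M ht

/-- The natural transformation `F̄_j E_i → E_i F̄_j`. -/
def fTrans (hβ : β = γ + Finsupp.single i 1) (hδ : δ = γ + Finsupp.single j 1)
    (hε : ε = β + Finsupp.single j 1) (hε' : ε = δ + Finsupp.single i 1) :
    (D.E n i β γ).comp (D.Fbar n j γ δ) ⟶ (D.Fbar (n + 1) j β ε).comp (D.E (n + 1) i ε δ) where
  app M := D.fHom hβ hδ hε hε' M
  naturality _ _ u := hom_ext fun t => Subtype.ext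
    (D.fMap_natural hβ hδ hε (Hom.toLin u) (Hom.toLin ((D.E n i β γ).map u)) (fun _ => rfl) t)

/-- The morphism `E_i F̄_i M → q ^ {-(α_i | β)} M ⊗ 𝐤[t_i]`. -/
def gHom (hε : ε = β + Finsupp.single i 1) (M : D.ModR n β) :
    ((D.Fbar n i β ε).comp (D.E n i ε β)).obj M ⟶ (D.qPoly n i β).obj M where
  toLin :=
    { toFun := fun t => D.gMap hε M.carrier t.1
      map_add' := fun x y => map_add (D.gMap hε M.carrier) x.1 y.1
      map_smul' := fun b t => Finsupp.ext fun p => D.gMap_homE_smul hε b t.1 p }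
  map_mem := fun {_ _} ht p => D.gMap_mem hε M ht p

/-- The natural transformation `E_i F̄_i M → q ^ {-(α_i | β)} M ⊗ 𝐤[t_i]`. -/
def gTrans (hε : ε = β + Finsupp.single i 1) :
    (D.Fbar n i β ε).comp (D.E n i ε β) ⟶ D.qPoly n i β where
  app M := D.gHom hε M
  naturality _ _ u := hom_ext fun t => Finsupp.ext fun p => D.gMap_natural hε (Hom.toLin u) t.1 p

theorem fMk_eq_indBr (M : D.ModR n β) (r : D.Block (n + 1) ε) (m : M.carrier) :
    D.fMk (i := j) r m = D.indBr n j β ε M.carrier r.1 m := by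
  rw [indBr_apply, toBlock_val]
  rfl

theorem fMap_fMk [Module (D.Block (n + 1) β) M] (hβ : β = γ + Finsupp.single i 1)
    (hδ : δ = γ + Finsupp.single j 1) (hε : ε = β + Finsupp.single j 1)
    (hε' : ε = δ + Finsupp.single i 1) (r : D.Block (n + 1) δ)
    (m : resSub (D.homE n i γ β) M) :
    D.fMap hβ hδ hε M (D.indBr n j γ δ _ r.1 m)
      = D.homE (n + 1) i δ ε r • D.indBr (n + 1) j β ε M 1 m.1 := by
  rw [← indBr_one_smul, D.fMap_smul hβ hδ hε hε', fMap_indBr, map_one]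

theorem eIncl_fTrans (hβ : β = γ + Finsupp.single i 1) (hδ : δ = γ + Finsupp.single j 1)
    (hε : ε = β + Finsupp.single j 1) (hε' : ε = δ + Finsupp.single i 1) (M : D.ModR (n + 1) β)
    (r : D.Block (n + 1) δ) (m : ((D.E n i β γ).obj M).carrier) :
    D.eIncl (Hom.toLin ((D.fTrans hβ hδ hε hε').app M) (D.fMk r m))
      = D.homE (n + 1) i δ ε r • D.fMk (i := j) (γ := ε) 1 (D.eIncl m) := by
  rw [D.fMk_eq_indBr M (1 : D.Block (n + 2) ε), D.fMk_eq_indBr _ r m]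
  refine (D.fMap_fMk hβ hδ hε hε' r m).trans ?_
  rw [← D.toBlock_one (n := n + 2) (β := ε), indBr_apply, indBr_apply, toBlock_val]
  rfl

theorem qCoeff_gTrans (hε : ε = β + Finsupp.single i 1) (M : D.ModR n β)
    (r : D.Block (n + 1) ε) (m : M.carrier) (p : ℕ) :
    D.qCoeff (Hom.toLin ((D.gTrans hε).app M) (D.eProj (D.fMk r m))) p
      = D.toBlock n β ((D.tauCoeff n (D.blockVal (n + 1) ε r) i).coeff p) • m := by
  rw [fMk_eq_indBr]
  refine (D.gMap_homE_smul hε 1 (D.indBr n i β ε M.carrier r.1 m) p).trans ?_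
  rw [one_smul, gMap_indBr]
  rfl

theorem fTrans_injective (hβ : β = γ + Finsupp.single i 1) (hδ : δ = γ + Finsupp.single j 1)
    (hε : ε = β + Finsupp.single j 1) (hε' : ε = δ + Finsupp.single i 1) (M : D.ModR (n + 1) β) :
    Function.Injective (Hom.toLin ((D.fTrans hβ hδ hε hε').app M)) := by
  intro x y hxy
  have h := congrArg (D.fInv hβ hδ hε M.carrier) (congrArg Subtype.val hxy)
  exact (D.fInv_fMap hβ hδ hε x).symm.trans (h.trans (D.fInv_fMap hβ hδ hε y))

theorem fTrans_bijective (hij : i ≠ j) (hβ : β = γ + Finsupp.single i 1)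
    (hδ : δ = γ + Finsupp.single j 1) (hε : ε = β + Finsupp.single j 1)
    (hε' : ε = δ + Finsupp.single i 1) (M : D.ModR (n + 1) β) :
    Function.Bijective (Hom.toLin ((D.fTrans hβ hδ hε hε').app M)) := by
  refine ⟨D.fTrans_injective hβ hδ hε hε' M, fun t => ⟨D.fInv hβ hδ hε M.carrier t.1,
    Subtype.ext ((D.fMap_fInv_of_ne hβ hδ hε hij t.1).trans (D.eLast_smul_resSub hε' t))⟩⟩

theorem gTrans_surjective (hε : ε = β + Finsupp.single i 1) (M : D.ModR n β) :
    Function.Surjective (Hom.toLin ((D.gTrans hε).app M)) := by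
  intro z
  -- The section takes values in the part fixed by `e(n,i)`, so it is a preimage in `E_i F̄_i M` and
  -- not merely in `F̄_i M`.
  refine ⟨⟨D.secMap (n := n) i ε M.carrier z, ?_⟩, D.gMap_secMap hε z⟩
  change D.homE n i β ε 1 • _ = _
  rw [homE_one' D hε]
  exact D.eLast_smul_secMap z

theorem fTrans_gTrans_exact (hβ : β = γ + Finsupp.single i 1) (hε : ε = β + Finsupp.single i 1)
    (M : D.ModR (n + 1) β) :
    Function.Exact (Hom.toLin ((D.fTrans hβ hβ hε hε).app M))
      (Hom.toLin ((D.gTrans hε).app M)) := by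
  intro t
  constructor
  · intro ht
    refine ⟨D.fInv hβ hβ hε M.carrier t.1, Subtype.ext ?_⟩
    -- With the `g`-term zero, the splitting identity presents `t` itself as an image.
    have h := D.fMap_fInv_add hβ hε t.1
    have ht' : D.gMap hε M.carrier t.1 = 0 := ht
    rw [ht', map_zero, add_zero] at h
    exact h.trans (D.eLast_smul_resSub hε t)
  · rintro ⟨s, rfl⟩
    exact D.gMap_fMap hβ hε s

/-- If `α_i` does not occur in `β`, the image of `Φ` contributes nothing after cutting by `e(n,i)`,
and the section becomes a two-sided inverse. This includes the case of height 0. -/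
theorem gTrans_bijective (hβ : β i = 0) (hε : ε = β + Finsupp.single i 1) (M : D.ModR n β) :
    Function.Bijective (Hom.toLin ((D.gTrans hε).app M)) := by
  refine ⟨fun x y hxy => Subtype.ext ?_, D.gTrans_surjective hε M⟩
  have h : ∀ t : ((((D.Fbar n i β ε).comp (D.E n i ε β)).obj M)).carrier,
      D.secMap (n := n) i ε M.carrier (D.gMap hε M.carrier t.1) = t.1 := fun t =>
    (D.eLast_smul_of_eq_zero hβ hε t.1).symm.trans (D.eLast_smul_resSub hε t)
  exact (h x).symm.trans ((congrArg (D.secMap (n := n) i ε M.carrier) hxy).trans (h y))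

theorem isIso_fTrans (hij : i ≠ j) (hβ : β = γ + Finsupp.single i 1)
    (hδ : δ = γ + Finsupp.single j 1) (hε : ε = β + Finsupp.single j 1)
    (hε' : ε = δ + Finsupp.single i 1) :
    CategoryTheory.IsIso (D.fTrans (n := n) hβ hδ hε hε') := by
  rw [CategoryTheory.NatTrans.isIso_iff_isIso_app]
  exact fun M => isIso_of_bijective _ (D.fTrans_bijective hij hβ hδ hε hε' M)

end Functors

end KLRDatum

end GKM

/-! ### Assembly of the theorem. -/

theorem mainTheorem8 {k I : Type u} [CommRing k] [Fintype I] [DecidableEq I]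
    (𝓀 : ℕ → AddSubgroup k) [GradedRing 𝓀] (D : GKM.KLRDatum 𝓀 I) :
    ∃ φ : ∀ n : ℕ, D.KLR (n + 1) →+ (I → Polynomial (D.KLR n)),
      -- the exact sequences of bimodules
      -- `0 → R(n) ⊗_{R(n-1)} R(n) → R(n + 1) → ⨁ i, R(n) ⊗ 𝐤[t_i] → 0`
      (∀ n, D.IsTauCoeff (φ n) ∧ Function.Surjective (φ n)) ∧
      Function.Injective (φ 0) ∧
      (∀ n, ∃ Φ : D.TensorSq n →+ D.KLR (n + 2),
        (∀ x y, Φ (D.tsMk x y) = D.iota (n + 1) x * D.xi (n + 1) y) ∧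
        Function.Injective Φ ∧ Function.Exact Φ (φ (n + 1))) ∧
      -- the natural isomorphism `F̄_j E_i ≅ E_i F̄_j` for `i ≠ j`
      (∀ (n : ℕ) (i j : I) (β γ δ ε : I →₀ ℕ), i ≠ j → Finsupp.degree γ = n →
        β = γ + Finsupp.single i 1 → δ = γ + Finsupp.single j 1 →
        ε = γ + Finsupp.single i 1 + Finsupp.single j 1 →
        ∃ f : (D.E n i β γ).comp (D.Fbar n j γ δ)
            ≅ (D.Fbar (n + 1) j β ε).comp (D.E (n + 1) i ε δ),
          ∀ (M : D.ModR (n + 1) β) (r : D.Block (n + 1) δ) (m : ((D.E n i β γ).obj M).carrier),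
            D.eIncl ((f.hom.app M).toLin (D.fMk r m))
              = D.homE (n + 1) i δ ε r • D.fMk 1 (D.eIncl m)) ∧
      -- the exact sequence `0 → F̄_i E_i M → E_i F̄_i M → q ^ {-(α_i | β)} M ⊗ 𝐤[t_i] → 0`
      (∀ (n : ℕ) (i : I) (β γ ε : I →₀ ℕ), Finsupp.degree γ = n →
        β = γ + Finsupp.single i 1 → ε = β + Finsupp.single i 1 →
        ∃ (f : (D.E n i β γ).comp (D.Fbar n i γ β)
            ⟶ (D.Fbar (n + 1) i β ε).comp (D.E (n + 1) i ε β))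
          (g : (D.Fbar (n + 1) i β ε).comp (D.E (n + 1) i ε β) ⟶ D.qPoly (n + 1) i β),
          (∀ (M : D.ModR (n + 1) β) (r : D.Block (n + 1) β) (m : ((D.E n i β γ).obj M).carrier),
            D.eIncl ((f.app M).toLin (D.fMk r m))
              = D.homE (n + 1) i β ε r • D.fMk 1 (D.eIncl m)) ∧
          (∀ (M : D.ModR (n + 1) β) (r : D.Block (n + 2) ε) (m : M.carrier) (p : ℕ),
            D.qCoeff ((g.app M).toLin (D.eProj (D.fMk r m))) p
              = D.toBlock (n + 1) β ((φ (n + 1) (D.blockVal (n + 2) ε r) i).coeff p) • m) ∧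
          ∀ M : D.ModR (n + 1) β,
            Function.Injective (f.app M).toLin ∧
            Function.Exact (f.app M).toLin (g.app M).toLin ∧
            Function.Surjective (g.app M).toLin) ∧
      -- the same exact sequence when `α_i` does not occur in `β`, so that `E_i M = 0`
      (∀ (n : ℕ) (i : I) (β ε : I →₀ ℕ), Finsupp.degree β = n → β i = 0 →
        ε = β + Finsupp.single i 1 →
        ∃ g : (D.Fbar n i β ε).comp (D.E n i ε β) ⟶ D.qPoly n i β,
          (∀ (M : D.ModR n β) (r : D.Block (n + 1) ε) (m : M.carrier) (p : ℕ),
            D.qCoeff ((g.app M).toLin (D.eProj (D.fMk r m))) p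
              = D.toBlock n β ((φ n (D.blockVal (n + 1) ε r) i).coeff p) • m) ∧
          ∀ M : D.ModR n β, Function.Bijective (g.app M).toLin) := by
  refine ⟨fun n => D.tauCoeff n, fun n => ⟨D.isTauCoeff n, D.tauCoeff_surjective⟩,
    D.tauCoeff_injective_zero,
    fun n => ⟨D.tsMul n, D.tsMul_tsMk, D.tsMul_injective, D.tsMul_exact⟩, ?_, ?_, ?_⟩
  · intro n i j β γ δ ε hij _ hβ hδ hε
    have h1 : ε = β + Finsupp.single j 1 := by rw [hε, hβ]
    have h2 : ε = δ + Finsupp.single i 1 := by rw [hε, hδ, add_right_comm]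
    have := D.isIso_fTrans (n := n) hij hβ hδ h1 h2
    exact ⟨CategoryTheory.asIso (D.fTrans hβ hδ h1 h2), D.eIncl_fTrans hβ hδ h1 h2⟩
  · intro n i β γ ε _ hβ hε
    exact ⟨D.fTrans hβ hβ hε hε, D.gTrans hε, D.eIncl_fTrans hβ hβ hε hε, D.qCoeff_gTrans hε,
      fun M => ⟨D.fTrans_injective hβ hβ hε hε M, D.fTrans_gTrans_exact hβ hε M,
        D.gTrans_surjective hε M⟩⟩
  · intro n i β ε _ hβ hε
    exact ⟨D.gTrans hε, D.qCoeff_gTrans hε, D.gTrans_bijective hβ hε⟩
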